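/- **Proposition 8.6 (the conjugacy invariant is trivial for simple deformations).** *Setting.* Let $M$ be a compact connected orientable surface, $\Sigma\subset M$ a non-empty finite set and $\zeta$ a translation surface structure on $(M,\Sigma)$: a maximal atlas of $M-\Sigma$ with charts in $\mathbb C=\mathbb R^2$ whose coordinate changes are locally translations, such that every $A\in\Sigma$ has a neighbourhood $V$ and a ramified covering $(V,A)\to(W,0)$ of some degree $\kappa\ge 1$ onto a neighbourhood $W$ of $0$ in $\mathbb R^2$ whose injective restrictions are charts of $\zeta$. Let $X_0=\partial/\partial y$ be the vertical vector field on $M-\Sigma$. Let $I$ be an open bounded horizontal segment in good position: $I$ meets every vertical connexion (every orbit of $X_0$ that starts and ends in $\Sigma$), and the endpoints of $I$ are distinct and each of them belongs to $\Sigma$ or is connected to a point of $\Sigma$ by a vertical segment not meeting $I$. Identify $I$ with an interval $(u_0,u_d)$ through the horizontal coordinate. Let $r\ge 1$ be an integer or $\infty$. A generalized i.e.m. $T$ on $I$ is given by two partitions (mod. $0$) of $I$ into $d\ge 2$ open intervals $I^t_\alpha$, resp. $I^b_\alpha$, indexed by an alphabet $\mathcal A$ and placed in the order prescribed by bijections $\pi_t$,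 resp. $\pi_b$, from $\mathcal A$ onto $\{1,\dots,d\}$, with $\pi_t^{-1}(\{1,\dots,k\})\neq\pi_b^{-1}(\{1,\dots,k\})$ for $1\le k<d$, and by orientation-preserving homeomorphisms $T:I^t_\alpha\to I^b_\alpha$. The pair $\pi=(\pi_t,\pi_b)$ is the combinatorial data of $T$. It is standard if these homeomorphisms are translations, and of class $C^r$ if each of them extends to a $C^r$-diffeomorphism between the closed intervals. For $\upsilon=(\alpha,L)$ (resp. $(\alpha,R)$) let $u^t(\upsilon),u^b(\upsilon)$ be the left (resp. right) endpoints of $I^t_\alpha,I^b_\alpha$, and $\varepsilon(\upsilon)=-1$ (resp. $+1$). Let $J^r$ be the group, under composition, of $r$-jets at $0$ of orientation-preserving diffeomorphisms of $\mathbb R$ fixing $0$. Let $j(T,\upsilon)\in J^r$ be the $r$-jet at $0$ of $x\mapsto T(u^t(\upsilon)+x)-u^b(\upsilon)$, with $x>0$ (resp. $x<0$). Let $\sigma$ be the permutation of $\mathcal A\times\{L,R\}$ given by * $\sigma(\alpha,R)=(\beta,L)$ if $\pi_t(\beta)=\pi_t(\alpha)+1$, and $\sigma(\alpha,R)=(\pi_b^{-1}(d),R)$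 if $\pi_t(\alpha)=d$; * $\sigma(\alpha,L)=(\beta,R)$ if $\pi_b(\beta)=\pi_b(\alpha)-1$, and $\sigma(\alpha,L)=(\pi_t^{-1}(1),L)$ if $\pi_b(\alpha)=1$. The invariant $J(T)$ is the family, indexed by the cycles $C=\{\upsilon_0,\upsilon_1=\sigma(\upsilon_0),\dots,\upsilon_\kappa\}$ of $\sigma$, of the conjugacy classes in $J^r$ of $j(T,\upsilon_0)^{\varepsilon(\upsilon_0)}j(T,\upsilon_1)^{\varepsilon(\upsilon_1)}\cdots j(T,\upsilon_\kappa)^{\varepsilon(\upsilon_\kappa)}$; it is trivial if all of them are the class of the neutral element. *Statement.* The return map $T_0$ of the flow of $X_0$ to $I$ is a standard i.e.m., and there is a neighbourhood $\mathcal U$ of $X_0$ for the $C^r$ topology (the topology of uniform convergence on $M-\Sigma$, in the charts of $\zeta$, of all derivatives of finite order at most $r$) with the following property. Let $X_*\in\mathcal U$ be a non-vanishing $C^r$ vector field on $M-\Sigma$ that coincides with $X_0$ in a neighbourhood of $\Sigma$ (that is, a $C^r$ simple deformation of $X_0$), and assume that $X_*$ coincides with $X_0$ on the vertical segments, not meeting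 $I$, that connect the endpoints of $I$ to $\Sigma$. Then the return map $T_*$ to $I$ of the flow of $X_*$ (defined exactly at the points of $I$ whose forward orbit under $X_*$ meets $I$ again) is a generalized i.e.m. of class $C^r$ with the same combinatorial data as $T_0$, and its conjugacy invariant $J(T_*)$ in $J^r$ is trivial. -/

import Mathlib

open Set Filter Topology Asymptotics
open scoped ContDiff

/-! ### Jets of orientation preserving diffeomorphisms of the line fixing the origin -/

/-- The group of orientation preserving `C^r` diffeomorphisms of `ℝ` fixing `0`; the product is
composition. -/
def JetDiff (r : ℕ∞) : Subgroup (ℝ ≃o ℝ) where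
  carrier := {f | f 0 = 0 ∧ ContDiff ℝ (r : WithTop ℕ∞) f ∧ ContDiff ℝ (r : WithTop ℕ∞) f.symm}
  mul_mem' := by
    rintro f g ⟨hf0, hf, hf'⟩ ⟨hg0, hg, hg'⟩
    refine ⟨?_, hf.comp hg, hg'.comp hf'⟩
    change f (g 0) = 0
    rw [hg0, hf0]
  one_mem' := ⟨rfl, contDiff_id, contDiff_id⟩
  inv_mem' := by
    rintro f ⟨hf0, hf, hf'⟩
    refine ⟨?_, hf', hf⟩
    change f.symm 0 = 0
    rw [OrderIso.symm_apply_eq, hf0]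

/-- A diffeomorphism in `JetDiff r` is `O(x)` at the origin when `r ≥ 1`. -/
theorem JetDiff.isBigO_id {r : ℕ∞} (hr : 1 ≤ r) {f : ℝ ≃o ℝ} (hf : f ∈ JetDiff r) :
    (fun x => f x) =O[𝓝 0] (fun x : ℝ => x) := by
  have h1 : DifferentiableAt ℝ f 0 :=
    (hf.2.1.differentiable (by
      have : (1 : WithTop ℕ∞) ≤ (r : WithTop ℕ∞) := by exact_mod_cast hr
      intro h0; rw [h0] at this; exact absurd this (by simp))) 0
  simpa [hf.1] using h1.isBigO_sub

theorem JetDiff.tendsto_zero {r : ℕ∞} {f : ℝ ≃o ℝ} (hf : f ∈ JetDiff r) :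
    Tendsto (fun x => f x) (𝓝 0) (𝓝 0) := by
  simpa [hf.1] using (f.continuous.tendsto 0)

/-- The diffeomorphisms whose `r`-jet at `0` is that of the identity, that is, which have a contact
of every finite order `k ≤ r` with the identity at `0`. -/
def JetDiff.flat (r : ℕ∞) : Subgroup (JetDiff r) where
  carrier := {f | ∀ k : ℕ, (k : ℕ∞) ≤ r →
    (fun x : ℝ => (f : ℝ ≃o ℝ) x - x) =o[𝓝 0] (fun x : ℝ => x ^ k)}
  mul_mem' := by
    rintro ⟨f, hfm⟩ ⟨g, hgm⟩ hf hg k hk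
    have hg0 := hg k hk
    have hf0 := (hf k hk).comp_tendsto (JetDiff.tendsto_zero hgm)
    have h2 : (fun x : ℝ => (g x) ^ k) =O[𝓝 0] (fun x : ℝ => x ^ k) := by
      rcases Nat.eq_zero_or_pos k with rfl | hkp
      · simpa using isBigO_refl (fun _ : ℝ => (1 : ℝ)) (𝓝 0)
      · exact (JetDiff.isBigO_id (le_trans (by exact_mod_cast hkp) hk) hgm).pow k
    have h3 := (hf0.trans_isBigO h2).add hg0
    refine h3.congr_left ?_
    intro x
    change f (g x) - g x + (g x - x) = f (g x) - x
    ring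
  one_mem' := by
    intro k _
    have : (fun x : ℝ => (((1 : JetDiff r) : ℝ ≃o ℝ)) x - x) = fun _ => 0 := by
      funext x
      change x - x = 0
      ring
    rw [this]
    exact isLittleO_zero _ _
  inv_mem' := by
    rintro ⟨f, hfm⟩ hf k hk
    have him : f⁻¹ ∈ JetDiff r := (JetDiff r).inv_mem hfm
    have hf0 := (hf k hk).comp_tendsto (JetDiff.tendsto_zero him)
    have h2 : (fun x : ℝ => (f⁻¹ x) ^ k) =O[𝓝 0] (fun x : ℝ => x ^ k) := by
      rcases Nat.eq_zero_or_pos k with rfl | hkp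
      · simpa using isBigO_refl (fun _ : ℝ => (1 : ℝ)) (𝓝 0)
      · exact (JetDiff.isBigO_id (le_trans (by exact_mod_cast hkp) hk) him).pow k
    refine (hf0.trans_isBigO h2).neg_left.congr_left ?_
    intro x
    change -(f (f.symm x) - f.symm x) = f.symm x - x
    rw [OrderIso.apply_symm_apply]
    ring

instance JetDiff.flat_normal (r : ℕ∞) : (JetDiff.flat r).Normal where
  conj_mem := by
    rintro ⟨f, hfm⟩ hf ⟨h, hhm⟩ k hk
    have him : h⁻¹ ∈ JetDiff r := (JetDiff r).inv_mem hhm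
    have hdef : ∀ x : ℝ, h (f (h⁻¹ x)) - h (h⁻¹ x) = h (f (h⁻¹ x)) - x := by
      intro x
      have : h (h⁻¹ x) = x := h.apply_symm_apply x
      rw [this]
    change (fun x : ℝ => h (f (h⁻¹ x)) - x) =o[𝓝 0] (fun x : ℝ => x ^ k)
    rcases Nat.eq_zero_or_pos k with rfl | hkp
    · have hc : Tendsto (fun x : ℝ => h (f (h⁻¹ x)) - x) (𝓝 0) (𝓝 0) := by
        have := (((JetDiff.tendsto_zero hhm).comp (JetDiff.tendsto_zero hfm)).comp
          (JetDiff.tendsto_zero him)).sub (tendsto_id (x := 𝓝 (0 : ℝ)))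
        simpa using this
      simpa using (isLittleO_one_iff ℝ).2 hc
    · have hr : 1 ≤ r := le_trans (by exact_mod_cast hkp) hk
      have hs : HasStrictDerivAt h (deriv h 0) 0 :=
        hhm.2.1.contDiffAt.hasStrictDerivAt (by
          have : (1 : WithTop ℕ∞) ≤ (r : WithTop ℕ∞) := by exact_mod_cast hr
          intro h0; rw [h0] at this; exact absurd this (by simp))
      have hb : (fun p : ℝ × ℝ => h p.1 - h p.2) =O[𝓝 (0, 0)] (fun p : ℝ × ℝ => p.1 - p.2) :=
        hs.hasStrictFDerivAt.isBigO_sub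
      have hi := JetDiff.tendsto_zero him
      have ht : Tendsto (fun x : ℝ => (f (h⁻¹ x), h⁻¹ x)) (𝓝 0) (𝓝 (0, 0)) :=
        ((JetDiff.tendsto_zero hfm).comp hi).prodMk_nhds hi
      have h1 := hb.comp_tendsto ht
      have h2 := (hf k hk).comp_tendsto hi
      have h3 : (fun x : ℝ => (h⁻¹ x) ^ k) =O[𝓝 0] (fun x : ℝ => x ^ k) :=
        (JetDiff.isBigO_id hr him).pow k
      have h4 := h1.trans_isLittleO (h2.trans_isBigO h3)
      exact h4.congr_left hdef

/-- The group `J^r` of `r`-jets at `0` of orientation preserving diffeomorphisms of `ℝ`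
fixing `0`. -/
abbrev JetGroup (r : ℕ∞) : Type := JetDiff r ⧸ JetDiff.flat r

/-! ### Combinatorial data and the permutation `σ` -/

/-- Combinatorial data on an alphabet `A` with `d` letters: positions in the top and in the bottom
partition (counted from `0`). -/
structure CombData (A : Type*) (d : ℕ) where
  top : A ≃ Fin d
  bot : A ≃ Fin d

namespace CombData

variable {A : Type*} {d : ℕ}

def Irreducible (π : CombData A d) : Prop :=
  ∀ k : ℕ, 1 ≤ k → k < d → {α | (π.top α : ℕ) < k} ≠ {α | (π.bot α : ℕ) < k}

/-- The map `σ` on the union `A ⊕ A` of two copies of the alphabet: `Sum.inl α` is `(α, L)` and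
`Sum.inr α` is `(α, R)`. -/
def sigmaFun (π : CombData A d) : A ⊕ A → A ⊕ A
  | Sum.inr α =>
      if h : (π.top α : ℕ) + 1 < d then Sum.inl (π.top.symm ⟨π.top α + 1, h⟩)
      else Sum.inr (π.bot.symm ⟨d - 1, by have := (π.top α).isLt; omega⟩)
  | Sum.inl α =>
      if 0 < (π.bot α : ℕ) then
        Sum.inr (π.bot.symm ⟨π.bot α - 1, by have := (π.bot α).isLt; omega⟩)
      else Sum.inl (π.top.symm ⟨0, by have := (π.bot α).isLt; omega⟩)

theorem sigmaFun_injective (π : CombData A d) : Function.Injective π.sigmaFun := by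
  have key : ∀ x y : A, (π.top x : ℕ) = π.top y → x = y := fun x y h =>
    π.top.injective (Fin.ext h)
  have key' : ∀ x y : A, (π.bot x : ℕ) = π.bot y → x = y := fun x y h =>
    π.bot.injective (Fin.ext h)
  rintro (x | x) (y | y) h
  · have hx := (π.bot x).isLt
    have hy := (π.bot y).isLt
    simp only [sigmaFun] at h
    split_ifs at h <;> simp at h
    · exact congrArg _ (key' x y (by omega))
    · exact congrArg _ (key' x y (by omega))
  · have hx := (π.bot x).isLt
    simp only [sigmaFun] at h
    split_ifs at h <;> simp at h
    omega
  · have hx := (π.bot y).isLt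
    simp only [sigmaFun] at h
    split_ifs at h <;> simp at h
    omega
  · have hx := (π.top x).isLt
    have hy := (π.top y).isLt
    simp only [sigmaFun] at h
    split_ifs at h <;> simp at h
    · exact congrArg _ (key x y (by omega))
    · exact congrArg _ (key x y (by omega))

noncomputable def sigma (π : CombData A d) : Equiv.Perm (A ⊕ A) :=
  Equiv.ofBijective π.sigmaFun (by
    have : Finite A := Finite.of_equiv _ π.top.symm
    exact Finite.injective_iff_bijective.1 π.sigmaFun_injective)

/-- The cycles of `σ` (fixed points included). -/
abbrev Cycles (π : CombData A d) : Type _ := Quotient (Equiv.Perm.SameCycle.setoid π.sigma)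

/-- The sign `ε`: `-1` at left endpoints, `+1` at right endpoints. -/
def sign : A ⊕ A → ℤ
  | Sum.inl _ => -1
  | Sum.inr _ => 1

/-- `j(υ₀)^ε(υ₀) j(υ₁)^ε(υ₁) ⋯ j(υ_κ)^ε(υ_κ)`, where `υ₀, υ₁ = σ(υ₀), …, υ_κ` is the cycle of
`υ₀`. -/
noncomputable def cycleProd {G : Type*} [Group G] (π : CombData A d) (j : A ⊕ A → G)
    (υ₀ : A ⊕ A) : G :=
  ((List.range (Function.minimalPeriod π.sigma υ₀)).map
    (fun i => j (π.sigma^[i] υ₀) ^ sign (π.sigma^[i] υ₀))).prod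

theorem cycleProd_conj {G : Type*} [Group G] (π : CombData A d) (j : A ⊕ A → G) (υ : A ⊕ A) :
    IsConj (π.cycleProd j (π.sigma υ)) (π.cycleProd j υ) := by
  have hper : Function.minimalPeriod π.sigma (π.sigma υ) = Function.minimalPeriod π.sigma υ := by
    have : Finite A := Finite.of_equiv _ π.top.symm
    exact Function.minimalPeriod_apply
      (Function.Injective.mem_periodicPts π.sigma.injective υ)
  rw [isConj_iff]
  refine ⟨j υ ^ sign υ, ?_⟩
  unfold cycleProd
  rw [hper]
  set n := Function.minimalPeriod π.sigma υ with hn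
  have h1 := List.prod_range_succ
    (fun i => j (π.sigma^[i] υ) ^ sign (π.sigma^[i] υ)) n
  have h2 := List.prod_range_succ'
    (fun i => j (π.sigma^[i] υ) ^ sign (π.sigma^[i] υ)) n
  rw [h1, hn, Function.iterate_minimalPeriod] at h2
  simp only [Function.iterate_succ, Function.comp_apply, Function.iterate_zero, id] at h2
  rw [mul_inv_eq_iff_eq_mul]
  exact h2.symm

/-- The family, parametrized by the cycles of `σ`, of the conjugacy classes of the products along
the cycles. -/
noncomputable def cycleClass {G : Type*} [Group G] (π : CombData A d) (j : A ⊕ A → G) :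
    π.Cycles → ConjClasses G :=
  Quotient.lift (fun υ => ConjClasses.mk (π.cycleProd j υ)) (by
    rintro a b ⟨i, rfl⟩
    apply Eq.symm
    rw [ConjClasses.mk_eq_mk_iff_isConj]
    induction i using Int.induction_on with
    | zero => exact IsConj.refl _
    | succ i ih =>
      rw [add_comm, zpow_add, zpow_one, Equiv.Perm.mul_apply]
      exact (π.cycleProd_conj j _).trans ih
    | pred i ih =>
      refine IsConj.trans ?_ ih
      have := π.cycleProd_conj j ((π.sigma ^ (-(i : ℤ) - 1)) a)
      rw [← Equiv.Perm.mul_apply, ← zpow_one_add] at this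
      rw [show 1 + (-(i : ℤ) - 1) = -(i : ℤ) by ring] at this
      exact this.symm)

end CombData

/-! ### Generalized interval exchange maps -/

/-- A generalized interval exchange map, with `d ≥ 2` letters and irreducible combinatorial data.
The points `ut 0 < ⋯ < ut d` and `ub 0 < ⋯ < ub d` delimit the top and bottom partitions of
`(ut 0, ut d) = (ub 0, ub d)`. Only the values of `toFun` on the open top intervals matter. -/
structure GIEM (A : Type*) (d : ℕ) where
  two_le : 2 ≤ d
  comb : CombData A d
  irreducible : comb.Irreducible
  ut : Fin (d + 1) → ℝ
  ub : Fin (d + 1) → ℝ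
  strictMono_ut : StrictMono ut
  strictMono_ub : StrictMono ub
  left_eq : ut 0 = ub 0
  right_eq : ut (Fin.last d) = ub (Fin.last d)
  toFun : ℝ → ℝ
  continuousOn : ∀ α, ContinuousOn toFun
    (Ioo (ut (comb.top α).castSucc) (ut (comb.top α).succ))
  strictMonoOn : ∀ α, StrictMonoOn toFun
    (Ioo (ut (comb.top α).castSucc) (ut (comb.top α).succ))
  image_eq : ∀ α, toFun '' (Ioo (ut (comb.top α).castSucc) (ut (comb.top α).succ)) =
    Ioo (ub (comb.bot α).castSucc) (ub (comb.bot α).succ)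

namespace GIEM

variable {A : Type*} {d : ℕ}

/-- The left (`Sum.inl α`) or right (`Sum.inr α`) endpoint of the top interval of `α`. -/
def utAt (T : GIEM A d) : A ⊕ A → ℝ
  | Sum.inl α => T.ut (T.comb.top α).castSucc
  | Sum.inr α => T.ut (T.comb.top α).succ

/-- The left (`Sum.inl α`) or right (`Sum.inr α`) endpoint of the bottom interval of `α`. -/
def ubAt (T : GIEM A d) : A ⊕ A → ℝ
  | Sum.inl α => T.ub (T.comb.bot α).castSucc
  | Sum.inr α => T.ub (T.comb.bot α).succ

/-- The open top interval of the letter `α`. -/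
def topInterval (T : GIEM A d) (α : A) : Set ℝ := Ioo (T.utAt (Sum.inl α)) (T.utAt (Sum.inr α))

/-- The domain of `T`, the union of the open top intervals. -/
def domain (T : GIEM A d) : Set ℝ := ⋃ α, T.topInterval α

/-- `T` is standard: a translation on each top interval (so that corresponding top and bottom
intervals have the same length). -/
def IsStandard (T : GIEM A d) : Prop :=
  ∀ α, ∃ c : ℝ, ∀ x ∈ T.topInterval α, T.toFun x = x + c

/-- `T` is of class `C^r`: on each top interval it extends to a `C^r` diffeomorphism of the closed
top interval onto the closed bottom interval. -/
def IsOfClass (r : ℕ∞) (T : GIEM A d) : Prop :=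
  ∀ α, ∃ g h : ℝ → ℝ,
    EqOn g T.toFun (T.topInterval α) ∧
    ContDiffOn ℝ (r : WithTop ℕ∞) g (Icc (T.utAt (Sum.inl α)) (T.utAt (Sum.inr α))) ∧
    ContDiffOn ℝ (r : WithTop ℕ∞) h (Icc (T.ubAt (Sum.inl α)) (T.ubAt (Sum.inr α))) ∧
    MapsTo g (Icc (T.utAt (Sum.inl α)) (T.utAt (Sum.inr α)))
      (Icc (T.ubAt (Sum.inl α)) (T.ubAt (Sum.inr α))) ∧
    MapsTo h (Icc (T.ubAt (Sum.inl α)) (T.ubAt (Sum.inr α)))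
      (Icc (T.utAt (Sum.inl α)) (T.utAt (Sum.inr α))) ∧
    LeftInvOn h g (Icc (T.utAt (Sum.inl α)) (T.utAt (Sum.inr α))) ∧
    RightInvOn h g (Icc (T.ubAt (Sum.inl α)) (T.ubAt (Sum.inr α)))

/-- The side on which the jet at an endpoint is taken: `x > 0` at left endpoints, `x < 0` at right
endpoints. -/
def side : A ⊕ A → Set ℝ
  | Sum.inl _ => Ioi 0
  | Sum.inr _ => Iio 0

/-- `j` is the `r`-jet `j(T, υ)` at `0` of `x ↦ T (u^t(υ) + x) - u^b(υ)`, where `x` stays on the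
side prescribed by `υ`. There is at most one such `j`, and exactly one when `T` is of
class `C^r`, `r ≥ 1`. -/
def IsJetAt (r : ℕ∞) (T : GIEM A d) (υ : A ⊕ A) (j : JetGroup r) : Prop :=
  ∃ f : JetDiff r, (QuotientGroup.mk f : JetGroup r) = j ∧
    ∀ k : ℕ, (k : ℕ∞) ≤ r →
      (fun x : ℝ => (T.toFun (T.utAt υ + x) - T.ubAt υ) - (f : ℝ ≃o ℝ) x)
        =o[𝓝[side υ] 0] (fun x : ℝ => x ^ k)

/-- `c` is the conjugacy invariant `J(T)` in `J^r`: the family, parametrized by the cycles of `σ`,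
of the conjugacy classes of the products of the jets of `T` along the cycles. -/
def IsConjInvariant (r : ℕ∞) (T : GIEM A d) (c : T.comb.Cycles → ConjClasses (JetGroup r)) :
    Prop :=
  ∃ j : A ⊕ A → JetGroup r, (∀ υ, T.IsJetAt r υ (j υ)) ∧ c = T.comb.cycleClass j

end GIEM

/-! ### Translation surfaces -/

/-- A translation surface structure on the (compact, connected, Hausdorff) space `M`: a nonempty
finite set `sing` of points and a maximal atlas of charts of its complement in `ℂ = ℝ²`, with
coordinate changes that are locally translations, such that near each point of `sing` the charts
are given by a ramified covering `φ ^ κ`, where `φ` is a homeomorphism of a neighbourhood onto an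
open neighbourhood of `0`. In particular `M` is a topological surface, and it is oriented by the
charts. -/
structure TranslationSurface (M : Type*) [TopologicalSpace M] where
  sing : Set M
  sing_finite : sing.Finite
  sing_nonempty : sing.Nonempty
  atlas : Set (OpenPartialHomeomorph M ℂ)
  source_subset : ∀ e ∈ atlas, e.source ⊆ singᶜ
  cover : ∀ p ∉ sing, ∃ e ∈ atlas, p ∈ e.source
  translation : ∀ e ∈ atlas, ∀ e' ∈ atlas, ∀ p ∈ e.source ∩ e'.source,
    ∃ c : ℂ, ∀ᶠ q in 𝓝 p, e' q = e q + c
  maximal : ∀ e : OpenPartialHomeomorph M ℂ, e.source ⊆ singᶜ →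
    (∀ e' ∈ atlas, ∀ p ∈ e.source ∩ e'.source, ∃ c : ℂ, ∀ᶠ q in 𝓝 p, e' q = e q + c) → e ∈ atlas
  ramified : ∀ A ∈ sing, ∃ κ : ℕ, 1 ≤ κ ∧ ∃ φ : OpenPartialHomeomorph M ℂ,
    A ∈ φ.source ∧ φ A = 0 ∧ φ.source ∩ sing = {A} ∧
    ∀ e ∈ atlas, ∀ p ∈ φ.source ∩ e.source, ∃ c : ℂ, ∀ᶠ q in 𝓝 p, e q = φ q ^ κ + c

namespace TranslationSurface

variable {M : Type*} [TopologicalSpace M] (S : TranslationSurface M)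

/-! As coordinate changes are translations, a vector field on the complement of `S.sing` reads in
the same way in all charts at a point. It is therefore given by a function `X : M → ℂ`, of which
only the values off `S.sing` are used: `X p` is the vector at `p` read in any chart. The vertical
vector field `∂/∂y` is the constant `Complex.I`. -/

/-- The vertical vector field. -/
def vertical (_S : TranslationSurface M) : M → ℂ := fun _ => Complex.I

/-- `γ` is on the interval `s` an integral curve, in the complement of `S.sing`, of the vector
field `X`. -/
def IsIntegralCurve (X : M → ℂ) (γ : ℝ → M) (s : Set ℝ) : Prop :=
  ContinuousOn γ s ∧ ∀ t ∈ s, γ t ∉ S.sing ∧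
    ∀ e ∈ S.atlas, γ t ∈ e.source → HasDerivWithinAt (fun u => e (γ u)) (X (γ t)) s t

/-- `X` is, off `S.sing`, a nowhere vanishing vector field of class `C^r` that coincides with the
vertical one in a neighbourhood of `S.sing`. -/
structure IsDeformation (r : ℕ∞) (X : M → ℂ) : Prop where
  contDiffOn : ∀ e ∈ S.atlas, ContDiffOn ℝ (r : WithTop ℕ∞) (fun z => X (e.symm z)) e.target
  ne_zero : ∀ p ∉ S.sing, X p ≠ 0
  eq_vertical : ∀ A ∈ S.sing, ∀ᶠ p in 𝓝 A, p ∉ S.sing → X p = S.vertical p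

/-- All derivatives of order at most `k` of `X - X₀`, where `X₀` is the vertical vector field, have
norm less than `ε` on the complement of `S.sing`. -/
def IsCloseToVertical (k : ℕ) (ε : ℝ) (X : M → ℂ) : Prop :=
  ∀ e ∈ S.atlas, ∀ z ∈ e.target, ∀ i ≤ k,
    ‖iteratedFDerivWithin ℝ i (fun w => X (e.symm w) - S.vertical (e.symm w)) e.target z‖ < ε

/-- `γ` is on `[0, ℓ]` a vertical connexion. -/
def IsVerticalConnexion (ℓ : ℝ) (γ : ℝ → M) : Prop :=
  0 < ℓ ∧ ContinuousOn γ (Icc 0 ℓ) ∧ γ 0 ∈ S.sing ∧ γ ℓ ∈ S.sing ∧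
    S.IsIntegralCurve S.vertical γ (Ioo 0 ℓ)

/-- `γ` is on `[0, ℓ]` a vertical segment, run through upwards or downwards, that connects the
point `p` to a point of `S.sing`. -/
def IsVerticalSegmentFrom (p : M) (ℓ : ℝ) (γ : ℝ → M) : Prop :=
  0 < ℓ ∧ ContinuousOn γ (Icc 0 ℓ) ∧ γ 0 = p ∧ γ ℓ ∈ S.sing ∧
    (S.IsIntegralCurve S.vertical γ (Ico 0 ℓ) ∨ S.IsIntegralCurve (-S.vertical) γ (Ico 0 ℓ))

/-- An open bounded horizontal segment with distinct endpoints, parametrized from left to right by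
its length on `(a, b)`. -/
structure HorizontalSegment where
  a : ℝ
  b : ℝ
  lt : a < b
  ι : ℝ → M
  continuousOn : ContinuousOn ι (Icc a b)
  injOn : InjOn ι (Icc a b)
  horizontal : S.IsIntegralCurve (fun _ => 1) ι (Ioo a b)

namespace HorizontalSegment

variable {S}
variable (I : S.HorizontalSegment)

/-- The open segment as a subset of the surface. -/
def carrier : Set M := I.ι '' Ioo I.a I.b

/-- Good position: the open segment meets every vertical connexion, and each endpoint is in
`S.sing` or is connected to a point of `S.sing` by a vertical segment not meeting the open
segment. -/
def GoodPosition : Prop :=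
  (∀ (ℓ : ℝ) (γ : ℝ → M), S.IsVerticalConnexion ℓ γ → ∃ t ∈ Ioo 0 ℓ, γ t ∈ I.carrier) ∧
  ∀ p, (p = I.ι I.a ∨ p = I.ι I.b) → p ∈ S.sing ∨
    ∃ (ℓ : ℝ) (γ : ℝ → M), S.IsVerticalSegmentFrom p ℓ γ ∧ ∀ t ∈ Icc 0 ℓ, γ t ∉ I.carrier

/-- The points, off `S.sing`, of the vertical separatrix segments that connect `S.sing` to the
endpoints of the segment without meeting the open segment. -/
def separatrixSegments : Set M :=
  {q | ∃ (p : M) (ℓ : ℝ) (γ : ℝ → M), (p = I.ι I.a ∨ p = I.ι I.b) ∧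
    S.IsVerticalSegmentFrom p ℓ γ ∧ (∀ t ∈ Icc 0 ℓ, γ t ∉ I.carrier) ∧ ∃ t ∈ Ico 0 ℓ, γ t = q}

/-- The orbit under `X` of the point with parameter `x` of the open segment returns to the open
segment, for the first time, at the point with parameter `y`. -/
def FirstReturn (X : M → ℂ) (x y : ℝ) : Prop :=
  x ∈ Ioo I.a I.b ∧ y ∈ Ioo I.a I.b ∧ ∃ (τ : ℝ) (γ : ℝ → M), 0 < τ ∧
    S.IsIntegralCurve X γ (Icc 0 τ) ∧ γ 0 = I.ι x ∧ γ τ = I.ι y ∧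
    ∀ t ∈ Ioo 0 τ, γ t ∉ I.carrier

/-- `T` is the return map of the flow of `X` on the segment: it acts on `(a, b)`, the union of its
top intervals is the set of points which return, and its values are the points of first return. -/
def IsReturnMap (X : M → ℂ) {A : Type*} {d : ℕ} (T : GIEM A d) : Prop :=
  T.ut 0 = I.a ∧ T.ut (Fin.last d) = I.b ∧
    ∀ x y : ℝ, I.FirstReturn X x y ↔ x ∈ T.domain ∧ y = T.toFun x

end HorizontalSegment

end TranslationSurface

/-! ### Flows of time dependent scalar differential equations -/

/-! Geometry of the vertical flow. Off `S.sing` the surface is locally a plane up to translations,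
so straight motion from a regular point `p` defines an exponential map on a star-shaped open set,
and this map is a developing map (`expMap_eventually`). Near a singular point reached along a ray it
is a branch of the inverse of a ramified chart, on a disc slit beyond that point (`exists_sector`).
A vertical leaf from `I` returns, ends in `S.sing`, or is infinite and avoids the closed segment
(`trichotomy`). Finitely many leaves end (`finite_ends`), and between them recurrence excludes
infinite leaves (`exists_returnsBy_of_Ioo`). Cutting `I` at the leaves that end therefore gives
rectangles with constant return time `h` and constant translation `c`: the return map is a standard
exchange.

Heights. Good position forbids connexions off `I`, so each side of a rectangle carries one singular
point, at a signed height `a`; if it lies outside `[0, h]`, it is on the prolongation of the side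
through an endpoint of `I` (`exists_sideHeight`). The height depends only on the partition point: it
is `A` at a top point, `B` at a bottom point, with `A - h = B` across a rectangle, `A = B` at the
two ends of `I`, and `A > 0 > B` at interior points. Summing differences of heights over a common
initial block of letters gives irreducibility.

Deformation. Only uniform closeness to the vertical field is needed. Dividing the field by its
vertical component changes neither orbits nor returns, and turns it, in the coordinates of a
rectangle, into a scalar equation `x' = F(t, x)` with `|F| ≤ ε`. The field is still vertical near
singular points, so the integral curve attached to a singular point of a side makes sense; it stays
in a cone of slope `ε` with its apex there, on which the rectangle coordinates persist
(`exists_isMargin`). These curves are the perturbed sides, and between them the flow goes from the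
bottom to the top. When the singular point is outside the rectangle, the hypothesis on the
separatrix segments keeps the perturbed side fixed at the endpoint of `I`. The branches of the
return map are restrictions of `C^r` diffeomorphisms of the line, with unchanged combinatorics.

Triviality of the invariant. To each perturbed top point is attached the jet `g` of the holonomy
from `I` to its singular point, and to each bottom point a jet `k` in the same way. The field being
vertical near the singular point, stopping slightly earlier does not change the jet. The jet of the
return map along a side is `k⁻¹ * g` (`exists_holonomy`). Uniqueness of integral curves makes `g`
and `k` independent of the rectangle on either side, and `g = k` at the ends of `I`. Along a cycle
of `σ` consecutive factors then share their `g` or `k` and the product telescopes to `1`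
(`CombData.cycleClass_quotient`). -/

/-- `g t x` is jointly continuous together with its partial derivatives in `x` up to order `n`. -/
def SpaceContDiff : ℕ → (ℝ → ℝ → ℝ) → Prop
  | 0, g => Continuous (Function.uncurry g)
  | n + 1, g => Continuous (Function.uncurry g) ∧
      ∃ g', SpaceContDiff n g' ∧ ∀ t x, HasDerivAt (g t) (g' t x) x

namespace SpaceContDiff

theorem continuous {n : ℕ} {g : ℝ → ℝ → ℝ} (h : SpaceContDiff n g) :
    Continuous (Function.uncurry g) := by
  cases n with
  | zero => exact h
  | succ n => exact h.1

theorem of_succ {n : ℕ} : ∀ {g : ℝ → ℝ → ℝ}, SpaceContDiff (n + 1) g → SpaceContDiff n g := by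
  induction n with
  | zero => exact fun h => h.1
  | succ n ih =>
    rintro g ⟨hc, g', hg', hd⟩
    exact ⟨hc, g', ih hg', hd⟩

theorem add {n : ℕ} : ∀ {g h : ℝ → ℝ → ℝ}, SpaceContDiff n g → SpaceContDiff n h →
    SpaceContDiff n (fun t x => g t x + h t x) := by
  induction n with
  | zero => exact fun hg hh => Continuous.add hg hh
  | succ n ih =>
    rintro g h ⟨hc, g', hg', hd⟩ ⟨kc, h', hh', kd⟩
    exact ⟨hc.add kc, _, ih hg' hh', fun t x => (hd t x).add (kd t x)⟩

theorem mul {n : ℕ} : ∀ {g h : ℝ → ℝ → ℝ}, SpaceContDiff n g → SpaceContDiff n h →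
    SpaceContDiff n (fun t x => g t x * h t x) := by
  induction n with
  | zero => exact fun hg hh => Continuous.mul hg hh
  | succ n ih =>
    intro g h hg hh
    obtain ⟨hc, g', hg', hd⟩ := id hg
    obtain ⟨kc, h', hh', kd⟩ := id hh
    exact ⟨hc.mul kc, _, (ih hg' hh.of_succ).add (ih hg.of_succ hh'),
      fun t x => (hd t x).mul (kd t x)⟩

theorem exp {n : ℕ} : ∀ {g : ℝ → ℝ → ℝ}, SpaceContDiff n g →
    SpaceContDiff n (fun t x => Real.exp (g t x)) := by
  induction n with
  | zero => exact fun hg => Real.continuous_exp.comp hg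
  | succ n ih =>
    intro g hg
    obtain ⟨hc, g', hg', hd⟩ := id hg
    exact ⟨Real.continuous_exp.comp hc, _, (ih hg.of_succ).mul hg', fun t x => (hd t x).exp⟩

theorem comp {n : ℕ} : ∀ {g h : ℝ → ℝ → ℝ}, SpaceContDiff n g → SpaceContDiff n h →
    SpaceContDiff n (fun t x => g t (h t x)) := by
  induction n with
  | zero => exact fun hg hh => Continuous.comp hg (continuous_fst.prodMk hh)
  | succ n ih =>
    intro g h hg hh
    obtain ⟨hc, g', hg', hd⟩ := id hg
    obtain ⟨kc, h', hh', kd⟩ := id hh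
    exact ⟨hc.comp (continuous_fst.prodMk kc), _, (ih hg' hh.of_succ).mul hh',
      fun t x => (hd t (h t x)).comp x (kd t x)⟩

/-- Joint continuity of `g'` bounds it on a compact product, which dominates the difference
quotients. -/
theorem hasDerivAt_integral {g g' : ℝ → ℝ → ℝ} (hg : Continuous (Function.uncurry g))
    (hg' : Continuous (Function.uncurry g')) (hd : ∀ t x, HasDerivAt (g t) (g' t x) x)
    (s t x : ℝ) :
    HasDerivAt (fun x => ∫ u in s..t, g u x) (∫ u in s..t, g' u x) x := by
  have hcg : ∀ x, Continuous fun u => g u x := fun x =>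
    hg.comp (continuous_id.prodMk continuous_const)
  have hcg' : ∀ x, Continuous fun u => g' u x := fun x =>
    hg'.comp (continuous_id.prodMk continuous_const)
  obtain ⟨C, hC⟩ := (isCompact_uIcc (a := s) (b := t)).prod (isCompact_closedBall x 1)
    |>.exists_bound_of_continuousOn hg'.continuousOn
  refine (intervalIntegral.hasDerivAt_integral_of_dominated_loc_of_deriv_le
    (F := fun x u => g u x) (F' := fun x u => g' u x) (bound := fun _ => C)
    (s := Metric.closedBall x 1)
    (Metric.closedBall_mem_nhds x one_pos) ?_ ?_ ?_ ?_ ?_ ?_).2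
  · exact Eventually.of_forall fun y => (hcg y).aestronglyMeasurable
  · exact (hcg x).intervalIntegrable _ _
  · exact (hcg' x).aestronglyMeasurable
  · exact Eventually.of_forall fun u hu y hy => hC (u, y) ⟨uIoc_subset_uIcc hu, hy⟩
  · exact intervalIntegrable_const
  · exact Eventually.of_forall fun u _ y _ => hd u y

theorem continuous_integral {g : ℝ → ℝ → ℝ} (hg : Continuous (Function.uncurry g)) (s : ℝ) :
    Continuous (Function.uncurry fun t x => ∫ u in s..t, g u x) := by
  have h := intervalIntegral.continuous_parametric_primitive_of_continuous
    (μ := MeasureTheory.volume) (a₀ := s) (f := fun x u => g u x)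
    (hg.comp continuous_swap)
  exact h.comp continuous_swap

theorem integral {n : ℕ} (s : ℝ) : ∀ {g : ℝ → ℝ → ℝ}, SpaceContDiff n g →
    SpaceContDiff n (fun t x => ∫ u in s..t, g u x) := by
  induction n with
  | zero => exact fun hg => continuous_integral hg s
  | succ n ih =>
    rintro g ⟨hc, g', hg', hd⟩
    exact ⟨continuous_integral hc s, _, ih hg',
      fun t x => hasDerivAt_integral hc hg'.continuous hd s t x⟩

theorem of_contDiff {n : ℕ} : ∀ {g : ℝ → ℝ → ℝ}, ContDiff ℝ n (Function.uncurry g) →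
    SpaceContDiff n g := by
  induction n with
  | zero => exact fun h => h.continuous
  | succ n ih =>
    intro g h
    have h1 : ContDiff ℝ ((n : WithTop ℕ∞) + 1) (Function.uncurry g) := by exact_mod_cast h
    refine ⟨h.continuous, fun t x => fderiv ℝ (Function.uncurry g) (t, x) (0, 1), ih ?_, ?_⟩
    · exact (h1.fderiv_right le_rfl).clm_apply contDiff_const
    · intro t x
      have hd : DifferentiableAt ℝ (Function.uncurry g) (t, x) :=
        (h1.differentiable (by simp)) (t, x)
      have hp : HasDerivAt (fun y : ℝ => (t, y)) ((0 : ℝ), (1 : ℝ)) x :=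
        (hasDerivAt_const x t).prodMk (hasDerivAt_id x)
      exact hd.hasFDerivAt.comp_hasDerivAt x hp

theorem contDiff {n : ℕ} : ∀ {g : ℝ → ℝ → ℝ}, SpaceContDiff n g → ∀ t, ContDiff ℝ n (g t) := by
  induction n with
  | zero =>
    intro g h t
    exact contDiff_zero.2 (h.continuous.comp (continuous_const.prodMk continuous_id))
  | succ n ih =>
    rintro g ⟨hc, g', hg', hd⟩ t
    have he : deriv (g t) = g' t := funext fun x => (hd t x).deriv
    have : ContDiff ℝ ((n : WithTop ℕ∞) + 1) (g t) := by
      rw [contDiff_succ_iff_deriv]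
      refine ⟨fun x => (hd t x).differentiableAt, fun h => by simp at h, ?_⟩
      rw [he]
      exact ih hg' t
    exact_mod_cast this

end SpaceContDiff

/-! ### Global flows of bounded Lipschitz scalar equations -/

/-- The data needed to build a global flow: a bounded field, Lipschitz in space. -/
structure IsGlobalField (F : ℝ → ℝ → ℝ) (C K : NNReal) : Prop where
  contDiff : ContDiff ℝ 1 (Function.uncurry F)
  bound : ∀ t x, |F t x| ≤ C
  lip : ∀ t, LipschitzWith K (F t)

namespace IsGlobalField

variable {F : ℝ → ℝ → ℝ} {C K : NNReal}

/-- In time `n + 1` a solution moves by at most `C * (n + 1)`, and the field is controlled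
everywhere, so Picard–Lindelöf applies on windows of any length. -/
theorem exists_Icc (hF : IsGlobalField F C K) (s x : ℝ) (n : ℕ) :
    ∃ c : ℝ → ℝ, c s = x ∧ ∀ t ∈ Ioo (s - (n + 1)) (s + (n + 1)), HasDerivAt c (F t (c t)) t := by
  have hmem : s ∈ Icc (s - (n + 1 : ℝ)) (s + (n + 1)) := by constructor <;> linarith
  have hPL : IsPicardLindelof F (⟨s, hmem⟩ : Icc (s - (n + 1 : ℝ)) (s + (n + 1))) x
      (C * (n + 1)) 0 C K := by
    refine ⟨fun t _ => (hF.lip t).lipschitzOnWith, fun y _ => ?_, fun t _ y _ => hF.bound t y, ?_⟩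
    · exact (hF.contDiff.continuous.comp (continuous_id.prodMk continuous_const)).continuousOn
    · simp
  obtain ⟨c, hc, hd⟩ := hPL.exists_eq_forall_mem_Icc_hasDerivWithinAt₀
  exact ⟨c, hc, fun t ht => (hd t (Ioo_subset_Icc_self ht)).hasDerivAt (Icc_mem_nhds ht.1 ht.2)⟩

theorem exists_solution (hF : IsGlobalField F C K) (s x : ℝ) :
    ∃ c : ℝ → ℝ, c s = x ∧ ∀ t, HasDerivAt c (F t (c t)) t := by
  choose α hα hd using hF.exists_Icc s x
  have hEq : ∀ m n : ℕ, m ≤ n → EqOn (α m) (α n) (Ioo (s - (m + 1)) (s + (m + 1))) := by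
    intro m n hmn
    have hmn' : (m : ℝ) ≤ n := by exact_mod_cast hmn
    have hs : s ∈ Ioo (s - (m + 1 : ℝ)) (s + (m + 1)) := by constructor <;> linarith
    refine ODE_solution_unique_of_mem_Ioo (v := F) (K := K) (s := fun _ => univ)
      (fun t _ => (hF.lip t).lipschitzOnWith)
      hs (fun t ht => ⟨hd m t ht, trivial⟩) (fun t ht => ⟨hd n t ⟨?_, ?_⟩, trivial⟩) ?_
    · linarith [ht.1]
    · linarith [ht.2]
    · rw [hα, hα]
  have hmemn : ∀ t, t ∈ Ioo (s - ((⌈|t - s|⌉₊ : ℕ) + 1 : ℝ)) (s + ((⌈|t - s|⌉₊ : ℕ) + 1)) := by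
    intro t
    have h1 := Nat.le_ceil |t - s|
    have h2 := abs_le.1 h1
    constructor <;> linarith [h2.1, h2.2]
  -- At time `t` the window of index `⌈|t - s|⌉₊` is used; it contains `t`, and uniqueness makes the
  -- windows agree on overlaps.
  refine ⟨fun t => α ⌈|t - s|⌉₊ t, hα _, fun t => ?_⟩
  have hcongr : (fun u => α ⌈|u - s|⌉₊ u) =ᶠ[𝓝 t] α ⌈|t - s|⌉₊ := by
    filter_upwards [Ioo_mem_nhds (hmemn t).1 (hmemn t).2] with u hu
    rcases le_total ⌈|u - s|⌉₊ ⌈|t - s|⌉₊ with h | h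
    · exact hEq _ _ h (hmemn u)
    · exact (hEq _ _ h hu).symm
  exact (hd _ t (hmemn t)).congr_of_eventuallyEq hcongr

/-- The value at time `t` of the solution with value `x` at time `s`. -/
noncomputable def sol (hF : IsGlobalField F C K) (s t x : ℝ) : ℝ :=
  (hF.exists_solution s x).choose t

theorem sol_self (hF : IsGlobalField F C K) (s x : ℝ) : hF.sol s s x = x :=
  (hF.exists_solution s x).choose_spec.1

theorem hasDerivAt_sol (hF : IsGlobalField F C K) (s t x : ℝ) :
    HasDerivAt (fun t => hF.sol s t x) (F t (hF.sol s t x)) t :=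
  (hF.exists_solution s x).choose_spec.2 t

theorem sol_unique (hF : IsGlobalField F C K) {c : ℝ → ℝ} {s : ℝ}
    (hc : ∀ t, HasDerivAt c (F t (c t)) t) (t : ℝ) : hF.sol s t (c s) = c t := by
  have := ODE_solution_unique_univ (v := F) (K := K) (s := fun _ => univ) (t₀ := s)
    (fun t => (hF.lip t).lipschitzOnWith)
    (fun t => ⟨hF.hasDerivAt_sol s t (c s), trivial⟩) (fun t => ⟨hc t, trivial⟩)
    (hF.sol_self s (c s))
  exact congrFun this t

theorem sol_sol (hF : IsGlobalField F C K) (s t u x : ℝ) :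
    hF.sol t u (hF.sol s t x) = hF.sol s u x :=
  hF.sol_unique (c := fun t => hF.sol s t x) (fun t => hF.hasDerivAt_sol s t x) u

theorem abs_sol_sub_le (hF : IsGlobalField F C K) (s t x : ℝ) :
    |hF.sol s t x - x| ≤ C * |t - s| := by
  have h := Convex.norm_image_sub_le_of_norm_hasDerivWithin_le (f := fun t => hF.sol s t x)
    (f' := fun t => F t (hF.sol s t x)) (s := univ) (x := s) (y := t) (C := C)
    (fun u _ => (hF.hasDerivAt_sol s u x).hasDerivWithinAt) (fun u _ => hF.bound _ _) convex_univ
    trivial trivial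
  simpa [hF.sol_self] using h

/-- The averaged space derivative of the field. -/
noncomputable def avg (_hF : IsGlobalField F C K) (u a b : ℝ) : ℝ :=
  ∫ θ in (0 : ℝ)..1, fderiv ℝ (Function.uncurry F) (u, a + θ * (b - a)) (0, 1)

theorem continuous_avg (hF : IsGlobalField F C K) :
    Continuous fun p : ℝ × ℝ × ℝ => hF.avg p.1 p.2.1 p.2.2 := by
  have h : Continuous fun q => fderiv ℝ (Function.uncurry F) q ((0 : ℝ), (1 : ℝ)) :=
    (hF.contDiff.continuous_fderiv (by simp)).clm_apply continuous_const
  refine intervalIntegral.continuous_parametric_intervalIntegral_of_continuous' ?_ _ _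
  exact h.comp (by fun_prop)

theorem hasDerivAt_field (hF : IsGlobalField F C K) (t x : ℝ) :
    HasDerivAt (F t) (fderiv ℝ (Function.uncurry F) (t, x) (0, 1)) x := by
  have hd : DifferentiableAt ℝ (Function.uncurry F) (t, x) :=
    (hF.contDiff.differentiable (by simp)) (t, x)
  have hp : HasDerivAt (fun y : ℝ => (t, y)) ((0 : ℝ), (1 : ℝ)) x :=
    (hasDerivAt_const x t).prodMk (hasDerivAt_id x)
  exact hd.hasFDerivAt.comp_hasDerivAt x hp

theorem sub_eq_avg (hF : IsGlobalField F C K) (u a b : ℝ) :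
    F u b - F u a = hF.avg u a b * (b - a) := by
  have hc : Continuous fun θ : ℝ =>
      fderiv ℝ (Function.uncurry F) (u, a + θ * (b - a)) ((0 : ℝ), (1 : ℝ)) * (b - a) := by
    have h : Continuous fun q => fderiv ℝ (Function.uncurry F) q ((0 : ℝ), (1 : ℝ)) :=
      (hF.contDiff.continuous_fderiv (by simp)).clm_apply continuous_const
    exact (h.comp (by fun_prop)).mul continuous_const
  have hder : ∀ θ ∈ uIcc (0 : ℝ) 1, HasDerivAt (fun θ => F u (a + θ * (b - a)))
      (fderiv ℝ (Function.uncurry F) (u, a + θ * (b - a)) ((0 : ℝ), (1 : ℝ)) * (b - a)) θ := by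
    intro θ _
    have h1 : HasDerivAt (fun θ : ℝ => a + θ * (b - a)) (b - a) θ := by
      simpa using ((hasDerivAt_id θ).mul_const (b - a)).const_add a
    exact (hF.hasDerivAt_field u (a + θ * (b - a))).comp θ h1
  have h := intervalIntegral.integral_eq_sub_of_hasDerivAt hder (hc.intervalIntegrable _ _)
  rw [intervalIntegral.integral_mul_const] at h
  rw [avg, h]
  simp

theorem avg_self (hF : IsGlobalField F C K) (u a : ℝ) :
    hF.avg u a a = fderiv ℝ (Function.uncurry F) (u, a) (0, 1) := by
  simp [avg]

theorem continuous_sol_time (hF : IsGlobalField F C K) (s x : ℝ) :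
    Continuous fun t => hF.sol s t x :=
  continuous_iff_continuousAt.2 fun t => (hF.hasDerivAt_sol s t x).continuousAt

/-- The difference of two solutions solves a linear equation whose coefficient is the averaged
derivative, hence is an explicit exponential. Monotonicity, continuity and differentiability in the
initial point all come from this identity. -/
theorem sol_sub_sol (hF : IsGlobalField F C K) (s t x y : ℝ) :
    hF.sol s t y - hF.sol s t x =
      (y - x) * Real.exp (∫ u in s..t, hF.avg u (hF.sol s u x) (hF.sol s u y)) := by
  set m : ℝ → ℝ := fun u => hF.avg u (hF.sol s u x) (hF.sol s u y) with hm
  have hmc : Continuous m := hF.continuous_avg.comp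
    (continuous_id.prodMk ((hF.continuous_sol_time s x).prodMk (hF.continuous_sol_time s y)))
  have hI : ∀ t, HasDerivAt (fun t => ∫ u in s..t, m u) (m t) t := fun t =>
    intervalIntegral.integral_hasDerivAt_right (hmc.intervalIntegrable _ _)
      hmc.stronglyMeasurable.stronglyMeasurableAtFilter hmc.continuousAt
  set D : ℝ → ℝ := fun t => (hF.sol s t y - hF.sol s t x) * Real.exp (-∫ u in s..t, m u) with hD
  have hD' : ∀ t, HasDerivAt D 0 t := by
    intro t
    have h1 := ((hF.hasDerivAt_sol s t y).sub (hF.hasDerivAt_sol s t x)).mul (hI t).neg.exp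
    have h2 : F t (hF.sol s t y) - F t (hF.sol s t x) = m t * (hF.sol s t y - hF.sol s t x) :=
      hF.sub_eq_avg t _ _
    refine h1.congr_deriv ?_
    rw [h2]
    simp only [Pi.sub_apply, Pi.neg_apply]
    ring
  have hconst : D t = D s := is_const_of_deriv_eq_zero (fun t => (hD' t).differentiableAt)
    (fun t => (hD' t).deriv) t s
  have hDs : D s = y - x := by simp [hD, hF.sol_self]
  rw [← hDs, ← hconst, hD]
  simp only
  rw [mul_assoc, ← Real.exp_add]
  simp

theorem strictMono_sol (hF : IsGlobalField F C K) (s t : ℝ) : StrictMono (hF.sol s t) := by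
  intro x y hxy
  have h := hF.sol_sub_sol s t x y
  have : 0 < (y - x) * Real.exp (∫ u in s..t, hF.avg u (hF.sol s u x) (hF.sol s u y)) :=
    mul_pos (sub_pos.2 hxy) (Real.exp_pos _)
  linarith

theorem abs_avg_le (hF : IsGlobalField F C K) (u a b : ℝ) : |hF.avg u a b| ≤ K := by
  have : ∀ x, ‖fderiv ℝ (Function.uncurry F) (u, x) ((0 : ℝ), (1 : ℝ))‖ ≤ K := by
    intro x
    have h := norm_fderiv_le_of_lipschitz ℝ (hF.lip u) (x₀ := x)
    rwa [← norm_deriv_eq_norm_fderiv, (hF.hasDerivAt_field u x).deriv] at h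
  have h := intervalIntegral.norm_integral_le_of_norm_le_const (a := 0) (b := 1)
    (f := fun θ => fderiv ℝ (Function.uncurry F) (u, a + θ * (b - a)) ((0 : ℝ), (1 : ℝ)))
    (C := K) (fun θ _ => this _)
  simpa [avg] using h

theorem continuous_sol (hF : IsGlobalField F C K) (s : ℝ) :
    Continuous (Function.uncurry fun t x => hF.sol s t x) := by
  rw [continuous_iff_continuousAt]
  rintro ⟨t₀, x₀⟩
  have hb : ∀ t x, |hF.sol s t x - hF.sol s t x₀| ≤ |x - x₀| * Real.exp (K * |t - s|) := by
    intro t x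
    rw [hF.sol_sub_sol, abs_mul, abs_of_pos (Real.exp_pos _)]
    refine mul_le_mul_of_nonneg_left (Real.exp_le_exp.2 ?_) (abs_nonneg _)
    refine le_trans (le_abs_self _) ?_
    have hle := intervalIntegral.norm_integral_le_of_norm_le_const (a := s) (b := t) (C := K)
      (f := fun u => hF.avg u (hF.sol s u x₀) (hF.sol s u x)) fun u _ => hF.abs_avg_le _ _ _
    exact hle
  have h1 : Tendsto (fun p : ℝ × ℝ => |p.2 - x₀| * Real.exp (K * |p.1 - s|)) (𝓝 (t₀, x₀))
      (𝓝 0) := by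
    have : Continuous fun p : ℝ × ℝ => |p.2 - x₀| * Real.exp (K * |p.1 - s|) := by fun_prop
    simpa using this.tendsto (t₀, x₀)
  have h2 : Tendsto (fun p : ℝ × ℝ => hF.sol s p.1 p.2 - hF.sol s p.1 x₀) (𝓝 (t₀, x₀)) (𝓝 0) :=
    squeeze_zero_norm (fun p => hb p.1 p.2) h1
  have h3 : Tendsto (fun p : ℝ × ℝ => hF.sol s p.1 x₀) (𝓝 (t₀, x₀)) (𝓝 (hF.sol s t₀ x₀)) :=
    ((hF.continuous_sol_time s x₀).comp continuous_fst).tendsto (t₀, x₀)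
  have h4 := h2.add h3
  simp only [sub_add_cancel, zero_add] at h4
  exact h4

/-- The slope is the exponential factor of `sol_sub_sol`, which is continuous in `y`, also at `y =
x`, where the average becomes the derivative. -/
theorem hasDerivAt_sol_space (hF : IsGlobalField F C K) (s t x : ℝ) :
    HasDerivAt (hF.sol s t)
      (Real.exp (∫ u in s..t, fderiv ℝ (Function.uncurry F) (u, hF.sol s u x) (0, 1))) x := by
  rw [hasDerivAt_iff_tendsto_slope]
  have hcont : Continuous fun y =>
      Real.exp (∫ u in s..t, hF.avg u (hF.sol s u x) (hF.sol s u y)) := by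
    refine Real.continuous_exp.comp ?_
    refine intervalIntegral.continuous_parametric_intervalIntegral_of_continuous' ?_ _ _
    refine hF.continuous_avg.comp (continuous_snd.prodMk (Continuous.prodMk ?_ ?_))
    · exact (hF.continuous_sol_time s x).comp continuous_snd
    · exact (hF.continuous_sol s).comp continuous_swap
  have h := (hcont.tendsto x).mono_left (nhdsWithin_le_nhds (s := {x}ᶜ))
  simp only [hF.avg_self] at h
  refine h.congr' ?_
  filter_upwards [self_mem_nhdsWithin] with y hy
  rw [slope_def_field, hF.sol_sub_sol]
  field_simp [sub_ne_zero.2 hy]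

/-- Bootstrap: the space derivative of the flow is the exponential of an integral of the derivative
of `F` along the flow, so it inherits the regularity already known for the flow. -/
theorem spaceContDiff_sol (hF : IsGlobalField F C K) (s : ℝ) {n : ℕ}
    (hn : ContDiff ℝ n (Function.uncurry F)) : SpaceContDiff n fun t x => hF.sol s t x := by
  induction n with
  | zero => exact hF.continuous_sol s
  | succ n ih =>
    have hn1 : ContDiff ℝ ((n : WithTop ℕ∞) + 1) (Function.uncurry F) := by exact_mod_cast hn
    have hP := ih (hn1.of_le (by simp))
    have hd : SpaceContDiff n fun t x => fderiv ℝ (Function.uncurry F) (t, x) (0, 1) :=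
      SpaceContDiff.of_contDiff ((hn1.fderiv_right le_rfl).clm_apply contDiff_const)
    exact ⟨hF.continuous_sol s, _, ((hd.comp hP).integral s).exp,
      fun t x => hF.hasDerivAt_sol_space s t x⟩

/-- The flow as a family of increasing homeomorphisms. -/
noncomputable def flow (hF : IsGlobalField F C K) (s t : ℝ) : ℝ ≃o ℝ where
  toFun := hF.sol s t
  invFun := hF.sol t s
  left_inv x := by rw [hF.sol_sol, hF.sol_self]
  right_inv x := by rw [hF.sol_sol, hF.sol_self]
  map_rel_iff' := (hF.strictMono_sol s t).le_iff_le

theorem contDiff_flow (hF : IsGlobalField F C K) {r : ℕ∞}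
    (hr : ContDiff ℝ (r : WithTop ℕ∞) (Function.uncurry F)) (s t : ℝ) :
    ContDiff ℝ (r : WithTop ℕ∞) (hF.flow s t) := by
  rw [contDiff_iff_forall_nat_le]
  intro m hm
  exact (hF.spaceContDiff_sol s (hr.of_le (by exact_mod_cast hm))).contDiff t

end IsGlobalField

/-- A compactly supported field of class `C^1` has a global flow. -/
theorem exists_isGlobalField {F : ℝ → ℝ → ℝ} (h : ContDiff ℝ 1 (Function.uncurry F))
    (hs : HasCompactSupport (Function.uncurry F)) {ε : NNReal} (hε : ∀ t x, |F t x| ≤ ε) :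
    ∃ K, IsGlobalField F ε K := by
  obtain ⟨K, hK⟩ := ContDiff.lipschitzWith_of_hasCompactSupport hs h (by simp)
  refine ⟨K, h, hε, fun t => ?_⟩
  have : LipschitzWith 1 fun x : ℝ => (t, x) := LipschitzWith.prodMk_left t
  have h2 := hK.comp this
  rw [mul_one] at h2
  exact h2

namespace TranslationSurface

variable {M : Type*} [TopologicalSpace M] {S : TranslationSurface M}

/-! ### Developing maps -/

variable (S) in
/-- Near `z` the map `Φ` is a local inverse of a chart, up to a translation. -/
def DevAt (Φ : ℂ → M) (z : ℂ) : Prop :=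
  ∃ e ∈ S.atlas, ∃ c : ℂ, ∀ᶠ w in 𝓝 z, Φ w ∈ e.source ∧ e (Φ w) = w + c

namespace DevAt

variable {Φ Ψ : ℂ → M} {z : ℂ}

theorem notMem_sing (h : S.DevAt Φ z) : Φ z ∉ S.sing := by
  obtain ⟨e, he, c, hc⟩ := h
  exact S.source_subset e he hc.self_of_nhds.1

theorem eventually (h : S.DevAt Φ z) : ∀ᶠ w in 𝓝 z, S.DevAt Φ w := by
  obtain ⟨e, he, c, hc⟩ := h
  filter_upwards [hc.eventually_nhds] with w hw using ⟨e, he, c, hw⟩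

theorem congr (h : S.DevAt Φ z) (hΨ : Ψ =ᶠ[𝓝 z] Φ) : S.DevAt Ψ z := by
  obtain ⟨e, he, c, hc⟩ := h
  refine ⟨e, he, c, ?_⟩
  filter_upwards [hc, hΨ] with w hw hw'
  rwa [hw']

theorem continuousAt (h : S.DevAt Φ z) : ContinuousAt Φ z := by
  obtain ⟨e, he, c, hc⟩ := h
  have h1 : Φ =ᶠ[𝓝 z] fun w => e.symm (w + c) := by
    filter_upwards [hc] with w hw
    rw [← hw.2, e.left_inv hw.1]
  have ht : z + c ∈ e.target := by
    rw [← hc.self_of_nhds.2]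
    exact e.map_source hc.self_of_nhds.1
  have h2 : ContinuousAt (fun w => e.symm (w + c)) z :=
    ContinuousAt.comp (f := fun w => w + c) (e.continuousAt_symm ht) (by fun_prop)
  exact h2.congr h1.symm

theorem chart (h : S.DevAt Φ z) {e : OpenPartialHomeomorph M ℂ} (he : e ∈ S.atlas)
    (hz : Φ z ∈ e.source) : ∃ c : ℂ, ∀ᶠ w in 𝓝 z, Φ w ∈ e.source ∧ e (Φ w) = w + c := by
  have hcont := h.continuousAt
  obtain ⟨e', he', c, hc⟩ := h
  obtain ⟨c', hc'⟩ := S.translation e' he' e he (Φ z) ⟨hc.self_of_nhds.1, hz⟩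
  refine ⟨c + c', ?_⟩
  filter_upwards [hc, hcont.eventually hc', hcont.eventually (e.open_source.mem_nhds hz)]
    with w h1 h2 h3
  exact ⟨h3, by rw [h2, h1.2, add_assoc]⟩

theorem comp_add (a : ℂ) (h : S.DevAt Φ (z + a)) : S.DevAt (fun w => Φ (w + a)) z := by
  obtain ⟨e, he, c, hc⟩ := h
  have ht : Tendsto (fun w : ℂ => w + a) (𝓝 z) (𝓝 (z + a)) :=
    (continuous_id.add continuous_const).tendsto z
  refine ⟨e, he, a + c, ?_⟩
  filter_upwards [ht.eventually hc] with w hw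
  exact ⟨hw.1, by rw [hw.2, add_assoc]⟩

theorem eventuallyEq (h : S.DevAt Φ z) (h' : S.DevAt Ψ z) (hz : Φ z = Ψ z) : Φ =ᶠ[𝓝 z] Ψ := by
  obtain ⟨e, he, c, hc⟩ := h
  obtain ⟨c', hc'⟩ := h'.chart he (hz ▸ hc.self_of_nhds.1)
  have hcc : c = c' := by
    have h1 := hc.self_of_nhds.2
    have h2 := hc'.self_of_nhds.2
    rw [hz, h2] at h1
    exact (add_left_cancel h1).symm
  filter_upwards [hc, hc'] with w h1 h2
  exact e.injOn h1.1 h2.1 (by rw [h1.2, h2.2, hcc])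

theorem eventually_injOn (h : S.DevAt Φ z) : ∃ N ∈ 𝓝 z, InjOn Φ N := by
  obtain ⟨e, he, c, hc⟩ := h
  refine ⟨_, hc, fun x hx y hy hxy => ?_⟩
  have h1 : x + c = y + c := by rw [← hx.2, ← hy.2, hxy]
  exact add_right_cancel h1

end DevAt

/-- Agreement is open because two developing maps with a common value differ by no translation;
disagreement is open because `M` is Hausdorff. -/
theorem eqOn_of_isPreconnected [T2Space M] {Φ Ψ : ℂ → M} {s : Set ℂ} (hs : IsPreconnected s)
    (hΦ : ∀ z ∈ s, S.DevAt Φ z) (hΨ : ∀ z ∈ s, S.DevAt Ψ z) {z₀ : ℂ} (hz₀ : z₀ ∈ s)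
    (h : Φ z₀ = Ψ z₀) : EqOn Φ Ψ s := by
  have hu : IsOpen {z | Φ =ᶠ[𝓝 z] Ψ} := isOpen_iff_mem_nhds.2 fun z hz => by
    filter_upwards [Filter.Eventually.eventually_nhds hz] with w hw using hw
  have hv : IsOpen {z | S.DevAt Φ z ∧ S.DevAt Ψ z ∧ Φ z ≠ Ψ z} := by
    refine isOpen_iff_mem_nhds.2 fun z hz => ?_
    filter_upwards [hz.1.eventually, hz.2.1.eventually,
      (hz.1.continuousAt.tendsto.prodMk_nhds hz.2.1.continuousAt.tendsto).eventually
        (isClosed_diagonal.isOpen_compl.mem_nhds hz.2.2)] with w h1 h2 h3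
    exact ⟨h1, h2, h3⟩
  have hd : Disjoint {z | Φ =ᶠ[𝓝 z] Ψ} {z | S.DevAt Φ z ∧ S.DevAt Ψ z ∧ Φ z ≠ Ψ z} := by
    rw [Set.disjoint_left]
    intro z h1 h2
    exact h2.2.2 h1.self_of_nhds
  have hsub := hs.subset_left_of_subset_union hu hv hd (fun z hz => by
    by_cases hzz : Φ z = Ψ z
    · exact Or.inl ((hΦ z hz).eventuallyEq (hΨ z hz) hzz)
    · exact Or.inr ⟨hΦ z hz, hΨ z hz, hzz⟩) ⟨z₀, hz₀, (hΦ _ hz₀).eventuallyEq (hΨ _ hz₀) h⟩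
  exact fun z hz => (hsub hz).self_of_nhds

/-- Every regular point has a developing map defined on a disc. -/
theorem exists_dev {p : M} (hp : p ∉ S.sing) (z₀ : ℂ) : ∃ Φ : ℂ → M, Φ z₀ = p ∧ ∃ ρ > 0,
    ∀ z ∈ Metric.ball z₀ ρ, S.DevAt Φ z := by
  obtain ⟨e, he, hpe⟩ := S.cover p hp
  have hd : S.DevAt (fun w => e.symm (w + (e p - z₀))) z₀ := by
    refine ⟨e, he, e p - z₀, ?_⟩
    have ht : Tendsto (fun w : ℂ => w + (e p - z₀)) (𝓝 z₀) (𝓝 (e p)) := by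
      have : Continuous fun w : ℂ => w + (e p - z₀) := by fun_prop
      simpa using this.tendsto z₀
    filter_upwards [ht.eventually (e.open_target.mem_nhds (e.map_source hpe))] with w hw
    exact ⟨e.map_target hw, e.right_inv hw⟩
  obtain ⟨ρ, hρ, hb⟩ := Metric.eventually_nhds_iff_ball.1 hd.eventually
  exact ⟨_, by simp [e.left_inv hpe], ρ, hρ, hb⟩

/-! ### Integral curves -/

namespace IsIntegralCurve

variable {X Y : M → ℂ} {γ γ' : ℝ → M} {s s' : Set ℝ}

theorem mono (h : S.IsIntegralCurve X γ s) (hs : s' ⊆ s) : S.IsIntegralCurve X γ s' :=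
  ⟨h.1.mono hs, fun t ht => ⟨(h.2 t (hs ht)).1,
    fun e he hte => ((h.2 t (hs ht)).2 e he hte).mono hs⟩⟩

theorem congr (h : S.IsIntegralCurve X γ s) (hγ : EqOn γ' γ s) : S.IsIntegralCurve X γ' s := by
  refine ⟨h.1.congr hγ, fun t ht => ⟨by rw [hγ ht]; exact (h.2 t ht).1, fun e he hte => ?_⟩⟩
  rw [hγ ht] at hte ⊢
  exact ((h.2 t ht).2 e he hte).congr (fun u hu => by rw [hγ hu]) (by rw [hγ ht])

theorem congr_field (h : S.IsIntegralCurve X γ s) (hX : ∀ t ∈ s, X (γ t) = Y (γ t)) :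
    S.IsIntegralCurve Y γ s :=
  ⟨h.1, fun t ht => ⟨(h.2 t ht).1, fun e he hte => hX t ht ▸ (h.2 t ht).2 e he hte⟩⟩

theorem of_dev {Φ : ℂ → M} {ζ : ℝ → ℂ} (hΦ : ∀ t ∈ s, S.DevAt Φ (ζ t))
    (hζ : ∀ t ∈ s, HasDerivWithinAt ζ (X (Φ (ζ t))) s t) :
    S.IsIntegralCurve X (fun t => Φ (ζ t)) s := by
  have hc : ContinuousOn (fun t => Φ (ζ t)) s := fun t ht =>
    ContinuousAt.comp_continuousWithinAt (g := Φ) (hΦ t ht).continuousAt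
      (hζ t ht).continuousWithinAt
  refine ⟨hc, fun t ht => ⟨(hΦ t ht).notMem_sing, fun e he hte => ?_⟩⟩
  obtain ⟨c, hc⟩ := (hΦ t ht).chart he hte
  have h1 : (fun u => e (Φ (ζ u))) =ᶠ[𝓝[s] t] fun u => ζ u + c := by
    filter_upwards [(hζ t ht).continuousWithinAt.eventually hc] with u hu using hu.2
  exact ((hζ t ht).add_const c).congr_of_eventuallyEq h1 hc.self_of_nhds.2

/-- An affine change of time. -/
theorem comp_affine (h : S.IsIntegralCurve X γ s) (k a : ℝ) :
    S.IsIntegralCurve (fun p => k * X p) (fun t => γ (k * t + a)) ((fun t => k * t + a) ⁻¹' s) := by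
  have hd : ∀ t, HasDerivWithinAt (fun t : ℝ => k * t + a) k ((fun t => k * t + a) ⁻¹' s) t := by
    intro t
    have := ((hasDerivAt_id t).const_mul k).add_const a
    simpa using this.hasDerivWithinAt
  refine ⟨h.1.comp (by fun_prop) (mapsTo_preimage _ _), fun t ht => ⟨(h.2 _ ht).1, ?_⟩⟩
  intro e he hte
  have h1 := ((h.2 _ ht).2 e he hte).scomp t (hd t) (mapsTo_preimage _ _)
  rw [Complex.real_smul] at h1
  exact h1

theorem comp_add (h : S.IsIntegralCurve X γ s) (a : ℝ) :
    S.IsIntegralCurve X (fun t => γ (t + a)) ((fun t => t + a) ⁻¹' s) := by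
  simpa using h.comp_affine 1 a

theorem reverse (h : S.IsIntegralCurve X γ s) (a : ℝ) :
    S.IsIntegralCurve (-X) (fun t => γ (a - t)) ((fun t => a - t) ⁻¹' s) := by
  have h1 := h.comp_affine (-1) a
  have h2 : (fun t : ℝ => -1 * t + a) = fun t => a - t := by funext t; ring
  simp only [h2] at h1
  convert h1 using 1
  · funext p; simp
  · funext t; congr 1; ring

theorem union_Icc {a b c : ℝ} (h₁ : S.IsIntegralCurve X γ (Icc a b))
    (h₂ : S.IsIntegralCurve X γ (Icc b c)) : S.IsIntegralCurve X γ (Icc a c) := by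
  rcases lt_or_ge b a with hab | hab
  · exact h₂.mono (Icc_subset_Icc_left hab.le)
  rcases lt_or_ge c b with hbc | hbc
  · exact h₁.mono (Icc_subset_Icc_right hbc.le)
  have hU : Icc a c = Icc a b ∪ Icc b c := (Icc_union_Icc_eq_Icc hab hbc).symm
  have hnear₁ : ∀ t ∈ Icc a c, t < b → Icc a b ∈ 𝓝[Icc a c] t := by
    intro t ht htb
    filter_upwards [self_mem_nhdsWithin, mem_nhdsWithin_of_mem_nhds (Iio_mem_nhds htb)] with u h1 h2
    exact ⟨h1.1, le_of_lt h2⟩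
  have hnear₂ : ∀ t ∈ Icc a c, b < t → Icc b c ∈ 𝓝[Icc a c] t := by
    intro t ht htb
    filter_upwards [self_mem_nhdsWithin, mem_nhdsWithin_of_mem_nhds (Ioi_mem_nhds htb)] with u h1 h2
    exact ⟨le_of_lt h2, h1.2⟩
  refine ⟨?_, fun t ht => ?_⟩
  · rw [hU]
    exact h₁.1.union_of_isClosed h₂.1 isClosed_Icc isClosed_Icc
  · rcases lt_trichotomy t b with htb | rfl | htb
    · refine ⟨(h₁.2 t ⟨ht.1, htb.le⟩).1, fun e he hte => ?_⟩
      exact ((h₁.2 t ⟨ht.1, htb.le⟩).2 e he hte).mono_of_mem_nhdsWithin (hnear₁ t ht htb)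
    · refine ⟨(h₁.2 t ⟨ht.1, le_rfl⟩).1, fun e he hte => ?_⟩
      rw [hU]
      exact ((h₁.2 t ⟨ht.1, le_rfl⟩).2 e he hte).union ((h₂.2 t ⟨le_rfl, ht.2⟩).2 e he hte)
    · refine ⟨(h₂.2 t ⟨htb.le, ht.2⟩).1, fun e he hte => ?_⟩
      exact ((h₂.2 t ⟨htb.le, ht.2⟩).2 e he hte).mono_of_mem_nhdsWithin (hnear₂ t ht htb)

/-- Concatenation of two integral curves. -/
theorem concat {a b c : ℝ} (h₁ : S.IsIntegralCurve X γ (Icc a b))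
    (h₂ : S.IsIntegralCurve X γ' (Icc b c)) (hb : γ b = γ' b) :
    S.IsIntegralCurve X (fun t => if t ≤ b then γ t else γ' t) (Icc a c) := by
  refine union_Icc (b := b) (h₁.congr fun t ht => by simp [ht.2]) (h₂.congr fun t ht => ?_)
  rcases eq_or_lt_of_le ht.1 with rfl | hlt
  · simp [hb]
  · simp [not_le.2 hlt]

end IsIntegralCurve

variable (S) in
/-- A vector field of class `C^1` on the complement of the singular set. -/
def IsC1Field (X : M → ℂ) : Prop :=
  ∀ e ∈ S.atlas, ContDiffOn ℝ 1 (fun z => X (e.symm z)) e.target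

theorem isC1Field_const (v : ℂ) : S.IsC1Field fun _ => v := fun _ _ => contDiffOn_const

theorem IsC1Field.neg {X : M → ℂ} (h : S.IsC1Field X) : S.IsC1Field (-X) :=
  fun e he => (h e he).neg

section Uniqueness

variable [T2Space M] {X : M → ℂ} {γ γ' : ℝ → M}

/-- The set of agreement is closed since `M` is Hausdorff, and it extends to the right of each of
its points because the field is Lipschitz in a chart there. -/
theorem IsC1Field.eqOn_Icc (hX : S.IsC1Field X) {a b : ℝ} (h : S.IsIntegralCurve X γ (Icc a b))
    (h' : S.IsIntegralCurve X γ' (Icc a b)) (ha : γ a = γ' a) : EqOn γ γ' (Icc a b) := by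
  have hcl : IsClosed ({t | γ t = γ' t} ∩ Icc a b) := by
    have h1 : ContinuousOn (fun t => (γ t, γ' t)) (Icc a b) := h.1.prodMk h'.1
    have h2 := h1.preimage_isClosed_of_isClosed isClosed_Icc isClosed_diagonal
    convert h2 using 1
    ext t
    simp [and_comm]
  refine hcl.Icc_subset_of_forall_mem_nhdsWithin ha ?_
  rintro t ⟨hte, hta, htb⟩
  obtain ⟨e, he, hpe⟩ := S.cover (γ t) (h.2 t ⟨hta, htb.le⟩).1
  have hpe' : γ' t ∈ e.source := by rw [← show γ t = γ' t from hte]; exact hpe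
  have hcd : ContDiffAt ℝ 1 (fun z => X (e.symm z)) (e (γ t)) :=
    (hX e he).contDiffAt (e.open_target.mem_nhds (e.map_source hpe))
  obtain ⟨K, N, hN, hL⟩ := hcd.exists_lipschitzOnWith
  have hIcc : Icc a b ∈ 𝓝[≥] t := by
    refine mem_of_superset (Icc_mem_nhdsGE htb) (Icc_subset_Icc_left hta)
  have key : ∀ δ : ℝ → M, S.IsIntegralCurve X δ (Icc a b) → δ t ∈ e.source → e (δ t) = e (γ t) →
      ∀ᶠ u in 𝓝[≥] t, δ u ∈ e.source ∧ e (δ u) ∈ N := by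
    intro δ hδ hsrc hval
    have hc : ContinuousWithinAt δ (Ici t) t := (hδ.1 t ⟨hta, htb.le⟩).mono_of_mem_nhdsWithin hIcc
    refine (hc.eventually (e.open_source.mem_nhds hsrc)).and ?_
    have hc2 : ContinuousWithinAt (fun u => e (δ u)) (Ici t) t :=
      ContinuousAt.comp_continuousWithinAt (g := e) (e.continuousAt hsrc) hc
    have hN' : N ∈ 𝓝 (e (δ t)) := by rw [hval]; exact hN
    exact hc2.tendsto.eventually hN'
  obtain ⟨η, hη, hball⟩ : ∃ η > t, Icc t η ⊆ {u | (γ u ∈ e.source ∧ e (γ u) ∈ N) ∧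
      (γ' u ∈ e.source ∧ e (γ' u) ∈ N) ∧ u ∈ Icc a b} := by
    have hev := (key γ h hpe rfl).and ((key γ' h' hpe' (by rw [hte])).and hIcc)
    rw [eventually_iff, mem_nhdsGE_iff_exists_Icc_subset] at hev
    exact hev
  have hsol : ∀ δ : ℝ → M, S.IsIntegralCurve X δ (Icc a b) →
      (∀ u ∈ Icc t η, δ u ∈ e.source ∧ u ∈ Icc a b) →
      ContinuousOn (fun u => e (δ u)) (Icc t η) ∧ ∀ u ∈ Ico t η,
        HasDerivWithinAt (fun u => e (δ u)) (X (e.symm (e (δ u)))) (Ici u) u := by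
    intro δ hδ hsrc
    refine ⟨?_, fun u hu => ?_⟩
    · exact e.continuousOn.comp (hδ.1.mono fun u hu => (hsrc u hu).2) fun u hu => (hsrc u hu).1
    · have hu' := hsrc u (Ico_subset_Icc_self hu)
      rw [e.left_inv hu'.1]
      refine ((hδ.2 u hu'.2).2 e he hu'.1).mono_of_mem_nhdsWithin ?_
      have hub : u < b := lt_of_lt_of_le hu.2 (hsrc η ⟨hη.le, le_rfl⟩).2.2
      exact mem_of_superset (Icc_mem_nhdsGE hub) (Icc_subset_Icc_left hu'.2.1)
  obtain ⟨c1, d1⟩ := hsol γ h fun u hu => ⟨(hball hu).1.1, (hball hu).2.2⟩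
  obtain ⟨c2, d2⟩ := hsol γ' h' fun u hu => ⟨(hball hu).2.1.1, (hball hu).2.2⟩
  have heq := ODE_solution_unique_of_mem_Icc_right (v := fun _ z => X (e.symm z)) (s := fun _ => N)
    (fun _ _ => hL) c1 d1 (fun u hu => (hball (Ico_subset_Icc_self hu)).1.2) c2 d2
    (fun u hu => (hball (Ico_subset_Icc_self hu)).2.1.2) (by rw [hte])
  refine mem_of_superset (Ioo_mem_nhdsGT hη) fun u hu => ?_
  have hu' := Ioo_subset_Icc_self hu
  exact e.injOn (hball hu').1.1 (hball hu').2.1.1 (heq hu')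

theorem IsC1Field.eqOn_Icc_of_right (hX : S.IsC1Field X) {a b : ℝ}
    (h : S.IsIntegralCurve X γ (Icc a b)) (h' : S.IsIntegralCurve X γ' (Icc a b))
    (hb : γ b = γ' b) : EqOn γ γ' (Icc a b) := by
  have hpre : (fun t : ℝ => b - t) ⁻¹' Icc a b = Icc 0 (b - a) := by
    ext t; simp only [mem_preimage, mem_Icc]; constructor <;> rintro ⟨h1, h2⟩ <;>
      constructor <;> linarith
  have h1 := h.reverse b
  have h2 := h'.reverse b
  rw [hpre] at h1 h2
  have h3 := hX.neg.eqOn_Icc h1 h2 (by simpa using hb)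
  intro t ht
  have := h3 (x := b - t) ⟨by linarith [ht.2], by linarith [ht.1]⟩
  simpa using this

theorem IsC1Field.eqOn (hX : S.IsC1Field X) {s : Set ℝ} (hs : s.OrdConnected)
    (h : S.IsIntegralCurve X γ s) (h' : S.IsIntegralCurve X γ' s) {t₀ : ℝ} (ht₀ : t₀ ∈ s)
    (he : γ t₀ = γ' t₀) : EqOn γ γ' s := by
  intro t ht
  rcases le_total t₀ t with hle | hle
  · have hsub := hs.out ht₀ ht
    exact hX.eqOn_Icc (h.mono hsub) (h'.mono hsub) he ⟨hle, le_rfl⟩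
  · have hsub := hs.out ht ht₀
    exact hX.eqOn_Icc_of_right (h.mono hsub) (h'.mono hsub) he ⟨le_rfl, hle⟩

end Uniqueness

/-! ### Straight curves -/

variable (S) in
/-- A curve with constant velocity `v`. -/
abbrev IsStraight (v : ℂ) (γ : ℝ → M) (s : Set ℝ) : Prop := S.IsIntegralCurve (fun _ => v) γ s

theorem isStraight_of_dev {Φ : ℂ → M} {z v : ℂ} {s : Set ℝ} (h : ∀ t ∈ s, S.DevAt Φ (z + t * v)) :
    S.IsStraight v (fun t => Φ (z + t * v)) s := by
  refine IsIntegralCurve.of_dev (ζ := fun t => z + t * v) h fun t _ => ?_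
  have h1 : HasDerivAt (fun t : ℝ => (t : ℂ)) 1 t := Complex.ofRealCLM.hasDerivAt
  simpa using ((h1.mul_const v).const_add z).hasDerivWithinAt

theorem IsStraight.eq_dev [T2Space M] {Φ : ℂ → M} {z v : ℂ} {s : Set ℝ} {γ : ℝ → M}
    (hs : s.OrdConnected) (hγ : S.IsStraight v γ s) (h : ∀ t ∈ s, S.DevAt Φ (z + t * v))
    {t₀ : ℝ} (ht₀ : t₀ ∈ s) (he : γ t₀ = Φ (z + t₀ * v)) : ∀ t ∈ s, γ t = Φ (z + t * v) :=
  (isC1Field_const v).eqOn hs hγ (isStraight_of_dev h) ht₀ he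

theorem IsStraight.scale {v : ℂ} {γ : ℝ → M} {s : Set ℝ} (h : S.IsStraight v γ s) (k : ℝ) :
    S.IsStraight (k * v) (fun t => γ (k * t)) ((fun t => k * t) ⁻¹' s) := by
  simpa using IsIntegralCurve.comp_affine h k 0

/-! ### The exponential map -/

variable (S) in
/-- The vectors along which one can move straight from `p`. -/
def expDom (p : M) : Set ℂ := {v | ∃ γ : ℝ → M, S.IsStraight v γ (Icc 0 1) ∧ γ 0 = p}

open Classical in
variable (S) in
/-- The endpoint of the straight curve from `p` along a vector. -/
noncomputable def expMap (p : M) (v : ℂ) : M :=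
  if h : v ∈ S.expDom p then h.choose 1 else p

theorem notMem_sing_of_mem_expDom {p : M} {v : ℂ} (hv : v ∈ S.expDom p) : p ∉ S.sing := by
  obtain ⟨γ, hγ, h0⟩ := hv
  rw [← h0]
  exact (hγ.2 0 ⟨le_rfl, zero_le_one⟩).1

theorem zero_mem_expDom {p : M} (hp : p ∉ S.sing) : (0 : ℂ) ∈ S.expDom p := by
  obtain ⟨Φ, h0, ρ, hρ, hΦ⟩ := exists_dev hp 0
  refine ⟨fun t => Φ (0 + t * 0), isStraight_of_dev fun t _ => ?_, by simpa using h0⟩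
  simpa using hΦ 0 (Metric.mem_ball_self hρ)

section Exp

variable [T2Space M] {p : M} {v : ℂ}

theorem expMap_eq {γ : ℝ → M} (h : S.IsStraight v γ (Icc 0 1)) (h0 : γ 0 = p) :
    v ∈ S.expDom p ∧ S.expMap p v = γ 1 := by
  have hv : v ∈ S.expDom p := ⟨γ, h, h0⟩
  refine ⟨hv, ?_⟩
  rw [expMap, dif_pos hv]
  exact (isC1Field_const v).eqOn_Icc hv.choose_spec.1 h (hv.choose_spec.2.trans h0.symm)
    ⟨zero_le_one, le_rfl⟩

theorem expMap_mul_eq {γ : ℝ → M} {s : Set ℝ} (hs : s.OrdConnected) (h : S.IsStraight v γ s)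
    (h0s : (0 : ℝ) ∈ s) (h0 : γ 0 = p) {t : ℝ} (ht : t ∈ s) :
    (t : ℂ) * v ∈ S.expDom p ∧ S.expMap p (t * v) = γ t := by
  have h1 := h.scale t
  have hsub : Icc (0 : ℝ) 1 ⊆ (fun u => t * u) ⁻¹' s := by
    intro u hu
    have : t * u ∈ uIcc 0 t := by
      rcases le_total 0 t with h | h
      · rw [uIcc_of_le h]
        exact ⟨mul_nonneg h hu.1, by nlinarith [hu.2]⟩
      · rw [uIcc_of_ge h]
        exact ⟨by nlinarith [hu.2], mul_nonpos_of_nonpos_of_nonneg h hu.1⟩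
    exact hs.uIcc_subset h0s ht this
  have h2 := expMap_eq (h1.mono hsub) (by simpa using h0)
  simpa using h2

theorem isStraight_expMap (hv : v ∈ S.expDom p) :
    S.IsStraight v (fun t => S.expMap p (t * v)) (Icc 0 1) := by
  obtain ⟨γ, hγ, h0⟩ := hv
  exact hγ.congr fun t ht => (expMap_mul_eq ordConnected_Icc hγ ⟨le_rfl, zero_le_one⟩ h0 ht).2

theorem smul_mem_expDom (hv : v ∈ S.expDom p) {t : ℝ} (ht : t ∈ Icc (0 : ℝ) 1) :
    (t : ℂ) * v ∈ S.expDom p := by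
  obtain ⟨γ, hγ, h0⟩ := hv
  exact (expMap_mul_eq ordConnected_Icc hγ ⟨le_rfl, zero_le_one⟩ h0 ht).1

theorem expMap_zero (hp : p ∉ S.sing) : S.expMap p 0 = p := by
  obtain ⟨Φ, h0, ρ, hρ, hΦ⟩ := exists_dev hp 0
  have h := expMap_eq (S := S) (p := p) (v := 0) (γ := fun t => Φ (0 + t * 0))
    (isStraight_of_dev fun t _ => by simpa using hΦ 0 (Metric.mem_ball_self hρ))
    (by simpa using h0)
  simpa [h0] using h.2

/-- Moving radially inside the domain of a developing map. -/
theorem expMap_eq_dev {Φ : ℂ → M} {w : ℂ} {k : ℝ} (hk : 0 < k) (hw : w ∈ S.expDom p)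
    (hΦ : ∀ t ∈ uIcc 1 k, S.DevAt Φ (t * w)) (he : S.expMap p w = Φ w) :
    (k : ℂ) * w ∈ S.expDom p ∧ S.expMap p (k * w) = Φ (k * w) := by
  have hst := isStraight_expMap hw
  rcases le_total k 1 with hk1 | hk1
  · rw [uIcc_of_ge hk1] at hΦ
    refine ⟨smul_mem_expDom hw ⟨hk.le, hk1⟩, ?_⟩
    have h1 := IsStraight.eq_dev (z := 0) ordConnected_Icc (hst.mono (Icc_subset_Icc_left hk.le))
      (fun t ht => by simpa using hΦ t ht) (t₀ := 1) ⟨hk1, le_rfl⟩ (by simpa using he) k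
      ⟨le_rfl, hk1⟩
    simpa using h1
  · rw [uIcc_of_le hk1] at hΦ
    have h2 : S.IsStraight w (fun t : ℝ => Φ (0 + t * w)) (Icc 1 k) :=
      isStraight_of_dev fun t ht => by simpa using hΦ t ht
    have h3 := IsIntegralCurve.concat hst h2 (by simpa using he)
    have h4 := expMap_mul_eq (p := p) ordConnected_Icc h3 ⟨le_rfl, hk.le⟩
      (by simpa using expMap_zero (notMem_sing_of_mem_expDom hw)) (t := k) ⟨hk.le, le_rfl⟩
    refine ⟨h4.1, h4.2.trans ?_⟩
    rcases eq_or_lt_of_le hk1 with rfl | hlt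
    · simpa using he
    · simp [not_le.2 hlt]

/-- `D t` expresses both conclusions near `t * v`. It holds at `0`, and for nearby times in `[0, 1]`
it passes from either one to the other; connectedness brings it to `1`. -/
theorem expMap_eventually (hv : v ∈ S.expDom p) :
    ∀ᶠ w in 𝓝 v, w ∈ S.expDom p ∧ S.DevAt (S.expMap p) w := by
  have hp := notMem_sing_of_mem_expDom hv
  set D : ℝ → Prop := fun t => ∀ᶠ w in 𝓝 ((t : ℂ) * v), w ∈ S.expDom p ∧ S.DevAt (S.expMap p) w
    with hD
  have hst := isStraight_expMap hv
  have hmulc : Continuous fun t : ℝ => (t : ℂ) * v := by fun_prop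
  have hD0 : D 0 := by
    obtain ⟨Φ, h0, ρ, hρ, hΦ⟩ := exists_dev hp 0
    have hball : ∀ w ∈ Metric.ball (0 : ℂ) ρ, w ∈ S.expDom p ∧ S.expMap p w = Φ w := by
      intro w hw
      have h := expMap_eq (S := S) (p := p) (v := w) (γ := fun t => Φ (0 + t * w))
        (isStraight_of_dev fun t ht => hΦ _ ?_) (by simpa using h0)
      · simpa using h
      · rw [mem_ball_zero_iff] at hw ⊢
        rw [zero_add, norm_mul, Complex.norm_real, Real.norm_eq_abs, abs_of_nonneg ht.1]
        nlinarith [norm_nonneg w, ht.2]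
    have hnhds : Metric.ball (0 : ℂ) ρ ∈ 𝓝 (((0 : ℝ) : ℂ) * v) := by
      simpa using Metric.ball_mem_nhds (0 : ℂ) hρ
    filter_upwards [eventually_mem_nhds_iff.2 hnhds] with w hw
    refine ⟨(hball w (mem_of_mem_nhds hw)).1, (hΦ w (mem_of_mem_nhds hw)).congr ?_⟩
    filter_upwards [hw] with w' hw' using (hball w' hw').2
  have hP : D 0 → D 1 := by
    refine isPreconnected_Icc.induction₂' (fun x y => D x → D y) (s := Icc (0 : ℝ) 1) ?_
      (fun x y z _ _ _ h1 h2 h => h2 (h1 h)) (by simp) (by simp)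
    intro x hx
    have hfor : D x → ∀ᶠ y in 𝓝[Icc 0 1] x, D y := fun h =>
      mem_nhdsWithin_of_mem_nhds ((hmulc.tendsto x).eventually (Filter.Eventually.eventually_nhds h))
    rcases eq_or_lt_of_le hx.1 with rfl | hxpos
    · filter_upwards [hfor hD0] with y hy using ⟨fun _ => hy, fun _ => hD0⟩
    obtain ⟨Φ, h0, ρ, hρ, hΦ⟩ := exists_dev (hst.2 x hx).1 ((x : ℂ) * v)
    have hnear : ∀ᶠ y : ℝ in 𝓝[Icc 0 1] x, ((y : ℂ) * v ∈ Metric.ball ((x : ℂ) * v) ρ ∧ 0 < y) := by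
      refine mem_nhdsWithin_of_mem_nhds (((hmulc.tendsto x).eventually
        (Metric.ball_mem_nhds _ hρ)).and (lt_mem_nhds hxpos))
    -- Here `Φ` is a developing map on a disc about `x * v`. If `D y` holds, the exponential map
    -- equals `Φ` near `y * v`; the homothety of ratio `y / x` and radial motion inside the disc
    -- carry this equality to a neighbourhood of `x * v`.
    have hback : ∀ᶠ y : ℝ in 𝓝[Icc 0 1] x, D y → D x := by
      filter_upwards [hnear, self_mem_nhdsWithin] with y hy hy01 hDy
      have hseg : ∀ t ∈ uIcc x y, (t : ℂ) * v ∈ Metric.ball ((x : ℂ) * v) ρ := by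
        intro t ht
        have h1 := (convex_ball ((x : ℂ) * v) ρ).segment_subset (Metric.mem_ball_self hρ) hy.1
        rw [← segment_eq_uIcc] at ht
        obtain ⟨a, b, ha, hb, hab, rfl⟩ := ht
        refine h1 ⟨a, b, ha, hb, hab, ?_⟩
        simp only [smul_eq_mul, Complex.real_smul]
        push_cast
        ring
      have hγy : S.expMap p (y * v) = Φ (y * v) := by
        have hsub : uIcc x y ⊆ Icc 0 1 := ordConnected_Icc.uIcc_subset hx hy01
        have := IsStraight.eq_dev (z := 0) ordConnected_uIcc (hst.mono hsub)
          (fun t ht => by simpa using hΦ _ (hseg t ht)) (t₀ := x) left_mem_uIcc (by simpa using h0.symm)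
          y right_mem_uIcc
        simpa using this
      have hDy' := hDy.and (hDy.self_of_nhds.2.eventuallyEq (hΦ _ hy.1) hγy)
      set κ : ℝ := y / x with hκ
      have hκpos : 0 < κ := div_pos hy.2 hxpos
      have hκx : κ * x = y := by rw [hκ]; field_simp
      have hcκ : Tendsto (fun w : ℂ => (κ : ℂ) * w) (𝓝 ((x : ℂ) * v)) (𝓝 ((y : ℂ) * v)) := by
        have : Continuous fun w : ℂ => (κ : ℂ) * w := by fun_prop
        have h := this.tendsto ((x : ℂ) * v)
        have h2 : (κ : ℂ) * ((x : ℂ) * v) = y * v := by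
          rw [← mul_assoc, ← Complex.ofReal_mul, hκx]
        rwa [h2] at h
      have hEv : ∀ᶠ w in 𝓝 ((x : ℂ) * v), w ∈ S.expDom p ∧ S.expMap p w = Φ w := by
        filter_upwards [hcκ.eventually hDy', hcκ.eventually (Metric.isOpen_ball.mem_nhds hy.1),
          Metric.ball_mem_nhds _ hρ] with w h1 h2 h3
        have hkw : ((κ⁻¹ : ℝ) : ℂ) * ((κ : ℂ) * w) = w := by
          rw [← mul_assoc, ← Complex.ofReal_mul, inv_mul_cancel₀ hκpos.ne', Complex.ofReal_one,
            one_mul]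
        have := expMap_eq_dev (Φ := Φ) (k := κ⁻¹) (inv_pos.2 hκpos) h1.1.1 ?_ h1.2
        · rwa [hkw] at this
        · intro t ht
          refine hΦ _ ?_
          have h4 := (convex_ball ((x : ℂ) * v) ρ).segment_subset h2 h3
          rw [← segment_eq_uIcc] at ht
          obtain ⟨a, b, ha, hb, hab, rfl⟩ := ht
          refine h4 ⟨a, b, ha, hb, hab, ?_⟩
          simp only [smul_eq_mul, Complex.real_smul]
          push_cast
          have : (κ : ℂ) ≠ 0 := by exact_mod_cast hκpos.ne'
          field_simp
      filter_upwards [hEv, hEv.eventually_nhds, Metric.isOpen_ball.mem_nhds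
        (Metric.mem_ball_self (x := (x : ℂ) * v) hρ)] with w h1 h2 h3
      exact ⟨h1.1, (hΦ w h3).congr (h2.mono fun w' hw' => hw'.2)⟩
    by_cases hDx : D x
    · filter_upwards [hfor hDx] with y hy using ⟨fun _ => hy, fun _ => hDx⟩
    · filter_upwards [hback] with y hy using ⟨fun h => absurd h hDx, hy⟩
  simpa [hD] using hP hD0

theorem isOpen_expDom (p : M) : IsOpen (S.expDom p) :=
  isOpen_iff_mem_nhds.2 fun _ hv => (expMap_eventually hv).mono fun _ h => h.1

theorem devAt_expMap (hv : v ∈ S.expDom p) : S.DevAt (S.expMap p) v :=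
  (expMap_eventually hv).self_of_nhds.2

/-- A developing map on a star-shaped set is given by the exponential map. -/
theorem dev_eq_expMap {Φ : ℂ → M} {c z : ℂ} (h : ∀ t ∈ Icc (0 : ℝ) 1, S.DevAt Φ (c + t * (z - c))) :
    z - c ∈ S.expDom (Φ c) ∧ S.expMap (Φ c) (z - c) = Φ z := by
  have := expMap_eq (p := Φ c) (isStraight_of_dev h) (by simp)
  simpa using this

end Exp

end TranslationSurface

namespace TranslationSurface

variable {M : Type*} [TopologicalSpace M] {S : TranslationSurface M}

/-! ### Limits of straight curves -/

theorem DevAt.map_nhds {Φ : ℂ → M} {z : ℂ} (h : S.DevAt Φ z) : map Φ (𝓝 z) = 𝓝 (Φ z) := by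
  obtain ⟨e, he, c, hc⟩ := h
  have h1 : Φ =ᶠ[𝓝 z] fun w => e.symm (w + c) := by
    filter_upwards [hc] with w hw
    rw [← hw.2, e.left_inv hw.1]
  have ht : z + c ∈ e.symm.source := by
    rw [← hc.self_of_nhds.2]
    exact e.map_source hc.self_of_nhds.1
  have h2 : map (fun w : ℂ => w + c) (𝓝 z) = 𝓝 (z + c) := (Homeomorph.addRight c).map_nhds_eq z
  rw [Filter.map_congr h1, h1.self_of_nhds]
  change map (e.symm ∘ fun w => w + c) (𝓝 z) = 𝓝 (e.symm (z + c))
  rw [← Filter.map_map, h2, e.symm.map_nhds_eq ht]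

section Limits

variable [T2Space M] {v : ℂ} {γ : ℝ → M} {a b : ℝ}

/-- At some time `t₁` close to `b` the curve is within half the radius of a disc about `q`, and the
displacement left until `b` is less than the other half. The rest of the curve is thus a segment of
the disc, time `b` included. -/
theorem IsStraight.exists_dev_of_clusterPt (h : S.IsStraight v γ (Ico a b)) (hab : a < b) {q : M}
    (hq : q ∉ S.sing) (hcl : MapClusterPt q (𝓝[<] b) γ) :
    ∃ (Φ : ℂ → M) (z : ℂ) (t₁ : ℝ), t₁ ∈ Ico a b ∧ (∀ t ∈ Icc t₁ b, S.DevAt Φ (z + t * v)) ∧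
      ∀ t ∈ Ico t₁ b, γ t = Φ (z + t * v) := by
  obtain ⟨Φ, h0, ρ, hρ, hΦ⟩ := exists_dev hq 0
  have hN : Φ '' Metric.ball 0 (ρ / 2) ∈ 𝓝 q := by
    rw [← h0, ← (hΦ 0 (Metric.mem_ball_self hρ)).map_nhds]
    exact image_mem_map (Metric.ball_mem_nhds _ (half_pos hρ))
  have hfr : ∃ᶠ t in 𝓝[<] b, γ t ∈ Φ '' Metric.ball 0 (ρ / 2) := hcl.frequently hN
  have hev : ∀ᶠ t in 𝓝[<] b, t ∈ Ico a b ∧ (b - t) * ‖v‖ < ρ / 2 := by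
    have h1 : ∀ᶠ t in 𝓝[<] b, t ∈ Ico a b := by
      filter_upwards [Ioo_mem_nhdsLT hab] with t ht using ⟨ht.1.le, ht.2⟩
    have h2 : Tendsto (fun t => (b - t) * ‖v‖) (𝓝[<] b) (𝓝 0) := by
      have : Continuous fun t => (b - t) * ‖v‖ := by fun_prop
      have h3 := (this.tendsto b).mono_left (nhdsWithin_le_nhds (s := Iio b))
      simpa using h3
    exact h1.and (h2.eventually (gt_mem_nhds (half_pos hρ)))
  obtain ⟨t₁, ⟨z₁, hz₁, hγz⟩, ht₁, hlt⟩ := (hfr.and_eventually hev).exists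
  have hdev : ∀ t ∈ Icc t₁ b, S.DevAt Φ (z₁ - t₁ * v + t * v) := by
    intro t ht
    refine hΦ _ ?_
    rw [mem_ball_zero_iff] at hz₁ ⊢
    have h1 : z₁ - t₁ * v + t * v = z₁ + ((t - t₁ : ℝ) : ℂ) * v := by push_cast; ring
    rw [h1]
    refine (norm_add_le _ _).trans_lt ?_
    rw [norm_mul, Complex.norm_real, Real.norm_eq_abs, abs_of_nonneg (sub_nonneg.2 ht.1)]
    have : (t - t₁) * ‖v‖ ≤ (b - t₁) * ‖v‖ :=
      mul_le_mul_of_nonneg_right (by linarith [ht.2]) (norm_nonneg _)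
    linarith
  refine ⟨Φ, z₁ - t₁ * v, t₁, ht₁, hdev, ?_⟩
  refine IsStraight.eq_dev ordConnected_Ico (h.mono (Ico_subset_Ico_left ht₁.1))
    (fun t ht => hdev t (Ico_subset_Icc_self ht)) (t₀ := t₁) ⟨le_rfl, ht₁.2⟩ ?_
  rw [← hγz]
  congr 1
  ring

theorem IsStraight.tendsto_of_clusterPt (h : S.IsStraight v γ (Ico a b)) (hab : a < b) {q : M}
    (hq : q ∉ S.sing) (hcl : MapClusterPt q (𝓝[<] b) γ) :
    ∃ p, p ∉ S.sing ∧ Tendsto γ (𝓝[<] b) (𝓝 p) := by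
  obtain ⟨Φ, z, t₁, ht₁, hdev, hγ⟩ := h.exists_dev_of_clusterPt hab hq hcl
  have hb : b ∈ Icc t₁ b := ⟨ht₁.2.le, le_rfl⟩
  refine ⟨Φ (z + b * v), (hdev b hb).notMem_sing, ?_⟩
  have hc : ContinuousAt (fun t : ℝ => Φ (z + t * v)) b :=
    ContinuousAt.comp (f := fun t : ℝ => z + t * v) (hdev b hb).continuousAt (by fun_prop)
  refine (hc.tendsto.mono_left nhdsWithin_le_nhds).congr' ?_
  filter_upwards [Ioo_mem_nhdsLT ht₁.2] with t ht using (hγ t ⟨ht.1.le, ht.2⟩).symm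

/-- A regular cluster point is a limit by the preceding lemma. If the curve clusters at a singular
point without converging to it, it keeps crossing a compact shell around it that contains no
singular point; a cluster point in the shell is regular, and is again a limit. -/
theorem IsStraight.exists_tendsto [CompactSpace M] (h : S.IsStraight v γ (Ico a b)) (hab : a < b) :
    ∃ p, Tendsto γ (𝓝[<] b) (𝓝 p) := by
  obtain ⟨p, hp⟩ : ∃ p, MapClusterPt p (𝓝[<] b) γ := by
    obtain ⟨p, -, hp⟩ := isCompact_univ.exists_mapClusterPt (f := 𝓝[<] b) (u := γ) (by simp)
    exact ⟨p, hp⟩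
  by_cases hps : p ∉ S.sing
  · obtain ⟨q, -, hq⟩ := h.tendsto_of_clusterPt hab hps hp
    exact ⟨q, hq⟩
  by_contra hcon
  push Not at hcon
  obtain ⟨N, hN, hNf⟩ : ∃ N ∈ 𝓝 p, ¬∀ᶠ t in 𝓝[<] b, γ t ∈ N := by
    by_contra hall
    push Not at hall
    exact hcon p fun N hN => hall N hN
  have hN' : N ∩ (S.sing \ {p})ᶜ ∈ 𝓝 p :=
    inter_mem hN ((S.sing_finite.subset sdiff_subset).isClosed.isOpen_compl.mem_nhds (by simp))
  obtain ⟨t, ht, htc, htN⟩ := exists_mem_nhds_isClosed_subset hN'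
  -- A connected tail of the curve that avoided the shell would stay in `interior t`, hence in `N`.
  have hfr : ∃ᶠ u in 𝓝[<] b, γ u ∈ t \ interior t := by
    intro hev
    rw [eventually_iff] at hev
    obtain ⟨t₁, ht₁, hsub⟩ := (mem_nhdsLT_iff_exists_Ioo_subset' hab).1
      (inter_mem hev (Ioo_mem_nhdsLT hab))
    have hpre : IsPreconnected (γ '' Ioo t₁ b) :=
      isPreconnected_Ioo.image _ (h.1.mono fun u hu => ⟨(hsub hu).2.1.le, (hsub hu).2.2⟩)
    have hsubset : γ '' Ioo t₁ b ⊆ interior t ∪ tᶜ := by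
      rintro _ ⟨u, hu, rfl⟩
      have h1 : γ u ∉ t \ interior t := (hsub hu).1
      by_cases h2 : γ u ∈ t
      · exact Or.inl (by_contra fun h3 => h1 ⟨h2, h3⟩)
      · exact Or.inr h2
    have hIoo : Ioo t₁ b ∈ 𝓝[<] b := Ioo_mem_nhdsLT ht₁
    have hne : (γ '' Ioo t₁ b ∩ interior t).Nonempty := by
      obtain ⟨u, hu, hu'⟩ := ((hp.frequently (interior_mem_nhds.2 ht)).and_eventually hIoo).exists
      exact ⟨_, ⟨u, hu', rfl⟩, hu⟩
    have hsub2 := hpre.subset_left_of_subset_union isOpen_interior htc.isOpen_compl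
      (disjoint_compl_right.mono_left interior_subset) hsubset hne
    refine hNf ?_
    filter_upwards [hIoo] with u hu
    exact (htN (interior_subset (hsub2 ⟨u, hu, rfl⟩))).1
  obtain ⟨q, hqK, hq⟩ := (htc.isCompact.diff isOpen_interior).exists_mapClusterPt_of_frequently hfr
  have hqs : q ∉ S.sing := fun hqs => (htN hqK.1).2 ⟨hqs, fun hqp => hqK.2 (by
    rw [mem_singleton_iff] at hqp
    rw [hqp]
    exact mem_interior_iff_mem_nhds.2 ht)⟩
  obtain ⟨q', -, hq'⟩ := h.tendsto_of_clusterPt hab hqs hq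
  exact hcon q' hq'

variable {p : M}

theorem isStraight_expMap_of_forall {s : Set ℝ} (h : ∀ t ∈ s, (t : ℂ) * v ∈ S.expDom p) :
    S.IsStraight v (fun t : ℝ => S.expMap p (t * v)) s := by
  have := isStraight_of_dev (S := S) (Φ := S.expMap p) (z := 0) (v := v) (s := s)
    fun t ht => by simpa using devAt_expMap (h t ht)
  simpa using this

theorem exists_tendsto_expMap [CompactSpace M] {τ : ℝ} (hτ : 0 < τ)
    (h : ∀ t ∈ Ico 0 τ, (t : ℂ) * v ∈ S.expDom p) :
    ∃ q, Tendsto (fun t : ℝ => S.expMap p (t * v)) (𝓝[<] τ) (𝓝 q) ∧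
      (q ∉ S.sing → (τ : ℂ) * v ∈ S.expDom p ∧ S.expMap p (τ * v) = q) := by
  have hst := isStraight_expMap_of_forall h
  obtain ⟨q, hq⟩ := hst.exists_tendsto hτ
  refine ⟨q, hq, fun hqs => ?_⟩
  obtain ⟨Φ, z, t₁, ht₁, hdev, hγ⟩ := hst.exists_dev_of_clusterPt hτ hqs hq.mapClusterPt
  have h2 : S.IsStraight v (fun t : ℝ => Φ (z + t * v)) (Icc t₁ τ) := isStraight_of_dev hdev
  have h3 := IsIntegralCurve.concat (hst.mono (Icc_subset_Ico_right ht₁.2)) h2 (hγ t₁ ⟨le_rfl, ht₁.2⟩)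
  have hp : p ∉ S.sing := notMem_sing_of_mem_expDom (h 0 ⟨le_rfl, hτ⟩)
  have h4 := (expMap_mul_eq (p := p) ordConnected_Icc h3 ⟨le_rfl, hτ.le⟩
    (by simpa [ht₁.1] using expMap_zero hp) (t := τ) ⟨hτ.le, le_rfl⟩).1
  refine ⟨h4, ?_⟩
  have hc : ContinuousAt (fun t : ℝ => S.expMap p (t * v)) τ :=
    ContinuousAt.comp (f := fun t : ℝ => (t : ℂ) * v) (devAt_expMap h4).continuousAt (by fun_prop)
  exact tendsto_nhds_unique (hc.tendsto.mono_left nhdsWithin_le_nhds) hq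

end Limits

/-! ### Ramified charts -/

variable (S) in
/-- A ramified chart `φ ^ κ` centred at `p`. -/
structure IsRamChart (p : M) (κ : ℕ) (φ : OpenPartialHomeomorph M ℂ) : Prop where
  one_le : 1 ≤ κ
  mem : p ∈ φ.source
  eq_zero : φ p = 0
  eq_of_mem : ∀ q ∈ φ.source, q ∈ S.sing → q = p
  regular : p ∉ S.sing → κ = 1
  chart : ∀ e ∈ S.atlas, ∀ q ∈ φ.source ∩ e.source, ∃ c : ℂ, ∀ᶠ q' in 𝓝 q, e q' = φ q' ^ κ + c

/-- A regular point receives a translated chart with `κ = 1`, so that regular and singular points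
can be treated together. -/
theorem exists_isRamChart (p : M) : ∃ κ φ, S.IsRamChart p κ φ := by
  by_cases hp : p ∈ S.sing
  · obtain ⟨κ, hκ, φ, h1, h2, h3, h4⟩ := S.ramified p hp
    refine ⟨κ, φ, hκ, h1, h2, fun q hq hqs => ?_, fun h => absurd hp h, h4⟩
    have : q ∈ φ.source ∩ S.sing := ⟨hq, hqs⟩
    rw [h3] at this
    exact this
  · obtain ⟨e, he, hpe⟩ := S.cover p hp
    refine ⟨1, e.transHomeomorph (Homeomorph.addRight (-e p)), le_rfl, by simpa using hpe, by simp,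
      fun q hq hqs => ?_, fun _ => rfl, fun e' he' q hq => ?_⟩
    · exact absurd hqs (S.source_subset e he (by simpa using hq))
    · obtain ⟨c, hc⟩ := S.translation e he e' he' q (by simpa using hq)
      refine ⟨c + e p, ?_⟩
      filter_upwards [hc] with q' hq'
      simp [hq']
      ring

theorem IsRamChart.hasDerivAt {p : M} {κ : ℕ} {φ : OpenPartialHomeomorph M ℂ}
    (h : S.IsRamChart p κ φ) {v : ℂ} {γ : ℝ → M} {s : Set ℝ} (hγ : S.IsStraight v γ s) {t : ℝ}
    (hs : s ∈ 𝓝 t) (ht : γ t ∈ φ.source) : HasDerivAt (fun t => φ (γ t) ^ κ) v t := by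
  have hts := mem_of_mem_nhds hs
  obtain ⟨e, he, hpe⟩ := S.cover (γ t) (hγ.2 t hts).1
  obtain ⟨c, hc⟩ := h.chart e he (γ t) ⟨ht, hpe⟩
  have hcont : ContinuousAt γ t := (hγ.1 t hts).continuousAt hs
  have h1 : HasDerivAt (fun t => e (γ t) - c) v t :=
    (((hγ.2 t hts).2 e he hpe).hasDerivAt hs).sub_const c
  refine h1.congr_of_eventuallyEq ?_
  filter_upwards [hcont.eventually hc] with u hu
  rw [hu]; ring

theorem sub_eq_of_hasDerivAt {g : ℝ → ℂ} {v : ℂ} {a b : ℝ} (hab : a < b)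
    (hc : ContinuousOn g (Icc a b)) (hd : ∀ x ∈ Ioo a b, HasDerivAt g v x) {x y : ℝ}
    (hx : x ∈ Icc a b) (hy : y ∈ Icc a b) : g y - g x = (y - x : ℝ) * v := by
  set f : ℝ → ℂ := fun t => g t - t * v with hf
  have hfc : ContinuousOn f (Icc a b) := hc.sub (by fun_prop)
  have hfd : ∀ x ∈ Ioo a b, HasDerivAt f 0 x := by
    intro x hx
    have h1 : HasDerivAt (fun t : ℝ => (t : ℂ)) 1 x := Complex.ofRealCLM.hasDerivAt
    have h2 := (hd x hx).sub (h1.mul_const v)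
    rw [one_mul, sub_self] at h2
    exact h2
  obtain ⟨m, hm⟩ : (Ioo a b).Nonempty := nonempty_Ioo.2 hab
  have hconst : EqOn f (fun _ => f m) (Ioo a b) := by
    intro x hx
    refine isOpen_Ioo.is_const_of_deriv_eq_zero isPreconnected_Ioo
      (fun x hx => (hfd x hx).differentiableAt.differentiableWithinAt)
      (fun x hx => (hfd x hx).deriv) hx hm
  have hcl : EqOn f (fun _ => f m) (Icc a b) := by
    refine hconst.of_subset_closure hfc continuousOn_const Ioo_subset_Icc_self ?_
    rw [closure_Ioo hab.ne]
  have h1 : f x = f y := (hcl hx).trans (hcl hy).symm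
  simp only [hf] at h1
  push_cast
  linear_combination -h1

/-- A straight curve starting at the centre of a ramified chart is a ray in this chart. -/
theorem IsRamChart.pow_eq {p : M} {κ : ℕ} {φ : OpenPartialHomeomorph M ℂ}
    (h : S.IsRamChart p κ φ) {v : ℂ} {γ : ℝ → M} {a b t₀ : ℝ} (hab : a < b)
    (hγ : S.IsStraight v γ (Ioo a b)) (hc : ContinuousOn γ (Icc a b)) (ht₀ : t₀ ∈ Icc a b)
    (hp : γ t₀ = p) (hsrc : ∀ t ∈ Icc a b, γ t ∈ φ.source) :
    ∀ t ∈ Icc a b, φ (γ t) ^ κ = (t - t₀ : ℝ) * v := by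
  intro t ht
  have hcg : ContinuousOn (fun t => φ (γ t) ^ κ) (Icc a b) := (φ.continuousOn.comp hc hsrc).pow κ
  have h1 := sub_eq_of_hasDerivAt hab hcg (fun x hx => h.hasDerivAt hγ (Ioo_mem_nhds hx.1 hx.2)
    (hsrc x (Ioo_subset_Icc_self hx))) ht₀ ht
  have h2 : κ ≠ 0 := by have := h.one_le; omega
  rw [hp, h.eq_zero, zero_pow h2, sub_zero] at h1
  exact h1

/-! ### Branches of ramified charts -/

/-- The branch of the `κ`-th root, on the plane slit along `-v`, with value `θ` at `v`. -/
noncomputable def rootBranch (κ : ℕ) (θ v z : ℂ) : ℂ := θ * (z / v) ^ ((κ : ℂ)⁻¹)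

section Root

variable {κ : ℕ} {θ v z : ℂ}

/-- This identity needs no slit: it also holds where the branch is discontinuous. -/
theorem rootBranch_pow (hκ : 1 ≤ κ) (hθ : θ ^ κ = v) (hv : v ≠ 0) :
    rootBranch κ θ v z ^ κ = z := by
  rw [rootBranch, mul_pow, Complex.cpow_nat_inv_pow _ (by omega), hθ]
  field_simp

theorem norm_rootBranch_lt (hκ : 1 ≤ κ) (hθ : θ ^ κ = v) (hv : v ≠ 0) {ρ : ℝ} (hρ : 0 < ρ)
    (hz : ‖z‖ < ρ ^ κ) : ‖rootBranch κ θ v z‖ < ρ := by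
  have h : ‖rootBranch κ θ v z‖ ^ κ < ρ ^ κ := by
    rwa [← norm_pow, rootBranch_pow hκ hθ hv]
  exact lt_of_pow_lt_pow_left₀ κ hρ.le h

theorem rootBranch_zero (hκ : 1 ≤ κ) (hθ : θ ^ κ = v) (hv : v ≠ 0) : rootBranch κ θ v 0 = 0 :=
  pow_eq_zero_iff (by omega : κ ≠ 0) |>.1 (rootBranch_pow hκ hθ hv)

theorem continuousAt_rootBranch (hz : z / v ∈ Complex.slitPlane) :
    ContinuousAt (rootBranch κ θ v) z := by
  have h1 : ContinuousAt (fun z : ℂ => z / v) z := by fun_prop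
  exact continuousAt_const.mul (h1.cpow continuousAt_const hz)

theorem continuousAt_rootBranch_zero (hκ : 1 ≤ κ) (hθ : θ ^ κ = v) (hv : v ≠ 0) :
    ContinuousAt (rootBranch κ θ v) 0 := by
  rw [ContinuousAt, rootBranch_zero hκ hθ hv, Metric.tendsto_nhds]
  intro ρ hρ
  filter_upwards [Metric.ball_mem_nhds (0 : ℂ) (pow_pos hρ κ)] with z hz
  rw [dist_zero_right]
  exact norm_rootBranch_lt hκ hθ hv hρ (by simpa using hz)

end Root

/-- A sectorial inverse of a ramified chart is a developing map on a slit disc. -/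
theorem IsRamChart.exists_branch {p : M} {κ : ℕ} {φ : OpenPartialHomeomorph M ℂ}
    (h : S.IsRamChart p κ φ) {v : ℂ} (hv : v ≠ 0) :
    ∃ ρ > 0, ∀ θ : ℂ, θ ^ κ = v → ContinuousAt (fun z => φ.symm (rootBranch κ θ v z)) 0 ∧
      φ.symm (rootBranch κ θ v 0) = p ∧
      ∀ z ∈ Metric.ball (0 : ℂ) ρ, φ.symm (rootBranch κ θ v z) ∈ φ.source ∧
        φ (φ.symm (rootBranch κ θ v z)) = rootBranch κ θ v z ∧
        (z / v ∈ Complex.slitPlane → S.DevAt (fun z => φ.symm (rootBranch κ θ v z)) z) := by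
  have h0 : (0 : ℂ) ∈ φ.target := h.eq_zero ▸ φ.map_source h.mem
  obtain ⟨ρ, hρ, hb⟩ := Metric.isOpen_iff.1 φ.open_target 0 h0
  -- Every root of a number of modulus less than `ρ ^ κ` lies in the disc of radius `ρ`.
  refine ⟨ρ ^ κ, pow_pos hρ κ, fun θ hθ => ?_⟩
  have hmem : ∀ z ∈ Metric.ball (0 : ℂ) (ρ ^ κ), rootBranch κ θ v z ∈ φ.target := fun z hz =>
    hb (by simpa using norm_rootBranch_lt h.one_le hθ hv hρ (by simpa using hz))
  have hcont : ∀ z ∈ Metric.ball (0 : ℂ) (ρ ^ κ), ContinuousAt (rootBranch κ θ v) z →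
      ContinuousAt (fun z => φ.symm (rootBranch κ θ v z)) z := fun z hz hc =>
    ContinuousAt.comp (φ.continuousAt_symm (hmem z hz)) hc
  refine ⟨hcont 0 (by simpa using pow_pos hρ κ)
    (continuousAt_rootBranch_zero h.one_le hθ hv), ?_, fun z hz =>
    ⟨φ.map_target (hmem z hz), φ.right_inv (hmem z hz), fun hzs => ?_⟩⟩
  · rw [rootBranch_zero h.one_le hθ hv, ← h.eq_zero, φ.left_inv h.mem]
  · have hc := hcont z hz (continuousAt_rootBranch hzs)
    have hsing : φ.symm (rootBranch κ θ v z) ∉ S.sing := by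
      intro hs
      have h1 := h.eq_of_mem _ (φ.map_target (hmem z hz)) hs
      have h2 : rootBranch κ θ v z = 0 := by rw [← φ.right_inv (hmem z hz), h1, h.eq_zero]
      have h3 := rootBranch_pow (z := z) h.one_le hθ hv
      rw [h2, zero_pow (by have := h.one_le; omega)] at h3
      rw [← h3, zero_div] at hzs
      exact Complex.slitPlane_ne_zero hzs rfl
    obtain ⟨e, he, hpe⟩ := S.cover _ hsing
    obtain ⟨c, hc'⟩ := h.chart e he _ ⟨φ.map_target (hmem z hz), hpe⟩
    refine ⟨e, he, c, ?_⟩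
    filter_upwards [hc.eventually hc', hc.eventually (e.open_source.mem_nhds hpe),
      Metric.isOpen_ball.mem_nhds hz] with w h1 h2 h3
    exact ⟨h2, by rw [h1, φ.right_inv (hmem w h3), rootBranch_pow h.one_le hθ hv]⟩

/-- Near a singular point reached along a ray, the exponential map is a branch of the inverse of a
ramified chart, on a disc slit beyond the singular point. -/
theorem exists_sector [T2Space M] {p A : M} {ζ : ℂ} (hζ : ζ ≠ 0)
    (hdom : ∀ t ∈ Ico (0 : ℝ) 1, (t : ℂ) * ζ ∈ S.expDom p)
    (hlim : Tendsto (fun t : ℝ => S.expMap p (t * ζ)) (𝓝[<] 1) (𝓝 A))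
    {κ : ℕ} {φ : OpenPartialHomeomorph M ℂ} (hφ : S.IsRamChart A κ φ) :
    ∃ (Ψ : ℂ → M) (ρ : ℝ), 0 < ρ ∧ Ψ ζ = A ∧ ContinuousAt Ψ ζ ∧
      ∀ z ∈ Metric.ball ζ ρ, Ψ z ∈ φ.source ∧ φ (Ψ z) ^ κ = z - ζ ∧
        ((z - ζ) / (-ζ) ∈ Complex.slitPlane →
          z ∈ S.expDom p ∧ S.expMap p z = Ψ z ∧ S.DevAt Ψ z) := by
  set γ : ℝ → M := fun t => if t < 1 then S.expMap p (t * ζ) else A with hγdef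
  have hst := isStraight_expMap_of_forall hdom
  have hγst : S.IsStraight ζ γ (Ico 0 1) := hst.congr fun t ht => by simp [hγdef, ht.2]
  have hγ1 : γ 1 = A := by simp [hγdef]
  have hγc : ContinuousWithinAt γ (Iic 1) 1 := by
    have h1 : Tendsto γ (𝓝[<] 1) (𝓝 (γ 1)) := by
      rw [hγ1]
      refine hlim.congr' ?_
      filter_upwards [self_mem_nhdsWithin] with t ht
      simp [hγdef, show t < 1 from ht]
    exact continuousWithinAt_Iio_iff_Iic.1 h1
  obtain ⟨t₀, ht₀, hsub⟩ : ∃ t₀ ∈ Ico (0 : ℝ) 1, Icc t₀ 1 ⊆ {t | γ t ∈ φ.source} := by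
    have h1 : {t | γ t ∈ φ.source} ∈ 𝓝[≤] 1 :=
      hγc (by rw [hγ1]; exact φ.open_source.mem_nhds hφ.mem)
    obtain ⟨l, hl, hl2⟩ := (mem_nhdsLE_iff_exists_mem_Ico_Ioc_subset (zero_lt_one (α := ℝ))).1 h1
    refine ⟨(l + 1) / 2, ⟨by linarith [hl.1], by linarith [hl.2]⟩, fun t ht => hl2 ⟨?_, ht.2⟩⟩
    linarith [hl.2, ht.1]
  have hpow : ∀ t ∈ Icc t₀ 1, φ (γ t) ^ κ = (t - 1 : ℝ) * ζ := by
    refine hφ.pow_eq (t₀ := 1) ht₀.2 (hγst.mono fun t ht => ⟨ht₀.1.trans ht.1.le, ht.2⟩) ?_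
      ⟨ht₀.2.le, le_rfl⟩ hγ1 hsub
    intro t ht
    rcases eq_or_lt_of_le ht.2 with rfl | hlt
    · exact hγc.mono fun u hu => hu.2
    · refine ((hγst.1 t ⟨ht₀.1.trans ht.1, hlt⟩).mono_of_mem_nhdsWithin ?_)
      filter_upwards [self_mem_nhdsWithin, mem_nhdsWithin_of_mem_nhds (Iio_mem_nhds hlt)] with u h1 h2
      exact ⟨ht₀.1.trans h1.1, h2⟩
  have hκ := hφ.one_le
  have hv : -ζ ≠ 0 := neg_ne_zero.2 hζ
  -- the choice of the branch
  have hbr : ∀ t₂ ∈ Ico t₀ 1, ∃ θ : ℂ, θ ^ κ = -ζ ∧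
      rootBranch κ θ (-ζ) ((t₂ - 1 : ℝ) * ζ) = φ (γ t₂) := by
    intro t₂ ht₂
    have hpos : (0 : ℝ) < 1 - t₂ := sub_pos.2 ht₂.2
    set m : ℂ := (((1 - t₂ : ℝ) : ℂ)) ^ ((κ : ℂ)⁻¹) with hm
    have hmk : m ^ κ = ((1 - t₂ : ℝ) : ℂ) := Complex.cpow_nat_inv_pow _ (by omega)
    have hne : ((1 - t₂ : ℝ) : ℂ) ≠ 0 := by exact_mod_cast hpos.ne'
    have hm0 : m ≠ 0 := by
      intro h0
      rw [h0, zero_pow (by omega)] at hmk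
      exact hne hmk.symm
    -- The branch takes the value `θ * m` at `(t₂ - 1) * ζ`, so this `θ` is the one for which it
    -- passes through the point of the ray.
    refine ⟨φ (γ t₂) / m, ?_, ?_⟩
    · rw [div_pow, hmk, hpow t₂ ⟨ht₂.1, ht₂.2.le⟩]
      rw [div_eq_iff hne]
      push_cast; ring
    · rw [rootBranch]
      have h1 : ((t₂ - 1 : ℝ) : ℂ) * ζ / (-ζ) = ((1 - t₂ : ℝ) : ℂ) := by
        rw [div_eq_iff hv]; push_cast; ring
      rw [h1, ← hm]
      field_simp
  obtain ⟨ρ, hρ, hall⟩ := hφ.exists_branch hv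
  -- a point of the ray close to the singular point
  obtain ⟨t₂, ht₂, ht₂pos, ht₂ρ⟩ : ∃ t₂ ∈ Ico t₀ 1, 0 < t₂ ∧ (1 - t₂) * ‖ζ‖ < ρ / 2 := by
    have h1 : ∀ᶠ t : ℝ in 𝓝[<] 1, t ∈ Ioo t₀ 1 := Ioo_mem_nhdsLT ht₀.2
    have h2 : Tendsto (fun t : ℝ => (1 - t) * ‖ζ‖) (𝓝[<] 1) (𝓝 0) := by
      have : Continuous fun t : ℝ => (1 - t) * ‖ζ‖ := by fun_prop
      simpa using (this.tendsto 1).mono_left (nhdsWithin_le_nhds (s := Iio 1))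
    obtain ⟨t, h3, h4⟩ := (h1.and (h2.eventually (gt_mem_nhds (half_pos hρ)))).exists
    exact ⟨t, ⟨h3.1.le, h3.2⟩, ht₀.1.trans_lt h3.1, h4⟩
  obtain ⟨θ, hθ, hθt⟩ := hbr t₂ ht₂
  obtain ⟨hΨc, hΨ0, hΨ⟩ := hall θ hθ
  set Ψ₀ : ℂ → M := fun z => φ.symm (rootBranch κ θ (-ζ) z) with hΨ₀
  have hdev : ∀ z ∈ Metric.ball ζ ρ, (z - ζ) / (-ζ) ∈ Complex.slitPlane →
      S.DevAt (fun z => Ψ₀ (z - ζ)) z := by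
    intro z hz hs
    have hz' : z - ζ ∈ Metric.ball (0 : ℂ) ρ := by
      rw [mem_ball_zero_iff, ← dist_eq_norm]; exact hz
    have := (hΨ _ hz').2.2 hs
    have h2 : S.DevAt Ψ₀ (z + -ζ) := by rwa [← sub_eq_add_neg]
    simpa [← sub_eq_add_neg] using h2.comp_add
  -- The slit lies on the ray beyond `ζ`, so shrinking `z` towards `0` avoids it: the quotient is
  -- scaled by `s` and increased by the real number `1 - s ≥ 0`.
  have hslit : ∀ (z : ℂ) (s : ℝ), 0 < s → s ≤ 1 → (z - ζ) / (-ζ) ∈ Complex.slitPlane →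
      ((s : ℂ) * z - ζ) / (-ζ) ∈ Complex.slitPlane := by
    intro z s hs hs1 hz
    have h1 : ((s : ℂ) * z - ζ) / (-ζ) = (s : ℂ) * ((z - ζ) / (-ζ)) + ((1 - s : ℝ) : ℂ) := by
      field_simp; push_cast; ring
    rw [h1]
    rw [Complex.mem_slitPlane_iff] at hz ⊢
    simp only [Complex.add_re, Complex.re_ofReal_mul, Complex.ofReal_re, Complex.add_im,
      Complex.im_ofReal_mul, Complex.ofReal_im, add_zero]
    rcases hz with hz | hz
    · left; have := mul_pos hs hz; linarith
    · right; exact mul_ne_zero hs.ne' hz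
  have hball : ∀ (z : ℂ) (s : ℝ), t₂ ≤ s → s ≤ 1 → z ∈ Metric.ball ζ (ρ / 2) →
      (s : ℂ) * z ∈ Metric.ball ζ ρ := by
    intro z s hs hs1 hz
    rw [Metric.mem_ball, dist_eq_norm] at hz ⊢
    have h1 : (s : ℂ) * z - ζ = (s : ℂ) * (z - ζ) - ((1 - s : ℝ) : ℂ) * ζ := by push_cast; ring
    rw [h1]
    refine (norm_sub_le _ _).trans_lt ?_
    rw [norm_mul, norm_mul, Complex.norm_real, Complex.norm_real, Real.norm_eq_abs,
      Real.norm_eq_abs, abs_of_nonneg (by linarith), abs_of_nonneg (by linarith)]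
    have h2 : s * ‖z - ζ‖ ≤ 1 * ‖z - ζ‖ := mul_le_mul_of_nonneg_right hs1 (norm_nonneg _)
    have h3 : (1 - s) * ‖ζ‖ ≤ (1 - t₂) * ‖ζ‖ :=
      mul_le_mul_of_nonneg_right (by linarith) (norm_nonneg _)
    linarith
  have hray : ((t₂ : ℂ) * ζ - ζ) / (-ζ) ∈ Complex.slitPlane := by
    have h1 : ((t₂ : ℂ) * ζ - ζ) / (-ζ) = ((1 - t₂ : ℝ) : ℂ) := by
      rw [div_eq_iff hv]; push_cast; ring
    rw [h1, Complex.ofReal_mem_slitPlane]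
    linarith [ht₂.2]
  have heq : S.expMap p (t₂ * ζ) = Ψ₀ ((t₂ : ℂ) * ζ - ζ) := by
    have h1 : (t₂ : ℂ) * ζ - ζ = ((t₂ - 1 : ℝ) : ℂ) * ζ := by push_cast; ring
    rw [hΨ₀, h1]
    simp only
    rw [hθt, φ.left_inv (hsub ⟨ht₂.1, ht₂.2.le⟩)]
    simp [hγdef, ht₂.2]
  have ht₂dom := hdom t₂ ⟨ht₂pos.le, ht₂.2⟩
  have hζball : ζ ∈ Metric.ball ζ (ρ / 2) := Metric.mem_ball_self (half_pos hρ)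
  have hnear : ∀ᶠ w in 𝓝 ((t₂ : ℂ) * ζ), w ∈ S.expDom p ∧ S.expMap p w = Ψ₀ (w - ζ) :=
    ((isOpen_expDom p).mem_nhds ht₂dom |> eventually_mem_set.2).and
      ((devAt_expMap ht₂dom).eventuallyEq (hdev _ (hball ζ t₂ le_rfl ht₂.2.le hζball) hray) heq)
  have hnear' : ∀ᶠ z in 𝓝 ζ, (t₂ : ℂ) * z ∈ S.expDom p ∧
      S.expMap p (t₂ * z) = Ψ₀ ((t₂ : ℂ) * z - ζ) := by
    have hc : Tendsto (fun z : ℂ => (t₂ : ℂ) * z) (𝓝 ζ) (𝓝 ((t₂ : ℂ) * ζ)) :=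
      (continuous_const.mul continuous_id).tendsto ζ
    exact hc.eventually hnear
  obtain ⟨ρ₁, hρ₁, hb₁⟩ := Metric.eventually_nhds_iff_ball.1 hnear'
  refine ⟨fun z => Ψ₀ (z - ζ), min ρ₁ (ρ / 2), lt_min hρ₁ (half_pos hρ), by simpa using hΨ0, ?_, ?_⟩
  · have hΨc' : ContinuousAt Ψ₀ (ζ - ζ) := by rw [sub_self]; exact hΨc
    exact ContinuousAt.comp (f := fun z => z - ζ) hΨc' (by fun_prop)
  intro z hz
  have hz1 : z ∈ Metric.ball ζ ρ₁ := Metric.ball_subset_ball (min_le_left _ _) hz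
  have hz2 : z ∈ Metric.ball ζ (ρ / 2) := Metric.ball_subset_ball (min_le_right _ _) hz
  have hz3 : z ∈ Metric.ball ζ ρ := Metric.ball_subset_ball (by linarith) hz2
  have hz' : z - ζ ∈ Metric.ball (0 : ℂ) ρ := by
    rw [mem_ball_zero_iff, ← dist_eq_norm]; exact hz3
  refine ⟨(hΨ _ hz').1, ?_, fun hs => ?_⟩
  · rw [hΨ₀, (hΨ _ hz').2.1, rootBranch_pow hκ hθ hv]
  · have hkt : ((t₂⁻¹ : ℝ) : ℂ) * ((t₂ : ℂ) * z) = z := by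
      rw [← mul_assoc, ← Complex.ofReal_mul, inv_mul_cancel₀ ht₂pos.ne', Complex.ofReal_one, one_mul]
    have h1 := expMap_eq_dev (Φ := fun z => Ψ₀ (z - ζ)) (k := t₂⁻¹) (inv_pos.2 ht₂pos)
      (hb₁ z hz1).1 ?_ (hb₁ z hz1).2
    · rw [hkt] at h1
      exact ⟨h1.1, h1.2, hdev z hz3 hs⟩
    · intro s hs'
      rw [uIcc_of_le ((one_le_inv₀ ht₂pos).2 ht₂.2.le)] at hs'
      have h2 : (s : ℂ) * ((t₂ : ℂ) * z) = ((s * t₂ : ℝ) : ℂ) * z := by push_cast; ring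
      have h3 : t₂ ≤ s * t₂ := by nlinarith [hs'.1]
      have h4 : s * t₂ ≤ 1 := by
        have := mul_le_mul_of_nonneg_right hs'.2 ht₂pos.le
        rwa [inv_mul_cancel₀ ht₂pos.ne'] at this
      rw [h2]
      exact hdev _ (hball z _ h3 h4 hz2) (hslit z _ (by linarith) h4 hs)

end TranslationSurface

namespace TranslationSurface

variable {M : Type*} [TopologicalSpace M] {S : TranslationSurface M}

/-! ### Shifting the base point of the exponential map -/

section Shift

variable [T2Space M] {p : M} {v : ℂ}

theorem expMap_shift {τ t u : ℝ} (h : (τ : ℂ) * v ∈ S.expDom p) (ht : t ∈ Icc 0 τ)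
    (hu : u ∈ Icc (-t) (τ - t)) :
    (u : ℂ) * v ∈ S.expDom (S.expMap p (t * v)) ∧
      S.expMap (S.expMap p (t * v)) (u * v) = S.expMap p ((t + u : ℝ) * v) := by
  have hdom : ∀ s ∈ Icc 0 τ, (s : ℂ) * v ∈ S.expDom p := by
    intro s hs
    rcases eq_or_lt_of_le (ht.1.trans ht.2) with h0 | h0
    · have : s = 0 := le_antisymm (h0 ▸ hs.2) hs.1
      rw [this]
      simpa [← h0] using h
    · have := smul_mem_expDom h (t := s / τ) ⟨div_nonneg hs.1 h0.le, (div_le_one h0).2 hs.2⟩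
      rw [← mul_assoc, ← Complex.ofReal_mul, div_mul_cancel₀ _ h0.ne'] at this
      exact this
  have h1 := (isStraight_expMap_of_forall hdom).comp_add t
  have h2 := expMap_mul_eq (p := S.expMap p (t * v)) (s := Icc (-t) (τ - t)) ordConnected_Icc
    (h1.mono (fun s hs => ⟨by linarith [hs.1], by linarith [hs.2]⟩)) ⟨by linarith [ht.1], by
      linarith [ht.2]⟩ (by simp) hu
  refine ⟨h2.1, ?_⟩
  rw [h2.2, add_comm]

theorem expMap_add {t s : ℝ} (ht : 0 ≤ t) (hs : 0 ≤ s) (h : (t : ℂ) * v ∈ S.expDom p)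
    (h' : (s : ℂ) * v ∈ S.expDom (S.expMap p (t * v))) :
    ((t + s : ℝ) : ℂ) * v ∈ S.expDom p ∧
      S.expMap p ((t + s : ℝ) * v) = S.expMap (S.expMap p (t * v)) (s * v) := by
  have hst : ∀ {q : M} {τ : ℝ}, 0 ≤ τ → (τ : ℂ) * v ∈ S.expDom q →
      S.IsStraight v (fun t : ℝ => S.expMap q (t * v)) (Icc 0 τ) := by
    intro q τ hτ hq
    refine isStraight_expMap_of_forall fun u hu => ?_
    have hq' := expMap_shift hq (t := 0) ⟨le_rfl, hτ⟩ (u := u) (by simpa using hu)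
    simpa [expMap_zero (notMem_sing_of_mem_expDom hq)] using hq'.1
  have h1 := hst ht h
  have h2 := (hst hs h').comp_add (-t)
  have h3 := IsIntegralCurve.concat (c := t + s) h1 (h2.mono (fun u hu =>
    ⟨by linarith [hu.1], by linarith [hu.2]⟩)) (by
      simp [expMap_zero (notMem_sing_of_mem_expDom h')])
  have h4 := expMap_mul_eq (p := p) ordConnected_Icc h3 ⟨le_rfl, by linarith⟩
    (by simp [ht, expMap_zero (notMem_sing_of_mem_expDom h)]) (t := t + s) ⟨by linarith, le_rfl⟩
  refine ⟨h4.1, h4.2.trans ?_⟩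
  rcases eq_or_lt_of_le hs with rfl | hlt
  · simp [expMap_zero (notMem_sing_of_mem_expDom h')]
  · simp [not_le.2 hlt]

/-- The segment from `0` to `v` is compact in an open domain, so nearby segments also lie in it, and
the developing map at `p` sends them to straight curves from `S.expMap p q.1`. This is what makes
neighbouring leaves parallel. -/
theorem expMap_tube (h : v ∈ S.expDom p) :
    ∀ᶠ q : ℂ × ℂ in 𝓝 ((0 : ℂ), v), q.1 ∈ S.expDom p ∧ q.2 ∈ S.expDom (S.expMap p q.1) ∧
      q.1 + q.2 ∈ S.expDom p ∧ S.expMap (S.expMap p q.1) q.2 = S.expMap p (q.1 + q.2) := by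
  have h1 : ∀ᶠ q : ℂ × ℂ in 𝓝 ((0 : ℂ), v), ∀ θ ∈ Icc (0 : ℝ) 1, q.1 + (θ : ℂ) * q.2 ∈ S.expDom p := by
    refine isCompact_Icc.eventually_forall_of_forall_eventually fun θ hθ => ?_
    have hc : Continuous fun z : (ℂ × ℂ) × ℝ => z.1.1 + z.2 * z.1.2 := by fun_prop
    refine (hc.tendsto ((0, v), θ)).eventually ((isOpen_expDom p).mem_nhds ?_)
    simpa using smul_mem_expDom h hθ
  filter_upwards [h1] with q hq
  have h2 := expMap_eq (S := S) (p := S.expMap p q.1) (isStraight_of_dev (Φ := S.expMap p) (z := q.1)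
    (v := q.2) fun t ht => devAt_expMap (hq t ht)) (by simp)
  have h3 := hq 0 ⟨le_rfl, zero_le_one⟩
  have h4 := hq 1 ⟨zero_le_one, le_rfl⟩
  simp only [Complex.ofReal_zero, zero_mul, add_zero, Complex.ofReal_one, one_mul] at h2 h3 h4
  exact ⟨h3, h2.1, h4, h2.2⟩

theorem mul_mem_expDom {t s : ℝ} (ht : t ∈ Icc 0 s) (h : (s : ℂ) * v ∈ S.expDom p) :
    (t : ℂ) * v ∈ S.expDom p := by
  have h1 := expMap_shift h (t := 0) ⟨le_rfl, ht.1.trans ht.2⟩ (u := t) (by simpa using ht)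
  simpa [expMap_zero (notMem_sing_of_mem_expDom h)] using h1.1

theorem tendsto_expMap {t : ℝ} (h : (t : ℂ) * v ∈ S.expDom p) :
    Tendsto (fun t : ℝ => S.expMap p (t * v)) (𝓝 t) (𝓝 (S.expMap p (t * v))) :=
  ContinuousAt.comp (f := fun t : ℝ => (t : ℂ) * v) (devAt_expMap h).continuousAt (by fun_prop)

/-- A ray that ends at a singular point, in a ramified chart. -/
theorem exists_ray_pow {A : M} (hv : v ≠ 0) {ℓ : ℝ} (hℓ : 0 < ℓ)
    (hdom : ∀ t ∈ Ico (0 : ℝ) ℓ, (t : ℂ) * v ∈ S.expDom p)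
    (hlim : Tendsto (fun t : ℝ => S.expMap p (t * v)) (𝓝[<] ℓ) (𝓝 A))
    {κ : ℕ} {φ : OpenPartialHomeomorph M ℂ} (hφ : S.IsRamChart A κ φ) :
    ∃ η > 0, η < ℓ ∧ ∀ s ∈ Ioo 0 η, S.expMap p ((ℓ - s : ℝ) * v) ∈ φ.source ∧
      φ (S.expMap p ((ℓ - s : ℝ) * v)) ^ κ = -(s : ℂ) * v := by
  have hℓ' : (ℓ : ℂ) ≠ 0 := by exact_mod_cast hℓ.ne'
  have hlim' : Tendsto (fun t : ℝ => S.expMap p (t * (ℓ * v))) (𝓝[<] 1) (𝓝 A) := by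
    have h1 : Tendsto (fun t : ℝ => t * ℓ) (𝓝[<] 1) (𝓝[<] ℓ) := by
      refine tendsto_nhdsWithin_iff.2 ⟨?_, ?_⟩
      · have : Continuous fun t : ℝ => t * ℓ := by fun_prop
        simpa using (this.tendsto 1).mono_left (nhdsWithin_le_nhds (s := Iio 1))
      · filter_upwards [self_mem_nhdsWithin] with t ht
        have : t < 1 := ht
        exact mul_lt_of_lt_one_left hℓ this
    refine (hlim.comp h1).congr fun t => ?_
    simp [mul_assoc]
  obtain ⟨Ψ, ρ, hρ, -, -, hΨ⟩ := exists_sector (mul_ne_zero hℓ' hv) (fun t ht => by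
    have := hdom (t * ℓ) ⟨mul_nonneg ht.1 hℓ.le, mul_lt_of_lt_one_left hℓ ht.2⟩
    simpa [mul_assoc] using this) hlim' hφ
  have hvn : 0 < ‖v‖ := norm_pos_iff.2 hv
  refine ⟨min (ℓ / 2) (ρ / ‖v‖), lt_min (half_pos hℓ) (div_pos hρ hvn),
    (min_le_left _ _).trans_lt (half_lt_self hℓ), fun s hs => ?_⟩
  have hz : ((ℓ - s : ℝ) : ℂ) * v - ℓ * v = -(s : ℂ) * v := by push_cast; ring
  have hball : ((ℓ - s : ℝ) : ℂ) * v ∈ Metric.ball ((ℓ : ℂ) * v) ρ := by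
    rw [Metric.mem_ball, dist_eq_norm, hz, norm_mul, norm_neg, Complex.norm_real, Real.norm_eq_abs,
      abs_of_pos hs.1]
    exact (lt_div_iff₀ hvn).1 (hs.2.trans_le (min_le_right _ _))
  obtain ⟨h1, h2, h3⟩ := hΨ _ hball
  have hs' : (((ℓ - s : ℝ) : ℂ) * v - ℓ * v) / (-(ℓ * v)) ∈ Complex.slitPlane := by
    have h4 : (((ℓ - s : ℝ) : ℂ) * v - ℓ * v) / (-(ℓ * v)) = ((s / ℓ : ℝ) : ℂ) := by
      rw [hz]; push_cast; field_simp
    rw [h4, Complex.ofReal_mem_slitPlane]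
    exact div_pos hs.1 hℓ
  rw [(h3 hs').2.1]
  exact ⟨h1, by rw [h2, hz]⟩

end Shift

/-! ### The closed segment in ramified charts -/

namespace HorizontalSegment

variable {I : S.HorizontalSegment}

theorem ι_notMem_sing {x : ℝ} (hx : x ∈ Ioo I.a I.b) : I.ι x ∉ S.sing := (I.horizontal.2 x hx).1

variable (I) in
/-- The closed segment. -/
def closedCarrier : Set M := I.ι '' Icc I.a I.b

theorem carrier_subset_closedCarrier : I.carrier ⊆ I.closedCarrier :=
  image_mono Ioo_subset_Icc_self

theorem ι_mem_carrier_iff {x : ℝ} (hx : x ∈ Icc I.a I.b) : I.ι x ∈ I.carrier ↔ x ∈ Ioo I.a I.b := by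
  constructor
  · rintro ⟨y, hy, hyx⟩
    rwa [← I.injOn (Ioo_subset_Icc_self hy) hx hyx]
  · exact fun h => ⟨x, h, rfl⟩

variable [T2Space M]

theorem isClosed_closedCarrier : IsClosed I.closedCarrier :=
  (isCompact_Icc.image_of_continuousOn I.continuousOn).isClosed

/-- The part of the segment near `x₀` is a ray or a line in the ramified chart. The remaining part
is compact and, by injectivity, misses `ι x₀`, so a small neighbourhood does not see it. -/
theorem exists_nhds_pow_eq {x₀ : ℝ} (hx₀ : x₀ ∈ Icc I.a I.b) {κ : ℕ}
    {φ : OpenPartialHomeomorph M ℂ} (hφ : S.IsRamChart (I.ι x₀) κ φ) :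
    ∃ N ∈ 𝓝 (I.ι x₀), ∀ x ∈ Icc I.a I.b, I.ι x ∈ N →
      I.ι x ∈ φ.source ∧ φ (I.ι x) ^ κ = (x - x₀ : ℝ) := by
  obtain ⟨δ, hδ, hsrc⟩ : ∃ δ > 0, ∀ x ∈ Icc I.a I.b, |x - x₀| ≤ δ → I.ι x ∈ φ.source := by
    have h1 := (I.continuousOn x₀ hx₀) (φ.open_source.mem_nhds hφ.mem)
    obtain ⟨δ, hδ, hb⟩ := Metric.mem_nhdsWithin_iff.1 h1
    refine ⟨δ / 2, half_pos hδ, fun x hx hxδ => hb ⟨?_, hx⟩⟩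
    rw [Metric.mem_ball, Real.dist_eq]
    linarith
  have hlt : max I.a (x₀ - δ) < min I.b (x₀ + δ) := by
    have := I.lt
    rw [max_lt_iff, lt_min_iff, lt_min_iff]
    refine ⟨⟨I.lt, by linarith [hx₀.1]⟩, by linarith [hx₀.2], by linarith⟩
  have hsub : Icc (max I.a (x₀ - δ)) (min I.b (x₀ + δ)) ⊆ Icc I.a I.b :=
    Icc_subset_Icc (le_max_left _ _) (min_le_left _ _)
  have hpow := hφ.pow_eq (v := 1) (γ := I.ι) (t₀ := x₀) hlt
    (I.horizontal.mono (Ioo_subset_Ioo (le_max_left _ _) (min_le_left _ _)))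
    (I.continuousOn.mono hsub)
    ⟨max_le hx₀.1 (by linarith), le_min hx₀.2 (by linarith)⟩ rfl (fun t ht => hsrc t (hsub ht)
      (abs_le.2 ⟨by linarith [le_max_right I.a (x₀ - δ), ht.1],
        by linarith [min_le_right I.b (x₀ + δ), ht.2]⟩))
  have hK : IsCompact (I.ι '' (Icc I.a I.b ∩ {x | δ ≤ |x - x₀|})) := by
    refine IsCompact.image_of_continuousOn ?_ (I.continuousOn.mono inter_subset_left)
    exact isCompact_Icc.inter_right (isClosed_le continuous_const (by fun_prop))
  refine ⟨_, hK.isClosed.isOpen_compl.mem_nhds ?_, fun x hx hxN => ?_⟩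
  · rintro ⟨x, ⟨hx, hxδ⟩, hxx⟩
    have := I.injOn hx hx₀ hxx
    rw [this] at hxδ
    simp at hxδ
    linarith
  · have hxδ : |x - x₀| < δ := by
      by_contra hcon
      exact hxN ⟨x, ⟨hx, not_lt.1 hcon⟩, rfl⟩
    refine ⟨hsrc x hx hxδ.le, ?_⟩
    have h2 := abs_lt.1 hxδ
    have := hpow x ⟨max_le hx.1 (by linarith), le_min hx.2 (by linarith)⟩
    simpa using this

/-- The closed segment is horizontal in (ramified) charts. -/
theorem eventually_horizontal {Ψ : ℂ → M} {ζ : ℂ} (hc : ContinuousAt Ψ ζ) {κ : ℕ}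
    {φ : OpenPartialHomeomorph M ℂ} (hφ : S.IsRamChart (Ψ ζ) κ φ)
    (hpow : ∀ᶠ z in 𝓝 ζ, φ (Ψ z) ^ κ = z - ζ) :
    ∀ᶠ z in 𝓝 ζ, ∀ x ∈ Icc I.a I.b, Ψ z = I.ι x →
      ∃ x₀ ∈ Icc I.a I.b, I.ι x₀ = Ψ ζ ∧ z - ζ = (x - x₀ : ℝ) := by
  by_cases hmem : Ψ ζ ∈ I.closedCarrier
  · obtain ⟨x₀, hx₀, hx₀ζ⟩ := hmem
    rw [← hx₀ζ] at hφ
    obtain ⟨N, hN, hNp⟩ := exists_nhds_pow_eq hx₀ hφ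
    rw [hx₀ζ] at hN
    filter_upwards [hc.eventually hN, hpow] with z h1 h2 x hx hzx
    refine ⟨x₀, hx₀, hx₀ζ, ?_⟩
    rw [hzx] at h1 h2
    rw [← h2, (hNp x hx h1).2]
  · filter_upwards [hc.eventually (isClosed_closedCarrier.isOpen_compl.mem_nhds hmem)] with z h1 x hx hzx
    exact absurd ⟨x, hx, hzx.symm⟩ h1

theorem _root_.TranslationSurface.DevAt.eventually_pow {Φ : ℂ → M} {z₀ : ℂ} (h : S.DevAt Φ z₀)
    {κ : ℕ} {φ : OpenPartialHomeomorph M ℂ} (hφ : S.IsRamChart (Φ z₀) κ φ) :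
    ∀ᶠ z in 𝓝 z₀, φ (Φ z) ^ κ = z - z₀ := by
  have hcont := h.continuousAt
  obtain ⟨e, he, c, hc⟩ := h
  obtain ⟨c', hc'⟩ := hφ.chart e he (Φ z₀) ⟨hφ.mem, hc.self_of_nhds.1⟩
  have h2 : κ ≠ 0 := by have := hφ.one_le; omega
  have h0 : z₀ + c = c' := by
    have h3 := hc'.self_of_nhds
    rw [hc.self_of_nhds.2, hφ.eq_zero, zero_pow h2, zero_add] at h3
    exact h3
  filter_upwards [hc, hcont.eventually hc'] with z h3 h4
  rw [h3.2] at h4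
  linear_combination h0 - h4

theorem eventually_horizontal_dev {Φ : ℂ → M} {z₀ : ℂ} (h : S.DevAt Φ z₀) :
    ∀ᶠ z in 𝓝 z₀, ∀ x ∈ Icc I.a I.b, Φ z = I.ι x →
      ∃ x₀ ∈ Icc I.a I.b, I.ι x₀ = Φ z₀ ∧ z - z₀ = (x - x₀ : ℝ) := by
  obtain ⟨κ, φ, hφ⟩ := exists_isRamChart (S := S) (Φ z₀)
  exact eventually_horizontal h.continuousAt hφ (h.eventually_pow hφ)

/-- The segment in a developing map. -/
theorem eventually_ι_eq {Φ : ℂ → M} {z₀ : ℂ} (h : S.DevAt Φ z₀) {x₀ : ℝ} (hx₀ : x₀ ∈ Icc I.a I.b)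
    (hz : Φ z₀ = I.ι x₀) :
    ∀ᶠ x in 𝓝[Icc I.a I.b] x₀, I.ι x = Φ (z₀ + (x - x₀ : ℝ)) := by
  have hc : ContinuousWithinAt I.ι (Icc I.a I.b) x₀ := I.continuousOn x₀ hx₀
  have h1 : ∀ N ∈ 𝓝 z₀, ∀ᶠ x in 𝓝[Icc I.a I.b] x₀, I.ι x ∈ Φ '' N := by
    intro N hN
    refine hc ?_
    rw [← hz, ← h.map_nhds]
    exact image_mem_map hN
  filter_upwards [h1 _ (eventually_horizontal_dev (I := I) h), self_mem_nhdsWithin] with x hx hxI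
  obtain ⟨z, hzN, hzx⟩ := hx
  obtain ⟨x₁, hx₁, h2, h3⟩ := hzN x hxI hzx
  have : x₁ = x₀ := I.injOn hx₁ hx₀ (h2.trans hz)
  rw [← hzx, ← this, ← h3]
  congr 1
  ring

theorem eventually_ι_eq_of_mem_Ioo {Φ : ℂ → M} {z₀ : ℂ} (h : S.DevAt Φ z₀) {x₀ : ℝ}
    (hx₀ : x₀ ∈ Ioo I.a I.b) (hz : Φ z₀ = I.ι x₀) :
    ∀ᶠ x in 𝓝 x₀, I.ι x = Φ (z₀ + (x - x₀ : ℝ)) := by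
  have := eventually_ι_eq h (Ioo_subset_Icc_self hx₀) hz
  rwa [nhdsWithin_eq_nhds.2 (Icc_mem_nhds hx₀.1 hx₀.2)] at this

/-! ### First return times and singular leaves -/

variable (I) in
/-- The vertical leaf from `ι x` with velocity `v` returns to the open segment at time `h`. -/
def Returns (v : ℂ) (x h : ℝ) : Prop :=
  0 < h ∧ (h : ℂ) * v ∈ S.expDom (I.ι x) ∧
    (∀ t ∈ Ioo 0 h, S.expMap (I.ι x) (t * v) ∉ I.carrier) ∧ S.expMap (I.ι x) (h * v) ∈ I.carrier

variable (I) in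
/-- The vertical leaf from `ι x` with velocity `v` ends in `S.sing` at time `ℓ`, without returning
to the open segment. -/
def Ends (v : ℂ) (x ℓ : ℝ) : Prop :=
  0 < ℓ ∧ (∀ t ∈ Ico 0 ℓ, (t : ℂ) * v ∈ S.expDom (I.ι x)) ∧
    (∀ t ∈ Ioo 0 ℓ, S.expMap (I.ι x) (t * v) ∉ I.carrier) ∧
    ∃ A ∈ S.sing, Tendsto (fun t : ℝ => S.expMap (I.ι x) (t * v)) (𝓝[<] ℓ) (𝓝 A)

/-- The two vertical directions. -/
def IsVert (v : ℂ) : Prop := v = Complex.I ∨ v = -Complex.I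

theorem IsVert.neg {v : ℂ} (hv : IsVert v) : IsVert (-v) := by
  rcases hv with rfl | rfl
  · exact Or.inr rfl
  · exact Or.inl (neg_neg _)

theorem IsVert.ne_zero {v : ℂ} (hv : IsVert v) : v ≠ 0 := by
  rcases hv with rfl | rfl <;> simp

theorem IsVert.norm_eq {v : ℂ} (hv : IsVert v) : ‖v‖ = 1 := by
  rcases hv with rfl | rfl <;> simp

theorem IsVert.eq_zero {v : ℂ} (hv : IsVert v) {t s : ℝ} (h : (t : ℂ) * v = s) : t = 0 ∧ s = 0 := by
  rcases hv with rfl | rfl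
  · have h1 := congrArg Complex.re h
    have h2 := congrArg Complex.im h
    simp at h1 h2
    exact ⟨h2, h1.symm⟩
  · have h1 := congrArg Complex.re h
    have h2 := congrArg Complex.im h
    simp at h1 h2
    exact ⟨h2, h1.symm⟩

theorem Ends.limit_ne {v : ℂ} {x ℓ : ℝ} (h : I.Ends v x ℓ) : (ℓ : ℂ) * v ∉ S.expDom (I.ι x) := by
  intro hd
  obtain ⟨A, hA, hlim⟩ := h.2.2.2
  have := tendsto_nhds_unique ((tendsto_expMap hd).mono_left nhdsWithin_le_nhds) hlim
  rw [← this] at hA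
  exact (devAt_expMap hd).notMem_sing hA

theorem Ends.not_mem_expDom {v : ℂ} {x ℓ t : ℝ} (h : I.Ends v x ℓ) (ht : ℓ ≤ t) :
    (t : ℂ) * v ∉ S.expDom (I.ι x) := fun hd => h.limit_ne (mul_mem_expDom ⟨h.1.le, ht⟩ hd)

theorem Ends.unique {v : ℂ} {x ℓ ℓ' : ℝ} (h : I.Ends v x ℓ) (h' : I.Ends v x ℓ') : ℓ = ℓ' := by
  rcases lt_trichotomy ℓ ℓ' with hlt | heq | hlt
  · exact absurd (h'.2.1 ℓ ⟨h.1.le, hlt⟩) h.limit_ne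
  · exact heq
  · exact absurd (h.2.1 ℓ' ⟨h'.1.le, hlt⟩) h'.limit_ne

theorem Returns.not_ends {v : ℂ} {x h ℓ : ℝ} (hr : I.Returns v x h) (he : I.Ends v x ℓ) : False := by
  rcases lt_or_ge h ℓ with hlt | hle
  · exact he.2.2.1 h ⟨hr.1, hlt⟩ hr.2.2.2
  · exact he.not_mem_expDom hle hr.2.1

theorem Returns.unique {v : ℂ} {x h h' : ℝ} (hr : I.Returns v x h) (hr' : I.Returns v x h') :
    h = h' := by
  rcases lt_trichotomy h h' with hlt | heq | hlt
  · exact absurd hr.2.2.2 (hr'.2.2.1 h ⟨hr.1, hlt⟩)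
  · exact heq
  · exact absurd hr'.2.2.2 (hr.2.2.1 h' ⟨hr'.1, hlt⟩)

/-- The good position in terms of singular leaves. -/
theorem GoodPosition.ends (hI : I.GoodPosition) {x : ℝ} (hx : x = I.a ∨ x = I.b)
    (hs : I.ι x ∉ S.sing) : ∃ v ℓ, IsVert v ∧ I.Ends v x ℓ := by
  obtain hp | ⟨ℓ, γ, ⟨hℓ, hc, h0, hend, hdir⟩, hav⟩ := hI.2 (I.ι x) (by
    rcases hx with rfl | rfl <;> simp)
  · exact absurd hp hs
  have key : ∀ v : ℂ, S.IsStraight v γ (Ico 0 ℓ) → I.Ends v x ℓ := by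
    intro v hv
    have h1 : ∀ t ∈ Ico 0 ℓ, (t : ℂ) * v ∈ S.expDom (I.ι x) ∧ S.expMap (I.ι x) (t * v) = γ t :=
      fun t ht => expMap_mul_eq ordConnected_Ico hv ⟨le_rfl, hℓ⟩ h0 ht
    refine ⟨hℓ, fun t ht => (h1 t ht).1, fun t ht => ?_, γ ℓ, hend, ?_⟩
    · rw [(h1 t ⟨ht.1.le, ht.2⟩).2]
      exact hav t ⟨ht.1.le, ht.2.le⟩
    · have h2 : Tendsto γ (𝓝[<] ℓ) (𝓝 (γ ℓ)) :=
        (hc ℓ ⟨hℓ.le, le_rfl⟩).mono_left (nhdsWithin_le_of_mem (by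
          filter_upwards [Ioo_mem_nhdsLT hℓ] with t ht using ⟨ht.1.le, ht.2.le⟩))
      refine h2.congr' ?_
      filter_upwards [Ioo_mem_nhdsLT hℓ] with t ht using (h1 t ⟨ht.1.le, ht.2⟩).2.symm
  rcases hdir with hd | hd
  · exact ⟨Complex.I, ℓ, Or.inl rfl, key _ hd⟩
  · exact ⟨-Complex.I, ℓ, Or.inr rfl, key _ hd⟩

/-- Prolonging a leaf by a leaf that ends in `S.sing`. -/
theorem Ends.prepend {v : ℂ} {x t e ℓ : ℝ} (hend : I.Ends v e ℓ) (ht : 0 < t)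
    (hd : (t : ℂ) * v ∈ S.expDom (I.ι x))
    (hav : ∀ s ∈ Ioo 0 t, S.expMap (I.ι x) (s * v) ∉ I.carrier)
    (hte : S.expMap (I.ι x) (t * v) = I.ι e) (hec : I.ι e ∉ I.carrier) : I.Ends v x (t + ℓ) := by
  have hadd : ∀ s ∈ Ico 0 ℓ, ((t + s : ℝ) : ℂ) * v ∈ S.expDom (I.ι x) ∧
      S.expMap (I.ι x) ((t + s : ℝ) * v) = S.expMap (I.ι e) (s * v) := by
    intro s hs
    rw [← hte]
    exact expMap_add ht.le hs.1 hd (hte ▸ hend.2.1 s hs)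
  refine ⟨by linarith [hend.1], fun s hs => ?_, fun s hs => ?_, ?_⟩
  · rcases le_total s t with h | h
    · exact mul_mem_expDom ⟨hs.1, h⟩ hd
    · have := (hadd (s - t) ⟨by linarith, by linarith [hs.2]⟩).1
      simpa using this
  · rcases lt_trichotomy s t with h | h | h
    · exact hav s ⟨hs.1, h⟩
    · rw [h, hte]; exact hec
    · have := (hadd (s - t) ⟨by linarith, by linarith [hs.2]⟩).2
      rw [add_sub_cancel] at this
      rw [this]
      exact hend.2.2.1 _ ⟨by linarith, by linarith [hs.2]⟩
  · obtain ⟨A, hA, hlim⟩ := hend.2.2.2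
    refine ⟨A, hA, ?_⟩
    have h1 : Tendsto (fun s : ℝ => s - t) (𝓝[<] (t + ℓ)) (𝓝[<] ℓ) := by
      refine tendsto_nhdsWithin_iff.2 ⟨?_, ?_⟩
      · have : Continuous fun s : ℝ => s - t := by fun_prop
        simpa using (this.tendsto (t + ℓ)).mono_left (nhdsWithin_le_nhds (s := Iio (t + ℓ)))
      · filter_upwards [self_mem_nhdsWithin] with s hs
        have : s < t + ℓ := hs
        show s - t < ℓ
        linarith
    refine (hlim.comp h1).congr' ?_
    filter_upwards [Ioo_mem_nhdsLT (show t < t + ℓ by linarith [hend.1])] with s hs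
    have := (hadd (s - t) ⟨by linarith [hs.1], by linarith [hs.2]⟩).2
    rw [add_sub_cancel] at this
    exact this.symm

/-- The rest of a leaf that ends in `S.sing`. -/
theorem Ends.shift {v : ℂ} {x t e ℓ : ℝ} (hend : I.Ends v x ℓ) (ht : t ∈ Ico 0 ℓ)
    (hte : S.expMap (I.ι x) (t * v) = I.ι e) : I.Ends v e (ℓ - t) := by
  have hadd : ∀ s ∈ Ico 0 (ℓ - t), (s : ℂ) * v ∈ S.expDom (I.ι e) ∧
      S.expMap (I.ι e) (s * v) = S.expMap (I.ι x) ((t + s : ℝ) * v) := by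
    intro s hs
    rw [← hte]
    exact expMap_shift (hend.2.1 (t + s) ⟨by linarith [ht.1, hs.1], by linarith [hs.2]⟩)
      ⟨ht.1, by linarith [hs.1]⟩ ⟨by linarith [ht.1, hs.1], by linarith⟩
  refine ⟨by linarith [ht.2], fun s hs => (hadd s hs).1, fun s hs => ?_, ?_⟩
  · rw [(hadd s ⟨hs.1.le, hs.2⟩).2]
    exact hend.2.2.1 _ ⟨by linarith [ht.1, hs.1], by linarith [hs.2]⟩
  · obtain ⟨A, hA, hlim⟩ := hend.2.2.2
    refine ⟨A, hA, ?_⟩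
    have h1 : Tendsto (fun s : ℝ => t + s) (𝓝[<] (ℓ - t)) (𝓝[<] ℓ) := by
      refine tendsto_nhdsWithin_iff.2 ⟨?_, ?_⟩
      · have : Continuous fun s : ℝ => t + s := by fun_prop
        simpa using (this.tendsto (ℓ - t)).mono_left (nhdsWithin_le_nhds (s := Iio (ℓ - t)))
      · filter_upwards [self_mem_nhdsWithin] with s hs
        have : s < ℓ - t := hs
        show t + s < ℓ
        linarith
    refine (hlim.comp h1).congr' ?_
    filter_upwards [Ioo_mem_nhdsLT (show 0 < ℓ - t by linarith [ht.2])] with s hs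
    exact (hadd s ⟨hs.1.le, hs.2⟩).2.symm

/-- If a leaf from the open segment reaches an endpoint before returning, it ends in `S.sing`
before returning. -/
theorem ends_of_endpoint (hI : I.GoodPosition) {v : ℂ} (hv : IsVert v) {x t : ℝ}
    (hx : x ∈ Ioo I.a I.b) (ht : 0 < t) (hd : (t : ℂ) * v ∈ S.expDom (I.ι x))
    (hav : ∀ s ∈ Ioo 0 t, S.expMap (I.ι x) (s * v) ∉ I.carrier) {e : ℝ} (he : e = I.a ∨ e = I.b)
    (hte : S.expMap (I.ι x) (t * v) = I.ι e) :
    ∃ ℓ, I.Ends v x (t + ℓ) ∧ I.Ends v e ℓ := by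
  have hes : I.ι e ∉ S.sing := hte ▸ (devAt_expMap hd).notMem_sing
  have hec : I.ι e ∉ I.carrier := by
    rw [ι_mem_carrier_iff]
    · rcases he with rfl | rfl <;> simp
    · rcases he with rfl | rfl
      · exact ⟨le_rfl, I.lt.le⟩
      · exact ⟨I.lt.le, le_rfl⟩
  obtain ⟨w, ℓ, hw, hend⟩ := hI.ends he hes
  have hwv : w = v ∨ w = -v := by
    rcases hv with rfl | rfl <;> rcases hw with rfl | rfl <;> simp
  rcases hwv with rfl | rfl
  · exact ⟨ℓ, hend.prepend ht hd hav hte hec, hend⟩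
  -- The separatrix of the endpoint runs back along the leaf. It would either meet `ι x` in the open
  -- segment before ending, or put a singular point on a regular stretch of leaf.
  · exfalso
    have hback : ∀ s ∈ Icc 0 t, (s : ℂ) * (-v) ∈ S.expDom (I.ι e) ∧
        S.expMap (I.ι e) (s * (-v)) = S.expMap (I.ι x) ((t - s : ℝ) * v) := by
      intro s hs
      have := expMap_shift hd (t := t) ⟨ht.le, le_rfl⟩ (u := -s) ⟨by linarith [hs.2], by
        linarith [hs.1]⟩
      rw [hte] at this
      simpa [sub_eq_add_neg] using this
    rcases lt_or_ge t ℓ with hlt | hle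
    · have h1 := hend.2.2.1 t ⟨ht, hlt⟩
      rw [(hback t ⟨ht.le, le_rfl⟩).2] at h1
      simp only [sub_self, Complex.ofReal_zero, zero_mul] at h1
      rw [expMap_zero (ι_notMem_sing hx)] at h1
      exact h1 ⟨x, hx, rfl⟩
    · exact hend.limit_ne (hback ℓ ⟨hend.1.le, hle⟩).1

/-- An endpoint of the segment met before the return would make the leaf end in `S.sing`, by
`ends_of_endpoint`. -/
theorem Returns.notMem_closedCarrier (hI : I.GoodPosition) {v : ℂ} (hv : IsVert v) {x h : ℝ}
    (hx : x ∈ Ioo I.a I.b) (hr : I.Returns v x h) {t : ℝ} (ht : t ∈ Ioo 0 h) :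
    S.expMap (I.ι x) (t * v) ∉ I.closedCarrier := by
  rintro ⟨e, he, hte⟩
  have hnc := hr.2.2.1 t ht
  have he' : e = I.a ∨ e = I.b := by
    by_contra hcon
    push Not at hcon
    rw [← hte] at hnc
    exact hnc ⟨e, ⟨lt_of_le_of_ne he.1 (Ne.symm hcon.1), lt_of_le_of_ne he.2 hcon.2⟩, rfl⟩
  obtain ⟨ℓ, hℓ, -⟩ := ends_of_endpoint hI hv hx ht.1 (mul_mem_expDom ⟨ht.1.le, ht.2.le⟩ hr.2.1)
    (fun s hs => hr.2.2.1 s ⟨hs.1, hs.2.trans ht.2⟩) he' hte.symm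
  exact hr.not_ends hℓ

/-- Let `τ` be the infimum of the bad times, at which the leaf is undefined or on the closed
segment. The leaf has a limit at `τ`. If the limit is singular the leaf ends; if it is in the open
segment the leaf returns; if it is an endpoint the leaf ends by good position. Otherwise neither `τ`
nor the times just after it are bad, which is absurd. -/
theorem trichotomy [CompactSpace M] (hI : I.GoodPosition) {v : ℂ} (hv : IsVert v) {x : ℝ}
    (hx : x ∈ Ioo I.a I.b) :
    (∃ h, I.Returns v x h) ∨ (∃ ℓ, I.Ends v x ℓ) ∨
      ∀ t : ℝ, 0 < t → (t : ℂ) * v ∈ S.expDom (I.ι x) ∧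
        S.expMap (I.ι x) (t * v) ∉ I.closedCarrier := by
  by_contra hcon
  push Not at hcon
  obtain ⟨hnr, hne, t₁, ht₁, hbad⟩ := hcon
  have hp := ι_notMem_sing hx
  set F : Set ℝ := {t | 0 < t ∧ ¬((t : ℂ) * v ∈ S.expDom (I.ι x) ∧
        S.expMap (I.ι x) (t * v) ∉ I.closedCarrier)} with hF
  have hFne : F.Nonempty := ⟨t₁, ht₁, fun h => h.2 (hbad h.1)⟩
  have hFb : BddBelow F := ⟨0, fun t ht => ht.1.le⟩
  set τ := sInf F with hτ
  have hgood : ∀ t, 0 < t → t < τ → (t : ℂ) * v ∈ S.expDom (I.ι x) ∧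
        S.expMap (I.ι x) (t * v) ∉ I.closedCarrier := by
    intro t ht htτ
    by_contra hc
    exact absurd (csInf_le hFb (show t ∈ F from ⟨ht, hc⟩)) (not_le.2 htτ)
  have hmulc : Continuous fun t : ℝ => (t : ℂ) * v := by fun_prop
  -- regular times are isolated from bad times
  have hreg : ∀ t : ℝ, 0 ≤ t → (t : ℂ) * v ∈ S.expDom (I.ι x) →
      ∀ᶠ s : ℝ in 𝓝 t, (s : ℂ) * v ∈ S.expDom (I.ι x) ∧
        (s ≠ t → S.expMap (I.ι x) (s * v) ∉ I.closedCarrier) := by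
    intro t ht htd
    filter_upwards [(hmulc.tendsto t).eventually ((isOpen_expDom _).mem_nhds htd),
      (hmulc.tendsto t).eventually (eventually_horizontal_dev (I := I) (devAt_expMap htd))]
      with s h1 h2
    refine ⟨h1, fun hst ⟨y, hy, hys⟩ => hst ?_⟩
    obtain ⟨x₀, -, -, h3⟩ := h2 y hy hys.symm
    have h4 : ((s - t : ℝ) : ℂ) * v = ((y - x₀ : ℝ) : ℂ) := by rw [← h3]; push_cast; ring
    linarith [(hv.eq_zero h4).1]
  have hτpos : 0 < τ := by
    have h0 := hreg 0 le_rfl (by simpa using zero_mem_expDom hp)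
    obtain ⟨δ, hδ, hb⟩ := Metric.eventually_nhds_iff.1 h0
    refine lt_of_lt_of_le hδ (le_csInf hFne fun t ht => ?_)
    by_contra hlt
    have h1 := hb (y := t) (by rw [Real.dist_eq, sub_zero, abs_of_pos ht.1]; exact not_le.1 hlt)
    exact ht.2 ⟨h1.1, h1.2 ht.1.ne'⟩
  have hdom : ∀ t ∈ Ico 0 τ, (t : ℂ) * v ∈ S.expDom (I.ι x) := by
    intro t ht
    rcases eq_or_lt_of_le ht.1 with rfl | h
    · simpa using zero_mem_expDom hp
    · exact (hgood t h ht.2).1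
  have hav : ∀ t ∈ Ioo 0 τ, S.expMap (I.ι x) (t * v) ∉ I.carrier := fun t ht hc =>
    (hgood t ht.1 ht.2).2 (carrier_subset_closedCarrier hc)
  obtain ⟨q, hq, hqs⟩ := exists_tendsto_expMap hτpos hdom
  by_cases hsing : q ∈ S.sing
  · exact hne τ ⟨hτpos, hdom, hav, q, hsing, hq⟩
  obtain ⟨hτd, hτq⟩ := hqs hsing
  have hτc : S.expMap (I.ι x) (τ * v) ∉ I.closedCarrier := by
    rintro ⟨e, he, hte⟩
    by_cases he' : e ∈ Ioo I.a I.b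
    · exact hnr τ ⟨hτpos, hτd, hav, e, he', hte⟩
    · have he'' : e = I.a ∨ e = I.b := by
        by_contra hc
        push Not at hc
        exact he' ⟨lt_of_le_of_ne he.1 (Ne.symm hc.1), lt_of_le_of_ne he.2 hc.2⟩
      obtain ⟨ℓ, hℓ, -⟩ := ends_of_endpoint hI hv hx hτpos hτd hav he'' hte.symm
      exact hne _ hℓ
  obtain ⟨δ, hδ, hb⟩ := Metric.eventually_nhds_iff.1 (hreg τ hτpos.le hτd)
  obtain ⟨t, htF, htδ⟩ := exists_lt_of_csInf_lt hFne (show sInf F < τ + δ by rw [← hτ]; linarith)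
  have hτt : τ ≤ t := csInf_le hFb htF
  have h1 := hb (y := t) (by rw [Real.dist_eq, abs_of_nonneg (by linarith)]; linarith)
  rcases eq_or_lt_of_le hτt with h | h
  · exact htF.2 (h ▸ ⟨hτd, hτc⟩)
  · exact htF.2 ⟨h1.1, h1.2 h.ne'⟩

end HorizontalSegment

end TranslationSurface

namespace TranslationSurface

variable {M : Type*} [TopologicalSpace M] {S : TranslationSurface M}

namespace HorizontalSegment

variable {I : S.HorizontalSegment} [T2Space M]

/-! ### Strips of vertical leaves -/

theorem eventually_ι_eq_expMap {x : ℝ} (hx : x ∈ Ioo I.a I.b) :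
    ∀ᶠ x' in 𝓝 x, I.ι x' = S.expMap (I.ι x) ((x' - x : ℝ) : ℂ) := by
  have hp := ι_notMem_sing hx
  have h1 := eventually_ι_eq_of_mem_Ioo (devAt_expMap (zero_mem_expDom hp)) hx (expMap_zero hp)
  simpa using h1

/-- The leaves that start near `ι x` follow the leaf of `ι x`. -/
theorem eventually_strip {v : ℂ} {x τ : ℝ} (hx : x ∈ Ioo I.a I.b)
    (h : (τ : ℂ) * v ∈ S.expDom (I.ι x)) :
    ∀ᶠ x' in 𝓝 x, ∀ t ∈ Icc 0 τ, ((x' - x : ℝ) : ℂ) + t * v ∈ S.expDom (I.ι x) ∧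
      (t : ℂ) * v ∈ S.expDom (I.ι x') ∧
      S.expMap (I.ι x') (t * v) = S.expMap (I.ι x) ((x' - x : ℝ) + t * v) := by
  have h1 : ∀ᶠ q : ℂ × ℂ in 𝓝 ((0 : ℂ), (τ : ℂ) * v), q.1 + q.2 ∈ S.expDom (I.ι x) ∧
      q.2 ∈ S.expDom (S.expMap (I.ι x) q.1) := (expMap_tube h).mono fun q hq => ⟨hq.2.2.1, hq.2.1⟩
  have h2 : ∀ᶠ x' in 𝓝 x, ∀ t ∈ Icc 0 τ, ((x' - x : ℝ) : ℂ) + t * v ∈ S.expDom (I.ι x) ∧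
      (t : ℂ) * v ∈ S.expDom (S.expMap (I.ι x) ((x' - x : ℝ) : ℂ)) ∧
      S.expMap (S.expMap (I.ι x) ((x' - x : ℝ) : ℂ)) (t * v)
        = S.expMap (I.ι x) ((x' - x : ℝ) + t * v) := by
    refine isCompact_Icc.eventually_forall_of_forall_eventually fun t ht => ?_
    have hc : Continuous fun z : ℝ × ℝ => (((z.1 - x : ℝ) : ℂ), (z.2 : ℂ) * v) := by fun_prop
    have h3 := hc.tendsto (x, t)
    simp only [sub_self, Complex.ofReal_zero] at h3
    filter_upwards [h3.eventually (expMap_tube (mul_mem_expDom ht h))] with z hz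
    exact ⟨hz.2.2.1, hz.2.1, hz.2.2.2⟩
  filter_upwards [h2, eventually_ι_eq_expMap hx] with x' h3 h4
  rw [h4]
  exact h3

variable (I) in
/-- The map that follows the vertical leaves from the segment. -/
noncomputable def leafMap (z : ℂ) : M := S.expMap (I.ι z.re) (z.im * Complex.I)

theorem devAt_leafMap {z : ℂ} (hz : z.re ∈ Ioo I.a I.b)
    (h : (z.im : ℂ) * Complex.I ∈ S.expDom (I.ι z.re)) : S.DevAt I.leafMap z := by
  have hd : S.DevAt (fun w => S.expMap (I.ι z.re) (w + -(z.re : ℂ))) z := by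
    refine DevAt.comp_add (Φ := S.expMap (I.ι z.re)) _ (devAt_expMap ?_)
    convert h using 1
    linear_combination -Complex.re_add_im z
  refine hd.congr ?_
  have hc : Continuous fun w : ℂ => (((w.re - z.re : ℝ) : ℂ), (w.im : ℂ) * Complex.I) := by
    fun_prop
  have h3 := hc.tendsto z
  simp only [sub_self, Complex.ofReal_zero] at h3
  filter_upwards [h3.eventually (expMap_tube h),
    (Complex.continuous_re.tendsto z).eventually (eventually_ι_eq_expMap hz)] with w h1 h2
  unfold leafMap
  rw [h2, h1.2.2.2]
  congr 1
  push_cast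
  linear_combination Complex.re_add_im w

theorem leafMap_eq {v : ℂ} (hv : IsVert v) (x t : ℝ) :
    I.leafMap (x + t * v) = S.expMap (I.ι x) (t * v) := by
  rcases hv with rfl | rfl <;> simp [leafMap]

theorem devAt_leafMap_of_isVert {v : ℂ} (hv : IsVert v) {x t : ℝ} (hx : x ∈ Ioo I.a I.b)
    (h : (t : ℂ) * v ∈ S.expDom (I.ι x)) : S.DevAt I.leafMap (x + t * v) := by
  refine devAt_leafMap ?_ ?_
  · rcases hv with rfl | rfl <;> simpa using hx
  · rcases hv with rfl | rfl <;> simpa using h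

/-! ### Local constancy of the return time -/

/-- A horizontally displaced leaf can meet the segment only at a height where the original leaf lies
on the closed segment, because the segment is horizontal; strictly before the return there is no
such height. Compactness of the time interval makes this uniform. -/
theorem Returns.eventually (hI : I.GoodPosition) {v : ℂ} (hv : IsVert v) {x h y : ℝ}
    (hx : x ∈ Ioo I.a I.b) (hr : I.Returns v x h) (hy : y ∈ Ioo I.a I.b)
    (hxy : S.expMap (I.ι x) (h * v) = I.ι y) :
    ∀ᶠ x' in 𝓝 x, I.Returns v x' h ∧ S.expMap (I.ι x') (h * v) = I.ι (y + (x' - x)) ∧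
      y + (x' - x) ∈ Ioo I.a I.b := by
  have hav : ∀ᶠ x' in 𝓝 x, ∀ t ∈ Icc 0 h, t ∈ Ioo 0 h →
      S.expMap (I.ι x) ((x' - x : ℝ) + t * v) ∉ I.carrier := by
    refine isCompact_Icc.eventually_forall_of_forall_eventually fun t ht => ?_
    have hd := mul_mem_expDom ht hr.2.1
    have hc : Continuous fun z : ℝ × ℝ => ((z.1 - x : ℝ) : ℂ) + z.2 * v := by fun_prop
    have h3 := hc.tendsto (x, t)
    simp only [sub_self, Complex.ofReal_zero, zero_add] at h3
    filter_upwards [h3.eventually (eventually_horizontal_dev (I := I) (devAt_expMap hd))] with z hz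
    rintro hz2 ⟨y', hy', hyz⟩
    obtain ⟨x₀, hx₀, hx₀e, heq⟩ := hz y' (Ioo_subset_Icc_self hy') hyz.symm
    have h4 : ((z.2 - t : ℝ) : ℂ) * v = ((y' - x₀ - (z.1 - x) : ℝ) : ℂ) := by
      push_cast at heq ⊢
      linear_combination heq
    have h5 := (hv.eq_zero h4).1
    have h6 : z.2 = t := by linarith
    exact hr.notMem_closedCarrier hI hv hx (h6 ▸ hz2) ⟨x₀, hx₀, hx₀e⟩
  have hend : ∀ᶠ x' in 𝓝 x, I.ι (y + (x' - x)) = S.expMap (I.ι x) (h * v + (x' - x : ℝ)) := by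
    have h1 := eventually_ι_eq_of_mem_Ioo (devAt_expMap hr.2.1) hy hxy
    have hc : Continuous fun x' : ℝ => y + (x' - x) := by fun_prop
    have h2 := hc.tendsto x
    simp only [sub_self, add_zero] at h2
    filter_upwards [h2.eventually h1] with x' h3
    rw [h3]
    congr 3
    ring
  have hmem : ∀ᶠ x' in 𝓝 x, y + (x' - x) ∈ Ioo I.a I.b := by
    have hc : Continuous fun x' : ℝ => y + (x' - x) := by fun_prop
    refine (hc.tendsto x).eventually (isOpen_Ioo.mem_nhds ?_)
    simpa using hy
  filter_upwards [hav, hend, hmem, eventually_strip hx hr.2.1] with x' h1 h2 h3 h4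
  have h5 := h4 h ⟨hr.1.le, le_rfl⟩
  have h6 : S.expMap (I.ι x') (h * v) = I.ι (y + (x' - x)) := by rw [h5.2.2, h2, add_comm]
  refine ⟨⟨hr.1, h5.2.1, fun t ht => ?_, h6 ▸ ⟨_, h3, rfl⟩⟩, h6, h3⟩
  have ht' := Ioo_subset_Icc_self ht
  rw [(h4 t ht').2.2]
  exact h1 t ht' ht

variable (I) in
/-- The leaf of `ι x` returns for the first time at time `h`, and at the point `ι (x + c)`. -/
def ReturnsBy (v : ℂ) (h c x : ℝ) : Prop :=
  I.Returns v x h ∧ x + c ∈ Ioo I.a I.b ∧ S.expMap (I.ι x) (h * v) = I.ι (x + c)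

theorem Returns.exists_returnsBy {v : ℂ} {x h : ℝ} (hr : I.Returns v x h) :
    ∃ c, I.ReturnsBy v h c x := by
  obtain ⟨y, hy, hyx⟩ := hr.2.2.2
  exact ⟨y - x, hr, by simpa using hy, by simpa using hyx.symm⟩

/-- Returning by `h` and `c` is open. So is its negation: by `trichotomy`, either the leaf returns
with other constants, and so do its neighbours, or it is infinite and off the closed segment at time
`h`, and its neighbours still are. -/
theorem returnsBy_of_isPreconnected [CompactSpace M] (hI : I.GoodPosition) {v : ℂ}
    (hv : IsVert v) {J : Set ℝ} (hJ : IsPreconnected J) (hJI : J ⊆ Ioo I.a I.b)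
    (hne : ∀ x ∈ J, ∀ ℓ, ¬I.Ends v x ℓ) {h c x₀ : ℝ} (hx₀ : x₀ ∈ J) (h₀ : I.ReturnsBy v h c x₀) :
    ∀ x ∈ J, I.ReturnsBy v h c x := by
  have hopen : ∀ x ∈ J, I.ReturnsBy v h c x → ∀ᶠ x' in 𝓝 x, I.ReturnsBy v h c x' := by
    intro x hx hr
    filter_upwards [hr.1.eventually hI hv (hJI hx) hr.2.1 hr.2.2] with x' h1
    rw [show x + c + (x' - x) = x' + c by ring] at h1
    exact ⟨h1.1, h1.2.2, h1.2.1⟩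
  have hclosed : ∀ x ∈ J, ¬I.ReturnsBy v h c x → ∀ᶠ x' in 𝓝 x, ¬I.ReturnsBy v h c x' := by
    intro x hx hr
    rcases trichotomy hI hv (hJI hx) with ⟨h', hr'⟩ | ⟨ℓ, hℓ⟩ | hw
    · obtain ⟨c', hc'⟩ := hr'.exists_returnsBy
      filter_upwards [hr'.eventually hI hv (hJI hx) hc'.2.1 hc'.2.2] with x' h1 h2
      rw [show x + c' + (x' - x) = x' + c' by ring] at h1
      have h3 : h' = h := h1.1.unique h2.1
      subst h3
      have h4 := I.injOn (Ioo_subset_Icc_self h1.2.2) (Ioo_subset_Icc_self h2.2.1)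
        (h1.2.1.symm.trans h2.2.2)
      have h5 : c' = c := by linarith
      exact hr (h5 ▸ hc')
    · exact absurd hℓ (hne x hx ℓ)
    · have hh := h₀.1.1
      obtain ⟨h1, h2⟩ := hw h hh
      have hc : Continuous fun x' : ℝ => ((x' - x : ℝ) : ℂ) + h * v := by fun_prop
      have h3 := hc.tendsto x
      simp only [sub_self, Complex.ofReal_zero, zero_add] at h3
      have h4 : Tendsto (fun x' : ℝ => S.expMap (I.ι x) (((x' - x : ℝ) : ℂ) + h * v)) (𝓝 x)
          (𝓝 (S.expMap (I.ι x) (h * v))) := (devAt_expMap h1).continuousAt.tendsto.comp h3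
      filter_upwards [h4.eventually (isClosed_closedCarrier.isOpen_compl.mem_nhds h2),
        eventually_strip (hJI hx) h1] with x' h5 h6 h7
      rw [← (h6 h ⟨hh.le, le_rfl⟩).2.2] at h5
      exact h5 (carrier_subset_closedCarrier h7.1.2.2.2)
  by_contra hcon
  push Not at hcon
  obtain ⟨x₁, hx₁, h₁⟩ := hcon
  set A : Set ℝ := {x | ∀ᶠ x' in 𝓝 x, I.ReturnsBy v h c x'}
  set B : Set ℝ := {x | ∀ᶠ x' in 𝓝 x, ¬I.ReturnsBy v h c x'}
  obtain ⟨x, -, hxA, hxB⟩ := hJ A B (isOpen_setOfPred_eventually_nhds) (isOpen_setOfPred_eventually_nhds)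
    (fun x hx => by
      by_cases hr : I.ReturnsBy v h c x
      · exact Or.inl (hopen x hx hr)
      · exact Or.inr (hclosed x hx hr))
    ⟨x₀, hx₀, hopen x₀ hx₀ h₀⟩ ⟨x₁, hx₁, hclosed x₁ hx₁ h₁⟩
  exact hxB.self_of_nhds hxA.self_of_nhds

theorem ReturnsBy.reverse {v : ℂ} {h c x : ℝ} (hx : x ∈ Ioo I.a I.b) (hr : I.ReturnsBy v h c x) :
    I.ReturnsBy (-v) h (-c) (x + c) := by
  have hp := ι_notMem_sing hx
  have hback : ∀ s ∈ Icc 0 h, (s : ℂ) * (-v) ∈ S.expDom (I.ι (x + c)) ∧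
      S.expMap (I.ι (x + c)) (s * (-v)) = S.expMap (I.ι x) ((h - s : ℝ) * v) := by
    intro s hs
    have := expMap_shift hr.1.2.1 (t := h) ⟨hr.1.1.le, le_rfl⟩ (u := -s) ⟨by linarith [hs.2], by
      linarith [hs.1]⟩
    rw [hr.2.2] at this
    simpa [sub_eq_add_neg] using this
  have hend := hback h ⟨hr.1.1.le, le_rfl⟩
  have hend' : S.expMap (I.ι (x + c)) (h * (-v)) = I.ι x := by
    rw [hend.2]
    simp [expMap_zero hp]
  refine ⟨⟨hr.1.1, hend.1, fun t ht => ?_, hend' ▸ ⟨x, hx, rfl⟩⟩, by simpa using hx, by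
    simpa using hend'⟩
  rw [(hback t (Ioo_subset_Icc_self ht)).2]
  exact hr.1.2.2.1 _ ⟨by linarith [ht.2], by linarith [ht.1]⟩

end HorizontalSegment

end TranslationSurface

namespace TranslationSurface

variable {M : Type*} [TopologicalSpace M] {S : TranslationSurface M}

namespace HorizontalSegment

variable {I : S.HorizontalSegment} [T2Space M]

/-! ### No leaf wanders -/

/-- An infinite leaf accumulates at a regular point. -/
theorem exists_mapClusterPt [CompactSpace M] {v : ℂ} (hv : IsVert v) {p : M}
    (h : ∀ t : ℝ, 0 ≤ t → (t : ℂ) * v ∈ S.expDom p) :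
    ∃ q ∉ S.sing, MapClusterPt q atTop (fun t : ℝ => S.expMap p (t * v)) := by
  by_contra hcon
  push Not at hcon
  obtain ⟨U, hU, hdisj⟩ := S.sing_finite.t2_separation
  choose κ φ hφ using fun A : M => exists_isRamChart (S := S) A
  -- Without regular cluster points the leaf finally stays in these disjoint neighbourhoods of the
  -- singular points, hence in a single one during a unit of time. But then `φ ^ κ` moves by `v`, of
  -- norm `1`, inside a disc of diameter `1 / 2`.
  set N : M → Set M := fun A => U A ∩ ((φ A).source ∩ φ A ⁻¹' {w | ‖w ^ κ A‖ < 1 / 4}) with hN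
  have hNo : ∀ A, IsOpen (N A) := fun A => (hU A).2.inter
    ((φ A).isOpen_inter_preimage (isOpen_lt (by fun_prop) continuous_const))
  have hNm : ∀ A, A ∈ N A := fun A => ⟨(hU A).1, (hφ A).mem, by
    have : κ A ≠ 0 := by have := (hφ A).one_le; omega
    simp [(hφ A).eq_zero, this]⟩
  have hev : ∀ᶠ t : ℝ in atTop, S.expMap p (t * v) ∈ ⋃ A ∈ S.sing, N A := by
    by_contra hne
    have hfr : ∃ᶠ t : ℝ in atTop, S.expMap p (t * v) ∈ (⋃ A ∈ S.sing, N A)ᶜ :=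
      not_eventually.1 hne
    have hcomp : IsCompact (⋃ A ∈ S.sing, N A)ᶜ :=
      (isOpen_biUnion fun A _ => hNo A).isClosed_compl.isCompact
    obtain ⟨q, hq, hqc⟩ := hcomp.exists_mapClusterPt_of_frequently hfr
    refine hcon q (fun hqs => hq ?_) hqc
    exact mem_biUnion hqs (hNm q)
  obtain ⟨t₀, ht₀⟩ := eventually_atTop.1 hev
  set t₁ := max t₀ 0 with ht₁
  set γ : ℝ → M := fun t => S.expMap p (t * v) with hγ
  have hst : S.IsStraight v γ (Ici 0) := isStraight_expMap_of_forall fun t ht => h t ht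
  have hsub : Icc t₁ (t₁ + 1) ⊆ Ici 0 := fun t ht => (le_max_right _ _).trans ht.1
  have hpre : IsPreconnected (γ '' Icc t₁ (t₁ + 1)) :=
    isPreconnected_Icc.image _ (hst.1.mono hsub)
  obtain ⟨A, hA, hAt⟩ := mem_iUnion₂.1 (ht₀ t₁ (le_max_left _ _))
  have hin : γ '' Icc t₁ (t₁ + 1) ⊆ N A := by
    have hopen2 : IsOpen (⋃ B ∈ S.sing \ {A}, N B) := isOpen_biUnion fun B _ => hNo B
    refine hpre.subset_left_of_subset_union (hNo A) hopen2 ?_ ?_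
      ⟨γ t₁, ⟨t₁, ⟨le_rfl, by linarith⟩, rfl⟩, hAt⟩
    · refine disjoint_iUnion₂_right.2 fun B hB => ?_
      exact (hdisj hA hB.1 (Ne.symm hB.2)).mono inter_subset_left inter_subset_left
    · rintro _ ⟨t, ht, rfl⟩
      obtain ⟨B, hB, hBt⟩ := mem_iUnion₂.1 (ht₀ t ((le_max_left _ _).trans ht.1))
      by_cases hBA : B = A
      · exact Or.inl (hBA ▸ hBt)
      · exact Or.inr (mem_biUnion (show B ∈ S.sing \ {A} from ⟨hB, hBA⟩) hBt)
  have hmem : ∀ t ∈ Icc t₁ (t₁ + 1), γ t ∈ (φ A).source ∧ ‖φ A (γ t) ^ κ A‖ < 1 / 4 :=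
    fun t ht => (hin ⟨t, ht, rfl⟩).2
  have hcont : ContinuousOn (fun t => φ A (γ t) ^ κ A) (Icc t₁ (t₁ + 1)) :=
    ((φ A).continuousOn.comp (hst.1.mono hsub) fun t ht => (hmem t ht).1).pow _
  have hsub2 := sub_eq_of_hasDerivAt (v := v) (g := fun t => φ A (γ t) ^ κ A)
    (show t₁ < t₁ + 1 by linarith) hcont (fun t ht => (hφ A).hasDerivAt hst
      (Ici_mem_nhds ((le_max_right _ _).trans_lt ht.1)) (hmem t (Ioo_subset_Icc_self ht)).1)
    (x := t₁) (y := t₁ + 1) ⟨le_rfl, by linarith⟩ ⟨by linarith, le_rfl⟩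
  have h1 := (hmem t₁ ⟨le_rfl, by linarith⟩).2
  have h2 := (hmem (t₁ + 1) ⟨by linarith, le_rfl⟩).2
  have h3 := norm_sub_le (φ A (γ (t₁ + 1)) ^ κ A) (φ A (γ t₁) ^ κ A)
  rw [hsub2] at h3
  rw [add_sub_cancel_left, Complex.ofReal_one, one_mul, hv.norm_eq] at h3
  linarith

/-- Otherwise all leaves over the interval are infinite and avoid the closed segment. One of them
visits a small disc at two distant times. The disc and the band of leaves are two developing maps of
the same region, so the second visit also lies on a neighbouring leaf at about the time of the
first; flowing both back shows that the leaf comes back to the segment. -/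
theorem exists_returnsBy_of_Ioo [CompactSpace M] (hI : I.GoodPosition) {v : ℂ} (hv : IsVert v)
    {u u' : ℝ} (hu : u < u') (hJI : Ioo u u' ⊆ Ioo I.a I.b)
    (hne : ∀ x ∈ Ioo u u', ∀ ℓ, ¬I.Ends v x ℓ) :
    ∃ h c, ∀ x ∈ Ioo u u', I.ReturnsBy v h c x := by
  by_contra hcon
  have hnr : ∀ x ∈ Ioo u u', ∀ h, ¬I.Returns v x h := by
    intro x hx h hr
    obtain ⟨c, hc⟩ := hr.exists_returnsBy
    exact hcon ⟨h, c, returnsBy_of_isPreconnected hI hv isPreconnected_Ioo hJI hne hx hc⟩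
  have hw : ∀ x ∈ Ioo u u', ∀ t : ℝ, 0 < t → (t : ℂ) * v ∈ S.expDom (I.ι x) ∧
      S.expMap (I.ι x) (t * v) ∉ I.closedCarrier := by
    intro x hx
    rcases trichotomy hI hv (hJI hx) with ⟨h, hr⟩ | ⟨ℓ, hℓ⟩ | h
    · exact absurd hr (hnr x hx h)
    · exact absurd hℓ (hne x hx ℓ)
    · exact h
  obtain ⟨x₀, hx₀⟩ : (Ioo u u').Nonempty := nonempty_Ioo.2 hu
  have hp := ι_notMem_sing (hJI hx₀)
  have hdom : ∀ x ∈ Ioo u u', ∀ t : ℝ, 0 ≤ t → (t : ℂ) * v ∈ S.expDom (I.ι x) := by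
    intro x hx t ht
    rcases eq_or_lt_of_le ht with rfl | h
    · simpa using zero_mem_expDom (ι_notMem_sing (hJI hx))
    · exact (hw x hx t h).1
  obtain ⟨q, hqs, hq⟩ := exists_mapClusterPt hv (hdom x₀ hx₀)
  obtain ⟨Φ, hΦ0, ρ, hρ, hΦ⟩ := exists_dev (S := S) hqs 0
  obtain ⟨δ, hδ, hδu⟩ : ∃ δ > 0, Ioo (x₀ - δ) (x₀ + δ) ⊆ Ioo u u' := by
    refine ⟨min (x₀ - u) (u' - x₀), lt_min (by linarith [hx₀.1]) (by linarith [hx₀.2]), ?_⟩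
    intro x hx
    exact ⟨by linarith [hx.1, min_le_left (x₀ - u) (u' - x₀)],
      by linarith [hx.2, min_le_right (x₀ - u) (u' - x₀)]⟩
  -- The three bounds keep the two visits in the disc, the shifted abscissa in the interval, and the
  -- shift in time below `1 / 2`, less than the gap between the visits.
  set η := min (ρ / 2) (min (δ / 2) (1 / 4)) with hη
  have hηρ : 2 * η ≤ ρ := by linarith [min_le_left (ρ / 2) (min (δ / 2) (1 / 4))]
  have hηδ : 2 * η ≤ δ := by
    linarith [min_le_right (ρ / 2) (min (δ / 2) (1 / 4)), min_le_left (δ / 2) (1 / 4 : ℝ)]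
  have hη1 : 4 * η ≤ 1 := by
    linarith [min_le_right (ρ / 2) (min (δ / 2) (1 / 4)), min_le_right (δ / 2) (1 / 4 : ℝ)]
  have hη0 : 0 < η := by positivity
  have hnear : ∀ T : ℝ, ∃ t ≥ T, ∃ z ∈ Metric.ball (0 : ℂ) η, Φ z = S.expMap (I.ι x₀) (t * v) := by
    intro T
    have h0 : Φ '' Metric.ball 0 η ∈ 𝓝 q := by
      rw [← hΦ0, ← (hΦ 0 (Metric.mem_ball_self hρ)).map_nhds]
      exact image_mem_map (Metric.ball_mem_nhds _ hη0)
    have h1 := (mapClusterPt_iff_frequently.1 hq _ h0).and_eventually (eventually_ge_atTop T)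
    obtain ⟨t, ⟨z, hz, hzt⟩, ht⟩ := h1.exists
    exact ⟨t, ht, z, hz, hzt⟩
  obtain ⟨t, ht, z, hz, hzt⟩ := hnear 1
  obtain ⟨t', ht', z', hz', hzt'⟩ := hnear (t + 1)
  rw [Metric.mem_ball, dist_zero_right] at hz hz'
  obtain ⟨s, d, hsd, hs, hd⟩ : ∃ s d : ℝ, z' - z = s + d * v ∧ |s| < 2 * η ∧ |d| < 2 * η := by
    have hn : ‖z' - z‖ < 2 * η := by linarith [norm_sub_le z' z]
    have hre := (Complex.abs_re_le_norm (z' - z)).trans_lt hn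
    have him := (Complex.abs_im_le_norm (z' - z)).trans_lt hn
    rcases hv with rfl | rfl
    · exact ⟨(z' - z).re, (z' - z).im, (Complex.re_add_im _).symm, hre, him⟩
    · refine ⟨(z' - z).re, -(z' - z).im, ?_, hre, by rwa [abs_neg]⟩
      push_cast
      linear_combination -Complex.re_add_im (z' - z)
  have hsJ : ∀ θ ∈ Icc (0 : ℝ) 1, x₀ + θ * s ∈ Ioo u u' := by
    intro θ hθ
    have h1 : |θ * s| < δ := by
      rw [abs_mul, abs_of_nonneg hθ.1]
      nlinarith [abs_nonneg s, hθ.2]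
    have := abs_lt.1 h1
    exact hδu ⟨by linarith, by linarith⟩
  have hdJ : ∀ θ ∈ Icc (0 : ℝ) 1, 0 ≤ t + θ * d := by
    intro θ hθ
    have h1 : |θ * d| < 1 := by
      rw [abs_mul, abs_of_nonneg hθ.1]
      nlinarith [abs_nonneg d, hθ.2]
    have := abs_lt.1 h1
    linarith
  -- two developing maps along the segment from `z` to `z'`
  set Λ : ℂ → M := fun w => I.leafMap (w + (x₀ + t * v - z)) with hΛ
  have hseg : ∀ w ∈ segment ℝ z z', ∃ θ ∈ Icc (0 : ℝ) 1, w = z + θ * (s + d * v) := by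
    intro w hw
    rw [segment_eq_image'] at hw
    obtain ⟨θ, hθ, rfl⟩ := hw
    refine ⟨θ, hθ, ?_⟩
    simp only [hsd, Complex.real_smul]
  have hΛd : ∀ w ∈ segment ℝ z z', S.DevAt Λ w := by
    intro w hw
    obtain ⟨θ, hθ, rfl⟩ := hseg w hw
    refine DevAt.comp_add _ ?_
    have h1 := devAt_leafMap_of_isVert hv (hJI (hsJ θ hθ)) (hdom _ (hsJ θ hθ) _ (hdJ θ hθ))
    convert h1 using 1
    push_cast
    ring
  have hΦd : ∀ w ∈ segment ℝ z z', S.DevAt Φ w := by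
    intro w hw
    have hb : Convex ℝ (Metric.ball (0 : ℂ) ρ) := convex_ball _ _
    refine hΦ w (hb.segment_subset ?_ ?_ hw)
    · rw [Metric.mem_ball, dist_zero_right]; linarith
    · rw [Metric.mem_ball, dist_zero_right]; linarith
  have heq := eqOn_of_isPreconnected (convex_segment z z').isPreconnected hΛd hΦd
    (left_mem_segment ℝ z z') (by
      rw [hΛ, hzt, ← leafMap_eq hv]
      simp) (right_mem_segment ℝ z z')
  have h1 : Λ z' = S.expMap (I.ι (x₀ + s)) ((t + d : ℝ) * v) := by
    rw [← leafMap_eq hv, hΛ]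
    simp only
    congr 1
    push_cast
    linear_combination hsd
  rw [h1, hzt'] at heq
  have hx1 : x₀ + s ∈ Ioo u u' := by simpa using hsJ 1 ⟨zero_le_one, le_rfl⟩
  have htd : 0 ≤ t + d := by simpa using hdJ 1 ⟨zero_le_one, le_rfl⟩
  have hdlt := abs_lt.1 hd
  have hb1 := expMap_shift (hdom _ hx1 _ htd) (t := t + d) ⟨htd, le_rfl⟩ (u := -(t + d))
    ⟨le_rfl, by linarith⟩
  have hb2 := expMap_shift (hdom _ hx₀ t' (by linarith)) (t := t') ⟨by linarith, le_rfl⟩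
    (u := -(t + d)) ⟨by linarith, by linarith⟩
  have hb3 := hb1.2.symm.trans ((congrArg (fun p => S.expMap p ((-(t + d) : ℝ) * v)) heq).trans
    hb2.2)
  rw [add_neg_cancel, Complex.ofReal_zero, zero_mul, expMap_zero (ι_notMem_sing (hJI hx1))] at hb3
  exact (hw x₀ hx₀ (t' + -(t + d)) (by linarith)).2
    (hb3 ▸ ⟨x₀ + s, Ioo_subset_Icc_self (hJI hx1), rfl⟩)

/-! ### Finiteness of the set of singular leaves -/

/-- Pigeonhole at each singular point `A`: a short time `s` before the end, all leaves arriving at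
`A` sit at `κ`-th roots of `-s * v` in the ramified chart. Among `κ + 1` of them two share a point;
followed back, either they start at the same point or one of them meets the open segment too early.
-/
theorem finite_ends {v : ℂ} (hv : IsVert v) : {x ∈ Ioo I.a I.b | ∃ ℓ, I.Ends v x ℓ}.Finite := by
  have key : ∀ A ∈ S.sing, {x ∈ Ioo I.a I.b | ∃ ℓ, I.Ends v x ℓ ∧
      Tendsto (fun t : ℝ => S.expMap (I.ι x) (t * v)) (𝓝[<] ℓ) (𝓝 A)}.Finite := by
    intro A hA
    by_contra hinf
    obtain ⟨κ, φ, hφ⟩ := exists_isRamChart (S := S) A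
    obtain ⟨F, hF, hFc⟩ := Set.Infinite.exists_subset_card_eq hinf (κ + 1)
    have h1 : ∀ x ∈ F, ∃ ℓ, I.Ends v x ℓ ∧ ∃ η > 0, η < ℓ ∧ ∀ s ∈ Ioo 0 η,
        S.expMap (I.ι x) ((ℓ - s : ℝ) * v) ∈ φ.source ∧
        φ (S.expMap (I.ι x) ((ℓ - s : ℝ) * v)) ^ κ = -(s : ℂ) * v := by
      intro x hx
      obtain ⟨-, ℓ, hℓ, hlim⟩ := hF hx
      exact ⟨ℓ, hℓ, exists_ray_pow hv.ne_zero hℓ.1 hℓ.2.1 hlim hφ⟩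
    choose! ℓ hℓ η hη hηℓ hpow using h1
    obtain ⟨s, hs0, hs⟩ : ∃ s > 0, ∀ x ∈ F, s < η x := by
      have : ∀ᶠ s : ℝ in 𝓝[>] 0, ∀ x ∈ F, s < η x :=
        (Finset.eventually_all F).2 fun x hx =>
          (eventually_lt_nhds (hη x hx)).filter_mono nhdsWithin_le_nhds
      obtain ⟨s, h1, h2⟩ := (this.and self_mem_nhdsWithin).exists
      exact ⟨s, h2, h1⟩
    set g : ℝ → ℂ := fun x => φ (S.expMap (I.ι x) ((ℓ x - s : ℝ) * v)) with hg
    have hκ : 0 < κ := hφ.one_le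
    have hmaps : ∀ x ∈ F, g x ∈ (Polynomial.nthRoots κ (-(s : ℂ) * v)).toFinset := by
      intro x hx
      rw [Multiset.mem_toFinset, Polynomial.mem_nthRoots hκ]
      exact (hpow x hx s ⟨hs0, hs x hx⟩).2
    obtain ⟨x, hx, y, hy, hxy, hgxy⟩ := Finset.exists_ne_map_eq_of_card_lt_of_maps_to
      (lt_of_le_of_lt ((Multiset.toFinset_card_le _).trans (Polynomial.card_nthRoots κ _))
        (show κ < F.card by omega)) hmaps
    have hpt := φ.injOn (hpow x hx s ⟨hs0, hs x hx⟩).1 (hpow y hy s ⟨hs0, hs y hy⟩).1 hgxy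
    have main : ∀ x ∈ F, ∀ y ∈ F, x ≠ y → ℓ x ≤ ℓ y →
        S.expMap (I.ι x) ((ℓ x - s : ℝ) * v) = S.expMap (I.ι y) ((ℓ y - s : ℝ) * v) → False := by
      intro x hx y hy hxy hle hpt
      have hsx := hs x hx
      have hsx' := hηℓ x hx
      have hb1 := expMap_shift ((hℓ x hx).2.1 (ℓ x - s) ⟨by linarith, by linarith⟩)
        (t := ℓ x - s) ⟨by linarith, le_rfl⟩ (u := -(ℓ x - s)) ⟨le_rfl, by linarith⟩
      have hb2 := expMap_shift ((hℓ y hy).2.1 (ℓ y - s) ⟨by linarith, by linarith⟩)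
        (t := ℓ y - s) ⟨by linarith, le_rfl⟩ (u := -(ℓ x - s)) ⟨by linarith, by linarith⟩
      have hb3 := hb1.2.symm.trans
        ((congrArg (fun p => S.expMap p ((-(ℓ x - s) : ℝ) * v)) hpt).trans hb2.2)
      rw [add_neg_cancel, Complex.ofReal_zero, zero_mul, expMap_zero (ι_notMem_sing (hF hx).1),
        show ℓ y - s + -(ℓ x - s) = ℓ y - ℓ x by ring] at hb3
      rcases eq_or_lt_of_le hle with h | h
      · rw [h, sub_self, Complex.ofReal_zero, zero_mul, expMap_zero (ι_notMem_sing (hF hy).1)] at hb3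
        exact hxy (I.injOn (Ioo_subset_Icc_self (hF hx).1) (Ioo_subset_Icc_self (hF hy).1) hb3)
      · refine (hℓ y hy).2.2.1 (ℓ y - ℓ x) ⟨by linarith, by linarith [(hℓ x hx).1]⟩ ?_
        rw [← hb3]
        exact ⟨x, (hF hx).1, rfl⟩
    rcases le_total (ℓ x) (ℓ y) with h | h
    · exact main x hx y hy hxy h hpt
    · exact main y hy x hx hxy.symm h hpt.symm
  refine (S.sing_finite.biUnion key).subset ?_
  rintro x ⟨hx, ℓ, hℓ⟩
  obtain ⟨A, hA, hlim⟩ := hℓ.2.2.2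
  exact mem_biUnion hA ⟨hx, ℓ, hℓ, hlim⟩

end HorizontalSegment

end TranslationSurface

namespace TranslationSurface

variable {M : Type*} [TopologicalSpace M] {S : TranslationSurface M}

namespace HorizontalSegment

variable {I : S.HorizontalSegment} [T2Space M]

/-! ### Signed heights -/

/-- There is no connexion that avoids the open segment. -/
theorem GoodPosition.no_connexion [CompactSpace M] (hI : I.GoodPosition) {v : ℂ} (hv : IsVert v)
    {γ : ℝ → M} {a b : ℝ} (hab : a < b) (hγ : S.IsStraight v γ (Ioo a b)) {A B : M}
    (hA : A ∈ S.sing) (hB : B ∈ S.sing) (hlA : Tendsto γ (𝓝[>] a) (𝓝 A))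
    (hlB : Tendsto γ (𝓝[<] b) (𝓝 B)) (hav : ∀ t ∈ Ioo a b, γ t ∉ I.carrier) : False := by
  have key : ∀ {γ : ℝ → M} {a b : ℝ} (hab : a < b) (hγ : S.IsStraight Complex.I γ (Ioo a b))
      {A B : M} (hA : A ∈ S.sing) (hB : B ∈ S.sing) (hlA : Tendsto γ (𝓝[>] a) (𝓝 A))
      (hlB : Tendsto γ (𝓝[<] b) (𝓝 B)) (hav : ∀ t ∈ Ioo a b, γ t ∉ I.carrier), False := by
    intro γ a b hab hγ A B hA hB hlA hlB hav
    have hext : EqOn (extendFrom (Ioo a b) γ) γ (Ioo a b) := 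
      extendFrom_extends hγ.1
    have hc := continuousOn_Icc_extendFrom_Ioo hγ.1 hlA hlB
    have h1 := (hγ.congr hext).comp_add a
    obtain ⟨t, ht, htc⟩ := hI.1 (b - a) (fun t => extendFrom (Ioo a b) γ (t + a))
      ⟨by linarith, hc.comp (by fun_prop) fun t ht => ⟨by linarith [ht.1], by linarith [ht.2]⟩, by
        simpa [eq_lim_at_left_extendFrom_Ioo hab hlA] using hA, by
        simpa [eq_lim_at_right_extendFrom_Ioo hab hlB] using hB,
        h1.mono fun t ht => ⟨by linarith [ht.1], by linarith [ht.2]⟩⟩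
    have ht' : t + a ∈ Ioo a b := ⟨by linarith [ht.1], by linarith [ht.2]⟩
    simp only [hext ht'] at htc
    exact hav _ ht' htc
  rcases hv with rfl | rfl
  · exact key hab hγ hA hB hlA hlB hav
  · have h1 := hγ.reverse (a + b)
    refine key (γ := fun t => γ (a + b - t)) hab ?_ hB hA ?_ ?_ fun t ht =>
      hav _ ⟨by linarith [ht.2], by linarith [ht.1]⟩
    · have h2 : S.IsStraight Complex.I (fun t => γ (a + b - t)) _ := h1.congr_field fun t ht => by
        simp
      exact h2.mono fun t ht => ⟨by linarith [ht.2], by linarith [ht.1]⟩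
    · refine hlB.comp (tendsto_nhdsWithin_iff.2 ⟨?_, ?_⟩)
      · have : Continuous fun t : ℝ => a + b - t := by fun_prop
        simpa using (this.tendsto a).mono_left (nhdsWithin_le_nhds (s := Ioi a))
      · filter_upwards [self_mem_nhdsWithin] with t ht
        have : a < t := ht
        show a + b - t < b
        linarith
    · refine hlA.comp (tendsto_nhdsWithin_iff.2 ⟨?_, ?_⟩)
      · have : Continuous fun t : ℝ => a + b - t := by fun_prop
        simpa using (this.tendsto b).mono_left (nhdsWithin_le_nhds (s := Iio b))
      · filter_upwards [self_mem_nhdsWithin] with t ht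
        have : t < b := ht
        show a < a + b - t
        linarith

/-- The two half-leaves would join into a connexion that avoids the open segment. -/
theorem not_ends_neg [CompactSpace M] (hI : I.GoodPosition) {v : ℂ} (hv : IsVert v) {x ℓ ℓ' : ℝ}
    (hx : I.ι x ∉ I.carrier) (h : I.Ends v x ℓ) (h' : I.Ends (-v) x ℓ') : False := by
  obtain ⟨A, hA, hlA⟩ := h.2.2.2
  obtain ⟨B, hB, hlB⟩ := h'.2.2.2
  have hp : I.ι x ∉ S.sing := notMem_sing_of_mem_expDom (h.2.1 0 ⟨le_rfl, h.1⟩)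
  have hdom : ∀ t ∈ Ioo (-ℓ') ℓ, (t : ℂ) * v ∈ S.expDom (I.ι x) := by
    intro t ht
    rcases le_total 0 t with h0 | h0
    · exact h.2.1 t ⟨h0, ht.2⟩
    · have := h'.2.1 (-t) ⟨by linarith, by linarith [ht.1]⟩
      simpa using this
  refine hI.no_connexion hv (a := -ℓ') (b := ℓ) (by linarith [h.1, h'.1])
    (isStraight_expMap_of_forall hdom) hB hA ?_ hlA ?_
  · have h1 : Tendsto (fun t : ℝ => -t) (𝓝[>] (-ℓ')) (𝓝[<] ℓ') := by
      simpa using tendsto_neg_nhdsGT (a := -ℓ')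
    refine (hlB.comp h1).congr fun t => ?_
    simp
  · intro t ht
    rcases lt_trichotomy t 0 with h0 | h0 | h0
    · have := h'.2.2.1 (-t) ⟨by linarith, by linarith [ht.1]⟩
      simpa using this
    · simpa [h0, expMap_zero hp] using hx
    · exact h.2.2.1 t ⟨h0, ht.2⟩

variable (I) in
/-- The leaf of `ι x` ends in `S.sing` at the time `a`, positive or negative, for the velocity `v`,
without meeting the open segment in between. -/
def Height (v : ℂ) (x a : ℝ) : Prop :=
  (0 < a ∧ I.Ends v x a) ∨ (a < 0 ∧ I.Ends (-v) x (-a)) ∨ (a = 0 ∧ I.ι x ∈ S.sing)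

theorem Height.neg {v : ℂ} {x a : ℝ} (h : I.Height v x a) : I.Height (-v) x (-a) := by
  rcases h with ⟨h1, h2⟩ | ⟨h1, h2⟩ | ⟨h1, h2⟩
  · exact Or.inr (Or.inl ⟨by linarith, by simpa using h2⟩)
  · exact Or.inl ⟨by linarith, h2⟩
  · exact Or.inr (Or.inr ⟨by linarith, h2⟩)

theorem Ends.notMem_sing {v : ℂ} {x ℓ : ℝ} (h : I.Ends v x ℓ) : I.ι x ∉ S.sing :=
  notMem_sing_of_mem_expDom (h.2.1 0 ⟨le_rfl, h.1⟩)

theorem Height.ends {v : ℂ} {x a : ℝ} (h : I.Height v x a) (ha : 0 < a) : I.Ends v x a := by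
  rcases h with ⟨-, h2⟩ | ⟨h1, -⟩ | ⟨h1, -⟩
  · exact h2
  · linarith
  · linarith

theorem Height.ends_neg {v : ℂ} {x a : ℝ} (h : I.Height v x a) (ha : a < 0) :
    I.Ends (-v) x (-a) := by
  rcases h with ⟨h1, -⟩ | ⟨-, h2⟩ | ⟨h1, -⟩
  · linarith
  · exact h2
  · linarith

theorem Height.unique [CompactSpace M] (hI : I.GoodPosition) {v : ℂ} (hv : IsVert v) {x a a' : ℝ}
    (hx : I.ι x ∉ I.carrier) (h : I.Height v x a) (h' : I.Height v x a') : a = a' := by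
  rcases h with ⟨h1, h2⟩ | ⟨h1, h2⟩ | ⟨h1, h2⟩ <;>
    rcases h' with ⟨h3, h4⟩ | ⟨h3, h4⟩ | ⟨h3, h4⟩
  · exact h2.unique h4
  · exact (not_ends_neg hI hv hx h2 h4).elim
  · exact absurd h4 h2.notMem_sing
  · exact (not_ends_neg hI hv hx h4 h2).elim
  · linarith [h2.unique h4]
  · exact absurd h4 h2.notMem_sing
  · exact absurd h2 h4.notMem_sing
  · exact absurd h2 h4.notMem_sing
  · rw [h1, h3]

theorem ι_endpoint_notMem_carrier {x : ℝ} (hx : x = I.a ∨ x = I.b) : I.ι x ∉ I.carrier := by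
  rw [ι_mem_carrier_iff]
  · rcases hx with rfl | rfl <;> simp
  · rcases hx with rfl | rfl
    · exact ⟨le_rfl, I.lt.le⟩
    · exact ⟨I.lt.le, le_rfl⟩

theorem eq_or_eq_of_notMem_Ioo {x : ℝ} (hx : x ∈ Icc I.a I.b) (h : x ∉ Ioo I.a I.b) :
    x = I.a ∨ x = I.b := by
  by_contra hcon
  push Not at hcon
  exact h ⟨lt_of_le_of_ne hx.1 (Ne.symm hcon.1), lt_of_le_of_ne hx.2 hcon.2⟩

theorem GoodPosition.exists_height (hI : I.GoodPosition) {v : ℂ} (hv : IsVert v) {x : ℝ}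
    (hx : x = I.a ∨ x = I.b) : ∃ a, I.Height v x a := by
  by_cases hs : I.ι x ∈ S.sing
  · exact ⟨0, Or.inr (Or.inr ⟨rfl, hs⟩)⟩
  · obtain ⟨w, ℓ, hw, hℓ⟩ := hI.ends hx hs
    have hwv : w = v ∨ w = -v := by
      rcases hv with rfl | rfl <;> rcases hw with rfl | rfl <;> simp
    rcases hwv with rfl | rfl
    · exact ⟨ℓ, Or.inl ⟨hℓ.1, hℓ⟩⟩
    · exact ⟨-ℓ, Or.inr (Or.inl ⟨by linarith [hℓ.1], by simpa using hℓ⟩)⟩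

/-! ### Rectangles -/

variable (I) in
/-- A maximal rectangle of vertical leaves that leave from `(u, u')` in the direction `v`, and
return by the translation by `c` after the time `h`. -/
structure Rect (v : ℂ) where
  u : ℝ
  u' : ℝ
  h : ℝ
  c : ℝ
  lt : u < u'
  sub : Ioo u u' ⊆ Ioo I.a I.b
  returns : ∀ x ∈ Ioo u u', I.ReturnsBy v h c x
  ends : ∀ w, w = u ∨ w = u' → w ∈ Ioo I.a I.b → ∃ ℓ, I.Ends v w ℓ
  ends' : ∀ w, w = u ∨ w = u' → w + c ∈ Ioo I.a I.b → ∃ ℓ, I.Ends (-v) (w + c) ℓ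

namespace Rect

variable {v : ℂ} (R : I.Rect v)

theorem h_pos : 0 < R.h := by
  obtain ⟨x, hx⟩ : (Ioo R.u R.u').Nonempty := nonempty_Ioo.2 R.lt
  exact (R.returns x hx).1.1

theorem side_mem_closure {w : ℝ} (hw : w = R.u ∨ w = R.u') : w ∈ closure (Ioo R.u R.u') := by
  rw [closure_Ioo R.lt.ne]
  rcases hw with rfl | rfl
  · exact ⟨le_rfl, R.lt.le⟩
  · exact ⟨R.lt.le, le_rfl⟩

theorem side_mem {w : ℝ} (hw : w = R.u ∨ w = R.u') : w ∈ Icc I.a I.b := by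
  have h1 := closure_mono R.sub (R.side_mem_closure hw)
  rwa [closure_Ioo I.lt.ne] at h1

theorem side_add_mem {w : ℝ} (hw : w = R.u ∨ w = R.u') : w + R.c ∈ Icc I.a I.b := by
  have h1 : MapsTo (fun x => x + R.c) (Ioo R.u R.u') (Ioo I.a I.b) := fun x hx =>
    (R.returns x hx).2.1
  have h2 := h1.closure (by fun_prop) (R.side_mem_closure hw)
  rwa [closure_Ioo I.lt.ne] at h2

/-- The same rectangle, upside down. -/
def flip : I.Rect (-v) where
  u := R.u + R.c
  u' := R.u' + R.c
  h := R.h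
  c := -R.c
  lt := by linarith [R.lt]
  sub := fun x hx => by
    have := (R.returns (x - R.c) ⟨by linarith [hx.1], by linarith [hx.2]⟩).2.1
    simpa using this
  returns := fun x hx => by
    have hx' : x - R.c ∈ Ioo R.u R.u' := ⟨by linarith [hx.1], by linarith [hx.2]⟩
    have := (R.returns _ hx').reverse (R.sub hx')
    simpa using this
  ends := fun w hw hwI => by
    obtain ⟨ℓ, hℓ⟩ := R.ends' (w - R.c) (by
      rcases hw with rfl | rfl
      · left; ring
      · right; ring) (by simpa using hwI)
    exact ⟨ℓ, by simpa using hℓ⟩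
  ends' := fun w hw hwI => by
    obtain ⟨ℓ, hℓ⟩ := R.ends (w - R.c) (by
      rcases hw with rfl | rfl
      · left; ring
      · right; ring) (by simpa [sub_eq_add_neg] using hwI)
    exact ⟨ℓ, by simpa [sub_eq_add_neg] using hℓ⟩

/-- The coordinate, relative to the centre of the rectangle, of the point of abscissa `x` and
height `t`. -/
noncomputable def pt (x t : ℝ) : ℂ :=
  ((x - (R.u + R.u') / 2 : ℝ) : ℂ) + ((t - R.h / 2 : ℝ) : ℂ) * v

/-- The centre of the rectangle. -/
noncomputable def center : M :=
  S.expMap (I.ι ((R.u + R.u') / 2)) (((R.h / 2 : ℝ) : ℂ) * v)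

theorem mid_mem : (R.u + R.u') / 2 ∈ Ioo R.u R.u' := ⟨by linarith [R.lt], by linarith [R.lt]⟩

theorem smul_pt (θ x t : ℝ) : (θ : ℂ) * R.pt x t =
    R.pt ((R.u + R.u') / 2 + θ * (x - (R.u + R.u') / 2)) (R.h / 2 + θ * (t - R.h / 2)) := by
  unfold pt; push_cast; ring

theorem segment_mem {w t θ : ℝ} (hw : w ∈ Icc R.u R.u') (ht : t ∈ Icc 0 R.h)
    (hθ : θ ∈ Ico (0 : ℝ) 1) :
    (R.u + R.u') / 2 + θ * (w - (R.u + R.u') / 2) ∈ Ioo R.u R.u' ∧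
      R.h / 2 + θ * (t - R.h / 2) ∈ Icc 0 R.h := by
  have := R.lt
  have := R.h_pos
  refine ⟨⟨?_, ?_⟩, ?_, ?_⟩ <;> nlinarith [hw.1, hw.2, ht.1, ht.2, hθ.1, hθ.2]

/-- The region is star-shaped about the centre, so the map that follows the leaves is the
exponential map of the centre. The rectangle is read from here on in this one developing map, which
also reaches the sides along rays and sees a singular point of a side as the end of a ray. -/
theorem interior (hv : IsVert v) {x t : ℝ} (hx : x ∈ Ioo R.u R.u') (ht : t ∈ Icc 0 R.h) :
    R.pt x t ∈ S.expDom R.center ∧ S.expMap R.center (R.pt x t) = S.expMap (I.ι x) (t * v) := by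
  have hdev : ∀ x ∈ Ioo R.u R.u', ∀ t ∈ Icc 0 R.h, S.DevAt I.leafMap (x + t * v) := fun x hx t ht =>
    devAt_leafMap_of_isVert hv (R.sub hx) (mul_mem_expDom ht (R.returns x hx).1.2.1)
  have h1 := dev_eq_expMap (S := S) (Φ := I.leafMap)
    (c := (((R.u + R.u') / 2 : ℝ) : ℂ) + ((R.h / 2 : ℝ) : ℂ) * v) (z := x + t * v) (by
      intro θ hθ
      rcases eq_or_lt_of_le hθ.2 with h | h
      · have := hdev x hx t ht
        rw [h]
        convert this using 1
        push_cast; ring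
      · have h2 := R.segment_mem (Ioo_subset_Icc_self hx) ht ⟨hθ.1, h⟩
        have := hdev _ h2.1 _ h2.2
        convert this using 1
        push_cast; ring)
  rw [leafMap_eq hv, leafMap_eq hv] at h1
  have h2 : ((x : ℂ) + t * v - ((((R.u + R.u') / 2 : ℝ) : ℂ) + ((R.h / 2 : ℝ) : ℂ) * v)) =
      R.pt x t := by unfold pt; push_cast; ring
  rw [h2] at h1
  exact h1

theorem flip_pt (x t : ℝ) : R.flip.pt (x + R.c) (R.h - t) = R.pt x t := by
  unfold pt flip; push_cast; ring

theorem flip_center : R.flip.center = R.center := by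
  have h1 := R.returns _ R.mid_mem
  have h2 := expMap_shift h1.1.2.1 (t := R.h) ⟨R.h_pos.le, le_rfl⟩ (u := -(R.h / 2))
    ⟨by linarith [R.h_pos], by linarith [R.h_pos]⟩
  rw [h1.2.2] at h2
  unfold center
  rw [show R.h / 2 = R.h + -(R.h / 2) by ring, ← h2.2]
  simp only [flip]
  congr 1
  · congr 1; ring
  · push_cast; ring

/-- A side of the rectangle from the point of view of its centre. -/
theorem exists_tendsto_side [CompactSpace M] (hv : IsVert v) {w t : ℝ} (hw : w ∈ Icc R.u R.u')
    (ht : t ∈ Icc 0 R.h) (hs : R.pt w t ∉ S.expDom R.center) :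
    (∀ θ ∈ Ico (0 : ℝ) 1, (θ : ℂ) * R.pt w t ∈ S.expDom R.center) ∧
      ∃ A ∈ S.sing, Tendsto (fun θ : ℝ => S.expMap R.center (θ * R.pt w t)) (𝓝[<] 1) (𝓝 A) := by
  have h1 : ∀ θ ∈ Ico (0 : ℝ) 1, (θ : ℂ) * R.pt w t ∈ S.expDom R.center := by
    intro θ hθ
    rw [R.smul_pt]
    have h2 := R.segment_mem hw ht hθ
    exact (R.interior hv h2.1 h2.2).1
  obtain ⟨q, hq, hqs⟩ := exists_tendsto_expMap one_pos h1
  refine ⟨h1, q, ?_, hq⟩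
  by_contra h
  exact hs (by simpa using (hqs h).1)

theorem _root_.TranslationSurface.exists_mul_of_notMem_slitPlane {z ζ : ℂ} (hζ : ζ ≠ 0)
    (h : (z - ζ) / (-ζ) ∉ Complex.slitPlane) : ∃ l : ℝ, 0 ≤ l ∧ z - ζ = l * ζ := by
  rw [Complex.mem_slitPlane_iff, not_or, not_lt, not_not] at h
  refine ⟨-((z - ζ) / (-ζ)).re, by linarith [h.1], ?_⟩
  have h1 : ((((z - ζ) / (-ζ)).re : ℝ) : ℂ) = (z - ζ) / (-ζ) := by
    apply Complex.ext <;> simp [h.2]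
  rw [Complex.ofReal_neg, h1]
  field_simp

/-- The domain of the exponential map is star-shaped, so it contains nothing beyond a missing point
on its ray. -/
theorem _root_.TranslationSurface.mem_slitPlane_of_mem_expDom {p : M} {z ζ : ℂ} (hζ : ζ ≠ 0)
    (h : ζ ∉ S.expDom p) (hz : z ∈ S.expDom p) : (z - ζ) / (-ζ) ∈ Complex.slitPlane := by
  by_contra hcon
  obtain ⟨l, hl, hlz⟩ := exists_mul_of_notMem_slitPlane hζ hcon
  have h1 := smul_mem_expDom hz (t := 1 / (1 + l)) ⟨by positivity, by
    rw [div_le_one (by positivity)]; linarith⟩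
  refine h ?_
  convert h1 using 1
  have h2 : (1 : ℂ) + l ≠ 0 := by exact_mod_cast (by positivity : (1 : ℝ) + l ≠ 0)
  push_cast
  field_simp
  linear_combination -hlz

theorem pt_ne_zero (hv : IsVert v) {w : ℝ} (hw : w = R.u ∨ w = R.u') (t : ℝ) : R.pt w t ≠ 0 := by
  intro h
  have h1 : ((t - R.h / 2 : ℝ) : ℂ) * v = ((-(w - (R.u + R.u') / 2) : ℝ) : ℂ) := by
    unfold pt at h; push_cast at h ⊢; linear_combination h
  have h2 := (hv.eq_zero h1).2
  have := R.lt
  rcases hw with rfl | rfl <;> linarith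

/-- Near a singular point of a side. -/
theorem exists_side_sector [CompactSpace M] (hv : IsVert v) {w t : ℝ} (hw : w = R.u ∨ w = R.u')
    (ht : t ∈ Icc 0 R.h) (hs : R.pt w t ∉ S.expDom R.center) :
    ∃ (Ψ : ℂ → M) (κ : ℕ) (φ : OpenPartialHomeomorph M ℂ), Ψ (R.pt w t) ∈ S.sing ∧
      ContinuousAt Ψ (R.pt w t) ∧ S.IsRamChart (Ψ (R.pt w t)) κ φ ∧
      ∀ᶠ z in 𝓝 (R.pt w t), φ (Ψ z) ^ κ = z - R.pt w t ∧
        ((z - R.pt w t) / (-R.pt w t) ∈ Complex.slitPlane →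
          z ∈ S.expDom R.center ∧ S.expMap R.center z = Ψ z) := by
  obtain ⟨h1, A, hA, hlim⟩ := R.exists_tendsto_side hv (by
    rcases hw with rfl | rfl
    · exact ⟨le_rfl, R.lt.le⟩
    · exact ⟨R.lt.le, le_rfl⟩) ht hs
  obtain ⟨κ, φ, hφ⟩ := exists_isRamChart (S := S) A
  obtain ⟨Ψ, ρ, hρ, hΨA, hΨc, hΨ⟩ := exists_sector (R.pt_ne_zero hv hw t) h1 hlim hφ
  refine ⟨Ψ, κ, φ, hΨA ▸ hA, hΨc, hΨA ▸ hφ, ?_⟩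
  filter_upwards [Metric.ball_mem_nhds _ hρ] with z hz
  exact ⟨(hΨ z hz).2.1, fun h => ⟨((hΨ z hz).2.2 h).1, ((hΨ z hz).2.2 h).2.1⟩⟩

theorem pt_sub_pt (w t t' : ℝ) : R.pt w t' - R.pt w t = ((t' - t : ℝ) : ℂ) * v := by
  unfold pt; push_cast; ring

theorem continuous_pt (w : ℝ) : Continuous (R.pt w) := by unfold pt; fun_prop

/-- The slit beyond the singular point is along the ray from the centre, which meets the vertical
line of the side only at that point. Hence the side just above and just below lies in the slit disc
where the branch is valid. -/
theorem tendsto_side [CompactSpace M] (hv : IsVert v) {w t : ℝ} (hw : w = R.u ∨ w = R.u')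
    (ht : t ∈ Icc 0 R.h) (hs : R.pt w t ∉ S.expDom R.center) :
    (∀ᶠ t' in 𝓝[≠] t, R.pt w t' ∈ S.expDom R.center) ∧
      ∃ A ∈ S.sing, Tendsto (fun t' => S.expMap R.center (R.pt w t')) (𝓝[≠] t) (𝓝 A) ∧
        Tendsto (fun x => S.expMap R.center (R.pt x t)) (𝓝[Ioo R.u R.u'] w) (𝓝 A) := by
  obtain ⟨Ψ, κ, φ, hA, hΨc, hφ, hΨ⟩ := R.exists_side_sector hv hw ht hs
  have h1 : ∀ᶠ t' in 𝓝[≠] t, R.pt w t' ∈ S.expDom R.center ∧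
      S.expMap R.center (R.pt w t') = Ψ (R.pt w t') := by
    filter_upwards [((R.continuous_pt w).tendsto t).eventually hΨ |>.filter_mono nhdsWithin_le_nhds,
      self_mem_nhdsWithin] with t' h1 h2
    refine h1.2 ?_
    by_contra hcon
    obtain ⟨l, hl, hlz⟩ := exists_mul_of_notMem_slitPlane (R.pt_ne_zero hv hw t) hcon
    rw [R.pt_sub_pt] at hlz
    have h3 : (((t' - t) - l * (t - R.h / 2) : ℝ) : ℂ) * v
        = ((l * (w - (R.u + R.u') / 2) : ℝ) : ℂ) := by
      unfold pt at hlz; push_cast at hlz ⊢; linear_combination hlz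
    obtain ⟨h4, h5⟩ := hv.eq_zero h3
    have h6 : l = 0 := by
      rcases mul_eq_zero.1 h5 with h | h
      · exact h
      · have := R.lt
        rcases hw with rfl | rfl <;> linarith
    rw [h6] at h4
    exact h2 (show t' = t by linarith)
  refine ⟨h1.mono fun _ h => h.1, _, hA, ?_, ?_⟩
  · have h2 : Tendsto (fun t' => Ψ (R.pt w t')) (𝓝 t) (𝓝 (Ψ (R.pt w t))) :=
      hΨc.tendsto.comp ((R.continuous_pt w).tendsto t)
    exact (h2.mono_left nhdsWithin_le_nhds).congr' (h1.mono fun _ h => h.2.symm)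
  · have hc : Continuous fun x => R.pt x t := by unfold pt; fun_prop
    have h2 : Tendsto (fun x => Ψ (R.pt x t)) (𝓝 w) (𝓝 (Ψ (R.pt w t))) :=
      hΨc.tendsto.comp (hc.tendsto w)
    refine (h2.mono_left nhdsWithin_le_nhds).congr' ?_
    filter_upwards [(hc.tendsto w).eventually hΨ |>.filter_mono nhdsWithin_le_nhds,
      self_mem_nhdsWithin] with x h3 h4
    exact (h3.2 (mem_slitPlane_of_mem_expDom (R.pt_ne_zero hv hw t) hs (R.interior hv h4 ht).1)).2.symm

theorem tendsto_bottom {w : ℝ} (hw : w = R.u ∨ w = R.u') (hv : IsVert v) :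
    Tendsto (fun x => S.expMap R.center (R.pt x 0)) (𝓝[Ioo R.u R.u'] w) (𝓝 (I.ι w)) := by
  have h1 : Tendsto I.ι (𝓝[Ioo R.u R.u'] w) (𝓝 (I.ι w)) :=
    (I.continuousOn w (R.side_mem hw)).mono_left
      (nhdsWithin_mono _ (R.sub.trans Ioo_subset_Icc_self))
  refine h1.congr' ?_
  filter_upwards [self_mem_nhdsWithin] with x hx
  rw [(R.interior hv hx ⟨le_rfl, R.h_pos.le⟩).2]
  simp [expMap_zero (ι_notMem_sing (R.sub hx))]

theorem nhdsWithin_side_neBot {w : ℝ} (hw : w = R.u ∨ w = R.u') : (𝓝[Ioo R.u R.u'] w).NeBot :=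
  mem_closure_iff_nhdsWithin_neBot.1 (R.side_mem_closure hw)

theorem sing_of_bottom [CompactSpace M] (hv : IsVert v) {w : ℝ} (hw : w = R.u ∨ w = R.u')
    (hs : R.pt w 0 ∉ S.expDom R.center) : I.ι w ∈ S.sing := by
  obtain ⟨-, A, hA, -, h⟩ := R.tendsto_side hv hw ⟨le_rfl, R.h_pos.le⟩ hs
  have := R.nhdsWithin_side_neBot hw
  rwa [tendsto_nhds_unique (R.tendsto_bottom hw hv) h]

theorem expMap_bottom (hv : IsVert v) {w : ℝ} (hw : w = R.u ∨ w = R.u')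
    (hs : R.pt w 0 ∈ S.expDom R.center) : S.expMap R.center (R.pt w 0) = I.ι w := by
  have := R.nhdsWithin_side_neBot hw
  refine tendsto_nhds_unique ?_ (R.tendsto_bottom hw hv)
  have hc : Continuous fun x => R.pt x 0 := by unfold pt; fun_prop
  exact ((devAt_expMap hs).continuousAt.tendsto.comp (hc.tendsto w)).mono_left nhdsWithin_le_nhds

/-- The open segment through a point inside a side would prolong horizontally into the rectangle,
whose leaves do not meet it before time `h`. -/
theorem side_notMem_carrier (hv : IsVert v) {w t : ℝ} (hw : w = R.u ∨ w = R.u')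
    (ht : t ∈ Ioo 0 R.h) (hs : R.pt w t ∈ S.expDom R.center) :
    S.expMap R.center (R.pt w t) ∉ I.carrier := by
  rintro ⟨x₀, hx₀, hx₀e⟩
  have h1 := eventually_ι_eq_of_mem_Ioo (devAt_expMap hs) hx₀ hx₀e.symm
  have := R.nhdsWithin_side_neBot hw
  have hc : Continuous fun x => x₀ + (x - w) := by fun_prop
  have h2 := hc.tendsto w
  simp only [sub_self, add_zero] at h2
  obtain ⟨x, ⟨h3, h4⟩, h5⟩ := ((((h2.eventually h1).and (h2.eventually (isOpen_Ioo.mem_nhds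
    hx₀))).filter_mono nhdsWithin_le_nhds).and (self_mem_nhdsWithin (s := Ioo R.u R.u'))).exists
  have h6 : R.pt w t + ((x₀ + (x - w) - x₀ : ℝ) : ℂ) = R.pt x t := by unfold pt; push_cast; ring
  rw [h6, (R.interior hv h5 (Ioo_subset_Icc_self ht)).2] at h3
  refine (R.returns x h5).1.2.2.1 t ht ?_
  rw [← h3]
  exact ⟨_, h4, rfl⟩

theorem isStraight_side {w : ℝ} {s : Set ℝ} (h : ∀ t ∈ s, R.pt w t ∈ S.expDom R.center) :
    S.IsStraight v (fun t => S.expMap R.center (R.pt w t)) s := by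
  have hpt : ∀ t : ℝ, R.pt w t = R.pt w 0 + t * v := by intro t; unfold pt; push_cast; ring
  have h1 := isStraight_of_dev (Φ := S.expMap R.center) (z := R.pt w 0) (v := v) (s := s) fun t ht =>
    devAt_expMap (by rw [← hpt]; exact h t ht)
  refine h1.congr fun t _ => ?_
  simp only [hpt t]

/-- Two consecutive singular points of a side would bound a connexion that avoids the open segment.
-/
theorem side_sing_unique [CompactSpace M] (hI : I.GoodPosition) (hv : IsVert v) {w t₁ t₂ : ℝ}
    (hw : w = R.u ∨ w = R.u') (h1 : t₁ ∈ Icc 0 R.h) (h2 : t₂ ∈ Icc 0 R.h)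
    (hs1 : R.pt w t₁ ∉ S.expDom R.center) (hs2 : R.pt w t₂ ∉ S.expDom R.center) : t₁ = t₂ := by
  have key : ∀ t₁ ∈ Icc 0 R.h, ∀ t₂ ∈ Icc 0 R.h, R.pt w t₁ ∉ S.expDom R.center →
      R.pt w t₂ ∉ S.expDom R.center → ¬t₁ < t₂ := by
    intro t₁ h1 t₂ h2 hs1 hs2 hlt
    obtain ⟨hreg, A, hA, hlA, -⟩ := R.tendsto_side hv hw h1 hs1
    have hreg' : ∀ᶠ t in 𝓝[>] t₁, R.pt w t ∈ S.expDom R.center :=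
      hreg.filter_mono (nhdsWithin_mono _ fun t ht => ne_of_gt ht)
    obtain ⟨t', ht', hsub⟩ := (mem_nhdsGT_iff_exists_Ioo_subset' hlt).1 hreg'
    have ht'2 : t' ≤ t₂ := by
      by_contra hcon
      exact hs2 (hsub ⟨hlt, not_le.1 hcon⟩)
    have hK : IsCompact (Icc t' R.h ∩ {t | R.pt w t ∉ S.expDom R.center}) :=
      isCompact_Icc.inter_right (((isOpen_expDom _).preimage (R.continuous_pt w)).isClosed_compl)
    -- Singular heights are isolated above `t₁`, and those above `t'` form a compact set; its least
    -- element `t₃` is the singular height next to `t₁`.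
    obtain ⟨t₃, ⟨ht₃, hs3⟩, hmin⟩ := hK.exists_isLeast ⟨t₂, ⟨ht'2, h2.2⟩, hs2⟩
    have ht13 : t₁ < t₃ := lt_of_lt_of_le ht' ht₃.1
    have h3 : t₃ ∈ Icc 0 R.h := ⟨h1.1.trans ht13.le, ht₃.2⟩
    obtain ⟨-, B, hB, hlB, -⟩ := R.tendsto_side hv hw h3 hs3
    have hdom : ∀ t ∈ Ioo t₁ t₃, R.pt w t ∈ S.expDom R.center := by
      intro t ht
      rcases lt_or_ge t t' with h | h
      · exact hsub ⟨ht.1, h⟩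
      · by_contra hcon
        exact absurd (hmin ⟨⟨h, ht.2.le.trans ht₃.2⟩, hcon⟩) (not_le.2 ht.2)
    exact hI.no_connexion hv ht13 (R.isStraight_side hdom) hA hB
      (hlA.mono_left (nhdsWithin_mono _ fun t ht => ne_of_gt ht))
      (hlB.mono_left (nhdsWithin_mono _ fun t ht => ne_of_lt ht))
      fun t ht => R.side_notMem_carrier hv hw ⟨h1.1.trans_lt ht.1, ht.2.trans_le ht₃.2⟩ (hdom t ht)
  exact le_antisymm (not_lt.1 (key t₂ h2 t₁ h1 hs2 hs1)) (not_lt.1 (key t₁ h1 t₂ h2 hs1 hs2))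

end Rect

end HorizontalSegment

end TranslationSurface

/-! ### Heights of the singular points of the sides -/

namespace TranslationSurface

variable {M : Type*} [TopologicalSpace M] {S : TranslationSurface M}

namespace HorizontalSegment

variable {I : S.HorizontalSegment} [T2Space M]

theorem Ends.mem_separatrixSegments {v : ℂ} (hv : IsVert v) {e ℓ t : ℝ} (he : e = I.a ∨ e = I.b)
    (h : I.Ends v e ℓ) (ht : t ∈ Ico 0 ℓ) : S.expMap (I.ι e) (t * v) ∈ I.separatrixSegments := by
  obtain ⟨A, hA, hlim⟩ := h.2.2.2
  set γ : ℝ → M := fun t => if t < ℓ then S.expMap (I.ι e) (t * v) else A with hγ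
  have hst := isStraight_expMap_of_forall h.2.1
  have hst' : S.IsStraight v γ (Ico 0 ℓ) := hst.congr fun t ht => by simp [hγ, ht.2]
  have h0 : γ 0 = I.ι e := by simp [hγ, h.1, expMap_zero h.notMem_sing]
  have hc : ContinuousOn γ (Icc 0 ℓ) := by
    intro t ht
    rcases eq_or_lt_of_le ht.2 with rfl | hlt
    · have h1 : Tendsto γ (𝓝[<] t) (𝓝 (γ t)) := by
        have h2 : γ t = A := by simp [hγ]
        rw [h2]
        refine hlim.congr' ?_
        filter_upwards [self_mem_nhdsWithin] with s hs
        have : s < t := hs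
        simp [hγ, this]
      have h2 : ContinuousWithinAt γ (Iic t) t := by
        rw [← Iio_insert, continuousWithinAt_insert_self]
        exact h1
      exact h2.mono fun s hs => hs.2
    · exact (hst'.1 t ⟨ht.1, hlt⟩).mono_of_mem_nhdsWithin (by
        filter_upwards [self_mem_nhdsWithin, nhdsWithin_le_nhds (Iio_mem_nhds hlt)] with s hs hs'
        exact ⟨hs.1, hs'⟩)
  refine ⟨I.ι e, ℓ, γ, by rcases he with rfl | rfl <;> simp, ⟨h.1, hc, h0, by simpa [hγ] using hA, ?_⟩,
    ?_, t, ht, by simp [hγ, ht.2]⟩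
  · rcases hv with rfl | rfl
    · exact Or.inl hst'
    · exact Or.inr hst'
  · intro t ht
    rcases eq_or_lt_of_le ht.1 with rfl | h0t
    · rw [h0]; exact ι_endpoint_notMem_carrier he
    · rcases eq_or_lt_of_le ht.2 with rfl | hlt
      · rintro ⟨x, hx, hxe⟩
        have h2 : γ t = A := by simp [hγ]
        rw [h2] at hxe
        exact ι_notMem_sing hx (hxe ▸ hA)
      · have h2 : γ t = S.expMap (I.ι e) (t * v) := by simp [hγ, hlt]
        rw [h2]
        exact h.2.2.1 t ⟨h0t, hlt⟩

namespace Rect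

variable {v : ℂ} (R : I.Rect v)

theorem flip_side {w : ℝ} (hw : w = R.u ∨ w = R.u') :
    w + R.c = R.flip.u ∨ w + R.c = R.flip.u' := by
  rcases hw with rfl | rfl
  · exact Or.inl rfl
  · exact Or.inr rfl

theorem leaf_side (hv : IsVert v) {w : ℝ} (hw : w = R.u ∨ w = R.u') {s : Set ℝ}
    (hs : OrdConnected s) (h0 : 0 ∈ s) (h : ∀ t ∈ s, R.pt w t ∈ S.expDom R.center) {t : ℝ}
    (ht : t ∈ s) : (t : ℂ) * v ∈ S.expDom (I.ι w) ∧
      S.expMap (I.ι w) (t * v) = S.expMap R.center (R.pt w t) :=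
  expMap_mul_eq hs (R.isStraight_side h) h0 (R.expMap_bottom hv hw (h 0 h0)) ht

theorem expMap_top (hv : IsVert v) {w : ℝ} (hw : w = R.u ∨ w = R.u')
    (hs : R.pt w R.h ∈ S.expDom R.center) : S.expMap R.center (R.pt w R.h) = I.ι (w + R.c) := by
  have h1 := R.flip.expMap_bottom hv.neg (R.flip_side hw)
  have h2 := R.flip_pt w R.h
  rw [sub_self] at h2
  rw [h2, R.flip_center] at h1
  exact h1 hs

variable [CompactSpace M]

theorem height_of_notMem (hI : I.GoodPosition) (hv : IsVert v) {w a : ℝ}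
    (hw : w = R.u ∨ w = R.u') (ha : a ∈ Icc 0 R.h) (hs : R.pt w a ∉ S.expDom R.center) :
    I.Height v w a := by
  rcases eq_or_lt_of_le ha.1 with rfl | h0
  · exact Or.inr (Or.inr ⟨rfl, R.sing_of_bottom hv hw hs⟩)
  have hreg : ∀ t ∈ Ico 0 a, R.pt w t ∈ S.expDom R.center := by
    intro t ht
    by_contra hcon
    exact ht.2.ne (R.side_sing_unique hI hv hw ⟨ht.1, ht.2.le.trans ha.2⟩ ha hcon hs)
  have hleaf := fun t ht => R.leaf_side hv hw ordConnected_Ico ⟨le_rfl, h0⟩ hreg (t := t) ht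
  refine Or.inl ⟨h0, h0, fun t ht => (hleaf t ht).1, fun t ht => ?_, ?_⟩
  · rw [(hleaf t ⟨ht.1.le, ht.2⟩).2]
    exact R.side_notMem_carrier hv hw ⟨ht.1, ht.2.trans_le ha.2⟩ (hreg t ⟨ht.1.le, ht.2⟩)
  · obtain ⟨-, A, hA, hlim, -⟩ := R.tendsto_side hv hw ha hs
    refine ⟨A, hA, (hlim.mono_left (nhdsWithin_mono _ fun t ht => ne_of_lt ht)).congr' ?_⟩
    filter_upwards [Ioo_mem_nhdsLT h0] with t ht
    exact (hleaf t ⟨ht.1.le, ht.2⟩).2.symm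

/-- The position of the singular point of a side of the rectangle, or of the first singular point on
the prolongation of the side. -/
structure SideHeight (w a : ℝ) : Prop where
  bot : I.Height v w a
  top : I.Height v (w + R.c) (a - R.h)
  pos : w ∈ Ioo I.a I.b → 0 < a
  lt : w + R.c ∈ Ioo I.a I.b → a < R.h
  mem_iff : ∀ t ∈ Icc 0 R.h, R.pt w t ∈ S.expDom R.center ↔ t ≠ a

theorem flip_pt_mem_iff (w t : ℝ) : R.flip.pt (w + R.c) t ∈ S.expDom R.flip.center ↔
    R.pt w (R.h - t) ∈ S.expDom R.center := by
  rw [R.flip_center, ← R.flip_pt w (R.h - t), sub_sub_cancel]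

theorem expMap_flip_pt (w t : ℝ) : S.expMap R.flip.center (R.flip.pt (w + R.c) t) =
    S.expMap R.center (R.pt w (R.h - t)) := by
  rw [R.flip_center, ← R.flip_pt w (R.h - t), sub_sub_cancel]

theorem SideHeight.flip {R : I.Rect v} {w a : ℝ} (h : R.SideHeight w a) :
    R.flip.SideHeight (w + R.c) (R.h - a) where
  bot := by simpa using h.top.neg
  top := by
    have := h.bot.neg
    simpa [Rect.flip] using this
  pos := fun hw => by linarith [h.lt hw]
  lt := fun hw => by
    have := h.pos (by simpa [Rect.flip] using hw)
    simp only [Rect.flip]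
    linarith
  mem_iff := fun t ht => by
    have ht' : t ∈ Icc 0 R.h := ht
    rw [R.flip_pt_mem_iff, h.mem_iff _ ⟨by linarith [ht'.2], by linarith [ht'.1]⟩, not_iff_not]
    constructor <;> intro h <;> linarith

theorem SideHeight.unflip {R : I.Rect v} {w a : ℝ} (h : R.flip.SideHeight (w + R.c) a) :
    R.SideHeight w (R.h - a) where
  bot := by simpa [Rect.flip] using h.top.neg
  top := by simpa [Rect.flip] using h.bot.neg
  pos := fun hw => by
    have := h.lt (by simpa [Rect.flip] using hw)
    simp only [Rect.flip] at this
    linarith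
  lt := fun hw => by linarith [h.pos hw]
  mem_iff := fun t ht => by
    have ht' : R.h - t ∈ Icc 0 R.flip.h := ⟨by linarith [ht.2], by
      simp only [Rect.flip]; linarith [ht.1]⟩
    have := h.mem_iff (R.h - t) ht'
    rw [R.flip_pt_mem_iff, sub_sub_cancel] at this
    rw [this, not_iff_not]
    constructor <;> intro h <;> linarith

/-- A regular side is a piece of the leaf of `ι w`, so that leaf ends only above the top; in
particular the top of the side cannot be in the open segment. -/
theorem sideHeight_of_ends (hv : IsVert v) {w a : ℝ} (hw : w = R.u ∨ w = R.u')
    (hreg : ∀ t ∈ Icc 0 R.h, R.pt w t ∈ S.expDom R.center) (hE : I.Ends v w a) :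
    R.SideHeight w a := by
  have hh := R.h_pos
  have hleaf := R.leaf_side hv hw ordConnected_Icc ⟨le_rfl, hh.le⟩ hreg (t := R.h) ⟨hh.le, le_rfl⟩
  rw [R.expMap_top hv hw (hreg _ ⟨hh.le, le_rfl⟩)] at hleaf
  have hlt : R.h < a := by
    by_contra hcon
    exact hE.not_mem_expDom (not_lt.1 hcon) hleaf.1
  refine ⟨Or.inl ⟨hE.1, hE⟩, Or.inl ⟨by linarith, hE.shift ⟨hh.le, hlt⟩ hleaf.2⟩, fun _ => hE.1,
    fun hc => ?_, fun t ht => ⟨fun _ => by linarith [ht.2], fun _ => hreg t ht⟩⟩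
  exact absurd ⟨_, hc, hleaf.2.symm⟩ (hE.2.2.1 R.h ⟨hh, hlt⟩)

/-- A singular point on the closed side gives the height. On a regular side the singular point is
looked for on a prolongation: above if `w` is interior to the segment, below if `w + c` is. If both
are endpoints, good position supplies a separatrix at `w`, which either follows the side upwards or
prolongs it downwards. -/
theorem exists_sideHeight (hI : I.GoodPosition) (hv : IsVert v) {w : ℝ}
    (hw : w = R.u ∨ w = R.u') : ∃ a, R.SideHeight w a := by
  have hh := R.h_pos
  by_cases hreg : ∀ t ∈ Icc 0 R.h, R.pt w t ∈ S.expDom R.center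
  swap
  · push Not at hreg
    obtain ⟨a, ha, hs⟩ := hreg
    have h1 := R.height_of_notMem hI hv hw ha hs
    have h2 := R.flip.height_of_notMem hI hv.neg (R.flip_side hw) (a := R.h - a)
      ⟨by linarith [ha.2], by simp only [Rect.flip]; linarith [ha.1]⟩ (by
        rw [R.flip_pt_mem_iff, sub_sub_cancel]; exact hs)
    refine ⟨a, h1, by simpa using h2.neg, fun hwI => ?_, fun hwI => ?_, fun t ht => ?_⟩
    · rcases eq_or_lt_of_le ha.1 with rfl | h
      · exact absurd (R.sing_of_bottom hv hw hs) (ι_notMem_sing hwI)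
      · exact h
    · rcases eq_or_lt_of_le ha.2 with rfl | h
      · rcases h2 with ⟨h3, -⟩ | ⟨h3, -⟩ | ⟨-, h3⟩
        · linarith
        · linarith
        · exact absurd h3 (ι_notMem_sing hwI)
      · exact h
    · constructor
      · rintro h rfl
        exact hs h
      · intro h
        by_contra hcon
        exact h (R.side_sing_unique hI hv hw ht ha hcon hs)
  have hregf : ∀ t ∈ Icc 0 R.flip.h, R.flip.pt (w + R.c) t ∈ S.expDom R.flip.center := by
    intro t ht
    have ht' : t ∈ Icc 0 R.h := ht
    rw [R.flip_pt_mem_iff]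
    exact hreg _ ⟨by linarith [ht'.2], by linarith [ht'.1]⟩
  by_cases hwI : w ∈ Ioo I.a I.b
  · obtain ⟨a, ha⟩ := R.ends w hw hwI
    exact ⟨a, R.sideHeight_of_ends hv hw hreg ha⟩
  have hflip : ∀ ℓ, I.Ends (-v) (w + R.c) ℓ → ∃ a, R.SideHeight w a := fun ℓ hℓ =>
    ⟨_, (R.flip.sideHeight_of_ends hv.neg (R.flip_side hw) hregf hℓ).unflip⟩
  by_cases hwcI : w + R.c ∈ Ioo I.a I.b
  · obtain ⟨ℓ, hℓ⟩ := R.ends' w hw hwcI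
    exact hflip ℓ hℓ
  have hwe := eq_or_eq_of_notMem_Ioo (R.side_mem hw) hwI
  obtain ⟨a, ha⟩ := hI.exists_height hv hwe
  rcases ha with ⟨-, ha⟩ | ⟨-, ha⟩ | ⟨-, ha⟩
  · exact ⟨a, R.sideHeight_of_ends hv hw hreg ha⟩
  -- The separatrix goes down from `w`: seen from the top of the side, it is preceded by the whole
  -- side.
  · refine hflip (R.h + -a) (ha.prepend hh ?_ ?_ ?_ (ι_endpoint_notMem_carrier hwe))
    · exact (R.flip.leaf_side hv.neg (R.flip_side hw) ordConnected_Icc ⟨le_rfl, hh.le⟩ hregf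
        (t := R.h) ⟨hh.le, le_rfl⟩).1
    · intro s hs
      rw [(R.flip.leaf_side hv.neg (R.flip_side hw) ordConnected_Icc ⟨le_rfl, hh.le⟩ hregf
        (Ioo_subset_Icc_self hs)).2]
      exact R.flip.side_notMem_carrier hv.neg (R.flip_side hw) hs (hregf s (Ioo_subset_Icc_self hs))
    · rw [(R.flip.leaf_side hv.neg (R.flip_side hw) ordConnected_Icc ⟨le_rfl, hh.le⟩ hregf
        (t := R.h) ⟨hh.le, le_rfl⟩).2, R.expMap_flip_pt, sub_self]
      exact R.expMap_bottom hv hw (hreg 0 ⟨le_rfl, hh.le⟩)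
  · refine absurd ha ?_
    rw [← R.expMap_bottom hv hw (hreg 0 ⟨le_rfl, hh.le⟩)]
    exact (devAt_expMap (hreg 0 ⟨le_rfl, hh.le⟩)).notMem_sing

/-- The points of a side between a point on an endpoint of the segment and the singular point. -/
theorem side_mem_separatrixSegments_of_le (hv : IsVert v) {w a t₀ t e : ℝ}
    (hw : w = R.u ∨ w = R.u') (ha : R.SideHeight w a) (ht₀ : t₀ ∈ Icc 0 R.h)
    (he : e = I.a ∨ e = I.b) (hte : S.expMap R.center (R.pt w t₀) = I.ι e) (ht : t ∈ Icc 0 R.h)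
    (h0t : t₀ ≤ t) (hta : t < a) : S.expMap R.center (R.pt w t) ∈ I.separatrixSegments := by
  have hE := ha.bot.ends ((ht.1).trans_lt hta)
  have hreg : ∀ s ∈ Icc 0 t, R.pt w s ∈ S.expDom R.center := fun s hs =>
    (ha.mem_iff s ⟨hs.1, hs.2.trans ht.2⟩).2 (hs.2.trans_lt hta).ne
  have hleaf := fun s hs => R.leaf_side hv hw ordConnected_Icc ⟨le_rfl, ht.1⟩ hreg (t := s) hs
  have h1 := hleaf t ⟨ht.1, le_rfl⟩
  have h2 := hleaf t₀ ⟨ht₀.1, h0t⟩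
  rw [hte] at h2
  have h3 := hE.shift ⟨ht₀.1, h0t.trans_lt hta⟩ h2.2
  have h4 := expMap_shift h1.1 (t := t₀) ⟨ht₀.1, h0t⟩ (u := t - t₀) ⟨by linarith [ht₀.1], le_rfl⟩
  rw [h2.2, add_sub_cancel, h1.2] at h4
  rw [← h4.2]
  exact h3.mem_separatrixSegments hv he ⟨by linarith, by linarith⟩

theorem side_mem_separatrixSegments (hv : IsVert v) {w a t₀ t e : ℝ}
    (hw : w = R.u ∨ w = R.u') (ha : R.SideHeight w a) (ht₀ : t₀ ∈ Icc 0 R.h)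
    (he : e = I.a ∨ e = I.b) (hte : S.expMap R.center (R.pt w t₀) = I.ι e) (ht : t ∈ Icc 0 R.h)
    (hta : t₀ ≤ t ∧ t < a ∨ a < t ∧ t ≤ t₀) :
    S.expMap R.center (R.pt w t) ∈ I.separatrixSegments := by
  rcases hta with ⟨h1, h2⟩ | ⟨h1, h2⟩
  · exact R.side_mem_separatrixSegments_of_le hv hw ha ht₀ he hte ht h1 h2
  · have := R.flip.side_mem_separatrixSegments_of_le hv.neg (R.flip_side hw) ha.flip
      (t₀ := R.h - t₀) (t := R.h - t) (e := e)
      ⟨by linarith [ht₀.2], by simp only [Rect.flip]; linarith [ht₀.1]⟩ he (by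
        rw [R.expMap_flip_pt, sub_sub_cancel]; exact hte)
      ⟨by linarith [ht.2], by simp only [Rect.flip]; linarith [ht.1]⟩ (by linarith) (by linarith)
    rwa [R.expMap_flip_pt, sub_sub_cancel] at this

end Rect

end HorizontalSegment

end TranslationSurface

/-! ### Finite partitions of an interval -/

theorem exists_partition {a b : ℝ} (hab : a < b) {F : Set ℝ} (hF : F.Finite) (hFs : F ⊆ Ioo a b) :
    ∃ (d : ℕ) (u : Fin (d + 1) → ℝ), StrictMono u ∧ u 0 = a ∧ u (Fin.last d) = b ∧
      range u = insert a (insert b F) := by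
  classical
  set s : Finset ℝ := insert a (insert b hF.toFinset) with hs
  have hmem : ∀ x, x ∈ s ↔ x = a ∨ x = b ∨ x ∈ F := by simp [hs]
  have hcard : 0 < s.card := Finset.card_pos.2 ⟨a, by simp [hs]⟩
  obtain ⟨d, hd⟩ : ∃ d, s.card = d + 1 := ⟨s.card - 1, by omega⟩
  have hbd : ∀ x ∈ s, a ≤ x ∧ x ≤ b := by
    intro x hx
    rcases (hmem x).1 hx with rfl | rfl | h
    · exact ⟨le_rfl, hab.le⟩
    · exact ⟨hab.le, le_rfl⟩
    · exact ⟨(hFs h).1.le, (hFs h).2.le⟩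
  have hr := Finset.range_orderEmbOfFin s hd
  have hrange : range (s.orderEmbOfFin hd) = insert a (insert b F) := by
    rw [hr]; ext x; simp [hmem]
  refine ⟨d, s.orderEmbOfFin hd, (s.orderEmbOfFin hd).strictMono, ?_, ?_, hrange⟩
  · obtain ⟨k, hk⟩ : a ∈ range (s.orderEmbOfFin hd) := by rw [hrange]; simp
    refine le_antisymm ?_ (hbd _ (Finset.orderEmbOfFin_mem s hd 0)).1
    rw [← hk]
    exact (s.orderEmbOfFin hd).monotone (Fin.zero_le k)
  · obtain ⟨k, hk⟩ : b ∈ range (s.orderEmbOfFin hd) := by rw [hrange]; simp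
    refine le_antisymm (hbd _ (Finset.orderEmbOfFin_mem s hd _)).2 ?_
    nth_rw 1 [← hk]
    exact (s.orderEmbOfFin hd).monotone (Fin.le_last k)

section Gaps

variable {d : ℕ} {u : Fin (d + 1) → ℝ}

theorem StrictMono.exists_gap {x : ℝ} (hx : x ∈ Ioo (u 0) (u (Fin.last d)))
    (hxu : x ∉ range u) : ∃ i : Fin d, x ∈ Ioo (u i.castSucc) (u i.succ) := by
  by_contra hcon
  push Not at hcon
  have h1 : ∀ k : Fin (d + 1), u k < x := by
    intro k
    induction k using Fin.induction with
    | zero => exact hx.1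
    | succ i ih =>
      by_contra h
      exact hcon i ⟨ih, lt_of_le_of_ne (not_lt.1 h) fun h => hxu ⟨_, h.symm⟩⟩
  exact absurd (h1 (Fin.last d)) (not_lt.2 hx.2.le)

theorem StrictMono.notMem_gap (hu : StrictMono u) (i : Fin d) (k : Fin (d + 1)) :
    u k ∉ Ioo (u i.castSucc) (u i.succ) := by
  rintro ⟨h1, h2⟩
  have h3 := hu.lt_iff_lt.1 h1
  have h4 := hu.lt_iff_lt.1 h2
  rw [Fin.lt_def] at h3 h4
  simp at h3 h4
  omega

theorem StrictMono.gap_unique (hu : StrictMono u) {i j : Fin d} {x : ℝ}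
    (hi : x ∈ Ioo (u i.castSucc) (u i.succ)) (hj : x ∈ Ioo (u j.castSucc) (u j.succ)) : i = j := by
  have key : ∀ i j : Fin d, x ∈ Ioo (u i.castSucc) (u i.succ) →
      x ∈ Ioo (u j.castSucc) (u j.succ) → ¬i < j := by
    intro i j hi hj hij
    have h1 : u i.succ ≤ u j.castSucc := hu.monotone (by
      rw [Fin.le_def]; rw [Fin.lt_def] at hij; simp; omega)
    linarith [hi.2, hj.1]
  exact le_antisymm (not_lt.1 (key j i hj hi)) (not_lt.1 (key i j hi hj))

theorem StrictMono.gap_subset (hu : StrictMono u) (i : Fin d) :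
    Ioo (u i.castSucc) (u i.succ) ⊆ Ioo (u 0) (u (Fin.last d)) :=
  Ioo_subset_Ioo (hu.monotone (Fin.zero_le _)) (hu.monotone (Fin.le_last _))

theorem StrictMono.exists_consecutive (hu : StrictMono u) {p q : ℝ} (hpq : p < q)
    (hp : p ∈ range u) (hq : q ∈ range u) (hno : ∀ k, u k ∉ Ioo p q) :
    ∃ j : Fin d, u j.castSucc = p ∧ u j.succ = q := by
  obtain ⟨k, rfl⟩ := hp
  obtain ⟨l, rfl⟩ := hq
  have hkl := hu.lt_iff_lt.1 hpq
  have hkd : (k : ℕ) < d := by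
    have := l.isLt
    rw [Fin.lt_def] at hkl
    omega
  have hk : (⟨k, hkd⟩ : Fin d).castSucc = k := by ext; simp
  refine ⟨⟨k, hkd⟩, by rw [hk], ?_⟩
  congr 1
  by_contra hne
  refine hno (⟨k, hkd⟩ : Fin d).succ ⟨hu ?_, hu (lt_of_le_of_ne ?_ hne)⟩
  · rw [Fin.lt_def]; simp
  · rw [Fin.le_def]; rw [Fin.lt_def] at hkl; simp; omega

theorem sum_filter_telescope (A : Fin (d + 1) → ℝ) {k : ℕ} (hk : k < d + 1) :
    ∑ i ∈ Finset.univ.filter (fun i : Fin d => (i : ℕ) < k), (A i.succ - A i.castSucc) = A ⟨k, hk⟩ - A 0 := by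
  induction k with
  | zero => simp
  | succ k ih =>
    have hkd : k < d := by omega
    have h1 : (Finset.univ.filter fun i : Fin d => (i : ℕ) < k + 1) =
        insert ⟨k, hkd⟩ (Finset.univ.filter fun i : Fin d => (i : ℕ) < k) := by
      ext i
      simp only [Finset.mem_filter, Finset.mem_univ, true_and, Finset.mem_insert, Fin.ext_iff]
      omega
    rw [h1, Finset.sum_insert (by simp), ih (by omega)]
    have h2 : (⟨k, hkd⟩ : Fin d).succ = ⟨k + 1, hk⟩ := rfl
    have h3 : (⟨k, hkd⟩ : Fin d).castSucc = ⟨k, by omega⟩ := rfl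
    rw [h2, h3]
    ring

end Gaps

/-! ### Cut points and the matching of the top and bottom partitions -/

namespace TranslationSurface

variable {M : Type*} [TopologicalSpace M] {S : TranslationSurface M}

namespace HorizontalSegment

variable {I : S.HorizontalSegment} [T2Space M] [CompactSpace M]

variable (I) in
/-- The endpoints of the segment and the points of the segment whose leaf ends in `S.sing` before
returning. -/
def cutPoints (v : ℂ) : Set ℝ := insert I.a (insert I.b {x ∈ Ioo I.a I.b | ∃ ℓ, I.Ends v x ℓ})

theorem ends_of_mem_cutPoints {v : ℂ} {x : ℝ} (h : x ∈ I.cutPoints v) (hx : x ∈ Ioo I.a I.b) :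
    ∃ ℓ, I.Ends v x ℓ := by
  rcases h with rfl | rfl | h
  · exact absurd hx.1 (lt_irrefl _)
  · exact absurd hx.2 (lt_irrefl _)
  · exact h.2

theorem mem_cutPoints {v : ℂ} {x : ℝ} (hx : x ∈ Icc I.a I.b)
    (h : x ∈ Ioo I.a I.b → ∃ ℓ, I.Ends v x ℓ) : x ∈ I.cutPoints v := by
  by_cases hxI : x ∈ Ioo I.a I.b
  · exact Or.inr (Or.inr ⟨hxI, h hxI⟩)
  · rcases eq_or_eq_of_notMem_Ioo hx hxI with rfl | rfl
    · exact Or.inl rfl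
    · exact Or.inr (Or.inl rfl)

theorem ReturnsBy.unique {v : ℂ} {h c h' c' x : ℝ} (hr : I.ReturnsBy v h c x)
    (hr' : I.ReturnsBy v h' c' x) : h = h' ∧ c = c' := by
  have h1 := hr.1.unique hr'.1
  subst h1
  refine ⟨rfl, ?_⟩
  have := I.injOn (Ioo_subset_Icc_self hr.2.1) (Ioo_subset_Icc_self hr'.2.1)
    (hr.2.2.symm.trans hr'.2.2)
  linarith

/-- Only the condition at the far end of a side needs an argument. If the backward leaf of `w + c`
did not end, the backward leaves of a neighbourhood would all return by one translation, necessarily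
`-c`. Then `w` would be interior and its forward leaf would return, whereas it ends. -/
theorem exists_rect (hI : I.GoodPosition) {v : ℂ} (hv : IsVert v) {d : ℕ} {u : Fin (d + 1) → ℝ}
    (hu : StrictMono u) (h0 : u 0 = I.a) (hl : u (Fin.last d) = I.b)
    (hr : range u = I.cutPoints v) (i : Fin d) :
    ∃ R : I.Rect v, R.u = u i.castSucc ∧ R.u' = u i.succ := by
  have hlt : u i.castSucc < u i.succ := hu (by rw [Fin.lt_def]; simp)
  have hsub : Ioo (u i.castSucc) (u i.succ) ⊆ Ioo I.a I.b := h0 ▸ hl ▸ hu.gap_subset i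
  have hne : ∀ x ∈ Ioo (u i.castSucc) (u i.succ), ∀ ℓ, ¬I.Ends v x ℓ := by
    intro x hx ℓ hℓ
    have h1 : x ∈ I.cutPoints v := Or.inr (Or.inr ⟨hsub hx, ℓ, hℓ⟩)
    rw [← hr] at h1
    obtain ⟨k, rfl⟩ := h1
    exact hu.notMem_gap i k hx
  obtain ⟨h, c, hrb⟩ := exists_returnsBy_of_Ioo hI hv hlt hsub hne
  have hends : ∀ w, w = u i.castSucc ∨ w = u i.succ → w ∈ Ioo I.a I.b → ∃ ℓ, I.Ends v w ℓ := by
    rintro w (rfl | rfl) hw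
    · exact ends_of_mem_cutPoints (hr ▸ mem_range_self _) hw
    · exact ends_of_mem_cutPoints (hr ▸ mem_range_self _) hw
  refine ⟨⟨u i.castSucc, u i.succ, h, c, hlt, hsub, hrb, hends, ?_⟩, rfl, rfl⟩
  intro w hw hwc
  by_contra hcon
  push Not at hcon
  obtain ⟨p, q, hpq, hpqs⟩ : ∃ p q, w + c ∈ Ioo p q ∧ Ioo p q ⊆ Ioo I.a I.b \
      ({x ∈ Ioo I.a I.b | ∃ ℓ, I.Ends (-v) x ℓ}) := by
    refine mem_nhds_iff_exists_Ioo_subset.1 ?_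
    have h1 := (isOpen_Ioo.sdiff (finite_ends (I := I) hv.neg).isClosed).mem_nhds
      (show w + c ∈ Ioo I.a I.b \ _ from ⟨hwc, fun h => h.2.elim hcon⟩)
    exact h1
  obtain ⟨h', c', hrb'⟩ := exists_returnsBy_of_Ioo hI hv.neg (hpq.1.trans hpq.2)
    (hpqs.trans sdiff_subset) fun x hx ℓ hℓ => (hpqs hx).2 ⟨(hpqs hx).1, ℓ, hℓ⟩
  have hcl : w ∈ closure (Ioo (u i.castSucc) (u i.succ)) := by
    rw [closure_Ioo hlt.ne]
    rcases hw with rfl | rfl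
    · exact ⟨le_rfl, hlt.le⟩
    · exact ⟨hlt.le, le_rfl⟩
  have hN : (fun x => x + c) ⁻¹' Ioo p q ∈ 𝓝 w :=
    (continuous_add_const c).continuousAt.preimage_mem_nhds (isOpen_Ioo.mem_nhds hpq)
  obtain ⟨x, hxN, hx⟩ := mem_closure_iff_nhds.1 hcl _ hN
  obtain ⟨rfl, rfl⟩ := ((hrb x hx).reverse (hsub hx)).unique (hrb' _ hxN)
  have h2 := hrb' _ hpq
  have hwI : w ∈ Ioo I.a I.b := by simpa using h2.2.1
  obtain ⟨ℓ, hℓ⟩ := hends w hw hwI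
  have h3 := h2.reverse hwc
  simp only [neg_neg, add_neg_cancel_right] at h3
  exact h3.1.not_ends hℓ

variable (I) in
/-- The rectangles over the top intervals, and the partitions. -/
structure ReturnData (d : ℕ) where
  ut : Fin (d + 1) → ℝ
  ub : Fin (d + 1) → ℝ
  σ : Fin d ≃ Fin d
  R : Fin d → I.Rect Complex.I
  strictMono_ut : StrictMono ut
  strictMono_ub : StrictMono ub
  ut_zero : ut 0 = I.a
  ut_last : ut (Fin.last d) = I.b
  ub_zero : ub 0 = I.a
  ub_last : ub (Fin.last d) = I.b
  u_eq : ∀ i, (R i).u = ut i.castSucc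
  u'_eq : ∀ i, (R i).u' = ut i.succ
  u_add_eq : ∀ i, (R i).u + (R i).c = ub (σ i).castSucc
  u'_add_eq : ∀ i, (R i).u' + (R i).c = ub (σ i).succ

/-- The top is cut by the leaves that end upwards, the bottom by those that end downwards. A
rectangle carries a top gap onto a bottom gap, since its sides arrive at bottom cut points and no
bottom cut point lies in between. Uniqueness of the return, forwards and backwards, makes the
correspondence bijective. -/
theorem exists_returnData (hI : I.GoodPosition) : ∃ d, Nonempty (I.ReturnData d) := by
  have hv : IsVert Complex.I := Or.inl rfl
  obtain ⟨d, ut, hut, ht0, htl, htr⟩ := exists_partition I.lt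
    (finite_ends (I := I) hv) (sep_subset _ _)
  obtain ⟨d', ub, hub, hb0, hbl, hbr⟩ := exists_partition I.lt
    (finite_ends (I := I) hv.neg) (sep_subset _ _)
  choose R hRu hRu' using exists_rect hI hv hut ht0 htl htr
  choose R' hRu2 hRu2' using exists_rect hI hv.neg hub hb0 hbl hbr
  have hτ : ∀ i, ∃ j : Fin d', ub j.castSucc = (R i).u + (R i).c ∧
      ub j.succ = (R i).u' + (R i).c := by
    intro i
    refine hub.exists_consecutive (by linarith [(R i).lt]) ?_ ?_ ?_
    · rw [hbr]
      exact mem_cutPoints ((R i).side_add_mem (Or.inl rfl)) fun h => (R i).ends' _ (Or.inl rfl) h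
    · rw [hbr]
      exact mem_cutPoints ((R i).side_add_mem (Or.inr rfl)) fun h => (R i).ends' _ (Or.inr rfl) h
    · intro k hk
      have hk' : ub k - (R i).c ∈ Ioo (R i).u (R i).u' := ⟨by linarith [hk.1], by linarith [hk.2]⟩
      have h1 := (R i).returns _ hk'
      have h2 := h1.2.1
      rw [sub_add_cancel] at h2
      obtain ⟨ℓ, hℓ⟩ := ends_of_mem_cutPoints (v := -Complex.I) (x := ub k)
        (hbr.subset (mem_range_self k)) h2
      have h3 := h1.reverse ((R i).sub hk')
      rw [sub_add_cancel] at h3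
      exact h3.1.not_ends hℓ
  choose τ hτ1 hτ2 using hτ
  have hgap : ∀ i x, x ∈ Ioo (ut i.castSucc) (ut i.succ) ↔ x ∈ Ioo (R i).u (R i).u' := by
    intro i x; rw [hRu, hRu']
  have hinj : Function.Injective τ := by
    intro i i' h
    obtain ⟨x, hx⟩ := nonempty_Ioo.2 (R i).lt
    have e1 : (R i).u + (R i).c = (R i').u + (R i').c := by rw [← hτ1, ← hτ1, h]
    have e2 : (R i).u' + (R i).c = (R i').u' + (R i').c := by rw [← hτ2, ← hτ2, h]
    have hx' : x + (R i).c - (R i').c ∈ Ioo (R i').u (R i').u' :=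
      ⟨by linarith [hx.1], by linarith [hx.2]⟩
    have h1 := ((R i).returns x hx).reverse ((R i).sub hx)
    have h2 := ((R i').returns _ hx').reverse ((R i').sub hx')
    rw [sub_add_cancel] at h2
    have h3 := (h1.unique h2).2
    have h4 : x + (R i).c - (R i').c = x := by linarith
    rw [h4] at hx'
    exact hut.gap_unique ((hgap i x).2 hx) ((hgap i' x).2 hx')
  have hsurj : Function.Surjective τ := by
    intro j
    obtain ⟨y, hy⟩ := nonempty_Ioo.2 (R' j).lt
    have h1 := (R' j).returns y hy
    have h2 := h1.reverse ((R' j).sub hy)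
    rw [neg_neg] at h2
    have h3 : y + (R' j).c ∉ range ut := by
      intro h
      rw [htr] at h
      obtain ⟨ℓ, hℓ⟩ := ends_of_mem_cutPoints h h1.2.1
      exact h2.1.not_ends hℓ
    obtain ⟨i, hi⟩ := StrictMono.exists_gap (by rw [ht0, htl]; exact h1.2.1) h3
    have hi' := (hgap i _).1 hi
    have h4 := (h2.unique ((R i).returns _ hi')).2
    refine ⟨i, hub.gap_unique (x := y) ⟨?_, ?_⟩ ⟨?_, ?_⟩⟩
    · rw [hτ1]; linarith [hi'.1]
    · rw [hτ2]; linarith [hi'.2]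
    · rw [← hRu2]; exact hy.1
    · rw [← hRu2']; exact hy.2
  have hbij : Function.Bijective τ := ⟨hinj, hsurj⟩
  have hd : d = d' := by simpa using Fintype.card_of_bijective hbij
  subst hd
  exact ⟨d, ⟨ut, ub, Equiv.ofBijective τ hbij, R, hut, hub, ht0, htl, hb0, hbl, hRu, hRu',
    fun i => (hτ1 i).symm, fun i => (hτ2 i).symm⟩⟩

end HorizontalSegment

end TranslationSurface

/-! ### Interval exchange maps from order isomorphisms -/

open Classical in
/-- The function that is `g i` on the `i`-th gap of the partition `u`. -/
noncomputable def gapFun {d : ℕ} (u : Fin (d + 1) → ℝ) (g : Fin d → ℝ ≃o ℝ) (x : ℝ) : ℝ :=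
  if h : ∃ i : Fin d, x ∈ Ioo (u i.castSucc) (u i.succ) then g h.choose x else x

theorem gapFun_eq {d : ℕ} {u : Fin (d + 1) → ℝ} (hu : StrictMono u) (g : Fin d → ℝ ≃o ℝ)
    {i : Fin d} {x : ℝ} (hx : x ∈ Ioo (u i.castSucc) (u i.succ)) : gapFun u g x = g i x := by
  have h : ∃ i : Fin d, x ∈ Ioo (u i.castSucc) (u i.succ) := ⟨i, hx⟩
  rw [gapFun, dif_pos h, hu.gap_unique h.choose_spec hx]

/-- The interval exchange map with given order isomorphisms between the gaps. -/
noncomputable def GIEM.ofOrderIso {d : ℕ} (two_le : 2 ≤ d) (π : CombData (Fin d) d)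
    (hπ : π.Irreducible) (ut ub : Fin (d + 1) → ℝ) (ht : StrictMono ut) (hb : StrictMono ub)
    (h0 : ut 0 = ub 0) (hl : ut (Fin.last d) = ub (Fin.last d)) (g : Fin d → ℝ ≃o ℝ)
    (hg : ∀ α, g (π.top α) (ut (π.top α).castSucc) = ub (π.bot α).castSucc)
    (hg' : ∀ α, g (π.top α) (ut (π.top α).succ) = ub (π.bot α).succ) : GIEM (Fin d) d where
  two_le := two_le
  comb := π
  irreducible := hπ
  ut := ut
  ub := ub
  strictMono_ut := ht
  strictMono_ub := hb
  left_eq := h0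
  right_eq := hl
  toFun := gapFun ut g
  continuousOn := fun α => (g (π.top α)).continuous.continuousOn.congr fun _ hx => gapFun_eq ht g hx
  strictMonoOn := fun α x hx y hy hxy => by
    rw [gapFun_eq ht g hx, gapFun_eq ht g hy]
    exact (g _).strictMono hxy
  image_eq := fun α => by
    rw [image_congr (g := g (π.top α)) fun x hx => gapFun_eq ht g hx, OrderIso.image_Ioo, hg, hg']

/-! ### Heights of the partition points and combinatorics of the return map -/

namespace TranslationSurface

variable {M : Type*} [TopologicalSpace M] {S : TranslationSurface M}

namespace HorizontalSegment

variable {I : S.HorizontalSegment} [T2Space M] [CompactSpace M]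

/-- The sign condition matters at interior points, where the leaf may end in both directions; at an
endpoint this would give a connexion off the segment. -/
theorem Height.unique_of_pos (hI : I.GoodPosition) {v : ℂ} (hv : IsVert v) {w a a' : ℝ}
    (hw : w ∈ Icc I.a I.b) (h : I.Height v w a) (h' : I.Height v w a')
    (hp : w ∈ Ioo I.a I.b → 0 < a) (hp' : w ∈ Ioo I.a I.b → 0 < a') : a = a' := by
  by_cases hwI : w ∈ Ioo I.a I.b
  · exact (h.ends (hp hwI)).unique (h'.ends (hp' hwI))
  · exact h.unique hI hv (ι_endpoint_notMem_carrier (eq_or_eq_of_notMem_Ioo hw hwI)) h'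

namespace ReturnData

variable {d : ℕ} (D : I.ReturnData d)

theorem pos_d (D : I.ReturnData d) : 0 < d := by
  rcases Nat.eq_zero_or_pos d with rfl | h
  · have h1 := D.ut_zero
    have h2 := D.ut_last
    rw [show Fin.last 0 = 0 from rfl, h1] at h2
    exact absurd h2 I.lt.ne
  · exact h

theorem _root_.Fin.exists_castSucc_or_succ {d : ℕ} (hd : 0 < d) (k : Fin (d + 1)) :
    ∃ i : Fin d, k = i.castSucc ∨ k = i.succ := by
  rcases Fin.eq_castSucc_or_eq_last k with ⟨i, rfl⟩ | rfl
  · exact ⟨i, Or.inl rfl⟩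
  · exact ⟨⟨d - 1, by omega⟩, Or.inr (by ext; simp; omega)⟩

/-- The signed heights of the points of the two partitions. -/
structure IsHeights (A B : Fin (d + 1) → ℝ) : Prop where
  left : ∀ i, (D.R i).SideHeight (D.ut i.castSucc) (A i.castSucc)
  right : ∀ i, (D.R i).SideHeight (D.ut i.succ) (A i.succ)
  left_sub : ∀ i, A i.castSucc - (D.R i).h = B (D.σ i).castSucc
  right_sub : ∀ i, A i.succ - (D.R i).h = B (D.σ i).succ
  zero : A 0 = B 0
  last : A (Fin.last d) = B (Fin.last d)
  top_pos : ∀ k, D.ut k ∈ Ioo I.a I.b → 0 < A k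
  bot_neg : ∀ k, D.ub k ∈ Ioo I.a I.b → B k < 0

/-- Adjacent rectangles give the same height to their common partition point by uniqueness, so
heights belong to partition points. At the ends of the segment the top and bottom points coincide,
whence `A = B` there. -/
theorem exists_isHeights (hI : I.GoodPosition) : ∃ A B, D.IsHeights A B := by
  have hv : IsVert Complex.I := Or.inl rfl
  have hside : ∀ i (k : Fin (d + 1)), k = i.castSucc ∨ k = i.succ →
      D.ut k = (D.R i).u ∨ D.ut k = (D.R i).u' := by
    rintro i k (rfl | rfl)
    · exact Or.inl (D.u_eq i).symm
    · exact Or.inr (D.u'_eq i).symm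
  have hA : ∀ k : Fin (d + 1), ∃ a, ∀ i, (k = i.castSucc ∨ k = i.succ) →
      (D.R i).SideHeight (D.ut k) a := by
    intro k
    obtain ⟨i₀, hi₀⟩ := Fin.exists_castSucc_or_succ D.pos_d k
    obtain ⟨a, ha⟩ := (D.R i₀).exists_sideHeight hI hv (hside i₀ k hi₀)
    refine ⟨a, fun i hi => ?_⟩
    obtain ⟨a', ha'⟩ := (D.R i).exists_sideHeight hI hv (hside i k hi)
    rwa [Height.unique_of_pos hI hv ((D.R i).side_mem (hside i k hi)) ha.bot ha'.bot ha.pos ha'.pos]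
  choose A hA using hA
  have hleft := fun i => hA _ i (Or.inl rfl)
  have hright := fun i => hA _ i (Or.inr rfl)
  have hB : ∀ k : Fin (d + 1), ∃ b, I.Height Complex.I (D.ub k) b ∧
      (D.ub k ∈ Ioo I.a I.b → b < 0) ∧ ∀ i, (k = (D.σ i).castSucc → A i.castSucc - (D.R i).h = b) ∧
        (k = (D.σ i).succ → A i.succ - (D.R i).h = b) := by
    intro k
    have hcl : ∀ i, k = (D.σ i).castSucc → D.ub k = D.ut i.castSucc + (D.R i).c := by
      rintro i rfl; rw [← D.u_add_eq, D.u_eq]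
    have hcr : ∀ i, k = (D.σ i).succ → D.ub k = D.ut i.succ + (D.R i).c := by
      rintro i rfl; rw [← D.u'_add_eq, D.u'_eq]
    have hex : ∃ b, I.Height Complex.I (D.ub k) b ∧ (D.ub k ∈ Ioo I.a I.b → b < 0) := by
      obtain ⟨j, hj⟩ := Fin.exists_castSucc_or_succ D.pos_d k
      obtain ⟨i, rfl⟩ := D.σ.surjective j
      rcases hj with hj | hj
      · refine ⟨_, hcl i hj ▸ (hleft i).top, fun h => ?_⟩
        linarith [(hleft i).lt (hcl i hj ▸ h)]
      · refine ⟨_, hcr i hj ▸ (hright i).top, fun h => ?_⟩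
        linarith [(hright i).lt (hcr i hj ▸ h)]
    have hmem : D.ub k ∈ Icc I.a I.b := by
      rw [← D.ub_zero, ← D.ub_last]
      exact ⟨D.strictMono_ub.monotone (Fin.zero_le _), D.strictMono_ub.monotone (Fin.le_last _)⟩
    obtain ⟨b, hb, hbn⟩ := hex
    refine ⟨b, hb, hbn, fun i => ⟨fun hk => ?_, fun hk => ?_⟩⟩
    · have h1 := Height.unique_of_pos hI hv.neg hmem hb.neg (hcl i hk ▸ (hleft i).top).neg
        (fun h => by linarith [hbn h]) (fun h => by linarith [(hleft i).lt (hcl i hk ▸ h)])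
      linarith
    · have h1 := Height.unique_of_pos hI hv.neg hmem hb.neg (hcr i hk ▸ (hright i).top).neg
        (fun h => by linarith [hbn h]) (fun h => by linarith [(hright i).lt (hcr i hk ▸ h)])
      linarith
  choose B hBh hBn hBe using hB
  have hAh : ∀ k, I.Height Complex.I (D.ut k) (A k) := by
    intro k
    obtain ⟨i, hi⟩ := Fin.exists_castSucc_or_succ D.pos_d k
    exact (hA k i hi).bot
  refine ⟨A, B, hleft, hright, fun i => (hBe _ i).1 rfl, fun i => (hBe _ i).2 rfl, ?_, ?_, ?_, hBn⟩
  · exact Height.unique hI hv (x := I.a) (ι_endpoint_notMem_carrier (Or.inl rfl))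
      (D.ut_zero ▸ hAh 0) (D.ub_zero ▸ hBh 0)
  · exact Height.unique hI hv (x := I.b) (ι_endpoint_notMem_carrier (Or.inr rfl))
      (D.ut_last ▸ hAh _) (D.ub_last ▸ hBh _)
  · intro k hk
    obtain ⟨i, hi⟩ := Fin.exists_castSucc_or_succ D.pos_d k
    exact (hA k i hi).pos hk

/-- The combinatorial data of the return map. -/
def comb : CombData (Fin d) d := ⟨Equiv.refl _, D.σ⟩

variable {D}

/-- A single rectangle would give `A 0 - h = B 0 = A 0` with `h > 0`. -/
theorem IsHeights.two_le {A B : Fin (d + 1) → ℝ} (h : D.IsHeights A B) : 2 ≤ d := by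
  have hd := D.pos_d
  by_contra hcon
  obtain rfl : d = 1 := by omega
  have h1 := h.left_sub 0
  have h2 : D.σ 0 = 0 := Subsingleton.elim _ _
  rw [h2, show (0 : Fin 1).castSucc = 0 from rfl, h.zero] at h1
  linarith [(D.R 0).h_pos]

/-- A rectangle preserves the difference of the heights of its two sides. If the first `k` letters
were the same on top and bottom, summing would give `A k - A 0 = B k - B 0`, hence `A k = B k`,
while `A k > 0 > B k`. -/
theorem IsHeights.irreducible {A B : Fin (d + 1) → ℝ} (h : D.IsHeights A B) :
    D.comb.Irreducible := by
  intro k hk1 hkd heq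
  have h1 := sum_filter_telescope A (k := k) (by omega)
  have h2 := sum_filter_telescope B (k := k) (by omega)
  have h3 : ∑ i ∈ Finset.univ.filter (fun i : Fin d => (i : ℕ) < k), (A i.succ - A i.castSucc) =
      ∑ i ∈ Finset.univ.filter (fun i : Fin d => (i : ℕ) < k), (B i.succ - B i.castSucc) := by
    refine Finset.sum_equiv D.σ (fun i => ?_) fun i _ => ?_
    · have := Set.ext_iff.1 heq i
      simpa [comb] using this
    · rw [← h.left_sub, ← h.right_sub]; ring
  rw [h1, h2, h.zero] at h3
  have hmt : StrictMono D.ut := D.strictMono_ut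
  have hmb : StrictMono D.ub := D.strictMono_ub
  have h4 : (0 : Fin (d + 1)) < ⟨k, by omega⟩ := by rw [Fin.lt_def]; simp; omega
  have h5 : (⟨k, by omega⟩ : Fin (d + 1)) < Fin.last d := by rw [Fin.lt_def]; simp; omega
  have h6 := h.top_pos ⟨k, by omega⟩ ⟨D.ut_zero ▸ hmt h4, D.ut_last ▸ hmt h5⟩
  have h7 := h.bot_neg ⟨k, by omega⟩ ⟨D.ub_zero ▸ hmb h4, D.ub_last ▸ hmb h5⟩
  linarith

end ReturnData

/-! ### Return maps -/

theorem FirstReturn.unique {X : M → ℂ} (hX : S.IsC1Field X) {x y y' : ℝ}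
    (h : I.FirstReturn X x y) (h' : I.FirstReturn X x y') : y = y' := by
  obtain ⟨hx, hy, τ, γ, hτ, hγ, h0, h1, hav⟩ := h
  obtain ⟨-, hy', τ', γ', hτ', hγ', h0', h1', hav'⟩ := h'
  have heq : EqOn γ γ' (Icc 0 (min τ τ')) :=
    hX.eqOn_Icc (hγ.mono (Icc_subset_Icc_right (min_le_left _ _)))
      (hγ'.mono (Icc_subset_Icc_right (min_le_right _ _))) (h0.trans h0'.symm)
  have hm : 0 < min τ τ' := lt_min hτ hτ'
  have h2 := heq ⟨hm.le, le_rfl⟩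
  rcases lt_trichotomy τ τ' with hlt | rfl | hlt
  · rw [min_eq_left hlt.le, h1] at h2
    exact absurd (h2 ▸ ⟨y, hy, rfl⟩) (hav' τ ⟨hτ, hlt⟩)
  · rw [min_self, h1, h1'] at h2
    exact I.injOn (Ioo_subset_Icc_self hy) (Ioo_subset_Icc_self hy') h2
  · rw [min_eq_right hlt.le, h1'] at h2
    exact absurd (h2 ▸ ⟨y', hy', rfl⟩) (hav τ' ⟨hτ', hlt⟩)

/-- As first returns are unique, it is enough that points of the gaps return as prescribed and that
interior partition points do not return. -/
theorem isReturnMap_of {X : M → ℂ} (hX : S.IsC1Field X) {d : ℕ} (T : GIEM (Fin d) d)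
    (htop : T.comb.top = Equiv.refl _) (h0 : T.ut 0 = I.a) (hl : T.ut (Fin.last d) = I.b)
    (hret : ∀ i : Fin d, ∀ x ∈ Ioo (T.ut i.castSucc) (T.ut i.succ), I.FirstReturn X x (T.toFun x))
    (hsing : ∀ k, T.ut k ∈ Ioo I.a I.b → ∀ y, ¬I.FirstReturn X (T.ut k) y) :
    I.IsReturnMap X T := by
  have hdom : ∀ x, x ∈ T.domain ↔ ∃ i : Fin d, x ∈ Ioo (T.ut i.castSucc) (T.ut i.succ) := by
    intro x
    simp only [GIEM.domain, mem_iUnion, GIEM.topInterval, GIEM.utAt, htop, Equiv.refl_apply]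
  refine ⟨h0, hl, fun x y => ⟨fun h => ?_, ?_⟩⟩
  · have hx : x ∉ range T.ut := by
      rintro ⟨k, rfl⟩
      exact hsing k h.1 y h
    obtain ⟨i, hi⟩ := StrictMono.exists_gap (u := T.ut) (by rw [h0, hl]; exact h.1) hx
    exact ⟨(hdom x).2 ⟨i, hi⟩, h.unique hX (hret i x hi)⟩
  · rintro ⟨hx, rfl⟩
    obtain ⟨i, hi⟩ := (hdom x).1 hx
    exact hret i x hi

theorem firstReturn_vertical {x h c : ℝ} (hx : x ∈ Ioo I.a I.b)
    (hr : I.ReturnsBy Complex.I h c x) : I.FirstReturn S.vertical x (x + c) := by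
  refine ⟨hx, hr.2.1, h, fun t => S.expMap (I.ι x) (t * Complex.I), hr.1.1,
    isStraight_expMap_of_forall fun t ht => mul_mem_expDom ht hr.1.2.1, ?_, hr.2.2,
    hr.1.2.2.1⟩
  simp [expMap_zero (ι_notMem_sing hx)]

theorem FirstReturn.returns {x y : ℝ} (h : I.FirstReturn S.vertical x y) :
    ∃ τ, I.Returns Complex.I x τ := by
  obtain ⟨hx, hy, τ, γ, hτ, hγ, h0, h1, hav⟩ := h
  have hleaf := fun t ht => expMap_mul_eq (v := Complex.I) ordConnected_Icc hγ ⟨le_rfl, hτ.le⟩ h0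
    (t := t) ht
  refine ⟨τ, hτ, (hleaf τ ⟨hτ.le, le_rfl⟩).1, fun t ht => ?_, ?_⟩
  · rw [(hleaf t (Ioo_subset_Icc_self ht)).2]
    exact hav t ht
  · rw [(hleaf τ ⟨hτ.le, le_rfl⟩).2, h1]
    exact ⟨y, hy, rfl⟩

/-- The return map of the vertical flow is a standard interval exchange map. -/
theorem ReturnData.exists_standard {d : ℕ} {D : I.ReturnData d} {A B : Fin (d + 1) → ℝ}
    (h : D.IsHeights A B) : ∃ T : GIEM (Fin d) d, T.comb = D.comb ∧ T.IsStandard ∧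
      I.IsReturnMap S.vertical T := by
  set T := GIEM.ofOrderIso h.two_le D.comb h.irreducible D.ut D.ub D.strictMono_ut D.strictMono_ub
    (D.ut_zero.trans D.ub_zero.symm) (D.ut_last.trans D.ub_last.symm)
    (fun i => OrderIso.addRight (D.R i).c) (fun i => by
      rw [← D.u_eq]; exact D.u_add_eq i) (fun i => by rw [← D.u'_eq]; exact D.u'_add_eq i) with hT
  have hgap : ∀ i x, x ∈ Ioo (D.ut i.castSucc) (D.ut i.succ) → T.toFun x = x + (D.R i).c :=
    fun i x hx =>
    gapFun_eq D.strictMono_ut (fun i => OrderIso.addRight (D.R i).c) hx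
  refine ⟨T, rfl, fun i => ⟨(D.R i).c, fun x hx => hgap i x hx⟩, ?_⟩
  refine isReturnMap_of (isC1Field_const _) T rfl D.ut_zero D.ut_last (fun i x hx => ?_)
    fun k hk y hret => ?_
  · rw [hgap i x hx]
    have hx' : x ∈ Ioo (D.R i).u (D.R i).u' := by rw [D.u_eq, D.u'_eq]; exact hx
    exact firstReturn_vertical ((D.R i).sub hx') ((D.R i).returns x hx')
  · obtain ⟨τ, hτ⟩ := hret.returns
    obtain ⟨i, hi⟩ := Fin.exists_castSucc_or_succ D.pos_d k
    have hside : D.ut k = (D.R i).u ∨ D.ut k = (D.R i).u' := by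
      rcases hi with rfl | rfl
      · exact Or.inl (D.u_eq i).symm
      · exact Or.inr (D.u'_eq i).symm
    obtain ⟨ℓ, hℓ⟩ := (D.R i).ends _ hside hk
    exact hτ.not_ends hℓ

end HorizontalSegment

end TranslationSurface

namespace TranslationSurface

variable {M : Type*} [TopologicalSpace M] {S : TranslationSurface M}

/-! ### Change of time -/

/-- `θ` is the inverse of the primitive of `k`; the lower bound `m` makes this primitive a bijection
of the line. -/
theorem exists_timeChange {k : ℝ → ℝ} (hk : Continuous k) {m : ℝ} (hm : 0 < m)
    (hkm : ∀ t, m ≤ k t) {τ : ℝ} (hτ : 0 < τ) :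
    ∃ τ' > 0, ∃ θ : ℝ → ℝ, StrictMono θ ∧ θ 0 = 0 ∧ θ τ' = τ ∧
      ∀ t, HasDerivAt θ (k (θ t))⁻¹ t := by
  set s : ℝ → ℝ := fun t => ∫ x in (0 : ℝ)..t, k x with hs
  have hd : ∀ t, HasDerivAt s (k t) t := fun t =>
    intervalIntegral.integral_hasDerivAt_right (hk.intervalIntegrable _ _)
      hk.stronglyMeasurable.stronglyMeasurableAtFilter hk.continuousAt
  have hmono : StrictMono s := strictMono_of_hasDerivAt_pos hd fun t => hm.trans_le (hkm t)
  have hs0 : s 0 = 0 := by simp [hs]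
  have hcont : Continuous s := continuous_iff_continuousAt.2 fun t => (hd t).continuousAt
  have hlin : Monotone fun t => s t - m * t := by
    have h1 : ∀ t, HasDerivAt (fun t => s t - m * t) (k t - m * 1) t := fun t =>
      (hd t).sub ((hasDerivAt_id t).const_mul m)
    refine monotone_of_deriv_nonneg (fun t => (h1 t).differentiableAt) fun t => ?_
    rw [(h1 t).deriv]
    linarith [hkm t]
  have hsurj : Function.Surjective s := by
    refine hcont.surjective ?_ ?_
    · refine tendsto_atTop_mono' atTop ?_ (tendsto_id.const_mul_atTop hm)
      filter_upwards [eventually_ge_atTop 0] with t ht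
      have := hlin ht
      simp only [hs0, mul_zero, sub_zero] at this
      simp only [id]
      linarith
    · refine tendsto_atBot_mono' atBot ?_ (tendsto_id.const_mul_atBot hm)
      filter_upwards [eventually_le_atBot 0] with t ht
      have := hlin ht
      simp only [hs0, mul_zero, sub_zero] at this
      simp only [id]
      linarith
  set e := hmono.orderIsoOfSurjective s hsurj with he
  have hes : ∀ t, e t = s t := fun t => rfl
  refine ⟨s τ, hs0 ▸ hmono hτ, e.symm, e.symm.strictMono, ?_, ?_, fun t => ?_⟩
  · rw [OrderIso.symm_apply_eq, hes, hs0]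
  · rw [OrderIso.symm_apply_eq, hes]
  · exact HasDerivAt.of_local_left_inverse e.symm.continuous.continuousAt (hd (e.symm t))
      (hm.trans_le (hkm _)).ne' (Eventually.of_forall fun y => e.apply_symm_apply y)

theorem IsIntegralCurve.exists_timeChange {X : M → ℂ} {γ : ℝ → M} {τ : ℝ} (hτ : 0 < τ)
    (h : S.IsIntegralCurve X γ (Icc 0 τ)) {g : M → ℝ} (hg : ContinuousOn g S.singᶜ)
    (hpos : ∀ p ∉ S.sing, 0 < g p) :
    ∃ τ' > 0, ∃ θ : ℝ → ℝ, StrictMono θ ∧ θ 0 = 0 ∧ θ τ' = τ ∧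
      S.IsIntegralCurve (fun p => g p * X p) (fun t => γ (θ t)) (Icc 0 τ') := by
  have hgγ : ContinuousOn (fun t => (g (γ t))⁻¹) (Icc 0 τ) :=
    (hg.comp h.1 fun t ht => (h.2 t ht).1).inv₀ fun t ht => (hpos _ (h.2 t ht).1).ne'
  -- The inverse of `g` along the curve is extended by constants outside `[0, τ]`, so its minimum on
  -- this compact interval bounds it below everywhere.
  set k : ℝ → ℝ := IccExtend hτ.le ((Icc 0 τ).domRestrict fun t => (g (γ t))⁻¹) with hk
  have hkc : Continuous k := (continuousOn_iff_continuous_domRestrict.1 hgγ).Icc_extend'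
  have hkeq : ∀ t ∈ Icc 0 τ, k t = (g (γ t))⁻¹ := fun t ht => IccExtend_of_mem _ _ ht
  obtain ⟨t₀, ht₀, hmin⟩ := isCompact_Icc.exists_isMinOn (nonempty_Icc.2 hτ.le) hgγ
  have hm : 0 < (g (γ t₀))⁻¹ := inv_pos.2 (hpos _ (h.2 t₀ ht₀).1)
  obtain ⟨τ', hτ', θ, hmono, h0, h1, hd⟩ := TranslationSurface.exists_timeChange hkc hm
    (fun t => hmin (projIcc 0 τ hτ.le t).2) hτ
  have hmaps : MapsTo θ (Icc 0 τ') (Icc 0 τ) := fun t ht =>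
    ⟨h0 ▸ hmono.monotone ht.1, h1 ▸ hmono.monotone ht.2⟩
  have hθc : Continuous θ := continuous_iff_continuousAt.2 fun t => (hd t).continuousAt
  refine ⟨τ', hτ', θ, hmono, h0, h1, h.1.comp hθc.continuousOn hmaps, fun t ht =>
    ⟨(h.2 _ (hmaps ht)).1, fun e he hes => ?_⟩⟩
  have h2 := ((h.2 _ (hmaps ht)).2 e he hes).scomp t (hd t).hasDerivWithinAt hmaps
  rw [hkeq _ (hmaps ht), inv_inv] at h2
  exact h2

namespace HorizontalSegment

variable {I : S.HorizontalSegment}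

theorem FirstReturn.timeChange {X : M → ℂ} {x y : ℝ} (h : I.FirstReturn X x y) {g : M → ℝ}
    (hg : ContinuousOn g S.singᶜ) (hpos : ∀ p ∉ S.sing, 0 < g p) :
    I.FirstReturn (fun p => g p * X p) x y := by
  obtain ⟨hx, hy, τ, γ, hτ, hγ, h0, h1, hav⟩ := h
  obtain ⟨τ', hτ', θ, hmono, hθ0, hθ1, hθ⟩ := hγ.exists_timeChange hτ hg hpos
  refine ⟨hx, hy, τ', _, hτ', hθ, by rw [hθ0, h0], by rw [hθ1, h1], fun t ht => hav _ ?_⟩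
  exact ⟨hθ0 ▸ hmono ht.1, hθ1 ▸ hmono ht.2⟩

end HorizontalSegment

/-! ### Vector fields with vertical component one -/

variable (S) in
/-- A field of class `C^r` with vertical component `1` and horizontal component at most `ε`, that is
vertical near the singular points. -/
structure IsGraphField (r : ℕ∞) (ε : ℝ) (Y : M → ℂ) : Prop where
  contDiffOn : ∀ e ∈ S.atlas, ContDiffOn ℝ (r : WithTop ℕ∞) (fun z => Y (e.symm z)) e.target
  im_eq : ∀ p ∉ S.sing, (Y p).im = 1
  abs_re_le : ∀ p ∉ S.sing, |(Y p).re| ≤ ε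
  eq_vertical : ∀ A ∈ S.sing, ∀ᶠ p in 𝓝 A, p ∉ S.sing → Y p = Complex.I

theorem IsGraphField.isC1Field {r : ℕ∞} (hr : 1 ≤ r) {ε : ℝ} {Y : M → ℂ}
    (h : S.IsGraphField r ε Y) : S.IsC1Field Y := fun e he =>
  (h.contDiffOn e he).of_le (by exact_mod_cast hr)

theorem IsCloseToVertical.norm_sub_lt {k : ℕ} {ε : ℝ} {X : M → ℂ}
    (h : S.IsCloseToVertical k ε X) {p : M} (hp : p ∉ S.sing) : ‖X p - Complex.I‖ < ε := by
  obtain ⟨e, he, hpe⟩ := S.cover p hp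
  have := h e he (e p) (e.map_source hpe) 0 (Nat.zero_le _)
  rw [norm_iteratedFDerivWithin_zero, e.left_inv hpe] at this
  exact this

theorem continuousOn_of_contDiffOn {r : ℕ∞} {X : M → ℂ}
    (h : ∀ e ∈ S.atlas, ContDiffOn ℝ (r : WithTop ℕ∞) (fun z => X (e.symm z)) e.target) :
    ContinuousOn X S.singᶜ := by
  intro p hp
  obtain ⟨e, he, hpe⟩ := S.cover p hp
  have h1 : ContinuousAt (fun z => X (e.symm z)) (e p) :=
    ((h e he).continuousOn _ (e.map_source hpe)).continuousAt
      (e.open_target.mem_nhds (e.map_source hpe))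
  have h2 := h1.comp (e.continuousAt hpe)
  refine (h2.congr ?_).continuousWithinAt
  filter_upwards [e.open_source.mem_nhds hpe] with q hq
  simp [e.left_inv hq]

/-- A deformation close to the vertical field is, up to a change of time, a field with vertical
component one. -/
theorem IsDeformation.exists_isGraphField {r : ℕ∞} {X : M → ℂ} (h : S.IsDeformation r X) {k : ℕ}
    {ε : ℝ} (hε : ε ≤ 1 / 2) (hc : S.IsCloseToVertical k ε X) :
    ∃ Y : M → ℂ, S.IsGraphField r (2 * ε) Y ∧ (∀ p, X p = Complex.I → Y p = Complex.I) ∧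
      ∀ (I : S.HorizontalSegment) (x y : ℝ), I.FirstReturn X x y ↔ I.FirstReturn Y x y := by
  have him : ∀ p ∉ S.sing, 1 / 2 < (X p).im := by
    intro p hp
    have h1 := (Complex.abs_im_le_norm (X p - Complex.I)).trans_lt (hc.norm_sub_lt hp)
    simp only [Complex.sub_im, Complex.I_im] at h1
    linarith [(abs_lt.1 h1).1]
  have hre : ∀ p ∉ S.sing, |(X p).re| < ε := by
    intro p hp
    have h1 := (Complex.abs_re_le_norm (X p - Complex.I)).trans_lt (hc.norm_sub_lt hp)
    simpa using h1
  have hXc := continuousOn_of_contDiffOn h.contDiffOn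
  have himc : ContinuousOn (fun p => (X p).im) S.singᶜ := Complex.continuous_im.comp_continuousOn hXc
  -- The vertical component exceeds `1 / 2`, so dividing by it at most doubles the horizontal
  -- component.
  refine ⟨fun p => (((X p).im⁻¹ : ℝ) : ℂ) * X p, ⟨fun e he => ?_, fun p hp => ?_, fun p hp => ?_,
    fun A hA => ?_⟩, fun p hp => by simp [hp], fun I x y => ⟨fun hr => ?_, fun hr => ?_⟩⟩
  · have h1 := h.contDiffOn e he
    have h2 : ContDiffOn ℝ (r : WithTop ℕ∞) (fun z => (X (e.symm z)).im) e.target :=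
      Complex.imCLM.contDiff.comp_contDiffOn h1
    have h3 := h2.inv fun z hz => (show (0 : ℝ) < (X (e.symm z)).im by
      linarith [him (e.symm z) (S.source_subset e he (e.map_target hz))]).ne'
    exact (Complex.ofRealCLM.contDiff.comp_contDiffOn h3).mul h1
  · have := him p hp
    rw [Complex.im_ofReal_mul]
    exact inv_mul_cancel₀ (show (0 : ℝ) < (X p).im by linarith).ne'
  · have h1 := him p hp
    simp only [Complex.re_ofReal_mul, abs_mul]
    rw [abs_of_pos (inv_pos.2 (by linarith))]
    have h2 : (X p).im⁻¹ ≤ 2 := by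
      rw [inv_le_comm₀ (by linarith) two_pos]; linarith
    have h3 := hre p hp
    exact mul_le_mul h2 h3.le (abs_nonneg _) two_pos.le
  · filter_upwards [h.eq_vertical A hA] with p hp hps
    have := hp hps
    simp [this, vertical]
  · exact hr.timeChange (himc.inv₀ fun p hp => (show (0 : ℝ) < (X p).im by
      linarith [him p hp]).ne') fun p hp => inv_pos.2 (by linarith [him p hp])
  · have h1 := hr.timeChange himc fun p hp => (by linarith [him p hp])
    obtain ⟨hx, hy, τ, γ, hτ, hγ, h0, h2, hav⟩ := h1
    refine ⟨hx, hy, τ, γ, hτ, hγ.congr_field fun t ht => ?_, h0, h2, hav⟩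
    have := him _ (hγ.2 t ht).1
    have h3 : ((X (γ t)).im : ℂ) ≠ 0 := by exact_mod_cast (by linarith : (0 : ℝ) < _).ne'
    push_cast
    rw [mul_inv_cancel_left₀ h3]

end TranslationSurface

/-! ### Germs of planar flows -/

theorem JetGroup.mk_eq_of_eventuallyEq {r : ℕ∞} {f g : JetDiff r}
    (h : ∀ᶠ y in 𝓝 (0 : ℝ), (f : ℝ ≃o ℝ) y = (g : ℝ ≃o ℝ) y) :
    (QuotientGroup.mk f : JetGroup r) = QuotientGroup.mk g := by
  rw [QuotientGroup.eq]
  intro k _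
  have h1 : (fun x : ℝ => ((f⁻¹ * g : JetDiff r) : ℝ ≃o ℝ) x - x) =ᶠ[𝓝 0] fun _ => 0 := by
    filter_upwards [h] with y hy
    change (f : ℝ ≃o ℝ).symm ((g : ℝ ≃o ℝ) y) - y = 0
    rw [← hy, OrderIso.symm_apply_apply, sub_self]
  exact h1.trans_isLittleO (isLittleO_zero _ _)

namespace IsGlobalField

variable {F : ℝ → ℝ → ℝ} {C K : NNReal}

theorem sol_eq_const (hF : IsGlobalField F C K) {t₀ t₁ x : ℝ} (h : ∀ t ∈ uIcc t₀ t₁, F t x = 0) :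
    hF.sol t₀ t₁ x = x := by
  rcases le_total t₀ t₁ with hle | hle
  · rw [uIcc_of_le hle] at h
    exact ODE_solution_unique_of_mem_Icc_right (v := F) (K := K) (s := fun _ => univ)
      (f := fun t => hF.sol t₀ t x) (g := fun _ => x)
      (fun t _ => (hF.lip t).lipschitzOnWith) (hF.continuous_sol_time t₀ x).continuousOn
      (fun t _ => (hF.hasDerivAt_sol t₀ t x).hasDerivWithinAt) (fun _ _ => trivial)
      continuousOn_const (fun t ht => by
        rw [h t (Ico_subset_Icc_self ht)]; exact hasDerivWithinAt_const ..) (fun _ _ => trivial)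
      (hF.sol_self t₀ x) ⟨hle, le_rfl⟩
  · rw [uIcc_of_ge hle] at h
    exact ODE_solution_unique_of_mem_Icc_left (v := F) (K := K) (s := fun _ => univ)
      (f := fun t => hF.sol t₀ t x) (g := fun _ => x)
      (fun t _ => (hF.lip t).lipschitzOnWith) (hF.continuous_sol_time t₀ x).continuousOn
      (fun t _ => (hF.hasDerivAt_sol t₀ t x).hasDerivWithinAt) (fun _ _ => trivial)
      continuousOn_const (fun t ht => by
        rw [h t (Ioc_subset_Icc_self ht)]; exact hasDerivWithinAt_const ..) (fun _ _ => trivial)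
      (hF.sol_self t₀ x) ⟨le_rfl, hle⟩

/-- The flow from time `s` to time `t` near the orbit of `x`, as a germ that fixes `0`. -/
noncomputable def germ (hF : IsGlobalField F C K) {r : ℕ∞}
    (hr : ContDiff ℝ (r : WithTop ℕ∞) (Function.uncurry F)) (s t x : ℝ) : JetDiff r :=
  ⟨((OrderIso.addLeft x).trans (hF.flow s t)).trans (OrderIso.addRight (-hF.sol s t x)), by
    refine ⟨?_, ?_, ?_⟩
    · change hF.sol s t (x + 0) + -hF.sol s t x = 0
      rw [add_zero, add_neg_cancel]
    · exact ((hF.contDiff_flow hr s t).comp (contDiff_const.add contDiff_id)).add contDiff_const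
    · have h1 : ContDiff ℝ (r : WithTop ℕ∞) (fun y => -x + hF.flow t s (y + - -hF.sol s t x)) :=
        contDiff_const.add ((hF.contDiff_flow hr t s).comp (contDiff_id.add contDiff_const))
      exact h1⟩

theorem germ_apply (hF : IsGlobalField F C K) {r : ℕ∞}
    (hr : ContDiff ℝ (r : WithTop ℕ∞) (Function.uncurry F)) (s t x y : ℝ) :
    (hF.germ hr s t x : ℝ ≃o ℝ) y = hF.sol s t (x + y) - hF.sol s t x :=
  (sub_eq_add_neg _ _).symm

theorem germ_mul (hF : IsGlobalField F C K) {r : ℕ∞}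
    (hr : ContDiff ℝ (r : WithTop ℕ∞) (Function.uncurry F)) (s t u x : ℝ) :
    hF.germ hr t u (hF.sol s t x) * hF.germ hr s t x = hF.germ hr s u x := by
  apply Subtype.ext
  apply OrderIso.ext
  funext y
  change (hF.germ hr t u (hF.sol s t x) : ℝ ≃o ℝ) ((hF.germ hr s t x : ℝ ≃o ℝ) y) = _
  rw [germ_apply, germ_apply, germ_apply, add_sub_cancel, hF.sol_sol, hF.sol_sol]

theorem germ_self (hF : IsGlobalField F C K) {r : ℕ∞}
    (hr : ContDiff ℝ (r : WithTop ℕ∞) (Function.uncurry F)) (s x : ℝ) :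
    hF.germ hr s s x = 1 := by
  apply Subtype.ext
  apply OrderIso.ext
  funext y
  rw [germ_apply, hF.sol_self, hF.sol_self, add_sub_cancel_left]
  rfl

/-- Where the field vanishes, the germ is trivial. -/
theorem mk_germ_eq_one (hF : IsGlobalField F C K) {r : ℕ∞}
    (hr : ContDiff ℝ (r : WithTop ℕ∞) (Function.uncurry F)) {s t x : ℝ}
    (h : ∀ᶠ y in 𝓝 x, ∀ u ∈ uIcc s t, F u y = 0) :
    (QuotientGroup.mk (hF.germ hr s t x) : JetGroup r) = 1 := by
  refine JetGroup.mk_eq_of_eventuallyEq (g := 1) ?_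
  have hc : Tendsto (fun y : ℝ => x + y) (𝓝 0) (𝓝 x) := by
    have : Continuous fun y : ℝ => x + y := by fun_prop
    simpa using this.tendsto 0
  filter_upwards [hc.eventually h] with y hy
  rw [germ_apply, hF.sol_eq_const hy, hF.sol_eq_const h.self_of_nhds, add_sub_cancel_left]
  rfl

end IsGlobalField

namespace TranslationSurface

variable {M : Type*} [TopologicalSpace M] {S : TranslationSurface M} [T2Space M]

/-! ### Reading a field in a developing map -/

theorem expMap_expMap_eventually {p : M} {v : ℂ} (hv : v ∈ S.expDom p) :
    ∀ᶠ w in 𝓝 (0 : ℂ), S.expMap (S.expMap p v) w = S.expMap p (v + w) := by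
  have h1 := zero_mem_expDom (devAt_expMap hv).notMem_sing
  have h2 : S.DevAt (fun w => S.expMap p (w + v)) 0 :=
    DevAt.comp_add v (by rw [zero_add]; exact devAt_expMap hv)
  have h3 := (devAt_expMap h1).eventuallyEq h2 (by
    rw [expMap_zero (devAt_expMap hv).notMem_sing, zero_add])
  filter_upwards [h3] with w hw
  rw [hw, add_comm]

theorem IsGraphField.contDiffAt_comp {r : ℕ∞} {ε : ℝ} {Y : M → ℂ} (hY : S.IsGraphField r ε Y)
    {Φ : ℂ → M} {z : ℂ} (h : S.DevAt Φ z) : ContDiffAt ℝ (r : WithTop ℕ∞) (fun w => Y (Φ w)) z := by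
  obtain ⟨e, he, c, hc⟩ := h
  have h1 : z + c ∈ e.target := by
    rw [← hc.self_of_nhds.2]
    exact e.map_source hc.self_of_nhds.1
  have h2 := (hY.contDiffOn e he).contDiffAt (e.open_target.mem_nhds h1)
  have h3 : ContDiffAt ℝ (r : WithTop ℕ∞) (fun w : ℂ => w + c) z :=
    (contDiff_id.add contDiff_const).contDiffAt
  refine (ContDiffAt.comp z h2 h3).congr_of_eventuallyEq ?_
  filter_upwards [hc] with w hw
  simp only [Function.comp_apply]
  rw [← hw.2, e.left_inv hw.1]

open Classical in
variable (S) in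
/-- The horizontal component of a field in a developing map, extended by `0`. -/
noncomputable def graphField (Y : M → ℂ) (p₀ : M) (z₀ z : ℂ) : ℝ :=
  if z - z₀ ∈ S.expDom p₀ then (Y (S.expMap p₀ (z - z₀))).re else 0

theorem graphField_eq {Y : M → ℂ} {p₀ : M} {z₀ z : ℂ} (h : z - z₀ ∈ S.expDom p₀) :
    S.graphField Y p₀ z₀ z = (Y (S.expMap p₀ (z - z₀))).re := if_pos h

/-- The horizontal component, extended by `0`, is `C^r` on an open set `W` containing `K`: either
the point is in the domain, or the field is vertical nearby wherever it is defined. A cut-off equal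
to `1` near `K` and supported in a bounded part of `W` makes it global and Lipschitz, and does not
increase the bound `ε`. -/
theorem IsGraphField.exists_isGlobalField {r : ℕ∞} (hr : 1 ≤ r) {ε : ℝ} (hε : 0 ≤ ε) {Y : M → ℂ}
    (hY : S.IsGraphField r ε Y) (p₀ : M) (z₀ : ℂ) {K : Set ℂ} (hK : IsCompact K)
    (hKd : ∀ z ∈ K, z - z₀ ∈ S.expDom p₀ ∨
      ∀ᶠ w in 𝓝 z, w - z₀ ∈ S.expDom p₀ → Y (S.expMap p₀ (w - z₀)) = Complex.I) :
    ∃ (F : ℝ → ℝ → ℝ) (L : NNReal) (_ : IsGlobalField F ⟨ε, hε⟩ L),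
      ContDiff ℝ (r : WithTop ℕ∞) (Function.uncurry F) ∧
      ∀ z ∈ K, ∀ᶠ w in 𝓝 z, F w.im w.re = S.graphField Y p₀ z₀ w := by
  set f := S.graphField Y p₀ z₀ with hf
  set W : Set ℂ := ((fun z => z - z₀) ⁻¹' S.expDom p₀) ∪ interior {z | f z = 0} with hW
  have hUo : IsOpen ((fun z => z - z₀) ⁻¹' S.expDom p₀) :=
    (isOpen_expDom p₀).preimage (by fun_prop)
  have hWo : IsOpen W := hUo.union isOpen_interior
  have hfW : ∀ z ∈ W, ContDiffAt ℝ (r : WithTop ℕ∞) f z := by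
    rintro z (hz | hz)
    · have h1 : S.DevAt (fun w => S.expMap p₀ (w + -z₀)) z :=
        DevAt.comp_add _ (by rw [← sub_eq_add_neg]; exact devAt_expMap hz)
      have h2 := Complex.reCLM.contDiff.contDiffAt.comp z (hY.contDiffAt_comp h1)
      refine h2.congr_of_eventuallyEq ?_
      filter_upwards [hUo.mem_nhds hz] with w hw
      rw [hf, graphField_eq hw, sub_eq_add_neg]
      rfl
    · refine (contDiffAt_const (c := (0 : ℝ))).congr_of_eventuallyEq ?_
      filter_upwards [isOpen_interior.mem_nhds hz] with w hw
      have h1 : w ∈ {z | f z = 0} := interior_subset hw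
      exact h1
  have hKW : K ⊆ W := by
    intro z hz
    rcases hKd z hz with h | h
    · exact Or.inl h
    · refine Or.inr (mem_interior_iff_mem_nhds.2 ?_)
      filter_upwards [h] with w hw
      by_cases hwd : w - z₀ ∈ S.expDom p₀
      · change f w = 0
        rw [hf, graphField_eq hwd, hw hwd, Complex.I_re]
      · exact if_neg hwd
  obtain ⟨ρ, hρ⟩ := hK.isBounded.subset_ball (0 : ℂ)
  obtain ⟨χ, h0, h1, h01⟩ := exists_contMDiffMap_zero_one_nhds_of_isClosed
    (modelWithCornersSelf ℝ ℂ) (n := (⊤ : ℕ∞)) (s := (W ∩ Metric.ball 0 ρ)ᶜ) (t := K)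
    (hWo.inter Metric.isOpen_ball).isClosed_compl hK.isClosed
    (disjoint_compl_left_iff_subset.2 (subset_inter hKW hρ))
  have hχ : ContDiff ℝ ∞ χ := χ.contMDiff.contDiff
  rw [eventually_nhdsSet_iff_forall] at h0 h1
  set G : ℂ → ℝ := fun z => χ z * f z with hG
  have hGc : ContDiff ℝ (r : WithTop ℕ∞) G := by
    rw [contDiff_iff_contDiffAt]
    intro z
    by_cases hz : z ∈ W ∩ Metric.ball 0 ρ
    · exact (hχ.contDiffAt.of_le (by exact_mod_cast le_top)).mul (hfW z hz.1)
    · refine (contDiffAt_const (c := (0 : ℝ))).congr_of_eventuallyEq ?_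
      filter_upwards [h0 z hz] with w hw
      simp [hG, hw]
  have hfb : ∀ z, |f z| ≤ ε := by
    intro z
    by_cases hz : z - z₀ ∈ S.expDom p₀
    · rw [hf, graphField_eq hz]
      exact hY.abs_re_le _ (devAt_expMap hz).notMem_sing
    · have : f z = 0 := if_neg hz
      simpa [this] using hε
  have hGb : ∀ z, |G z| ≤ ε := by
    intro z
    simp only [hG, abs_mul]
    rw [abs_of_nonneg (h01 z).1]
    exact (mul_le_of_le_one_left (abs_nonneg _) (h01 z).2).trans (hfb z)
  set T : (ℝ × ℝ) ≃L[ℝ] ℂ := (ContinuousLinearEquiv.prodComm ℝ ℝ ℝ).trans Complex.equivRealProdCLM.symm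
    with hT
  have hTa : ∀ t x : ℝ, T (t, x) = x + t * Complex.I := fun t x => by
    apply Complex.ext <;> simp [hT]
  have hGs : HasCompactSupport G := by
    refine HasCompactSupport.of_support_subset_isCompact (isCompact_closedBall (0 : ℂ) ρ) ?_
    intro z hz
    by_contra hcon
    refine hz ?_
    have h2 : z ∈ (W ∩ Metric.ball 0 ρ)ᶜ := fun h => hcon (Metric.ball_subset_closedBall h.2)
    simp [hG, (h0 z h2).self_of_nhds]
  have hunc : Function.uncurry (fun t x : ℝ => G (x + t * Complex.I)) = G ∘ T := by
    funext ⟨t, x⟩; simp [hTa]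
  have hFc : ContDiff ℝ (r : WithTop ℕ∞)
      (Function.uncurry (fun t x : ℝ => G (x + t * Complex.I))) := by
    rw [hunc]; exact hGc.comp T.contDiff
  obtain ⟨L, hL⟩ := _root_.exists_isGlobalField (F := fun t x : ℝ => G (x + t * Complex.I)) (ε := ⟨ε, hε⟩)
    (hFc.of_le (by exact_mod_cast hr)) (by
      rw [hunc]; exact hGs.comp_homeomorph T.toHomeomorph) (fun t x => hGb _)
  refine ⟨_, L, hL, hFc, fun z hz => ?_⟩
  filter_upwards [h1 z hz] with w hw
  simp [hG, hw, Complex.re_add_im]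

/-! ### Holonomy germs along integral curves -/

section Holonomy

variable {Y : M → ℂ} {F : ℝ → ℝ → ℝ} {C L : NNReal} {p₀ : M} {z₀ : ℂ}

/-- The planar flow gives integral curves. -/
theorem IsGraphField.isIntegralCurve_sol {r : ℕ∞} {ε : ℝ} (hY : S.IsGraphField r ε Y)
    (hF : IsGlobalField F C L) {s : Set ℝ} {t₀ x : ℝ}
    (h : ∀ t ∈ s, ((hF.sol t₀ t x : ℝ) : ℂ) + t * Complex.I - z₀ ∈ S.expDom p₀ ∧
      F t (hF.sol t₀ t x) = S.graphField Y p₀ z₀ (hF.sol t₀ t x + t * Complex.I)) :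
    S.IsIntegralCurve Y
      (fun t => S.expMap p₀ (((hF.sol t₀ t x : ℝ) : ℂ) + t * Complex.I - z₀)) s := by
  refine IsIntegralCurve.of_dev (Φ := S.expMap p₀)
    (ζ := fun t : ℝ => ((hF.sol t₀ t x : ℝ) : ℂ) + t * Complex.I - z₀)
    (fun t ht => devAt_expMap (h t ht).1) fun t ht => ?_
  obtain ⟨h1, h2⟩ := h t ht
  rw [graphField_eq h1] at h2
  have h3 : HasDerivAt (fun t : ℝ => (t : ℂ)) 1 t := Complex.ofRealCLM.hasDerivAt
  have h4 := (((hF.hasDerivAt_sol t₀ t x).ofReal_comp.add (h3.mul_const Complex.I)).sub_const z₀)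
  have h5 : Y (S.expMap p₀ (((hF.sol t₀ t x : ℝ) : ℂ) + t * Complex.I - z₀)) =
      ((F t (hF.sol t₀ t x) : ℝ) : ℂ) + 1 * Complex.I := by
    rw [h2, ← Complex.ofReal_one, ← hY.im_eq _ (devAt_expMap h1).notMem_sing, Complex.re_add_im]
  rw [h5]
  exact h4.hasDerivWithinAt

/-- The germ `f` describes how the integral curves of duration `τ` go from a neighbourhood of `p` to
a neighbourhood of `q`. -/
def HolRel (S : TranslationSurface M) {r : ℕ∞} (Y : M → ℂ) (p q : M) (τ : ℝ) (f : JetDiff r) :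
    Prop :=
  ∀ᶠ y : ℝ in 𝓝 0, ∃ γ : ℝ → M, S.IsIntegralCurve Y γ (Icc 0 τ) ∧ γ 0 = S.expMap p y ∧
    γ τ = S.expMap q ((f : ℝ ≃o ℝ) y : ℝ)

/-- The transversals are horizontal, parametrized by the exponential map on real vectors.
Compactness of the time interval extends the hypotheses to the orbits that start near `x`, and the
planar flow provides the curves. -/
theorem IsGraphField.holRel_sol {r : ℕ∞} {ε : ℝ} (hY : S.IsGraphField r ε Y)
    (hF : IsGlobalField F C L) (hr : ContDiff ℝ (r : WithTop ℕ∞) (Function.uncurry F)) {t₁ t₂ x : ℝ}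
    (ht : t₁ ≤ t₂)
    (hd : ∀ t ∈ Icc t₁ t₂, ((hF.sol t₁ t x : ℝ) : ℂ) + t * Complex.I - z₀ ∈ S.expDom p₀)
    (hFf : ∀ t ∈ Icc t₁ t₂, ∀ᶠ w in 𝓝 (((hF.sol t₁ t x : ℝ) : ℂ) + t * Complex.I),
      F w.im w.re = S.graphField Y p₀ z₀ w) :
    S.HolRel Y (S.expMap p₀ (x + t₁ * Complex.I - z₀))
      (S.expMap p₀ (((hF.sol t₁ t₂ x : ℝ) : ℂ) + t₂ * Complex.I - z₀)) (t₂ - t₁)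
      (hF.germ hr t₁ t₂ x) := by
  have hev : ∀ᶠ y : ℝ in 𝓝 0, ∀ t ∈ Icc t₁ t₂,
      ((hF.sol t₁ t (x + y) : ℝ) : ℂ) + t * Complex.I - z₀ ∈ S.expDom p₀ ∧
      F t (hF.sol t₁ t (x + y)) = S.graphField Y p₀ z₀ (hF.sol t₁ t (x + y) + t * Complex.I) := by
    refine isCompact_Icc.eventually_forall_of_forall_eventually fun t ht => ?_
    have hc : Continuous fun q : ℝ × ℝ => ((hF.sol t₁ q.2 (x + q.1) : ℝ) : ℂ) + q.2 * Complex.I := by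
      have h1 : Continuous fun q : ℝ × ℝ => hF.sol t₁ q.2 (x + q.1) :=
        (hF.continuous_sol t₁).comp (continuous_snd.prodMk (continuous_const.add continuous_fst))
      fun_prop
    have h2 := hc.tendsto (0, t)
    simp only [add_zero] at h2
    have h3 : ∀ᶠ w : ℂ in 𝓝 (((hF.sol t₁ t x : ℝ) : ℂ) + t * Complex.I), w - z₀ ∈ S.expDom p₀ :=
      ((isOpen_expDom p₀).preimage (by fun_prop : Continuous fun w : ℂ => w - z₀)).mem_nhds (hd t ht)
    filter_upwards [h2.eventually h3, h2.eventually (hFf t ht)] with q h4 h5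
    refine ⟨h4, ?_⟩
    simpa using h5
  have hleft : ∀ᶠ y : ℝ in 𝓝 0, S.expMap (S.expMap p₀ (x + t₁ * Complex.I - z₀)) y =
      S.expMap p₀ ((x + y : ℝ) + t₁ * Complex.I - z₀) := by
    have h1 := hd t₁ ⟨le_rfl, ht⟩
    rw [hF.sol_self] at h1
    have hc : Tendsto (fun y : ℝ => (y : ℂ)) (𝓝 0) (𝓝 0) := by
      simpa using Complex.continuous_ofReal.tendsto 0
    filter_upwards [hc.eventually (expMap_expMap_eventually h1)] with y hy
    rw [hy]
    congr 1
    push_cast; ring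
  have hright : ∀ᶠ y : ℝ in 𝓝 0,
      S.expMap (S.expMap p₀ (((hF.sol t₁ t₂ x : ℝ) : ℂ) + t₂ * Complex.I - z₀))
        ((hF.germ hr t₁ t₂ x : ℝ ≃o ℝ) y : ℝ) =
      S.expMap p₀ ((hF.sol t₁ t₂ (x + y) : ℝ) + t₂ * Complex.I - z₀) := by
    have hc : Tendsto (fun y : ℝ => ((((hF.germ hr t₁ t₂ x : ℝ ≃o ℝ) y : ℝ)) : ℂ)) (𝓝 0) (𝓝 0) := by
      have h1 := JetDiff.tendsto_zero (hF.germ hr t₁ t₂ x).2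
      have h2 := (Complex.continuous_ofReal.tendsto 0).comp h1
      rw [Complex.ofReal_zero] at h2
      exact h2
    filter_upwards [hc.eventually (expMap_expMap_eventually (hd t₂ ⟨ht, le_rfl⟩))] with y hy
    rw [hy, hF.germ_apply]
    congr 1
    push_cast; ring
  filter_upwards [hev, hleft, hright] with y h1 h2 h3
  have h4 := (hY.isIntegralCurve_sol hF h1).comp_add t₁
  refine ⟨_, h4.mono fun t ht => ⟨by linarith [ht.1], by linarith [ht.2]⟩, ?_, ?_⟩
  · simp only [zero_add]
    rw [h2, hF.sol_self]
  · simp only [sub_add_cancel]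
    rw [h3]

/-- By its default value the exponential map is constant at a singular point; hence the existence of
the curves in `HolRel` already forces both end points to be regular. -/
theorem expMap_eq_self {p : M} (hp : p ∈ S.sing) (v : ℂ) : S.expMap p v = p :=
  dif_neg fun h => notMem_sing_of_mem_expDom h hp

namespace HolRel

variable {r : ℕ∞} {p q p' q' : M} {τ τ' : ℝ} {f g : JetDiff r}

theorem left_notMem_sing (hτ : 0 ≤ τ) (h : S.HolRel Y p q τ f) : p ∉ S.sing := by
  intro hp
  obtain ⟨γ, hγ, h0, -⟩ := h.self_of_nhds
  rw [expMap_eq_self hp] at h0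
  exact (hγ.2 0 ⟨le_rfl, hτ⟩).1 (h0 ▸ hp)

theorem right_notMem_sing (hτ : 0 ≤ τ) (h : S.HolRel Y p q τ f) : q ∉ S.sing := by
  intro hq
  obtain ⟨γ, hγ, -, h1⟩ := h.self_of_nhds
  rw [expMap_eq_self hq] at h1
  exact (hγ.2 τ ⟨hτ, le_rfl⟩).1 (h1 ▸ hq)

theorem trans (hτ : 0 ≤ τ) (hτ' : 0 ≤ τ') (h : S.HolRel Y p q τ f) (h' : S.HolRel Y q q' τ' g) :
    S.HolRel Y p q' (τ + τ') (g * f) := by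
  filter_upwards [h, (JetDiff.tendsto_zero f.2).eventually h'] with y h1 h2
  obtain ⟨γ, hγ, h0, h3⟩ := h1
  obtain ⟨γ', hγ', h0', h3'⟩ := h2
  have h4 := (hγ'.comp_add (-τ)).mono (s' := Icc τ (τ + τ')) fun t ht =>
    ⟨by linarith [ht.1], by linarith [ht.2]⟩
  refine ⟨_, hγ.concat h4 (by simp [h3, h0']), by simp [hτ, h0], ?_⟩
  rcases eq_or_lt_of_le hτ' with h5 | h5
  · rw [← h5] at h3' ⊢
    rw [h0'] at h3'
    simp only [add_zero, le_refl, if_true]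
    rw [h3, h3']
    rfl
  · have : ¬τ + τ' ≤ τ := by linarith
    simp only [this, if_false, add_neg_cancel_comm]
    rw [h3']
    rfl

theorem eventually_eq_of_expMap_eq {p : M} (hp : p ∉ S.sing) {f g : ℝ → ℝ}
    (hf : Tendsto f (𝓝 0) (𝓝 0)) (hg : Tendsto g (𝓝 0) (𝓝 0))
    (h : ∀ᶠ y in 𝓝 (0 : ℝ), S.expMap p (f y : ℝ) = S.expMap p (g y : ℝ)) : f =ᶠ[𝓝 0] g := by
  obtain ⟨N, hN, hinj⟩ := (devAt_expMap (zero_mem_expDom hp)).eventually_injOn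
  have hc : Tendsto (fun y : ℝ => (y : ℂ)) (𝓝 0) (𝓝 0) := by
    simpa using Complex.continuous_ofReal.tendsto 0
  filter_upwards [(hc.comp hf) hN, (hc.comp hg) hN, h] with y h1 h2 h3
  exact Complex.ofReal_injective (hinj h1 h2 h3)

/-- Curves with the same end and the same duration coincide, so the inverse germs lead to the same
points; the exponential map at a regular point is injective near `0`. -/
theorem unique_left (hY : S.IsC1Field Y) (hτ : 0 ≤ τ) (h : S.HolRel Y p q τ f)
    (h' : S.HolRel Y p' q τ g) : p = p' ∧ (QuotientGroup.mk f : JetGroup r) = QuotientGroup.mk g := by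
  have hf := JetDiff.tendsto_zero (f⁻¹).2
  have hg := JetDiff.tendsto_zero (g⁻¹).2
  have heq : ∀ᶠ y in 𝓝 (0 : ℝ), S.expMap p (((f⁻¹ : JetDiff r) : ℝ ≃o ℝ) y : ℝ) =
      S.expMap p' (((g⁻¹ : JetDiff r) : ℝ ≃o ℝ) y : ℝ) := by
    filter_upwards [hf.eventually h, hg.eventually h'] with y h1 h2
    obtain ⟨γ, hγ, h0, h3⟩ := h1
    obtain ⟨γ', hγ', h0', h3'⟩ := h2
    have e1 : (f : ℝ ≃o ℝ) (((f⁻¹ : JetDiff r) : ℝ ≃o ℝ) y) = y := OrderIso.apply_symm_apply _ _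
    have e2 : (g : ℝ ≃o ℝ) (((g⁻¹ : JetDiff r) : ℝ ≃o ℝ) y) = y := OrderIso.apply_symm_apply _ _
    rw [e1] at h3
    rw [e2] at h3'
    have := hY.eqOn_Icc_of_right hγ hγ' (h3.trans h3'.symm) ⟨le_rfl, hτ⟩
    rw [← h0, ← h0', this]
  have hpp : p = p' := by
    have := heq.self_of_nhds
    rwa [(f⁻¹).2.1, (g⁻¹).2.1, Complex.ofReal_zero, expMap_zero (h.left_notMem_sing hτ),
      expMap_zero (h'.left_notMem_sing hτ)] at this
  subst hpp
  refine ⟨rfl, ?_⟩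
  have h1 := JetGroup.mk_eq_of_eventuallyEq
    (eventually_eq_of_expMap_eq (h.left_notMem_sing hτ) hf hg heq)
  rw [QuotientGroup.mk_inv, QuotientGroup.mk_inv] at h1
  exact inv_injective h1

theorem unique_right (hY : S.IsC1Field Y) (hτ : 0 ≤ τ) (h : S.HolRel Y p q τ f)
    (h' : S.HolRel Y p q' τ g) : q = q' ∧ (QuotientGroup.mk f : JetGroup r) = QuotientGroup.mk g := by
  have hf := JetDiff.tendsto_zero f.2
  have hg := JetDiff.tendsto_zero g.2
  have heq : ∀ᶠ y in 𝓝 (0 : ℝ), S.expMap q ((f : ℝ ≃o ℝ) y : ℝ) =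
      S.expMap q' ((g : ℝ ≃o ℝ) y : ℝ) := by
    filter_upwards [h, h'] with y h1 h2
    obtain ⟨γ, hγ, h0, h3⟩ := h1
    obtain ⟨γ', hγ', h0', h3'⟩ := h2
    have := hY.eqOn_Icc hγ hγ' (h0.trans h0'.symm) ⟨hτ, le_rfl⟩
    rw [← h3, ← h3', this]
  have hqq : q = q' := by
    have := heq.self_of_nhds
    rwa [f.2.1, g.2.1, Complex.ofReal_zero, expMap_zero (h.right_notMem_sing hτ),
      expMap_zero (h'.right_notMem_sing hτ)] at this
  subst hqq
  exact ⟨rfl, JetGroup.mk_eq_of_eventuallyEq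
    (eventually_eq_of_expMap_eq (h.right_notMem_sing hτ) hf hg heq)⟩

end HolRel

end Holonomy

end TranslationSurface

/-- A property that holds near a compact rectangle holds on a slightly wider rectangle. -/
theorem exists_margin {u u' h : ℝ} (hu : u ≤ u') {P : ℝ × ℝ → Prop}
    (hP : ∀ q ∈ Icc u u' ×ˢ Icc 0 h, ∀ᶠ q' in 𝓝 q, P q') :
    ∃ δ > 0, ∀ x t, t ∈ Icc 0 h → u - δ < x → x < u' + δ → P (x, t) := by
  have hK : IsCompact (Icc u u' ×ˢ Icc 0 h) := isCompact_Icc.prod isCompact_Icc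
  have hsub : Icc u u' ×ˢ Icc 0 h ⊆ interior {q | P q} := fun q hq =>
    mem_interior_iff_mem_nhds.2 (hP q hq)
  obtain ⟨δ, hδ, hth⟩ := hK.exists_thickening_subset_open isOpen_interior hsub
  refine ⟨δ, hδ, fun x t ht h1 h2 => ?_⟩
  have h3 : (x, t) ∈ Metric.thickening δ (Icc u u' ×ˢ Icc 0 h) := by
    rw [Metric.mem_thickening_iff]
    refine ⟨(max u (min u' x), t), ⟨⟨le_max_left _ _, max_le hu (min_le_left _ _)⟩, ht⟩, ?_⟩
    rw [Prod.dist_eq, dist_self, max_lt_iff]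
    refine ⟨?_, hδ⟩
    rw [Real.dist_eq, abs_lt]
    rcases le_total u' x with h3 | h3
    · rw [min_eq_left h3, max_eq_right hu]; constructor <;> linarith
    · rw [min_eq_right h3]
      rcases le_total u x with h4 | h4
      · rw [max_eq_right h4]; constructor <;> linarith
      · rw [max_eq_left h4]; constructor <;> linarith
  exact interior_subset (hth h3)

namespace TranslationSurface

variable {M : Type*} [TopologicalSpace M] {S : TranslationSurface M}

namespace HorizontalSegment

variable {I : S.HorizontalSegment} [T2Space M] [CompactSpace M]

namespace Rect

variable {v : ℂ} {R : I.Rect v}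

/-! ### A neighbourhood of a rectangle -/

theorem continuous_pt_prod (R : I.Rect v) : Continuous fun q : ℝ × ℝ => R.pt q.1 q.2 := by
  unfold pt; fun_prop

theorem pt_eq_add (R : I.Rect v) (x t x' t' : ℝ) :
    R.pt x t - R.pt x' t' = ((x - x' : ℝ) : ℂ) + ((t - t' : ℝ) : ℂ) * v := by
  unfold pt; push_cast; ring

/-- A point `ζ` of the closed rectangle is regular, or the singular point of a side. -/
theorem regular_or_side (hv : IsVert v) {aL aR : ℝ} (hL : R.SideHeight R.u aL)
    (hR : R.SideHeight R.u' aR) {x t : ℝ} (hx : x ∈ Icc R.u R.u') (ht : t ∈ Icc 0 R.h) :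
    R.pt x t ∈ S.expDom R.center ∨
      ∃ w a, (w = R.u ∧ a = aL ∨ w = R.u' ∧ a = aR) ∧ x = w ∧ t = a := by
  by_cases hreg : R.pt x t ∈ S.expDom R.center
  · exact Or.inl hreg
  · refine Or.inr ?_
    rcases eq_or_lt_of_le hx.1 with rfl | h1
    · refine ⟨_, aL, Or.inl ⟨rfl, rfl⟩, rfl, ?_⟩
      by_contra hne
      exact hreg ((hL.mem_iff t ht).2 hne)
    · rcases eq_or_lt_of_le hx.2 with rfl | h2
      · refine ⟨_, aR, Or.inr ⟨rfl, rfl⟩, rfl, ?_⟩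
        by_contra hne
        exact hreg ((hR.mem_iff t ht).2 hne)
      · exact absurd (R.interior hv ⟨h1, h2⟩ ht).1 hreg

/-- Near a singular point of a side, only the ray beyond it may be lost. -/
theorem eventually_mem_expDom (hv : IsVert v) {aL aR : ℝ} (hL : R.SideHeight R.u aL)
    (hR : R.SideHeight R.u' aR) {x t : ℝ} (hx : x ∈ Icc R.u R.u') (ht : t ∈ Icc 0 R.h) :
    ∀ᶠ q : ℝ × ℝ in 𝓝 (x, t), R.pt q.1 q.2 ∈ S.expDom R.center ∨
      ∃ w a, (w = R.u ∧ a = aL ∨ w = R.u' ∧ a = aR) ∧ a ∈ Icc 0 R.h ∧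
        ∃ l : ℝ, 0 ≤ l ∧ R.pt q.1 q.2 - R.pt w a = l * R.pt w a := by
  by_cases hreg : R.pt x t ∈ S.expDom R.center
  · filter_upwards [(R.continuous_pt_prod.tendsto (x, t)).eventually
      ((isOpen_expDom _).mem_nhds hreg)] with q hq
    exact Or.inl hq
  obtain ⟨w, a, hwa, rfl, rfl⟩ := (regular_or_side hv hL hR hx ht).resolve_left hreg
  have hw : x = R.u ∨ x = R.u' := hwa.imp And.left And.left
  obtain ⟨Ψ, κ, φ, -, -, -, hΨ⟩ := R.exists_side_sector hv hw ht hreg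
  filter_upwards [(R.continuous_pt_prod.tendsto (x, t)).eventually hΨ] with q hq
  by_cases hs : (R.pt q.1 q.2 - R.pt x t) / (-R.pt x t) ∈ Complex.slitPlane
  · exact Or.inl (hq.2 hs).1
  · exact Or.inr ⟨x, t, hwa, ht, exists_mul_of_notMem_slitPlane (R.pt_ne_zero hv hw t) hs⟩

theorem interior_notMem_carrier (hv : IsVert v) {x t : ℝ} (hx : x ∈ Ioo R.u R.u')
    (ht : t ∈ Ioo 0 R.h) : S.expMap R.center (R.pt x t) ∉ I.carrier := by
  rw [(R.interior hv hx (Ioo_subset_Icc_self ht)).2]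
  exact (R.returns x hx).1.2.2.1 t ht

/-- Near a rectangle, the segment only appears as a prolongation of a point of a side. -/
theorem eventually_notMem_carrier (hv : IsVert v) {aL aR : ℝ}
    (hL : R.SideHeight R.u aL) (hR : R.SideHeight R.u' aR) {x t : ℝ} (hx : x ∈ Icc R.u R.u')
    (ht : t ∈ Icc 0 R.h) :
    ∀ᶠ q : ℝ × ℝ in 𝓝 (x, t), R.pt q.1 q.2 ∈ S.expDom R.center → q.2 ∈ Ioo 0 R.h →
      S.expMap R.center (R.pt q.1 q.2) ∈ I.carrier →
      (q.1 < R.u ∧ (q.2 = aL ∨ ∃ e, (e = I.a ∨ e = I.b) ∧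
        S.expMap R.center (R.pt R.u q.2) = I.ι e)) ∨
      (R.u' < q.1 ∧ (q.2 = aR ∨ ∃ e, (e = I.a ∨ e = I.b) ∧
        S.expMap R.center (R.pt R.u' q.2) = I.ι e)) := by
  have hlt := R.lt
  -- the segment is horizontal near the point
  have key : ∃ B : M, (∀ᶠ q : ℝ × ℝ in 𝓝 (x, t), R.pt q.1 q.2 ∈ S.expDom R.center →
        ∀ y ∈ Icc I.a I.b, S.expMap R.center (R.pt q.1 q.2) = I.ι y →
        ∃ y₀ ∈ Icc I.a I.b, I.ι y₀ = B ∧ R.pt q.1 q.2 - R.pt x t = (y - y₀ : ℝ)) ∧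
      (R.pt x t ∈ S.expDom R.center → B = S.expMap R.center (R.pt x t)) := by
    by_cases hreg : R.pt x t ∈ S.expDom R.center
    · refine ⟨_, ?_, fun _ => rfl⟩
      filter_upwards [(R.continuous_pt_prod.tendsto (x, t)).eventually
        (eventually_horizontal_dev (I := I) (devAt_expMap hreg))] with q hq _ y hy hqy
      exact hq y hy hqy
    · obtain ⟨w, a, hwa, rfl, rfl⟩ := (regular_or_side hv hL hR hx ht).resolve_left hreg
      have hw : x = R.u ∨ x = R.u' := hwa.imp And.left And.left
      obtain ⟨Ψ, κ, φ, hsing, hΨc, hφ, hΨ⟩ := R.exists_side_sector hv hw ht hreg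
      refine ⟨Ψ (R.pt x t), ?_, fun h => absurd h hreg⟩
      have h1 := eventually_horizontal (I := I) hΨc hφ (hΨ.mono fun z hz => hz.1)
      filter_upwards [(R.continuous_pt_prod.tendsto (x, t)).eventually h1,
        (R.continuous_pt_prod.tendsto (x, t)).eventually hΨ] with q h2 h3 hqd y hy hqy
      refine h2 y hy ?_
      rw [← (h3.2 (mem_slitPlane_of_mem_expDom (R.pt_ne_zero hv hw t) hreg hqd)).2]
      exact hqy
  obtain ⟨B, hB, hBeq⟩ := key
  have hnear : ∀ᶠ q : ℝ × ℝ in 𝓝 (x, t), (x < R.u' → q.1 < R.u') ∧ (R.u < x → R.u < q.1) := by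
    refine Filter.Eventually.and ?_ ?_
    · by_cases h : x < R.u'
      · filter_upwards [(continuous_fst.tendsto (x, t)).eventually (gt_mem_nhds h)] with q hq _
        exact hq
      · exact Eventually.of_forall fun q hq => absurd hq h
    · by_cases h : R.u < x
      · filter_upwards [(continuous_fst.tendsto (x, t)).eventually (lt_mem_nhds h)] with q hq _
        exact hq
      · exact Eventually.of_forall fun q hq => absurd hq h
  filter_upwards [hB, hnear] with q hq hn hqd hqt hqc
  obtain ⟨y, hy, hyq⟩ := hqc
  obtain ⟨y₀, hy₀, hy₀B, heq⟩ := hq hqd y (Ioo_subset_Icc_self hy) hyq.symm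
  -- The displacement from `(x, t)` to `q` is real: `q` has the height of the reference point, and
  -- its abscissa moves along the segment.
  rw [R.pt_eq_add] at heq
  have h1 : ((q.2 - t : ℝ) : ℂ) * v = ((y - y₀ - (q.1 - x) : ℝ) : ℂ) := by
    push_cast at heq ⊢; linear_combination heq
  have hqt' : q.2 = t := by linarith [(hv.eq_zero h1).1]
  have hyx : y - y₀ = q.1 - x := by linarith [(hv.eq_zero h1).2]
  have htI : t ∈ Ioo 0 R.h := hqt' ▸ hqt
  have hqn : q.1 ∉ Ioo R.u R.u' := fun h =>
    interior_notMem_carrier hv h hqt (hyq ▸ ⟨y, hy, rfl⟩)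
  have hqx : q.1 ≠ x := by
    intro h
    rw [h, hqt'] at hqd hyq
    have hy₀' : y = y₀ := by linarith
    have hyc : S.expMap R.center (R.pt x t) ∈ I.carrier := hyq ▸ ⟨y, hy, rfl⟩
    rcases eq_or_lt_of_le hx.1 with h2 | h2
    · exact R.side_notMem_carrier hv (Or.inl h2.symm) htI hqd hyc
    · rcases eq_or_lt_of_le hx.2 with h3 | h3
      · exact R.side_notMem_carrier hv (Or.inr h3) htI hqd hyc
      · exact interior_notMem_carrier hv ⟨h2, h3⟩ htI hyc
  -- If the reference point is regular, it lies on the closed segment but, being inside a side, not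
  -- on the open one; so it is an endpoint.
  have hend : ∀ w, w = R.u ∨ w = R.u' → x = w → R.pt w t ∈ S.expDom R.center →
      ∃ e, (e = I.a ∨ e = I.b) ∧ S.expMap R.center (R.pt w t) = I.ι e := by
    rintro w hw rfl hreg
    refine ⟨y₀, eq_or_eq_of_notMem_Ioo hy₀ fun hy₀I => ?_, by rw [hy₀B, hBeq hreg]⟩
    refine R.side_notMem_carrier hv hw htI hreg ?_
    rw [← hBeq hreg, ← hy₀B]
    exact ⟨y₀, hy₀I, rfl⟩
  rw [hqt']
  rcases eq_or_lt_of_le hx.1 with h2 | h2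
  · refine Or.inl ⟨?_, ?_⟩
    · by_contra hcon
      have : q.1 < R.u' := hn.1 (by linarith)
      exact hqn ⟨lt_of_le_of_ne (not_lt.1 hcon) fun h => hqx (by linarith), this⟩
    · by_cases hreg : R.pt R.u t ∈ S.expDom R.center
      · exact Or.inr (hend R.u (Or.inl rfl) h2.symm hreg)
      · left
        by_contra hne
        exact hreg ((hL.mem_iff t ht).2 hne)
  · rcases eq_or_lt_of_le hx.2 with h3 | h3
    · refine Or.inr ⟨?_, ?_⟩
      · by_contra hcon
        exact hqn ⟨hn.2 h2, lt_of_le_of_ne (not_lt.1 hcon) fun h => hqx (by linarith)⟩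
      · by_cases hreg : R.pt R.u' t ∈ S.expDom R.center
        · exact Or.inr (hend R.u' (Or.inr rfl) h3 hreg)
        · left
          by_contra hne
          exact hreg ((hR.mem_iff t ht).2 hne)
    · exact absurd ⟨hn.2 h2, hn.1 h3⟩ hqn

/-- At a regular bottom point the segment is horizontal in the developing map. A singular bottom
point is an endpoint of the segment, so nearby parameters in `[a, b]` are that endpoint or abscissae
inside the rectangle. -/
theorem eventually_bottom (hv : IsVert v) {aL aR : ℝ} (hL : R.SideHeight R.u aL)
    (hR : R.SideHeight R.u' aR) {x t : ℝ} (hx : x ∈ Icc R.u R.u') (ht : t ∈ Icc 0 R.h) :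
    ∀ᶠ q : ℝ × ℝ in 𝓝 (x, t), q.2 = 0 → R.pt q.1 q.2 ∈ S.expDom R.center → q.1 ∈ Icc I.a I.b →
      S.expMap R.center (R.pt q.1 q.2) = I.ι q.1 := by
  have hlt := R.lt
  have hside : ∀ w, w = R.u ∨ w = R.u' → w ∈ Icc I.a I.b := fun w hw => R.side_mem hw
  have hxI : x ∈ Icc I.a I.b :=
    ⟨(hside _ (Or.inl rfl)).1.trans hx.1, hx.2.trans (hside _ (Or.inr rfl)).2⟩
  rcases eq_or_ne t 0 with rfl | ht0
  swap
  · filter_upwards [(continuous_snd.tendsto (x, t)).eventually (isOpen_ne.mem_nhds ht0)] with q h1 h2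
    exact absurd h2 h1
  have hint : ∀ y ∈ Ioo R.u R.u', S.expMap R.center (R.pt y 0) = I.ι y := by
    intro y hy
    rw [(R.interior hv hy ht).2]
    simp [expMap_zero (ι_notMem_sing (R.sub hy))]
  by_cases hreg : R.pt x 0 ∈ S.expDom R.center
  · have h0 : S.expMap R.center (R.pt x 0) = I.ι x := by
      rcases eq_or_lt_of_le hx.1 with h2 | h2
      · rw [← h2] at hreg ⊢
        exact R.expMap_bottom hv (Or.inl rfl) hreg
      · rcases eq_or_lt_of_le hx.2 with h3 | h3
        · rw [h3] at hreg ⊢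
          exact R.expMap_bottom hv (Or.inr rfl) hreg
        · exact hint x ⟨h2, h3⟩
    have h1 := eventually_nhdsWithin_iff.1 (eventually_ι_eq (devAt_expMap hreg) hxI h0)
    filter_upwards [(continuous_fst.tendsto (x, (0 : ℝ))).eventually h1] with q hq hq0 _ hqI
    rw [hq hqI, hq0]
    congr 1
    unfold pt; push_cast; ring
  · obtain ⟨w, a, hwa, rfl, ha⟩ := (regular_or_side hv hL hR hx ht).resolve_left hreg
    have hw : x = R.u ∨ x = R.u' := hwa.imp And.left And.left
    have hsing := R.sing_of_bottom hv hw hreg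
    have hxn : x ∉ Ioo I.a I.b := fun h => ι_notMem_sing h hsing
    have hev : ∀ᶠ q : ℝ × ℝ in 𝓝 (x, (0 : ℝ)), q.1 ∈ Icc I.a I.b → q.1 ∈ Ioo R.u R.u' ∨ q.1 = x := by
      have hua := (hside R.u (Or.inl rfl))
      have hub := (hside R.u' (Or.inr rfl))
      rcases hw with rfl | rfl
      · have hxa : R.u = I.a := (eq_or_eq_of_notMem_Ioo hxI hxn).resolve_right (by
          intro h; linarith [hub.2])
        filter_upwards [(continuous_fst.tendsto (R.u, (0 : ℝ))).eventually (gt_mem_nhds hlt)]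
          with q h1 h2
        rcases eq_or_lt_of_le (hxa ▸ h2.1) with h | h
        · exact Or.inr h.symm
        · exact Or.inl ⟨h, h1⟩
      · have hxb : R.u' = I.b := (eq_or_eq_of_notMem_Ioo hxI hxn).resolve_left (by
          intro h; linarith [hua.1])
        filter_upwards [(continuous_fst.tendsto (R.u', (0 : ℝ))).eventually (lt_mem_nhds hlt)]
          with q h1 h2
        rcases eq_or_lt_of_le (hxb ▸ h2.2) with h | h
        · exact Or.inr h
        · exact Or.inl ⟨h1, h⟩
    filter_upwards [hev] with q hq hq0 hqd hqI
    rw [hq0] at hqd ⊢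
    rcases hq hqI with h | h
    · exact hint _ h
    · rw [h] at hqd
      exact absurd hqd hreg

/-- The height at which the singular point of a side lies, moved into `[0, h]`. -/
noncomputable def clip (R : I.Rect v) (a : ℝ) : ℝ := max 0 (min R.h a)

theorem clip_mem (a : ℝ) : R.clip a ∈ Icc 0 R.h :=
  ⟨le_max_left _ _, max_le R.h_pos.le (min_le_left _ _)⟩

theorem clip_eq {a : ℝ} (ha : a ∈ Icc 0 R.h) : R.clip a = a := by
  rw [clip, min_eq_right ha.2, max_eq_right ha.1]

theorem clip_of_le {a : ℝ} (ha : a ≤ 0) : R.clip a = 0 := by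
  rw [clip, min_eq_right (ha.trans R.h_pos.le), max_eq_left ha]

theorem clip_of_ge {a : ℝ} (ha : R.h ≤ a) : R.clip a = R.h := by
  rw [clip, min_eq_left ha, max_eq_right R.h_pos.le]

/-- The cones over the singular points of the sides. -/
structure MemCone (R : I.Rect v) (aL aR ε x t : ℝ) : Prop where
  mem : t ∈ Icc 0 R.h
  le : R.u - ε * |t - R.clip aL| ≤ x
  ge : x ≤ R.u' + ε * |t - R.clip aR|

/-- The properties of the rectangle that persist on the cones. -/
structure IsMargin (R : I.Rect v) (aL aR ε : ℝ) : Prop where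
  pos : 0 < ε
  lt : ε * R.h < R.u' - R.u
  bot_mem : ∀ w, (w = R.u ∨ w = R.u') → w ∈ Ioo I.a I.b → ∀ x, |x - w| ≤ ε * R.h → x ∈ Ioo I.a I.b
  top_mem : ∀ w, (w = R.u ∨ w = R.u') → w + R.c ∈ Ioo I.a I.b → ∀ x, |x - w| ≤ ε * R.h →
    x + R.c ∈ Ioo I.a I.b
  dom : ∀ x t, R.MemCone aL aR ε x t → R.pt x t ∈ S.expDom R.center ∨ (x = R.u ∧ t = aL) ∨
    (x = R.u' ∧ t = aR)
  notMem : ∀ x t, R.MemCone aL aR ε x t → R.pt x t ∈ S.expDom R.center → t ∈ Ioo 0 R.h →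
    S.expMap R.center (R.pt x t) ∈ I.carrier →
      (x < R.u ∧ ∃ e, (e = I.a ∨ e = I.b) ∧ S.expMap R.center (R.pt R.u t) = I.ι e) ∨
      (R.u' < x ∧ ∃ e, (e = I.a ∨ e = I.b) ∧ S.expMap R.center (R.pt R.u' t) = I.ι e)
  bottom : ∀ x, R.MemCone aL aR ε x 0 → R.pt x 0 ∈ S.expDom R.center → x ∈ Icc I.a I.b →
    S.expMap R.center (R.pt x 0) = I.ι x
  top : ∀ x, R.MemCone aL aR ε x R.h → R.pt x R.h ∈ S.expDom R.center → x + R.c ∈ Icc I.a I.b →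
    S.expMap R.center (R.pt x R.h) = I.ι (x + R.c)

/-- The local statements hold uniformly on a margin of width `δ`, and the slope is chosen so that
cones stay within half of it. A lost ray leaves the singular point in the direction away from the
centre, with horizontal slope at least `(u' - u) / h`; the cone opens with a smaller slope, so they
meet only at the apex. -/
theorem exists_isMargin (hv : IsVert v) {aL aR : ℝ}
    (hL : R.SideHeight R.u aL) (hR : R.SideHeight R.u' aR) : ∃ ε, R.IsMargin aL aR ε := by
  have hh := R.h_pos
  have hlt := R.lt
  obtain ⟨δ₁, hδ₁, h1⟩ := exists_margin hlt.le (fun q hq =>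
    eventually_mem_expDom hv hL hR (x := q.1) (t := q.2) hq.1 hq.2)
  obtain ⟨δ₂, hδ₂, h2⟩ := exists_margin hlt.le (fun q hq =>
    eventually_notMem_carrier hv hL hR (x := q.1) (t := q.2) hq.1 hq.2)
  obtain ⟨δ₃, hδ₃, h3⟩ := exists_margin hlt.le (fun q hq =>
    eventually_bottom hv hL hR (x := q.1) (t := q.2) hq.1 hq.2)
  obtain ⟨δ₄, hδ₄, h4⟩ := exists_margin (u := R.flip.u) (u' := R.flip.u') (h := R.flip.h)
    R.flip.lt.le (fun q hq =>
      eventually_bottom hv.neg (hL.flip) (hR.flip) (x := q.1) (t := q.2) hq.1 hq.2)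
  have hseg : ∀ y : ℝ, ∃ ρ > 0, y ∈ Ioo I.a I.b → ∀ x, |x - y| < ρ → x ∈ Ioo I.a I.b := by
    intro y
    by_cases hy : y ∈ Ioo I.a I.b
    · obtain ⟨ρ, hρ, hsub⟩ := Metric.mem_nhds_iff.1 (isOpen_Ioo.mem_nhds hy)
      exact ⟨ρ, hρ, fun _ x hx => hsub (by rwa [Metric.mem_ball, Real.dist_eq])⟩
    · exact ⟨1, one_pos, fun h => absurd h hy⟩
  choose ρ hρ hseg using hseg
  set δ₅ := min (min (ρ R.u) (ρ R.u')) (min (ρ (R.u + R.c)) (ρ (R.u' + R.c))) with hδ₅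
  have hδ₅pos : 0 < δ₅ := lt_min (lt_min (hρ _) (hρ _)) (lt_min (hρ _) (hρ _))
  set δ := min (min (min δ₁ δ₂) δ₅) (min (min δ₃ δ₄) (R.u' - R.u)) with hδ
  have hδpos : 0 < δ := by
    have : 0 < R.u' - R.u := by linarith
    positivity
  have e6 : δ ≤ δ₅ := (min_le_left _ _).trans (min_le_right _ _)
  have e1 : δ ≤ δ₁ := (min_le_left _ _).trans ((min_le_left _ _).trans (min_le_left _ _))
  have e2 : δ ≤ δ₂ := (min_le_left _ _).trans ((min_le_left _ _).trans (min_le_right _ _))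
  have e3 : δ ≤ δ₃ := (min_le_right _ _).trans ((min_le_left _ _).trans (min_le_left _ _))
  have e4 : δ ≤ δ₄ := (min_le_right _ _).trans ((min_le_left _ _).trans (min_le_right _ _))
  have e5 : δ ≤ R.u' - R.u := (min_le_right _ _).trans (min_le_right _ _)
  -- With this value the excess `ε * h` of a cone over the rectangle is `δ / 2`, below every margin
  -- and below the width.
  set ε := δ / (2 * R.h) with hε
  have hεpos : 0 < ε := by positivity
  have hεh : ε * R.h = δ / 2 := by rw [hε]; field_simp
  have hbd : ∀ x t, R.MemCone aL aR ε x t → R.u - δ < x ∧ x < R.u' + δ := by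
    intro x t ⟨ht, hle, hge⟩
    have hab : ∀ a, ε * |t - R.clip a| ≤ δ / 2 := by
      intro a
      have hc := R.clip_mem a
      rw [← hεh]
      refine mul_le_mul_of_nonneg_left ?_ hεpos.le
      rw [abs_le]
      constructor <;> linarith [ht.1, ht.2, hc.1, hc.2]
    exact ⟨by linarith [hab aL], by linarith [hab aR]⟩
  have hlt5 : ε * R.h < δ₅ := by linarith
  refine ⟨ε, hεpos, by linarith, ?_, ?_, ?_, ?_, ?_, ?_⟩
  · rintro w hw hwI x hx
    refine hseg w hwI x (hx.trans_lt (hlt5.trans_le ?_))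
    rcases hw with rfl | rfl
    · exact (min_le_left _ _).trans (min_le_left _ _)
    · exact (min_le_left _ _).trans (min_le_right _ _)
  · rintro w hw hwI x hx
    refine hseg _ hwI (x + R.c) ?_
    rw [add_sub_add_right_eq_sub]
    refine hx.trans_lt (hlt5.trans_le ?_)
    rcases hw with rfl | rfl
    · exact (min_le_right _ _).trans (min_le_left _ _)
    · exact (min_le_right _ _).trans (min_le_right _ _)
  · intro x t hx
    have hb := hbd x t hx
    rcases h1 x t hx.mem (by linarith) (by linarith) with h | ⟨w, a, hwa, ha, l, hl, hlz⟩
    · exact Or.inl h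
    right
    rw [R.pt_eq_add] at hlz
    have h5 : (((t - a) - l * (a - R.h / 2) : ℝ) : ℂ) * v
        = ((l * (w - (R.u + R.u') / 2) - (x - w) : ℝ) : ℂ) := by
      unfold pt at hlz; push_cast at hlz ⊢; linear_combination hlz
    obtain ⟨h6, h7⟩ := hv.eq_zero h5
    have h8 : |t - a| ≤ l * (R.h / 2) := by
      rw [show t - a = l * (a - R.h / 2) by linarith, abs_mul, abs_of_nonneg hl]
      refine mul_le_mul_of_nonneg_left ?_ hl
      rw [abs_le]; constructor <;> linarith [ha.1, ha.2]
    have h9 : ε * |t - a| ≤ l * (δ / 4) := by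
      calc ε * |t - a| ≤ ε * (l * (R.h / 2)) := mul_le_mul_of_nonneg_left h8 hεpos.le
        _ = l * (ε * R.h / 2) := by ring
        _ = l * (δ / 4) := by rw [hεh]; ring
    -- Going along the lost ray by `l` moves the abscissa outwards by `l * (u' - u) / 2`, while the
    -- cone only allows `l * δ / 4`.
    have hl0 : l = 0 := by
      by_contra hne
      have hlpos : 0 < l := lt_of_le_of_ne hl (Ne.symm hne)
      have h10 : l * (δ / 4) < l * ((R.u' - R.u) / 2) := mul_lt_mul_of_pos_left (by linarith) hlpos
      rcases hwa with ⟨rfl, rfl⟩ | ⟨rfl, rfl⟩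
      · have := hx.le
        rw [clip_eq ha] at this
        nlinarith
      · have := hx.ge
        rw [clip_eq ha] at this
        nlinarith
    rw [hl0] at h6 h7
    rcases hwa with ⟨rfl, rfl⟩ | ⟨rfl, rfl⟩
    · exact Or.inl ⟨by linarith, by linarith⟩
    · exact Or.inr ⟨by linarith, by linarith⟩
  · intro x t hx hd ht hc
    have hb := hbd x t hx
    rcases h2 x t hx.mem (by linarith) (by linarith) hd ht hc with ⟨h5, h6⟩ | ⟨h5, h6⟩
    · refine Or.inl ⟨h5, h6.resolve_left fun h => ?_⟩
      have h7 := hx.le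
      rw [clip_eq (h ▸ hx.mem), show t - aL = 0 by linarith, abs_zero] at h7
      linarith
    · refine Or.inr ⟨h5, h6.resolve_left fun h => ?_⟩
      have h7 := hx.ge
      rw [clip_eq (h ▸ hx.mem), show t - aR = 0 by linarith, abs_zero] at h7
      linarith
  · intro x hx hd hxI
    have hb := hbd x 0 hx
    exact h3 x 0 hx.mem (by linarith) (by linarith) rfl hd hxI
  · intro x hx hd hxI
    have hb := hbd x R.h hx
    have h5 := R.flip_pt x R.h
    rw [sub_self] at h5
    have h6 := h4 (x + R.c) 0 ⟨le_rfl, hh.le⟩ (by simp only [flip]; linarith)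
      (by simp only [flip]; linarith) rfl (by rw [h5, R.flip_center]; exact hd) hxI
    rw [h5, R.flip_center] at h6
    exact h6

end Rect

end HorizontalSegment

end TranslationSurface

/-! ### Holonomy from the segment to the singular points -/

namespace TranslationSurface

variable {M : Type*} [TopologicalSpace M] {S : TranslationSurface M} [T2Space M]

section Holonomy

variable {Y : M → ℂ} {r : ℕ∞} {ε : ℝ}

theorem IsGraphField.mono {ε' : ℝ} (hY : S.IsGraphField r ε Y) (h : ε ≤ ε') :
    S.IsGraphField r ε' Y :=
  ⟨hY.contDiffOn, hY.im_eq, fun p hp => (hY.abs_re_le p hp).trans h, hY.eq_vertical⟩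

/-- Where a straight segment ends at a singular point, the field is vertical. -/
theorem IsGraphField.eventually_eq_vertical [CompactSpace M] (hY : S.IsGraphField r ε Y) {p : M}
    {ζ : ℂ} (hζ : ζ ≠ 0) (h1 : ∀ θ ∈ Ico (0 : ℝ) 1, (θ : ℂ) * ζ ∈ S.expDom p) (hs : ζ ∉ S.expDom p) :
    ∀ᶠ z in 𝓝 ζ, z ∈ S.expDom p → Y (S.expMap p z) = Complex.I := by
  obtain ⟨A, hlim, hA⟩ := exists_tendsto_expMap one_pos h1
  have hAs : A ∈ S.sing := by
    by_contra h
    exact hs (by simpa using (hA h).1)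
  obtain ⟨κ, φ, hφ⟩ := exists_isRamChart (S := S) A
  obtain ⟨Ψ, ρ, hρ, hΨA, hΨc, hΨ⟩ := exists_sector hζ h1 hlim hφ
  have h2 : ∀ᶠ q in 𝓝 (Ψ ζ), q ∉ S.sing → Y q = Complex.I := by
    rw [hΨA]; exact hY.eq_vertical A hAs
  filter_upwards [Metric.ball_mem_nhds _ hρ, hΨc.eventually h2] with z hz h3 hzd
  have h4 := ((hΨ z hz).2.2 (mem_slitPlane_of_mem_expDom hζ hs hzd)).2.1
  have h5 := (devAt_expMap hzd).notMem_sing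
  rw [h4] at h5 ⊢
  exact h3 h5

section Singular

variable {F : ℝ → ℝ → ℝ} {C L : NNReal} {p₀ : M} {z₀ : ℂ}

/-- Where the field is vertical, solutions are constant and germs are trivial. This lets a holonomy
to a singular point be stopped at any small distance from it with the same jet. -/
theorem _root_.IsGlobalField.exists_germ_eq_one (hF : IsGlobalField F C L)
    (hr : ContDiff ℝ (r : WithTop ℕ∞) (Function.uncurry F)) {a w : ℝ}
    (h0 : ∀ᶠ q : ℝ × ℝ in 𝓝 (w, a), F q.2 q.1 = 0) :
    ∃ ρ > 0, ∀ s t, |s - a| < ρ → |t - a| < ρ → hF.sol s t w = w ∧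
      (QuotientGroup.mk (hF.germ hr s t w) : JetGroup r) = 1 := by
  rw [nhds_prod_eq, eventually_prod_iff] at h0
  obtain ⟨P, hP, Q, hQ, hPQ⟩ := h0
  obtain ⟨ρ, hρ, hsub⟩ := Metric.eventually_nhds_iff.1 hQ
  have hu : ∀ s t, |s - a| < ρ → |t - a| < ρ → ∀ u ∈ uIcc s t, Q u := by
    intro s t hs ht u hu
    refine hsub ?_
    rw [Real.dist_eq]
    rw [abs_lt] at hs ht ⊢
    rcases le_total s t with h | h
    · rw [uIcc_of_le h] at hu
      constructor <;> linarith [hu.1, hu.2]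
    · rw [uIcc_of_ge h] at hu
      constructor <;> linarith [hu.1, hu.2]
  refine ⟨ρ, hρ, fun s t hs ht => ⟨hF.sol_eq_const fun u hut => ?_, hF.mk_germ_eq_one hr ?_⟩⟩
  · exact hPQ hP.self_of_nhds (hu s t hs ht u hut)
  · filter_upwards [hP] with y hy u hut
    exact hPQ hy (hu s t hs ht u hut)

/-- The holonomy along a curve that goes up to a singular point. -/
theorem IsGraphField.holRel_to_singular (hY : S.IsGraphField r ε Y) (hF : IsGlobalField F C L)
    (hr : ContDiff ℝ (r : WithTop ℕ∞) (Function.uncurry F)) {t₀ a w : ℝ} (ht : t₀ < a)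
    (hd : ∀ t ∈ Ico t₀ a, ((hF.sol a t w : ℝ) : ℂ) + t * Complex.I - z₀ ∈ S.expDom p₀)
    (hFf : ∀ t ∈ Ico t₀ a, ∀ᶠ w in 𝓝 (((hF.sol a t w : ℝ) : ℂ) + t * Complex.I),
      F w.im w.re = S.graphField Y p₀ z₀ w)
    (h0 : ∀ᶠ q : ℝ × ℝ in 𝓝 (w, a), F q.2 q.1 = 0) :
    ∀ᶠ η in 𝓝[>] (0 : ℝ), ∃ f : JetDiff r,
      (QuotientGroup.mk f : JetGroup r) = QuotientGroup.mk (hF.germ hr t₀ a (hF.sol a t₀ w)) ∧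
      S.HolRel Y (S.expMap p₀ (((hF.sol a t₀ w : ℝ) : ℂ) + t₀ * Complex.I - z₀))
        (S.expMap p₀ (w + (a - η : ℝ) * Complex.I - z₀)) (a - η - t₀) f := by
  obtain ⟨ρ, hρ, hρ'⟩ := hF.exists_germ_eq_one hr h0
  filter_upwards [Ioo_mem_nhdsGT (lt_min hρ (sub_pos.2 ht))] with η hη
  have hη1 : η < ρ := hη.2.trans_le (min_le_left _ _)
  have hη2 : η < a - t₀ := hη.2.trans_le (min_le_right _ _)
  have h1 := hρ' a (a - η) (by simpa using hρ) (by simpa [abs_of_pos hη.1] using hη1)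
  have h2 := hρ' (a - η) a (by simpa [abs_of_pos hη.1] using hη1) (by simpa using hρ)
  have h3 : ∀ t, hF.sol t₀ t (hF.sol a t₀ w) = hF.sol a t w := fun t => hF.sol_sol ..
  refine ⟨hF.germ hr t₀ (a - η) (hF.sol a t₀ w), ?_, ?_⟩
  · rw [← hF.germ_mul hr t₀ (a - η) a, QuotientGroup.mk_mul, h3, h1.1, h2.2, one_mul]
  · have h4 := hY.holRel_sol (p₀ := p₀) (z₀ := z₀) hF hr (t₁ := t₀) (t₂ := a - η)
      (x := hF.sol a t₀ w) (by linarith)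
      (fun t ht => by rw [h3]; exact hd t ⟨ht.1, by linarith [ht.2, hη.1]⟩)
      (fun t ht => by rw [h3]; exact hFf t ⟨ht.1, by linarith [ht.2, hη.1]⟩)
    rwa [h3, h1.1] at h4

/-- The holonomy along a curve that goes down to a singular point. -/
theorem IsGraphField.holRel_from_singular (hY : S.IsGraphField r ε Y) (hF : IsGlobalField F C L)
    (hr : ContDiff ℝ (r : WithTop ℕ∞) (Function.uncurry F)) {t₁ a w : ℝ} (ht : a < t₁)
    (hd : ∀ t ∈ Ioc a t₁, ((hF.sol a t w : ℝ) : ℂ) + t * Complex.I - z₀ ∈ S.expDom p₀)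
    (hFf : ∀ t ∈ Ioc a t₁, ∀ᶠ w in 𝓝 (((hF.sol a t w : ℝ) : ℂ) + t * Complex.I),
      F w.im w.re = S.graphField Y p₀ z₀ w)
    (h0 : ∀ᶠ q : ℝ × ℝ in 𝓝 (w, a), F q.2 q.1 = 0) :
    ∀ᶠ η in 𝓝[>] (0 : ℝ), ∃ f : JetDiff r,
      (QuotientGroup.mk f : JetGroup r) = QuotientGroup.mk (hF.germ hr a t₁ w) ∧
      S.HolRel Y (S.expMap p₀ (w + (a + η : ℝ) * Complex.I - z₀))
        (S.expMap p₀ (((hF.sol a t₁ w : ℝ) : ℂ) + t₁ * Complex.I - z₀)) (t₁ - (a + η)) f := by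
  obtain ⟨ρ, hρ, hρ'⟩ := hF.exists_germ_eq_one hr h0
  filter_upwards [Ioo_mem_nhdsGT (lt_min hρ (sub_pos.2 ht))] with η hη
  have hη1 : η < ρ := hη.2.trans_le (min_le_left _ _)
  have hη2 : η < t₁ - a := hη.2.trans_le (min_le_right _ _)
  have h1 := hρ' a (a + η) (by simpa using hρ) (by simpa [abs_of_pos hη.1] using hη1)
  have h3 : ∀ t, hF.sol (a + η) t w = hF.sol a t w := fun t => by
    have := hF.sol_sol a (a + η) t w
    rwa [h1.1] at this
  refine ⟨hF.germ hr (a + η) t₁ w, ?_, ?_⟩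
  · rw [← hF.germ_mul hr a (a + η) t₁, QuotientGroup.mk_mul, h1.1, h1.2, mul_one]
  · have h4 := hY.holRel_sol (p₀ := p₀) (z₀ := z₀) hF hr (t₁ := a + η) (t₂ := t₁)
      (x := w) (by linarith)
      (fun t ht => by rw [h3]; exact hd t ⟨by linarith [ht.1, hη.1], ht.2⟩)
      (fun t ht => by rw [h3]; exact hFf t ⟨by linarith [ht.1, hη.1], ht.2⟩)
    rwa [h3] at h4

end Singular

namespace HorizontalSegment

variable {I : S.HorizontalSegment}

variable (I) in
/-- The germ `g` describes how the integral curves go from a neighbourhood of `ι x` to a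
neighbourhood of the singular point at the signed height `a` on the vertical leaf of `ι w`, where
the field is vertical. -/
def Holonomy (Y : M → ℂ) (x w a : ℝ) (g : JetGroup r) : Prop :=
  (0 < a ∧ ∀ᶠ η in 𝓝[>] (0 : ℝ), ∃ f : JetDiff r, (QuotientGroup.mk f : JetGroup r) = g ∧
    S.HolRel Y (I.ι x) (S.expMap (I.ι w) ((a - η : ℝ) * Complex.I)) (a - η) f) ∨
  (a < 0 ∧ ∀ᶠ η in 𝓝[>] (0 : ℝ), ∃ f : JetDiff r, (QuotientGroup.mk f : JetGroup r) = g⁻¹ ∧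
    S.HolRel Y (S.expMap (I.ι w) ((a + η : ℝ) * Complex.I)) (I.ι x) (-(a + η)) f) ∨
  (a = 0 ∧ x = w ∧ g = 1)

/-- For a small common `η` both holonomies relate the segment to the same regular point near the
singular one. Since the vertical component is `1`, the durations agree as well, and uniqueness of
integral curves applies. -/
theorem Holonomy.unique (hY : S.IsC1Field Y) {x x' w a : ℝ} {g g' : JetGroup r}
    (hx : x ∈ Icc I.a I.b) (hx' : x' ∈ Icc I.a I.b) (h : I.Holonomy Y x w a g)
    (h' : I.Holonomy Y x' w a g') : x = x' ∧ g = g' := by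
  rcases h with ⟨h1, h2⟩ | ⟨h1, h2⟩ | ⟨h1, h2, h3⟩ <;>
    rcases h' with ⟨h1', h2'⟩ | ⟨h1', h2'⟩ | ⟨h1', h2', h3'⟩ <;> try (exfalso; linarith)
  · obtain ⟨η, ⟨⟨f, rfl, hf⟩, f', rfl, hf'⟩, hη⟩ := ((h2.and h2').and (Ioo_mem_nhdsGT h1)).exists
    obtain ⟨e1, e2⟩ := hf.unique_left hY (by linarith [hη.2]) hf'
    exact ⟨I.injOn hx hx' e1, e2⟩
  · obtain ⟨η, ⟨⟨f, e, hf⟩, f', e', hf'⟩, hη⟩ :=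
      ((h2.and h2').and (Ioo_mem_nhdsGT (neg_pos.2 h1))).exists
    obtain ⟨e1, e2⟩ := hf.unique_right hY (by linarith [hη.2]) hf'
    rw [e, e'] at e2
    exact ⟨I.injOn hx hx' e1, inv_injective e2⟩
  · exact ⟨h2.trans h2'.symm, h3.trans h3'.symm⟩

theorem Height.ne_sing_dom {x a : ℝ} (h : I.Height Complex.I x a) (ha : a ≠ 0) :
    (∀ t ∈ uIcc 0 a, t ≠ a → (t : ℂ) * Complex.I ∈ S.expDom (I.ι x)) ∧
      (a : ℂ) * Complex.I ∉ S.expDom (I.ι x) := by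
  rcases lt_or_gt_of_ne ha with h0 | h0
  · have hE := h.ends_neg h0
    refine ⟨fun t ht hta => ?_, fun hcon => hE.not_mem_expDom le_rfl (by simpa using hcon)⟩
    rw [uIcc_of_ge h0.le] at ht
    have := hE.2.1 (-t) ⟨by linarith [ht.2], by
      have := lt_of_le_of_ne ht.1 (Ne.symm hta); linarith⟩
    simpa using this
  · have hE := h.ends h0
    refine ⟨fun t ht hta => ?_, fun hcon => hE.not_mem_expDom le_rfl hcon⟩
    rw [uIcc_of_le h0.le] at ht
    exact hE.2.1 t ⟨ht.1, lt_of_le_of_ne ht.2 hta⟩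

theorem Height.mem_separatrixSegments {e a t : ℝ} (he : e = I.a ∨ e = I.b)
    (h : I.Height Complex.I e a) (ht : t ∈ uIcc 0 a) (hta : t ≠ a) :
    S.expMap (I.ι e) (t * Complex.I) ∈ I.separatrixSegments := by
  rcases lt_trichotomy a 0 with h0 | rfl | h0
  · rw [uIcc_of_ge h0.le] at ht
    have := (h.ends_neg h0).mem_separatrixSegments (Or.inr rfl) he (t := -t) ⟨by linarith [ht.2], by
      have := lt_of_le_of_ne ht.1 (Ne.symm hta); linarith⟩
    simpa using this
  · exact absurd (by simpa using ht) hta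
  · rw [uIcc_of_le h0.le] at ht
    exact (h.ends h0).mem_separatrixSegments (Or.inl rfl) he ⟨ht.1, lt_of_le_of_ne ht.2 hta⟩

/-- The field is vertical on the separatrix of an endpoint, so this separatrix is still an integral
curve: in the developing map at `ι e` the constant `e` is a solution up to the singular height. -/
theorem Height.exists_holonomy [CompactSpace M] (hr : 1 ≤ r) (hε : 0 ≤ ε)
    (hY : S.IsGraphField r ε Y) (hsep : ∀ p ∈ I.separatrixSegments, Y p = Complex.I) {e a : ℝ}
    (he : e = I.a ∨ e = I.b) (h : I.Height Complex.I e a) :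
    ∃ g : JetGroup r, I.Holonomy Y e e a g := by
  rcases eq_or_ne a 0 with rfl | ha
  · exact ⟨1, Or.inr (Or.inr ⟨rfl, rfl, rfl⟩)⟩
  obtain ⟨hdom, hsing⟩ := h.ne_sing_dom ha
  have hev : ∀ᶠ z in 𝓝 ((a : ℂ) * Complex.I), z ∈ S.expDom (I.ι e) →
      Y (S.expMap (I.ι e) z) = Complex.I := by
    refine hY.eventually_eq_vertical (by simp [ha]) (fun θ hθ => ?_) hsing
    have h1 := hdom (θ * a) (by
      rcases le_total 0 a with h0 | h0
      · rw [uIcc_of_le h0]; constructor <;> nlinarith [hθ.1, hθ.2]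
      · rw [uIcc_of_ge h0]; constructor <;> nlinarith [hθ.1, hθ.2]) (fun h => hθ.2.ne (by
        field_simp at h; exact h))
    rw [← mul_assoc]
    exact_mod_cast h1
  set K : Set ℂ := (fun t : ℝ => (e : ℂ) + t * Complex.I) '' uIcc 0 a with hK
  have hev' : ∀ᶠ w : ℂ in 𝓝 ((e : ℂ) + a * Complex.I), w - e ∈ S.expDom (I.ι e) →
      Y (S.expMap (I.ι e) (w - e)) = Complex.I := by
    have h1 : Tendsto (fun w : ℂ => w - e) (𝓝 ((e : ℂ) + a * Complex.I)) (𝓝 ((a : ℂ) * Complex.I)) := by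
      have : Continuous fun w : ℂ => w - e := by fun_prop
      simpa using this.tendsto ((e : ℂ) + a * Complex.I)
    exact h1.eventually hev
  obtain ⟨F, L, hF, hFr, hFf⟩ := hY.exists_isGlobalField hr hε (I.ι e) e (K := K)
    (isCompact_uIcc.image (by fun_prop)) (by
      rintro _ ⟨t, ht, rfl⟩
      rcases eq_or_ne t a with rfl | hta
      · exact Or.inr hev'
      · left
        simpa using hdom t ht hta)
  have hFt : ∀ t ∈ uIcc 0 a, ∀ᶠ w in 𝓝 ((e : ℂ) + t * Complex.I),
      F w.im w.re = S.graphField Y (I.ι e) e w := fun t ht => hFf _ ⟨t, ht, rfl⟩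
  have h0 : ∀ᶠ q : ℝ × ℝ in 𝓝 (e, a), F q.2 q.1 = 0 := by
    have hc : Tendsto (fun q : ℝ × ℝ => (q.1 : ℂ) + q.2 * Complex.I) (𝓝 (e, a))
        (𝓝 ((e : ℂ) + a * Complex.I)) := by
      have : Continuous fun q : ℝ × ℝ => (q.1 : ℂ) + q.2 * Complex.I := by fun_prop
      exact this.tendsto (e, a)
    filter_upwards [hc.eventually hev', hc.eventually (hFt a right_mem_uIcc)] with q h1 h2
    have h3 : F q.2 q.1 = S.graphField Y (I.ι e) e (q.1 + q.2 * Complex.I) := by simpa using h2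
    rw [h3]
    by_cases hd : (q.1 : ℂ) + q.2 * Complex.I - e ∈ S.expDom (I.ι e)
    · rw [graphField_eq hd, h1 hd, Complex.I_re]
    · exact if_neg hd
  have hF0 : ∀ t ∈ uIcc 0 a, F t e = 0 := by
    intro t ht
    rcases eq_or_ne t a with rfl | hta
    · exact h0.self_of_nhds
    · have h1 := (hFt t ht).self_of_nhds
      have h2 : F t e = S.graphField Y (I.ι e) e (e + t * Complex.I) := by simpa using h1
      rw [h2, graphField_eq (by simpa using hdom t ht hta), add_sub_cancel_left,
        hsep _ (h.mem_separatrixSegments he ht hta), Complex.I_re]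
  have hsol : ∀ t ∈ uIcc 0 a, hF.sol a t e = e := fun t ht => hF.sol_eq_const fun u hu =>
    hF0 u (uIcc_subset_uIcc right_mem_uIcc ht hu)
  have hι : I.ι e ∉ S.sing := by
    rcases lt_or_gt_of_ne ha with h1 | h1
    · exact (h.ends_neg h1).notMem_sing
    · exact (h.ends h1).notMem_sing
  rcases lt_or_gt_of_ne ha with hlt | hlt
  · have h1 := hY.holRel_from_singular (p₀ := I.ι e) (z₀ := e) hF hFr (t₁ := 0) (a := a) (w := e) hlt
      (fun t ht => by
        have ht' : t ∈ uIcc 0 a := by rw [uIcc_of_ge hlt.le]; exact Ioc_subset_Icc_self ht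
        rw [hsol t ht']
        simpa using hdom t ht' ht.1.ne')
      (fun t ht => by
        have ht' : t ∈ uIcc 0 a := by rw [uIcc_of_ge hlt.le]; exact Ioc_subset_Icc_self ht
        rw [hsol t ht']
        exact hFt t ht') h0
    refine ⟨(QuotientGroup.mk (hF.germ hFr a 0 e) : JetGroup r)⁻¹, Or.inr (Or.inl ⟨hlt, ?_⟩)⟩
    filter_upwards [h1] with η ⟨f, hf, hf'⟩
    refine ⟨f, by rw [hf, inv_inv], ?_⟩
    rw [hsol 0 left_mem_uIcc] at hf'
    simpa [expMap_zero hι] using hf'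
  · have h1 := hY.holRel_to_singular (p₀ := I.ι e) (z₀ := e) hF hFr (t₀ := 0) (a := a) (w := e) hlt
      (fun t ht => by
        have ht' : t ∈ uIcc 0 a := by rw [uIcc_of_le hlt.le]; exact Ico_subset_Icc_self ht
        rw [hsol t ht']
        simpa using hdom t ht' ht.2.ne)
      (fun t ht => by
        have ht' : t ∈ uIcc 0 a := by rw [uIcc_of_le hlt.le]; exact Ico_subset_Icc_self ht
        rw [hsol t ht']
        exact hFt t ht') h0
    refine ⟨QuotientGroup.mk (hF.germ hFr 0 a (hF.sol a 0 e)), Or.inl ⟨hlt, ?_⟩⟩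
    filter_upwards [h1] with η ⟨f, hf, hf'⟩
    refine ⟨f, hf, ?_⟩
    rw [hsol 0 left_mem_uIcc] at hf'
    simpa [expMap_zero hι] using hf'

/-- A curve that leaves from the same point as a curve that ends in a singular point cannot outlive
it. -/
theorem _root_.TranslationSurface.IsC1Field.lt_of_tendsto_sing (hY : S.IsC1Field Y) {γ σ : ℝ → M}
    {τ ℓ : ℝ} (hℓ : 0 < ℓ) (hγ : S.IsIntegralCurve Y γ (Icc 0 τ))
    (hσ : S.IsIntegralCurve Y σ (Ico 0 ℓ)) (h0 : γ 0 = σ 0) {A : M} (hA : A ∈ S.sing)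
    (hlim : Tendsto σ (𝓝[<] ℓ) (𝓝 A)) : τ < ℓ ∧ EqOn γ σ (Icc 0 τ) := by
  have hlt : τ < ℓ := by
    by_contra hcon
    have hle : ℓ ≤ τ := not_lt.1 hcon
    have heq : EqOn γ σ (Ico 0 ℓ) := hY.eqOn ordConnected_Ico
      (hγ.mono fun t ht => ⟨ht.1, ht.2.le.trans hle⟩) hσ ⟨le_rfl, hℓ⟩ h0
    have h1 : Tendsto γ (𝓝[<] ℓ) (𝓝 (γ ℓ)) := by
      refine (hγ.1 ℓ ⟨hℓ.le, hle⟩).tendsto.mono_left ?_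
      rw [← nhdsWithin_Ico_eq_nhdsLT hℓ]
      exact nhdsWithin_mono _ fun t ht => ⟨ht.1, ht.2.le.trans hle⟩
    have h2 : Tendsto γ (𝓝[<] ℓ) (𝓝 A) := by
      refine hlim.congr' ?_
      filter_upwards [Ioo_mem_nhdsLT hℓ] with t ht
      exact (heq ⟨ht.1.le, ht.2⟩).symm
    have h3 := tendsto_nhds_unique h1 h2
    exact (hγ.2 ℓ ⟨hℓ.le, hle⟩).1 (h3 ▸ hA)
  exact ⟨hlt, hY.eqOn_Icc hγ (hσ.mono fun t ht => ⟨ht.1, ht.2.trans_lt hlt⟩) h0⟩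

end HorizontalSegment

end Holonomy

end TranslationSurface

namespace TranslationSurface

variable {M : Type*} [TopologicalSpace M] {S : TranslationSurface M} [T2Space M] [CompactSpace M]

namespace HorizontalSegment

variable {I : S.HorizontalSegment}

namespace Rect

/-! ### The flow of a field in a neighbourhood of a rectangle -/

/-- The coordinate of the centre of the rectangle. -/
noncomputable def base {v : ℂ} (R : I.Rect v) : ℂ :=
  (((R.u + R.u') / 2 : ℝ) : ℂ) + ((R.h / 2 : ℝ) : ℂ) * Complex.I

variable {R : I.Rect Complex.I} {r : ℕ∞} {Y : M → ℂ} {aL aR : ℝ} {ε L : NNReal} {F : ℝ → ℝ → ℝ}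
  {w a t x : ℝ}

theorem add_sub_base (R : I.Rect Complex.I) (x t : ℝ) :
    (x : ℂ) + t * Complex.I - R.base = R.pt x t := by
  unfold base pt; push_cast; ring

/-- `F` is a global extension of the field `Y` read near the rectangle. -/
structure IsAdapted (R : I.Rect Complex.I) (r : ℕ∞) (Y : M → ℂ) (aL aR : ℝ) (ε : NNReal)
    (F : ℝ → ℝ → ℝ) (L : NNReal) : Prop where
  left : R.SideHeight R.u aL
  right : R.SideHeight R.u' aR
  margin : R.IsMargin aL aR ε
  field : S.IsGraphField r ε Y
  sep : ∀ p ∈ I.separatrixSegments, Y p = Complex.I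
  global : IsGlobalField F ε L
  contDiff : ContDiff ℝ (r : WithTop ℕ∞) (Function.uncurry F)
  eq : ∀ x t, R.MemCone aL aR ε x t → ∀ᶠ z in 𝓝 ((x : ℂ) + t * Complex.I),
    F z.im z.re = S.graphField Y R.center R.base z

/-- The abscissa `w` is that of a side, the singular point of which has height `a`. -/
def IsSide (R : I.Rect Complex.I) (aL aR w a : ℝ) : Prop :=
  (w = R.u ∧ a = aL) ∨ (w = R.u' ∧ a = aR)

theorem IsSide.eq_or_eq (hs : R.IsSide aL aR w a) : w = R.u ∨ w = R.u' :=
  hs.imp And.left And.left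

theorem IsMargin.memCone (hm : R.IsMargin aL aR ε) (hs : R.IsSide aL aR w a) (ht : t ∈ Icc 0 R.h)
    (hx : |x - w| ≤ ε * |t - R.clip a|) : R.MemCone aL aR ε x t := by
  have hε : (0 : ℝ) ≤ ε := ε.2
  have h1 : ε * |t - R.clip a| ≤ ε * R.h := by
    refine mul_le_mul_of_nonneg_left ?_ hε
    have hc := R.clip_mem a
    rw [abs_le]
    constructor <;> linarith [ht.1, ht.2, hc.1, hc.2]
  have h2 : ∀ b, 0 ≤ ε * |t - R.clip b| := fun b => mul_nonneg hε (abs_nonneg _)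
  have hlt := hm.lt
  obtain ⟨h3, h4⟩ := abs_le.1 hx
  rcases hs with ⟨rfl, rfl⟩ | ⟨rfl, rfl⟩
  · exact ⟨ht, by linarith, by linarith [h2 aR]⟩
  · exact ⟨ht, by linarith [h2 aL], by linarith⟩

theorem eventually_eq_vertical (hY : S.IsGraphField r ε Y) {x t : ℝ} (hx : x = R.u ∨ x = R.u')
    (ht : t ∈ Icc 0 R.h) (hs : R.pt x t ∉ S.expDom R.center) :
    ∀ᶠ z in 𝓝 ((x : ℂ) + t * Complex.I), z - R.base ∈ S.expDom R.center →
      Y (S.expMap R.center (z - R.base)) = Complex.I := by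
  have hv : IsVert Complex.I := Or.inl rfl
  have hxI : x ∈ Icc R.u R.u' := by
    rcases hx with rfl | rfl
    · exact ⟨le_rfl, R.lt.le⟩
    · exact ⟨R.lt.le, le_rfl⟩
  have h1 := hY.eventually_eq_vertical (R.pt_ne_zero hv hx t) (fun θ hθ => by
    rw [R.smul_pt]
    have h2 := R.segment_mem hxI ht hθ
    exact (R.interior hv h2.1 h2.2).1) hs
  have hc : Continuous fun z : ℂ => z - R.base := by fun_prop
  have h2 := hc.tendsto ((x : ℂ) + t * Complex.I)
  rw [R.add_sub_base] at h2
  exact h2.eventually h1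

theorem isCompact_cones (R : I.Rect Complex.I) (aL aR : ℝ) (ε : NNReal) :
    IsCompact {q : ℝ × ℝ | R.MemCone aL aR ε q.1 q.2} := by
  have hcl : IsClosed {q : ℝ × ℝ | R.MemCone aL aR ε q.1 q.2} := by
    have h1 : {q : ℝ × ℝ | R.MemCone aL aR ε q.1 q.2} = ({q | q.2 ∈ Icc 0 R.h} ∩
        {q | R.u - ε * |q.2 - R.clip aL| ≤ q.1}) ∩ {q | q.1 ≤ R.u' + ε * |q.2 - R.clip aR|} := by
      ext q
      exact ⟨fun h => ⟨⟨h.mem, h.le⟩, h.ge⟩, fun h => ⟨h.1.1, h.1.2, h.2⟩⟩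
    rw [h1]
    refine ((isClosed_Icc.preimage continuous_snd).inter (isClosed_le ?_ ?_)).inter
      (isClosed_le ?_ ?_) <;> fun_prop
  refine ((isCompact_Icc (a := R.u - ε * R.h) (b := R.u' + ε * R.h)).prod
    (isCompact_Icc (a := 0) (b := R.h))).of_isClosed_subset hcl fun q hq => ?_
  have h1 : ∀ b, ε * |q.2 - R.clip b| ≤ ε * R.h := by
    intro b
    refine mul_le_mul_of_nonneg_left ?_ ε.2
    have hc := R.clip_mem b
    rw [abs_le]
    constructor <;> linarith [hq.mem.1, hq.mem.2, hc.1, hc.2]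
  exact ⟨⟨by linarith [hq.le, h1 aL], by linarith [hq.ge, h1 aR]⟩, hq.mem⟩

theorem exists_isAdapted (hr : 1 ≤ r) (hL : R.SideHeight R.u aL) (hR : R.SideHeight R.u' aR)
    (hm : R.IsMargin aL aR ε) (hY : S.IsGraphField r ε Y)
    (hsep : ∀ p ∈ I.separatrixSegments, Y p = Complex.I) :
    ∃ F L, R.IsAdapted r Y aL aR ε F L := by
  obtain ⟨F, L, hF, hFr, hFf⟩ := hY.exists_isGlobalField hr ε.2 R.center R.base
    (K := (fun q : ℝ × ℝ => (q.1 : ℂ) + q.2 * Complex.I) '' {q | R.MemCone aL aR ε q.1 q.2})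
    ((R.isCompact_cones aL aR ε).image (by fun_prop)) (by
      rintro _ ⟨⟨x, t⟩, hq, rfl⟩
      rw [R.add_sub_base]
      by_cases hreg : R.pt x t ∈ S.expDom R.center
      · exact Or.inl hreg
      · right
        refine eventually_eq_vertical hY ?_ hq.mem hreg
        exact ((hm.dom x t hq).resolve_left hreg).imp And.left And.left)
  exact ⟨F, L, hL, hR, hm, hY, hsep, hF, hFr, fun x t hq => hFf _ ⟨(x, t), hq, rfl⟩⟩

namespace IsAdapted

theorem sideHeight (hA : R.IsAdapted r Y aL aR ε F L) (hs : R.IsSide aL aR w a) :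
    R.SideHeight w a := by
  rcases hs with ⟨rfl, rfl⟩ | ⟨rfl, rfl⟩
  · exact hA.left
  · exact hA.right

theorem left_isSide (_ : R.IsAdapted r Y aL aR ε F L) : R.IsSide aL aR R.u aL :=
  Or.inl ⟨rfl, rfl⟩

theorem right_isSide (_ : R.IsAdapted r Y aL aR ε F L) : R.IsSide aL aR R.u' aR :=
  Or.inr ⟨rfl, rfl⟩

/-- The curve through the singular point of a side, or its vertical prolongation. -/
noncomputable def curve (hA : R.IsAdapted r Y aL aR ε F L) (w a t : ℝ) : ℝ :=
  hA.global.sol (R.clip a) t w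

theorem sol_curve (hA : R.IsAdapted r Y aL aR ε F L) (w a s t : ℝ) :
    hA.global.sol s t (hA.curve w a s) = hA.curve w a t := hA.global.sol_sol ..

theorem abs_curve_sub_le (hA : R.IsAdapted r Y aL aR ε F L) (w a t : ℝ) :
    |hA.curve w a t - w| ≤ ε * |t - R.clip a| := hA.global.abs_sol_sub_le ..

theorem abs_curve_sub_le' (hA : R.IsAdapted r Y aL aR ε F L) (w a : ℝ) (ht : t ∈ Icc 0 R.h) :
    |hA.curve w a t - w| ≤ ε * R.h := by
  refine (hA.abs_curve_sub_le w a t).trans (mul_le_mul_of_nonneg_left ?_ ε.2)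
  have hc := R.clip_mem a
  rw [abs_le]
  constructor <;> linarith [ht.1, ht.2, hc.1, hc.2]

/-- The curve passes through the apex and has slope at most `ε`. -/
theorem memCone_curve (hA : R.IsAdapted r Y aL aR ε F L) (hs : R.IsSide aL aR w a)
    (ht : t ∈ Icc 0 R.h) : R.MemCone aL aR ε (hA.curve w a t) t :=
  hA.margin.memCone hs ht (hA.abs_curve_sub_le ..)

/-- The order is checked at the height `R.clip aL`, where the left curve is at `u` and the right one
has moved by at most `ε * h < u' - u`; the flow is increasing, so the order holds at all heights. -/
theorem curve_lt_curve (hA : R.IsAdapted r Y aL aR ε F L) (t : ℝ) :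
    hA.curve R.u aL t < hA.curve R.u' aR t := by
  have h1 := (abs_le.1 (hA.abs_curve_sub_le' R.u' aR (R.clip_mem aL))).1
  have h2 := hA.margin.lt
  have h3 : R.u < hA.curve R.u' aR (R.clip aL) := by linarith
  have h4 := hA.global.strictMono_sol (R.clip aL) t h3
  rwa [hA.sol_curve] at h4

/-- The curve of a side is regular off the singular point. -/
theorem curve_mem (hA : R.IsAdapted r Y aL aR ε F L) (hs : R.IsSide aL aR w a)
    (ht : t ∈ Icc 0 R.h) (hta : t ≠ a) : R.pt (hA.curve w a t) t ∈ S.expDom R.center := by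
  have h1 := abs_le.1 (hA.abs_curve_sub_le' w a ht)
  have h2 := hA.margin.lt
  rcases hA.margin.dom _ t (hA.memCone_curve hs ht) with h | ⟨h3, h4⟩ | ⟨h3, h4⟩
  · exact h
  · rcases hs with ⟨rfl, rfl⟩ | ⟨rfl, rfl⟩
    · exact absurd h4 hta
    · linarith
  · rcases hs with ⟨rfl, rfl⟩ | ⟨rfl, rfl⟩
    · linarith
    · exact absurd h4 hta

theorem field_eq_zero_near (hA : R.IsAdapted r Y aL aR ε F L) (hs : R.IsSide aL aR w a)
    (ha : a ∈ Icc 0 R.h) : ∀ᶠ q : ℝ × ℝ in 𝓝 (w, a), F q.2 q.1 = 0 := by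
  have h1 := hA.eq w a (hA.margin.memCone hs ha (by simp; positivity))
  have hsing : R.pt w a ∉ S.expDom R.center := fun h =>
    ((hA.sideHeight hs).mem_iff a ha).1 h rfl
  have h2 := eventually_eq_vertical hA.field hs.eq_or_eq ha hsing
  have hc : Tendsto (fun q : ℝ × ℝ => (q.1 : ℂ) + q.2 * Complex.I) (𝓝 (w, a))
      (𝓝 ((w : ℂ) + a * Complex.I)) := by
    have : Continuous fun q : ℝ × ℝ => (q.1 : ℂ) + q.2 * Complex.I := by fun_prop
    exact this.tendsto (w, a)
  filter_upwards [hc.eventually h1, hc.eventually h2] with q h3 h4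
  have h5 : F q.2 q.1 = S.graphField Y R.center R.base (q.1 + q.2 * Complex.I) := by simpa using h3
  rw [h5]
  by_cases hd : (q.1 : ℂ) + q.2 * Complex.I - R.base ∈ S.expDom R.center
  · rw [graphField_eq hd, h4 hd, Complex.I_re]
  · exact if_neg hd

/-- Between an endpoint of the segment on a side and the singular point, the curve is vertical. -/
theorem curve_eq_of_endpoint (hA : R.IsAdapted r Y aL aR ε F L) (hs : R.IsSide aL aR w a)
    {t₀ e : ℝ} (ht₀ : t₀ ∈ Icc 0 R.h) (he : e = I.a ∨ e = I.b)
    (hte : t₀ ≠ a → S.expMap R.center (R.pt w t₀) = I.ι e) : hA.curve w a t₀ = w := by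
  rcases eq_or_ne t₀ a with rfl | hta
  · rw [curve, clip_eq ht₀, hA.global.sol_self]
  have hsub : uIcc (R.clip a) t₀ ⊆ Icc 0 R.h := uIcc_subset_Icc (R.clip_mem a) ht₀
  refine hA.global.sol_eq_const fun t ht => ?_
  have htI := hsub ht
  rcases eq_or_ne t a with rfl | hne
  · exact (hA.field_eq_zero_near hs htI).self_of_nhds
  have h1 := (hA.eq w t (hA.margin.memCone hs htI (by simp; positivity))).self_of_nhds
  have h2 : F t w = S.graphField Y R.center R.base (w + t * Complex.I) := by simpa using h1
  have hreg := ((hA.sideHeight hs).mem_iff t htI).2 hne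
  rw [h2, graphField_eq (by rwa [R.add_sub_base]), R.add_sub_base]
  -- Clipping `a` keeps it on the same side of `t₀`, so these heights lie between the endpoint of
  -- the segment and the true singular point, on a separatrix segment where the field is vertical.
  have hbetween : t₀ ≤ t ∧ t < a ∨ a < t ∧ t ≤ t₀ := by
    rcases lt_or_ge a 0 with h0 | h0
    · rw [clip_of_le h0.le, uIcc_of_le ht₀.1] at ht
      exact Or.inr ⟨h0.trans_le ht.1, ht.2⟩
    rcases le_or_gt a R.h with h1 | h1
    · rw [clip_eq ⟨h0, h1⟩] at ht
      rcases le_total a t₀ with h3 | h3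
      · rw [uIcc_of_le h3] at ht
        exact Or.inr ⟨lt_of_le_of_ne ht.1 hne.symm, ht.2⟩
      · rw [uIcc_of_ge h3] at ht
        exact Or.inl ⟨ht.1, lt_of_le_of_ne ht.2 hne⟩
    · rw [clip_of_ge h1.le, uIcc_of_ge ht₀.2] at ht
      exact Or.inl ⟨ht.1, ht.2.trans_lt h1⟩
  rw [hA.sep _ (R.side_mem_separatrixSegments (Or.inl rfl) hs.eq_or_eq (hA.sideHeight hs) ht₀ he
    (hte hta) htI hbetween), Complex.I_re]

theorem zero_mem (R : I.Rect Complex.I) : (0 : ℝ) ∈ Icc 0 R.h := ⟨le_rfl, R.h_pos.le⟩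

theorem h_mem (R : I.Rect Complex.I) : R.h ∈ Icc 0 R.h := ⟨R.h_pos.le, le_rfl⟩

theorem curve_zero_of_endpoint (hA : R.IsAdapted r Y aL aR ε F L) (hs : R.IsSide aL aR w a)
    (hw : w = I.a ∨ w = I.b) : hA.curve w a 0 = w :=
  hA.curve_eq_of_endpoint hs (zero_mem R) hw fun h =>
    R.expMap_bottom (Or.inl rfl) hs.eq_or_eq (((hA.sideHeight hs).mem_iff 0 (zero_mem R)).2 h)

theorem curve_h_of_endpoint (hA : R.IsAdapted r Y aL aR ε F L) (hs : R.IsSide aL aR w a)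
    (hw : w + R.c = I.a ∨ w + R.c = I.b) : hA.curve w a R.h = w :=
  hA.curve_eq_of_endpoint hs (h_mem R) hw fun h =>
    R.expMap_top (Or.inl rfl) hs.eq_or_eq (((hA.sideHeight hs).mem_iff R.h (h_mem R)).2 h)

theorem curve_zero_mem (hA : R.IsAdapted r Y aL aR ε F L) (hs : R.IsSide aL aR w a) :
    hA.curve w a 0 ∈ Icc I.a I.b ∧ (w ∈ Ioo I.a I.b → hA.curve w a 0 ∈ Ioo I.a I.b) := by
  have h1 : w ∈ Ioo I.a I.b → hA.curve w a 0 ∈ Ioo I.a I.b := fun hwI =>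
    hA.margin.bot_mem w hs.eq_or_eq hwI _ (hA.abs_curve_sub_le' w a (zero_mem R))
  refine ⟨?_, h1⟩
  by_cases hwI : w ∈ Ioo I.a I.b
  · exact Ioo_subset_Icc_self (h1 hwI)
  · rw [hA.curve_zero_of_endpoint hs (eq_or_eq_of_notMem_Ioo (R.side_mem hs.eq_or_eq) hwI)]
    exact R.side_mem hs.eq_or_eq

theorem curve_h_mem (hA : R.IsAdapted r Y aL aR ε F L) (hs : R.IsSide aL aR w a) :
    hA.curve w a R.h + R.c ∈ Icc I.a I.b := by
  by_cases hwI : w + R.c ∈ Ioo I.a I.b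
  · exact Ioo_subset_Icc_self (hA.margin.top_mem w hs.eq_or_eq hwI _
      (hA.abs_curve_sub_le' w a (h_mem R)))
  · rw [hA.curve_h_of_endpoint hs (eq_or_eq_of_notMem_Ioo (R.side_add_mem hs.eq_or_eq) hwI)]
    exact R.side_add_mem hs.eq_or_eq

theorem expMap_curve_zero (hA : R.IsAdapted r Y aL aR ε F L) (hs : R.IsSide aL aR w a)
    (ha : a ≠ 0) : S.expMap R.center (R.pt (hA.curve w a 0) 0) = I.ι (hA.curve w a 0) :=
  hA.margin.bottom _ (hA.memCone_curve hs (zero_mem R)) (hA.curve_mem hs (zero_mem R) ha.symm)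
    (hA.curve_zero_mem hs).1

theorem expMap_curve_h (hA : R.IsAdapted r Y aL aR ε F L) (hs : R.IsSide aL aR w a)
    (ha : a ≠ R.h) :
    S.expMap R.center (R.pt (hA.curve w a R.h) R.h) = I.ι (hA.curve w a R.h + R.c) :=
  hA.margin.top _ (hA.memCone_curve hs (h_mem R)) (hA.curve_mem hs (h_mem R) ha.symm)
    (hA.curve_h_mem hs)

/-- A solution between the curves of the sides does not meet the segment inside the rectangle. -/
theorem notMem_carrier (hA : R.IsAdapted r Y aL aR ε F L) (ht : t ∈ Ioo 0 R.h)
    (hx : x ∈ Icc (hA.curve R.u aL t) (hA.curve R.u' aR t))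
    (hd : R.pt x t ∈ S.expDom R.center) : S.expMap R.center (R.pt x t) ∉ I.carrier := by
  intro hc
  have htI := Ioo_subset_Icc_self ht
  have hcone : R.MemCone aL aR ε x t :=
    ⟨htI, (hA.memCone_curve hA.left_isSide htI).le.trans hx.1,
      hx.2.trans (hA.memCone_curve hA.right_isSide htI).ge⟩
  -- A hit could only occur outside a side, at the height of an endpoint of the segment lying on it.
  -- There the curve coincides with the side, so the point is not between the curves.
  rcases hA.margin.notMem x t hcone hd ht hc with ⟨h1, e, he, hte⟩ | ⟨h1, e, he, hte⟩
  · have := hA.curve_eq_of_endpoint hA.left_isSide htI he fun _ => hte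
    linarith [hx.1]
  · have := hA.curve_eq_of_endpoint hA.right_isSide htI he fun _ => hte
    linarith [hx.2]

theorem isIntegralCurve (hA : R.IsAdapted r Y aL aR ε F L) {s : Set ℝ} {t₀ : ℝ}
    (hs : s ⊆ Icc 0 R.h)
    (h : ∀ t ∈ s, R.MemCone aL aR ε (hA.global.sol t₀ t x) t ∧
      R.pt (hA.global.sol t₀ t x) t ∈ S.expDom R.center) :
    S.IsIntegralCurve Y (fun t => S.expMap R.center (R.pt (hA.global.sol t₀ t x) t)) s := by
  have h1 := hA.field.isIntegralCurve_sol (p₀ := R.center) (z₀ := R.base) hA.global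
    (s := s) (t₀ := t₀) (x := x) (fun t ht => ⟨by
      rw [R.add_sub_base]; exact (h t ht).2, by
      simpa using (hA.eq _ t (h t ht).1).self_of_nhds⟩)
  simpa only [R.add_sub_base] using h1

/-- The points between the curves of the sides return through the rectangle. -/
theorem firstReturn (hA : R.IsAdapted r Y aL aR ε F L)
    (hx : x ∈ Ioo (hA.curve R.u aL 0) (hA.curve R.u' aR 0)) :
    I.FirstReturn Y x (hA.global.sol 0 R.h x + R.c) := by
  have hin : ∀ t, hA.global.sol 0 t x ∈ Ioo (hA.curve R.u aL t) (hA.curve R.u' aR t) := by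
    intro t
    have h1 := hA.global.strictMono_sol 0 t hx.1
    have h2 := hA.global.strictMono_sol 0 t hx.2
    rw [hA.sol_curve] at h1 h2
    exact ⟨h1, h2⟩
  have hcone : ∀ t ∈ Icc 0 R.h, R.MemCone aL aR ε (hA.global.sol 0 t x) t := fun t ht =>
    ⟨ht, (hA.memCone_curve hA.left_isSide ht).le.trans (hin t).1.le,
      (hin t).2.le.trans (hA.memCone_curve hA.right_isSide ht).ge⟩
  have hreg : ∀ t ∈ Icc 0 R.h, R.pt (hA.global.sol 0 t x) t ∈ S.expDom R.center := by
    intro t ht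
    -- The exceptional points are the apexes; they lie on the side curves, and the solution is
    -- strictly between these.
    rcases hA.margin.dom _ t (hcone t ht) with h | ⟨h1, h2⟩ | ⟨h1, h2⟩
    · exact h
    · have h3 : hA.curve R.u aL t = R.u := by
        rw [curve, h2, clip_eq (h2 ▸ ht), hA.global.sol_self]
      linarith [(hin t).1]
    · have h3 : hA.curve R.u' aR t = R.u' := by
        rw [curve, h2, clip_eq (h2 ▸ ht), hA.global.sol_self]
      linarith [(hin t).2]
  have hxI : x ∈ Ioo I.a I.b :=
    ⟨(hA.curve_zero_mem hA.left_isSide).1.1.trans_lt hx.1,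
      hx.2.trans_le (hA.curve_zero_mem hA.right_isSide).1.2⟩
  have hyI : hA.global.sol 0 R.h x + R.c ∈ Ioo I.a I.b :=
    ⟨(hA.curve_h_mem hA.left_isSide).1.trans_lt (by linarith [(hin R.h).1]),
      (by linarith [(hin R.h).2] : _ < hA.curve R.u' aR R.h + R.c).trans_le
        (hA.curve_h_mem hA.right_isSide).2⟩
  refine ⟨hxI, hyI, R.h, _, R.h_pos,
    hA.isIntegralCurve (t₀ := 0) (x := x) subset_rfl fun t ht => ⟨hcone t ht, hreg t ht⟩, ?_, ?_, ?_⟩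
  · have h1 := hA.margin.bottom _ (hcone 0 (zero_mem R)) (hreg 0 (zero_mem R))
    rw [hA.global.sol_self] at h1
    simp only [hA.global.sol_self]
    exact h1 (Ioo_subset_Icc_self hxI)
  · exact hA.margin.top _ (hcone R.h (h_mem R)) (hreg R.h (h_mem R)) (Ioo_subset_Icc_self hyI)
  · intro t ht
    exact hA.notMem_carrier ht (Ioo_subset_Icc_self (hin t)) (hreg t (Ioo_subset_Icc_self ht))

theorem curve_mem_Icc (hA : R.IsAdapted r Y aL aR ε F L) (hs : R.IsSide aL aR w a) (t : ℝ) :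
    hA.curve w a t ∈ Icc (hA.curve R.u aL t) (hA.curve R.u' aR t) := by
  have h1 := hA.curve_lt_curve t
  rcases hs with ⟨rfl, rfl⟩ | ⟨rfl, rfl⟩
  · exact ⟨le_rfl, h1.le⟩
  · exact ⟨h1.le, le_rfl⟩

theorem isIntegralCurve_curve (hA : R.IsAdapted r Y aL aR ε F L) (hs : R.IsSide aL aR w a)
    {s : Set ℝ} (hsub : s ⊆ Icc 0 R.h) (has : a ∉ s) :
    S.IsIntegralCurve Y (fun t => S.expMap R.center (R.pt (hA.curve w a t) t)) s :=
  hA.isIntegralCurve hsub fun t ht =>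
    ⟨hA.memCone_curve hs (hsub ht), hA.curve_mem hs (hsub ht) fun h => has (h ▸ ht)⟩

end IsAdapted

end Rect

end HorizontalSegment

end TranslationSurface

/-! ### Perturbed partition points: non-return, and jets along the sides -/

namespace TranslationSurface

variable {M : Type*} [TopologicalSpace M] {S : TranslationSurface M} [T2Space M] [CompactSpace M]

namespace HorizontalSegment

variable {I : S.HorizontalSegment}

namespace Rect

variable {R : I.Rect Complex.I} {r : ℕ∞} {Y : M → ℂ} {aL aR : ℝ} {ε L : NNReal} {F : ℝ → ℝ → ℝ}
  {w a t x : ℝ}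

namespace IsAdapted

theorem exists_tendsto_curve (hA : R.IsAdapted r Y aL aR ε F L) (hs : R.IsSide aL aR w a)
    (ha : a ∈ Icc 0 R.h) : ∃ A ∈ S.sing,
      Tendsto (fun t => S.expMap R.center (R.pt (hA.curve w a t) t)) (𝓝[<] a) (𝓝 A) := by
  have hsing : R.pt w a ∉ S.expDom R.center := fun h =>
    ((hA.sideHeight hs).mem_iff a ha).1 h rfl
  obtain ⟨-, A, hAs, hlim, -⟩ := R.tendsto_side (Or.inl rfl) hs.eq_or_eq ha hsing
  refine ⟨A, hAs, (hlim.mono_left (nhdsWithin_mono _ fun t ht => ne_of_lt ht)).congr' ?_⟩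
  obtain ⟨ρ, hρ, hρ'⟩ := hA.global.exists_germ_eq_one hA.contDiff (hA.field_eq_zero_near hs ha)
  filter_upwards [Ioo_mem_nhdsLT (show a - ρ < a by linarith)] with t ht
  have h1 := (hρ' a t (by simpa using hρ) (by rw [abs_lt]; constructor <;> linarith [ht.1, ht.2])).1
  rw [curve, clip_eq ha, h1]

/-- The endpoints of the perturbed top intervals do not return. -/
theorem not_firstReturn (hr : 1 ≤ r) (hA : R.IsAdapted r Y aL aR ε F L) (hs : R.IsSide aL aR w a)
    (hw : w ∈ Ioo I.a I.b) (y : ℝ) : ¬I.FirstReturn Y (hA.curve w a 0) y := by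
  rintro ⟨-, hy, τ, γ, hτ, hγ, h0, h1, -⟩
  have hY := hA.field.isC1Field hr
  have hh := R.h_pos
  have ha : 0 < a := (hA.sideHeight hs).pos hw
  have hyc : γ τ ∈ I.carrier := h1 ▸ ⟨y, hy, rfl⟩
  rw [← hA.expMap_curve_zero hs ha.ne'] at h0
  have hav : ∀ t ∈ Ioo 0 R.h, t ≠ a →
      S.expMap R.center (R.pt (hA.curve w a t) t) ∉ I.carrier := fun t ht hta =>
    hA.notMem_carrier ht (hA.curve_mem_Icc hs t) (hA.curve_mem hs (Ioo_subset_Icc_self ht) hta)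
  rcases le_or_gt a R.h with hah | hah
  -- The singular point is on the side: the orbit runs into it at time `a` without meeting the
  -- segment.
  · obtain ⟨A, hAs, hlim⟩ := hA.exists_tendsto_curve hs ⟨ha.le, hah⟩
    have hσ := hA.isIntegralCurve_curve hs (s := Ico 0 a)
      (fun t ht => ⟨ht.1, ht.2.le.trans hah⟩) fun h => h.2.ne rfl
    obtain ⟨hlt, heq⟩ := hY.lt_of_tendsto_sing ha hγ hσ h0 hAs hlim
    rw [heq ⟨hτ.le, le_rfl⟩] at hyc
    exact hav τ ⟨hτ, hlt.trans_le hah⟩ hlt.ne hyc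
  · have hσ := hA.isIntegralCurve_curve hs (s := Icc 0 R.h) subset_rfl
      fun h => absurd h.2 (not_le.2 hah)
    -- The singular point is above the side, which happens only if the side arrives at an endpoint
    -- of the segment. The orbit reaches this endpoint and follows its separatrix, where the field
    -- is vertical, into the singular point.
    have hend : w + R.c = I.a ∨ w + R.c = I.b :=
      eq_or_eq_of_notMem_Ioo (R.side_add_mem hs.eq_or_eq) fun h =>
        absurd ((hA.sideHeight hs).lt h) (not_lt.2 hah.le)
    have hσh : S.expMap R.center (R.pt (hA.curve w a R.h) R.h) = I.ι (w + R.c) := by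
      rw [hA.expMap_curve_h hs hah.ne', hA.curve_h_of_endpoint hs hend]
    have hE := (hA.sideHeight hs).top.ends (sub_pos.2 hah)
    rcases le_or_gt τ R.h with hτh | hτh
    · have heq := hY.eqOn_Icc hγ (hσ.mono (Icc_subset_Icc_right hτh)) h0 (x := τ) ⟨hτ.le, le_rfl⟩
      rw [heq] at hyc
      rcases eq_or_lt_of_le hτh with rfl | hlt
      · simp only [hσh] at hyc
        exact ι_endpoint_notMem_carrier hend hyc
      · exact hav τ ⟨hτ, hlt⟩ (hlt.trans hah).ne hyc
    · have heq := hY.eqOn_Icc (hγ.mono (Icc_subset_Icc_right hτh.le)) hσ h0 (x := R.h)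
        ⟨hh.le, le_rfl⟩
      have h2 := (hγ.comp_add R.h).mono (s' := Icc 0 (τ - R.h)) fun t ht =>
        ⟨by linarith [ht.1], by linarith [ht.2]⟩
      have h3 : S.IsIntegralCurve Y (fun t => S.expMap (I.ι (w + R.c)) (t * Complex.I))
          (Ico 0 (a - R.h)) := by
        refine (isStraight_expMap_of_forall hE.2.1).congr_field fun t ht => ?_
        rw [hA.sep _ (hE.mem_separatrixSegments (Or.inl rfl) hend ht)]
      obtain ⟨A, hAs, hlim⟩ := hE.2.2.2
      obtain ⟨hlt, heq'⟩ := hY.lt_of_tendsto_sing (sub_pos.2 hah) h2 h3 (by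
        simp [heq, hσh, expMap_zero hE.notMem_sing]) hAs hlim
      have h4 := heq' (x := τ - R.h) ⟨by linarith, le_rfl⟩
      simp only [sub_add_cancel] at h4
      rw [h4] at hyc
      exact hE.2.2.1 (τ - R.h) ⟨by linarith, hlt⟩ hyc

/-- The holonomy of a side without singular point. -/
theorem holRel_side (hA : R.IsAdapted r Y aL aR ε F L) (hs : R.IsSide aL aR w a)
    (ha : a ∉ Icc 0 R.h) : S.HolRel Y (I.ι (hA.curve w a 0)) (I.ι (hA.curve w a R.h + R.c)) R.h
      (hA.global.germ hA.contDiff 0 R.h (hA.curve w a 0)) := by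
  have hne : ∀ t ∈ Icc 0 R.h, t ≠ a := fun t ht h => ha (h ▸ ht)
  have h1 := hA.field.holRel_sol (p₀ := R.center) (z₀ := R.base) hA.global hA.contDiff
    (t₁ := 0) (t₂ := R.h) (x := hA.curve w a 0) R.h_pos.le
    (fun t ht => by
      rw [hA.sol_curve, R.add_sub_base]; exact hA.curve_mem hs ht (hne t ht))
    (fun t ht => by rw [hA.sol_curve]; exact hA.eq _ t (hA.memCone_curve hs ht))
  rwa [hA.sol_curve, R.add_sub_base, R.add_sub_base,
    hA.expMap_curve_zero hs (hne 0 (zero_mem R)).symm,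
    hA.expMap_curve_h hs (hne R.h (h_mem R)).symm, sub_zero] at h1

theorem leaf_top (hA : R.IsAdapted r Y aL aR ε F L) (hs : R.IsSide aL aR w a) (hat : a < t)
    (ht : t ∈ Icc 0 R.h) : S.expMap (I.ι (w + R.c)) ((t - R.h : ℝ) * Complex.I) =
      S.expMap R.center (R.pt w t) := by
  have h1 := R.flip.leaf_side (v := -Complex.I) (Or.inr rfl) (R.flip_side hs.eq_or_eq)
    (s := Icc 0 (R.h - t)) ordConnected_Icc ⟨le_rfl, by linarith [ht.2]⟩ (fun t' ht' => by
      rw [R.flip_pt_mem_iff]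
      exact ((hA.sideHeight hs).mem_iff _ ⟨by linarith [ht'.2, ht.1], by linarith [ht'.1]⟩).2
        (by linarith [ht'.2] : a < R.h - t').ne') (t := R.h - t) ⟨by linarith [ht.2], le_rfl⟩
  rw [R.expMap_flip_pt, sub_sub_cancel] at h1
  rw [← h1.2]
  congr 1
  push_cast; ring

theorem leaf_bottom (hA : R.IsAdapted r Y aL aR ε F L) (hs : R.IsSide aL aR w a) (hta : t < a)
    (ht : t ∈ Icc 0 R.h) : S.expMap (I.ι w) ((t : ℝ) * Complex.I) =
      S.expMap R.center (R.pt w t) :=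
  (R.leaf_side (Or.inl rfl) hs.eq_or_eq (s := Icc 0 t) ordConnected_Icc ⟨le_rfl, ht.1⟩
    (fun t' ht' => ((hA.sideHeight hs).mem_iff _ ⟨ht'.1, ht'.2.trans ht.2⟩).2
      (ht'.2.trans_lt hta).ne) ⟨ht.1, le_rfl⟩).2

/-- The jet of the holonomy of a side is the quotient of the jets from its ends to the singular
point. -/
theorem exists_holonomy (hr : 1 ≤ r) (hA : R.IsAdapted r Y aL aR ε F L)
    (hs : R.IsSide aL aR w a) : ∃ g k : JetGroup r, I.Holonomy Y (hA.curve w a 0) w a g ∧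
      I.Holonomy Y (hA.curve w a R.h + R.c) (w + R.c) (a - R.h) k ∧
      (QuotientGroup.mk (hA.global.germ hA.contDiff 0 R.h (hA.curve w a 0)) : JetGroup r) =
        k⁻¹ * g := by
  have hh := R.h_pos
  have hH := hA.sideHeight hs
  by_cases ha : a ∈ Icc 0 R.h
  · have hca : hA.curve w a a = w := by rw [curve, clip_eq ha, hA.global.sol_self]
    have hcl : R.clip a = a := clip_eq ha
    have hsol : ∀ t, hA.global.sol a t w = hA.curve w a t := fun t => by rw [curve, hcl]
    -- With the singular point on the side, the flow from `0` to `h` factors at height `a`. The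
    -- first factor is `g`; the second leaves from the singular point, so it is `k⁻¹`.
    refine ⟨QuotientGroup.mk (hA.global.germ hA.contDiff 0 a (hA.curve w a 0)),
      (QuotientGroup.mk (hA.global.germ hA.contDiff a R.h w))⁻¹, ?_, ?_, ?_⟩
    · rcases eq_or_lt_of_le ha.1 with h0 | h0
      · refine Or.inr (Or.inr ⟨h0.symm, by rw [h0, hca], ?_⟩)
        rw [← h0, hA.global.germ_self]
        rfl
      · have h1 := hA.field.holRel_to_singular (p₀ := R.center) (z₀ := R.base) hA.global
          hA.contDiff h0 (w := w)
          (fun t ht => by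
            rw [hsol, R.add_sub_base]; exact hA.curve_mem hs ⟨ht.1, ht.2.le.trans ha.2⟩ ht.2.ne)
          (fun t ht => by
            rw [hsol]; exact hA.eq _ t (hA.memCone_curve hs ⟨ht.1, ht.2.le.trans ha.2⟩))
          (hA.field_eq_zero_near hs ha)
        refine Or.inl ⟨h0, ?_⟩
        filter_upwards [h1, Ioo_mem_nhdsGT h0] with η ⟨f, hf, hf'⟩ hη
        refine ⟨f, by rw [hf, hsol], ?_⟩
        rw [hsol, R.add_sub_base, R.add_sub_base, hA.expMap_curve_zero hs h0.ne', sub_zero,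
          ← hA.leaf_bottom hs (by linarith [hη.1])
            ⟨by linarith [hη.2], by linarith [hη.1, ha.2]⟩] at hf'
        exact hf'
    · rcases eq_or_lt_of_le ha.2 with h0 | h0
      · refine Or.inr (Or.inr ⟨by linarith, by rw [← h0, hca], ?_⟩)
        rw [← h0, hA.global.germ_self]
        exact inv_one
      · have h1 := hA.field.holRel_from_singular (p₀ := R.center) (z₀ := R.base) hA.global
          hA.contDiff h0 (w := w)
          (fun t ht => by
            rw [hsol, R.add_sub_base]; exact hA.curve_mem hs ⟨ha.1.trans ht.1.le, ht.2⟩ ht.1.ne')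
          (fun t ht => by
            rw [hsol]; exact hA.eq _ t (hA.memCone_curve hs ⟨ha.1.trans ht.1.le, ht.2⟩))
          (hA.field_eq_zero_near hs ha)
        refine Or.inr (Or.inl ⟨by linarith, ?_⟩)
        filter_upwards [h1, Ioo_mem_nhdsGT (sub_pos.2 h0)] with η ⟨f, hf, hf'⟩ hη
        refine ⟨f, by rw [hf, inv_inv], ?_⟩
        rw [hsol, R.add_sub_base, R.add_sub_base, hA.expMap_curve_h hs h0.ne,
          ← hA.leaf_top hs (by linarith [hη.1])
            ⟨by linarith [hη.1, ha.1], by linarith [hη.2]⟩] at hf'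
        rw [show a - R.h + η = a + η - R.h by ring, show -(a + η - R.h) = R.h - (a + η) by ring]
        exact hf'
    · rw [inv_inv, ← QuotientGroup.mk_mul]
      congr 1
      have h1 := hA.global.germ_mul hA.contDiff 0 a R.h (hA.curve w a 0)
      rw [hA.sol_curve, hca] at h1
      exact h1.symm
  have hside := hA.holRel_side hs ha
  set j := hA.global.germ hA.contDiff 0 R.h (hA.curve w a 0)
  rcases lt_or_ge a 0 with h0 | h0
  -- The singular point is below the side, so `ι w` is an endpoint. Its separatrix gives `g`, and
  -- the holonomy from the singular point to the top is that separatrix followed by the side; this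
  -- determines `k`.
  · have hend : w = I.a ∨ w = I.b := eq_or_eq_of_notMem_Ioo (R.side_mem hs.eq_or_eq) fun h =>
      absurd (hH.pos h) (not_lt.2 h0.le)
    obtain ⟨g, hg⟩ := hH.bot.exists_holonomy hr ε.2 hA.field hA.sep hend
    rw [hA.curve_zero_of_endpoint hs hend] at hside ⊢
    refine ⟨g, g * (QuotientGroup.mk j)⁻¹, hg, Or.inr (Or.inl ⟨by linarith, ?_⟩), by group⟩
    rcases hg with ⟨h1, -⟩ | ⟨-, hg⟩ | ⟨h1, -⟩
    · linarith
    · filter_upwards [hg, Ioo_mem_nhdsGT (neg_pos.2 h0)] with η ⟨f, hf, hf'⟩ hη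
      have h2 := hf'.trans (by linarith [hη.2]) hh.le hside
      refine ⟨j * f, by rw [QuotientGroup.mk_mul, hf]; group, ?_⟩
      have hE := (hH.top.ends_neg (by linarith)).2.1 (R.h - (a + η))
        ⟨by linarith [hη.2], by linarith [hη.1]⟩
      have h3 := expMap_shift hE (t := R.h) ⟨hh.le, by linarith [hη.2]⟩ (u := -(a + η))
        ⟨by linarith [hη.2], by linarith⟩
      have h4 := hA.leaf_top hs h0 (zero_mem R)
      have h5 : S.expMap R.center (R.pt w 0) = I.ι w := by
        have := hA.expMap_curve_zero hs h0.ne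
        rwa [hA.curve_zero_of_endpoint hs hend] at this
      rw [h5] at h4
      have e1 : ((0 - R.h : ℝ) : ℂ) * Complex.I = (R.h : ℂ) * -Complex.I := by push_cast; ring
      have e2 : ((a + η : ℝ) : ℂ) * Complex.I = ((-(a + η) : ℝ) : ℂ) * -Complex.I := by
        push_cast; ring
      have e3 : ((a - R.h + η : ℝ) : ℂ) * Complex.I =
          ((R.h + -(a + η) : ℝ) : ℂ) * -Complex.I := by push_cast; ring
      rw [e1] at h4
      rw [h4] at h3
      rw [e2, h3.2] at h2
      rw [e3, show -(a - R.h + η) = -(a + η) + R.h by ring]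
      exact h2
    · linarith
  -- Symmetric case: the side, followed by the separatrix of the endpoint at its top, leads to the
  -- singular point; now `k` is given and `g` is determined.
  · have hah : R.h < a := by
      by_contra hcon
      exact ha ⟨h0, not_lt.1 hcon⟩
    have hend : w + R.c = I.a ∨ w + R.c = I.b :=
      eq_or_eq_of_notMem_Ioo (R.side_add_mem hs.eq_or_eq) fun h =>
        absurd (hH.lt h) (not_lt.2 hah.le)
    obtain ⟨k, hk⟩ := hH.top.exists_holonomy hr ε.2 hA.field hA.sep hend
    rw [hA.curve_h_of_endpoint hs hend] at hside ⊢
    refine ⟨k * QuotientGroup.mk j, k, Or.inl ⟨by linarith, ?_⟩, hk, by group⟩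
    rcases hk with ⟨-, hk⟩ | ⟨h1, -⟩ | ⟨h1, -⟩
    · filter_upwards [hk, Ioo_mem_nhdsGT (sub_pos.2 hah)] with η ⟨f, hf, hf'⟩ hη
      have h2 := hside.trans hh.le (by linarith [hη.2]) hf'
      refine ⟨f * j, by rw [QuotientGroup.mk_mul, hf], ?_⟩
      have hE := (hH.bot.ends (by linarith)).2.1 (a - η) ⟨by linarith [hη.2], by linarith [hη.1]⟩
      have h3 := expMap_shift hE (t := R.h) ⟨hh.le, by linarith [hη.2]⟩ (u := a - R.h - η)
        ⟨by linarith [hη.2], by linarith⟩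
      have h4 := hA.leaf_bottom hs hah (h_mem R)
      have h5 : S.expMap R.center (R.pt w R.h) = I.ι (w + R.c) := by
        have := hA.expMap_curve_h hs hah.ne'
        rwa [hA.curve_h_of_endpoint hs hend] at this
      rw [h4, h5] at h3
      rw [h3.2] at h2
      rw [show a - η = R.h + (a - R.h - η) by ring]
      exact h2
    · linarith
    · linarith

end IsAdapted

end Rect

end HorizontalSegment

end TranslationSurface

/-! ### Telescoping products along the cycles of `σ` -/

theorem CombData.sigma_apply {A : Type*} {d : ℕ} (π : CombData A d) (υ : A ⊕ A) :
    π.sigma υ = π.sigmaFun υ := rfl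

/-- A product that telescopes along the cycles is trivial. -/
theorem CombData.cycleProd_eq_one {A : Type*} {d : ℕ} {G : Type*} [Group G] (π : CombData A d)
    (j l : A ⊕ A → G) (h : ∀ υ, j υ ^ CombData.sign υ = (l υ)⁻¹ * l (π.sigma υ)) (υ : A ⊕ A) :
    π.cycleProd j υ = 1 := by
  have key : ∀ n : ℕ, ((List.range n).map
      (fun i => j (π.sigma^[i] υ) ^ CombData.sign (π.sigma^[i] υ))).prod =
      (l υ)⁻¹ * l (π.sigma^[n] υ) := by
    intro n
    induction n with
    | zero => simp
    | succ n ih =>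
      rw [List.prod_range_succ, ih, h, Function.iterate_succ_apply']
      group
  rw [CombData.cycleProd, key, Function.iterate_minimalPeriod, inv_mul_cancel]

theorem CombData.cycleClass_eq_one {A : Type*} {d : ℕ} {G : Type*} [Group G] (π : CombData A d)
    (j l : A ⊕ A → G) (h : ∀ υ, j υ ^ CombData.sign υ = (l υ)⁻¹ * l (π.sigma υ)) :
    π.cycleClass j = fun _ => 1 := by
  funext C
  induction C using Quotient.inductionOn with
  | h υ =>
    change ConjClasses.mk (π.cycleProd j υ) = 1
    rw [π.cycleProd_eq_one j l h, ConjClasses.one_eq_mk_one]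

/-- The jets of the form `k⁻¹ * g`, where `g` and `k` depend on the points of the top and of the
bottom partition, have trivial products along the cycles. -/
theorem CombData.cycleClass_quotient {d : ℕ} {G : Type*} [Group G] (σ : Fin d ≃ Fin d)
    (g k : Fin (d + 1) → G) (h0 : g 0 = k 0) (hl : g (Fin.last d) = k (Fin.last d)) :
    (CombData.mk (Equiv.refl (Fin d)) σ).cycleClass
      (Sum.elim (fun α => (k (σ α).castSucc)⁻¹ * g α.castSucc)
        (fun α => (k (σ α).succ)⁻¹ * g α.succ)) = fun _ => 1 := by
  refine CombData.cycleClass_eq_one _ _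
    -- The potential is `g` at left ends of top intervals and `k` at right ends of bottom intervals.
    -- At a left end the inverse factor is `g⁻¹ * k`, at a right end it is `k⁻¹ * g`, and `σ` moves
    -- to the interval that shares the last point.
    (Sum.elim (fun α => g α.castSucc) (fun α => k (σ α).succ)) ?_
  rintro (α | α)
  · simp only [CombData.sign, Sum.elim_inl, zpow_neg, zpow_one, mul_inv_rev, inv_inv]
    congr 1
    rw [CombData.sigma_apply]
    simp only [CombData.sigmaFun]
    split_ifs with h
    · simp only [Sum.elim_inr, Equiv.apply_symm_apply]
      congr 1
      ext
      simp only [Fin.val_castSucc, Fin.succ_mk]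
      omega
    -- At the left end of the whole interval `σ` passes from the bottom to the top partition; the
    -- equality `g 0 = k 0` is needed exactly here.
    · have h1 : (σ α).castSucc = 0 := by
        ext
        simp only [Fin.val_castSucc, Fin.val_zero]
        omega
      simp only [Sum.elim_inl, Equiv.refl_symm, Equiv.refl_apply]
      rw [h1, ← h0]
      rfl
  · simp only [CombData.sign, Sum.elim_inr, zpow_one]
    congr 1
    rw [CombData.sigma_apply]
    simp only [CombData.sigmaFun]
    split_ifs with h
    · rfl
    · have h1 : α.succ = Fin.last d := by
        ext
        simp only [Fin.val_succ, Fin.val_last]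
        simp only [Equiv.refl_apply] at h
        omega
      simp only [Sum.elim_inr, Equiv.apply_symm_apply]
      rw [h1, hl]
      congr 1
      ext
      simp only [Fin.val_last, Fin.succ_mk]
      have := α.isLt
      omega

/-! ### Class and jets of an exchange map made of diffeomorphisms of the line -/

namespace GIEM

variable {d : ℕ} {two_le : 2 ≤ d} {π : CombData (Fin d) d} {hπ : π.Irreducible}
  {ut ub : Fin (d + 1) → ℝ} {ht : StrictMono ut} {hb : StrictMono ub} {h0 : ut 0 = ub 0}
  {hl : ut (Fin.last d) = ub (Fin.last d)} {g : Fin d → ℝ ≃o ℝ}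
  {hg : ∀ α, g (π.top α) (ut (π.top α).castSucc) = ub (π.bot α).castSucc}
  {hg' : ∀ α, g (π.top α) (ut (π.top α).succ) = ub (π.bot α).succ}

theorem ofOrderIso_toFun (α : Fin d) {x : ℝ}
    (hx : x ∈ Ioo (ut (π.top α).castSucc) (ut (π.top α).succ)) :
    (ofOrderIso two_le π hπ ut ub ht hb h0 hl g hg hg').toFun x = g (π.top α) x :=
  gapFun_eq ht g hx

theorem isOfClass_ofOrderIso {r : ℕ∞} (hc : ∀ i, ContDiff ℝ (r : WithTop ℕ∞) (g i))
    (hc' : ∀ i, ContDiff ℝ (r : WithTop ℕ∞) (g i).symm) :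
    (ofOrderIso two_le π hπ ut ub ht hb h0 hl g hg hg').IsOfClass r := by
  intro α
  refine ⟨g (π.top α), (g (π.top α)).symm, fun x hx => (ofOrderIso_toFun α hx).symm,
    (hc _).contDiffOn, (hc' _).contDiffOn, fun x hx => ?_, fun x hx => ?_,
    fun x _ => (g (π.top α)).symm_apply_apply x, fun x _ => (g (π.top α)).apply_symm_apply x⟩
  · change _ ∈ Icc (ub (π.bot α).castSucc) (ub (π.bot α).succ)
    rw [← hg, ← hg']
    exact ⟨(g _).monotone hx.1, (g _).monotone hx.2⟩
  · have hx' : x ∈ Icc (ub (π.bot α).castSucc) (ub (π.bot α).succ) := hx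
    rw [← hg, ← hg'] at hx'
    exact ⟨(g _).le_symm_apply.2 hx'.1, (g _).symm_apply_le.2 hx'.2⟩

theorem isJetAt_left {r : ℕ∞} (α : Fin d) (f : JetDiff r)
    (hf : ∀ x, (f : ℝ ≃o ℝ) x =
      g (π.top α) (ut (π.top α).castSucc + x) - g (π.top α) (ut (π.top α).castSucc)) :
    (ofOrderIso two_le π hπ ut ub ht hb h0 hl g hg hg').IsJetAt r (Sum.inl α)
      (QuotientGroup.mk f) := by
  refine ⟨f, rfl, fun k _ => ?_⟩
  have hlt : ut (π.top α).castSucc < ut (π.top α).succ := ht (by rw [Fin.lt_def]; simp)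
  have h1 : ∀ᶠ x in 𝓝[>] (0 : ℝ),
      ((ofOrderIso two_le π hπ ut ub ht hb h0 hl g hg hg').toFun (ut (π.top α).castSucc + x) -
        ub (π.bot α).castSucc) - (f : ℝ ≃o ℝ) x = 0 := by
    filter_upwards [Ioo_mem_nhdsGT (sub_pos.2 hlt)] with x hx
    rw [ofOrderIso_toFun α ⟨by linarith [hx.1], by linarith [hx.2]⟩, hf, hg, sub_self]
  exact (EventuallyEq.trans_isLittleO (f₂ := fun _ => (0 : ℝ)) h1 (isLittleO_zero _ _))

theorem isJetAt_right {r : ℕ∞} (α : Fin d) (f : JetDiff r)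
    (hf : ∀ x, (f : ℝ ≃o ℝ) x =
      g (π.top α) (ut (π.top α).succ + x) - g (π.top α) (ut (π.top α).succ)) :
    (ofOrderIso two_le π hπ ut ub ht hb h0 hl g hg hg').IsJetAt r (Sum.inr α)
      (QuotientGroup.mk f) := by
  refine ⟨f, rfl, fun k _ => ?_⟩
  have hlt : ut (π.top α).castSucc < ut (π.top α).succ := ht (by rw [Fin.lt_def]; simp)
  have h1 : ∀ᶠ x in 𝓝[<] (0 : ℝ),
      ((ofOrderIso two_le π hπ ut ub ht hb h0 hl g hg hg').toFun (ut (π.top α).succ + x) -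
        ub (π.bot α).succ) - (f : ℝ ≃o ℝ) x = 0 := by
    filter_upwards [Ioo_mem_nhdsLT (sub_neg.2 hlt)] with x hx
    rw [ofOrderIso_toFun α ⟨by linarith [hx.1], by linarith [hx.2]⟩, hf, hg', sub_self]
  exact (EventuallyEq.trans_isLittleO (f₂ := fun _ => (0 : ℝ)) h1 (isLittleO_zero _ _))

end GIEM

/-! ### The return map of the deformed field -/

namespace TranslationSurface

variable {M : Type*} [TopologicalSpace M] {S : TranslationSurface M} [T2Space M] [CompactSpace M]

namespace HorizontalSegment

variable {I : S.HorizontalSegment}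

namespace ReturnData

variable {d : ℕ} {D : I.ReturnData d} {A B : Fin (d + 1) → ℝ}

theorem IsHeights.exists_margin (h : D.IsHeights A B) :
    ∃ η > 0, ∃ ε : Fin d → ℝ, (∀ i, η ≤ ε i) ∧
      ∀ i, (D.R i).IsMargin (A i.castSucc) (A i.succ) (ε i) := by
  have hex : ∀ i, ∃ ε, (D.R i).IsMargin (A i.castSucc) (A i.succ) ε := fun i =>
    (D.R i).exists_isMargin (Or.inl rfl) (D.u_eq i ▸ h.left i) (D.u'_eq i ▸ h.right i)
  choose ε hε using hex
  have : Nonempty (Fin d) := ⟨⟨0, D.pos_d⟩⟩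
  obtain ⟨i₀, hi₀⟩ := Finite.exists_min ε
  exact ⟨ε i₀, (hε i₀).pos, ε, hi₀, hε⟩

/-- The return map of a field close to the vertical one. -/
theorem exists_deformed {r : ℕ∞} (hr : 1 ≤ r) (h : D.IsHeights A B) {ε : Fin d → ℝ}
    (hε : ∀ i, (D.R i).IsMargin (A i.castSucc) (A i.succ) (ε i)) {Y : M → ℂ}
    (hY : ∀ i, S.IsGraphField r (ε i) Y) (hsep : ∀ p ∈ I.separatrixSegments, Y p = Complex.I) :
    ∃ T : GIEM (Fin d) d, T.comb = D.comb ∧ T.IsOfClass r ∧ I.IsReturnMap Y T ∧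
      T.IsConjInvariant r (fun _ => 1) := by
  have hC1 : S.IsC1Field Y := (hY ⟨0, D.pos_d⟩).isC1Field hr
  have hex := fun i => Rect.exists_isAdapted (ε := ⟨ε i, (hε i).pos.le⟩) hr
    (D.u_eq i ▸ h.left i) (D.u'_eq i ▸ h.right i) (hε i) (hY i) hsep
  choose F L hA using hex
  set cL : Fin d → ℝ → ℝ := fun i => (hA i).curve (D.R i).u (A i.castSucc) with hcL
  set cR : Fin d → ℝ → ℝ := fun i => (hA i).curve (D.R i).u' (A i.succ) with hcR
  have hL := fun i => (hA i).exists_holonomy hr (hA i).left_isSide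
  have hR := fun i => (hA i).exists_holonomy hr (hA i).right_isSide
  choose gL kL hgL hkL hjL using hL
  choose gR kR hgR hkR hjR using hR
  have hcLmem : ∀ i, cL i 0 ∈ Icc I.a I.b := fun i => ((hA i).curve_zero_mem (hA i).left_isSide).1
  have hcRmem : ∀ i, cR i 0 ∈ Icc I.a I.b := fun i => ((hA i).curve_zero_mem (hA i).right_isSide).1
  have hcLmem' : ∀ i, cL i (D.R i).h + (D.R i).c ∈ Icc I.a I.b := fun i =>
    (hA i).curve_h_mem (hA i).left_isSide
  have hcRmem' : ∀ i, cR i (D.R i).h + (D.R i).c ∈ Icc I.a I.b := fun i =>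
    (hA i).curve_h_mem (hA i).right_isSide
  have hgL' : ∀ i, I.Holonomy Y (cL i 0) (D.ut i.castSucc) (A i.castSucc) (gL i) := fun i => by
    rw [← D.u_eq]; exact hgL i
  have hgR' : ∀ i, I.Holonomy Y (cR i 0) (D.ut i.succ) (A i.succ) (gR i) := fun i => by
    rw [← D.u'_eq]; exact hgR i
  have hkL' : ∀ i, I.Holonomy Y (cL i (D.R i).h + (D.R i).c) (D.ub (D.σ i).castSucc)
      (B (D.σ i).castSucc) (kL i) := fun i => by
    rw [← D.u_add_eq, ← h.left_sub]; exact hkL i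
  have hkR' : ∀ i, I.Holonomy Y (cR i (D.R i).h + (D.R i).c) (D.ub (D.σ i).succ)
      (B (D.σ i).succ) (kR i) := fun i => by
    rw [← D.u'_add_eq, ← h.right_sub]; exact hkR i
  -- the points of the perturbed partitions and the jets of the holonomy to the singular points
  have htop : ∀ k, ∃ x ∈ Icc I.a I.b, ∃ g : JetGroup r, I.Holonomy Y x (D.ut k) (A k) g := by
    intro k
    obtain ⟨i, rfl | rfl⟩ := Fin.exists_castSucc_or_succ D.pos_d k
    · exact ⟨_, hcLmem i, _, hgL' i⟩
    · exact ⟨_, hcRmem i, _, hgR' i⟩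
  have hbot : ∀ k, ∃ x ∈ Icc I.a I.b, ∃ g : JetGroup r, I.Holonomy Y x (D.ub k) (B k) g := by
    intro k
    obtain ⟨j, hj⟩ := Fin.exists_castSucc_or_succ D.pos_d k
    obtain ⟨i, rfl⟩ := D.σ.surjective j
    rcases hj with rfl | rfl
    · exact ⟨_, hcLmem' i, _, hkL' i⟩
    · exact ⟨_, hcRmem' i, _, hkR' i⟩
  choose xs hxs g hg using htop
  choose ys hys k hk using hbot
  -- A partition point is a side of up to two rectangles; uniqueness of the holonomy identifies both
  -- the perturbed points and the jets that they provide.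
  have exL := fun i => (hg _).unique hC1 (hxs _) (hcLmem i) (hgL' i)
  have exR := fun i => (hg _).unique hC1 (hxs _) (hcRmem i) (hgR' i)
  have eyL := fun i => (hk _).unique hC1 (hys _) (hcLmem' i) (hkL' i)
  have eyR := fun i => (hk _).unique hC1 (hys _) (hcRmem' i) (hkR' i)
  -- At an end of the segment the top and bottom points, and their singular points, are the same,
  -- hence so are the jets.
  have e0 : xs 0 = ys 0 ∧ g 0 = k 0 := by
    have h1 := hg 0
    rw [D.ut_zero, ← D.ub_zero, h.zero] at h1
    exact h1.unique hC1 (hxs _) (hys _) (hk 0)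
  have el : xs (Fin.last d) = ys (Fin.last d) ∧ g (Fin.last d) = k (Fin.last d) := by
    have h1 := hg (Fin.last d)
    rw [D.ut_last, ← D.ub_last, h.last] at h1
    exact h1.unique hC1 (hxs _) (hys _) (hk _)
  have hx0 : xs 0 = I.a := by
    have h1 := (exL ⟨0, D.pos_d⟩).1
    have h2 : (D.R ⟨0, D.pos_d⟩).u = I.a := (D.u_eq _).trans D.ut_zero
    rw [hcL] at h1
    simp only [(hA ⟨0, D.pos_d⟩).curve_zero_of_endpoint (hA _).left_isSide (Or.inl h2)] at h1
    exact h1.trans h2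
  have hxl : xs (Fin.last d) = I.b := by
    have hlast : (⟨d - 1, by have := D.pos_d; omega⟩ : Fin d).succ = Fin.last d := by
      ext; simp only [Fin.succ_mk, Fin.val_last]; have := D.pos_d; omega
    have h1 := (exR ⟨d - 1, by have := D.pos_d; omega⟩).1
    have h2 : (D.R ⟨d - 1, by have := D.pos_d; omega⟩).u' = I.b := by
      rw [D.u'_eq, hlast, D.ut_last]
    rw [hcR] at h1
    simp only [(hA ⟨d - 1, by have := D.pos_d; omega⟩).curve_zero_of_endpoint
      (hA _).right_isSide (Or.inr h2)] at h1
    rw [hlast] at h1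
    exact h1.trans h2
  have hxmono : StrictMono xs := by
    rw [Fin.strictMono_iff_lt_succ]
    intro i
    rw [(exL i).1, (exR i).1]
    exact (hA i).curve_lt_curve 0
  have hymono : StrictMono ys := by
    rw [Fin.strictMono_iff_lt_succ]
    intro j
    obtain ⟨i, rfl⟩ := D.σ.surjective j
    rw [(eyL i).1, (eyR i).1]
    have := (hA i).curve_lt_curve (D.R i).h
    simp only [hcL, hcR]
    linarith
  -- The flow through the rectangle followed by its translation. It is a diffeomorphism of the whole
  -- line, so its restrictions are smooth up to the endpoints and its jets there are two-sided.
  set f : Fin d → ℝ ≃o ℝ := fun i =>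
    ((hA i).global.flow 0 (D.R i).h).trans (OrderIso.addRight (D.R i).c) with hf
  have hfL : ∀ i, f i (xs i.castSucc) = ys (D.σ i).castSucc := by
    intro i
    rw [(exL i).1, (eyL i).1]
    exact congrArg (· + (D.R i).c) ((hA i).sol_curve (D.R i).u (A i.castSucc) 0 (D.R i).h)
  have hfR : ∀ i, f i (xs i.succ) = ys (D.σ i).succ := by
    intro i
    rw [(exR i).1, (eyR i).1]
    exact congrArg (· + (D.R i).c) ((hA i).sol_curve (D.R i).u' (A i.succ) 0 (D.R i).h)
  have hgerm : ∀ i x y, ((hA i).global.germ (hA i).contDiff 0 (D.R i).h x : ℝ ≃o ℝ) y =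
      f i (x + y) - f i x := by
    intro i x y
    refine ((hA i).global.germ_apply (hA i).contDiff 0 (D.R i).h x y).trans ?_
    change _ = (hA i).global.sol 0 (D.R i).h (x + y) + (D.R i).c -
      ((hA i).global.sol 0 (D.R i).h x + (D.R i).c)
    ring
  refine ⟨GIEM.ofOrderIso h.two_le D.comb h.irreducible xs ys hxmono hymono e0.1 el.1 f hfL hfR,
    rfl, GIEM.isOfClass_ofOrderIso (fun i => ?_) (fun i => ?_), ?_, ?_⟩
  · exact ((hA i).global.contDiff_flow (hA i).contDiff 0 (D.R i).h).add contDiff_const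
  · have h1 := (hA i).global.contDiff_flow (hA i).contDiff (D.R i).h 0
    exact h1.comp (contDiff_id.add (contDiff_const (c := -(D.R i).c)))
  · refine isReturnMap_of hC1 _ rfl hx0 hxl (fun i x hx => ?_) fun k hk => ?_
    · have hval : gapFun xs f x = f i x := gapFun_eq hxmono f hx
      change I.FirstReturn Y x (gapFun xs f x)
      rw [hval]
      refine (hA i).firstReturn ⟨?_, ?_⟩
      · exact (exL i).1.symm.trans_lt hx.1
      · exact lt_of_lt_of_eq hx.2 (exR i).1
    · have hk' : xs k ∈ Ioo I.a I.b := hk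
      -- The perturbed partition keeps the ends of the segment, so an interior perturbed point has
      -- an interior index.
      have hutk : D.ut k ∈ Ioo I.a I.b := by
        have h1 : k ≠ 0 := by rintro rfl; exact hk'.1.ne hx0.symm
        have h2 : k ≠ Fin.last d := by rintro rfl; exact hk'.2.ne hxl
        rw [← D.ut_zero, ← D.ut_last]
        exact ⟨D.strictMono_ut (Fin.pos_iff_ne_zero.2 h1), D.strictMono_ut (Fin.lt_last_iff_ne_last.2 h2)⟩
      change ∀ y, ¬I.FirstReturn Y (xs k) y
      obtain ⟨i, rfl | rfl⟩ := Fin.exists_castSucc_or_succ D.pos_d k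
      · rw [(exL i).1]
        exact (hA i).not_firstReturn hr (hA i).left_isSide (D.u_eq i ▸ hutk)
      · rw [(exR i).1]
        exact (hA i).not_firstReturn hr (hA i).right_isSide (D.u'_eq i ▸ hutk)
  · refine ⟨Sum.elim (fun α => (k (D.σ α).castSucc)⁻¹ * g α.castSucc)
      (fun α => (k (D.σ α).succ)⁻¹ * g α.succ), ?_,
      (CombData.cycleClass_quotient D.σ g k e0.2 el.2).symm⟩
    rintro (α | α)
    · rw [Sum.elim_inl, (exL α).2, (eyL α).2, ← hjL α]
      refine GIEM.isJetAt_left α _ fun x => ?_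
      rw [hgerm]
      change _ = f α (xs α.castSucc + x) - f α (xs α.castSucc)
      rw [(exL α).1]
    · rw [Sum.elim_inr, (exR α).2, (eyR α).2, ← hjR α]
      refine GIEM.isJetAt_right α _ fun x => ?_
      rw [hgerm]
      change _ = f α (xs α.succ + x) - f α (xs α.succ)
      rw [(exR α).1]

end ReturnData

end HorizontalSegment

end TranslationSurface

theorem proposition8p6 {M : Type*} [TopologicalSpace M] [T2Space M] [CompactSpace M]
    [ConnectedSpace M] (S : TranslationSurface M) (I : S.HorizontalSegment)
    (hI : I.GoodPosition) (r : ℕ∞) (hr : 1 ≤ r) :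
    ∃ (d : ℕ) (T₀ : GIEM (Fin d) d), T₀.IsStandard ∧ I.IsReturnMap S.vertical T₀ ∧
      ∃ k : ℕ, (k : ℕ∞) ≤ r ∧ ∃ ε : ℝ, 0 < ε ∧
        ∀ X : M → ℂ, S.IsDeformation r X → S.IsCloseToVertical k ε X →
          (∀ p ∈ I.separatrixSegments, X p = S.vertical p) →
          ∃ T : GIEM (Fin d) d, T.comb = T₀.comb ∧ T.IsOfClass r ∧ I.IsReturnMap X T ∧
            T.IsConjInvariant r (fun _ => 1) := by
  obtain ⟨d, ⟨D⟩⟩ := TranslationSurface.HorizontalSegment.exists_returnData hI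
  obtain ⟨A, B, h⟩ := D.exists_isHeights hI
  obtain ⟨T₀, hcomb, hstd, hret⟩ := TranslationSurface.HorizontalSegment.ReturnData.exists_standard h
  obtain ⟨η, hη, ε, hηε, hε⟩ := h.exists_margin
  -- Closeness of order `0` suffices. The bound `1 / 2` keeps the vertical component away from `0`,
  -- and `η / 2` accounts for the doubling of the horizontal component by the change of time, `η`
  -- being the smallest slope allowed by the rectangles.
  refine ⟨d, T₀, hstd, hret, 0, by simp, min (1 / 2) (η / 2), by positivity, fun X hX hXc hXs => ?_⟩
  obtain ⟨Y, hY, hXY, hFR⟩ := hX.exists_isGraphField (min_le_left _ _) hXc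
  have hY' : ∀ i, S.IsGraphField r (ε i) Y := fun i => hY.mono (by
    have := min_le_right (1 / 2) (η / 2)
    linarith [hηε i])
  obtain ⟨T, hT, hTc, hTr, hTi⟩ := TranslationSurface.HorizontalSegment.ReturnData.exists_deformed hr h
    hε hY' fun p hp => hXY p (hXs p hp)
  exact ⟨T, hT.trans hcomb.symm, hTc,
    ⟨hTr.1, hTr.2.1, fun x y => (hFR I x y).trans (hTr.2.2 x y)⟩, hTi⟩
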